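/- For $\Lambda\ge 0$, $\lambda\ge 0$ consider the spherically symmetric static $SU(2)$ Einstein--Yang--Mills equations $$rA'+2Aw'^2=\Phi,\qquad r^2Aw''+rw'\Phi+w(1-w^2)=0,\qquad \Phi=1-A-\frac{(1-w^2)^2}{r^2}-\Lambda r^2,$$ and their solution that is smooth at $r=0$ with $(A,w,w',w'')(0)=(1,1,0,-\lambda)$. It is continued through zeros of $A$ as the maximal solution, on an interval $(-\infty,\tau_0)$, of $$\dot r=rN,\quad \dot w=rU,\quad \dot N=(\kappa-N)N-2U^2,\quad \dot U=-\frac{w(1-w^2)}{r}-(\kappa-N)U,\quad \dot\kappa=1+2U^2-\kappa^2-2\Lambda r^2,$$ where, near $r=0$ (that is, as $\tau\to-\infty$), $N=\sqrt A$, $U=Nw'$, $2N\kappa=\Phi+2Aw'^2+2A$; throughout, $A=N^2$ and $w'=U/N$ where $N\neq 0$. Zeros of $w$ are counted over $\tau\in(-\infty,\tau_0)$. Say that $r$ turns if there is $\tau_c<\tau_0$ with $N>0$ before $\tau_c$, $N(\tau_c)=0$, and $N<0$ on $(\tau_c,\tau_0)$. The solution is * generic if $r$ turns, and $r\to 0$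 and $A\to\infty$ as $\tau\nearrow\tau_0$; * a black hole if $r$ turns, and $r\to r_0$ for some $r_0>0$, $A\to 0$ and $w'$ stays bounded as $\tau\nearrow\tau_0$; * noncompact if $N>0$ on $(-\infty,\tau_0)$ and, as $\tau\nearrow\tau_0$: when $\Lambda>0$, $r\to r_c\in(0,\infty)$, $A\to0$ and $w'$ stays bounded; when $\Lambda=0$, $r\to\infty$ and $(A,w^2,w')\to(1,1,0)$ (a particlelike solution). Let $\Lambda_0>0$ and $L=[0,\Lambda_0]\times[0,\max\{2,2\Lambda_0\}]$. Let $n\ge 0$ and let $l_n=(\lambda_n,\lambda_{n+1})$, $0\le\lambda_n<\lambda_{n+1}$, be an interval such that for $\Lambda=0$ the parameters $\lambda_n$ and $\lambda_{n+1}$ give particlelike solutions with exactly $n$ and $n+1$ zeros of $w$, and every $\lambda\in l_n$ gives a solution with exactly $n+1$ zeros. Let $C_n$ be the closure of $P\setminus(\{0\}\times l_n)$, where $P$ is the path component containing $\{0\}\times l_n$ of the set of those $(\Lambda,\lambda)\in L$ for which $w$ has exactly $n+1$ zeros, and let $\partial C_n$ be the boundary of $C_n$ in $L$. Let $\bar\partial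 C_n$ and $\bar\partial C_{n+1}$ be the sets of points of $\partial C_n$ whose solution is noncompact with exactly $n$, respectively exactly $n+1$, zeros of $w$. **Theorem.** Let $(\hat\Lambda,\hat\lambda)\in\bar\partial C_{n+1}$. There is a neighborhood $V$ of $(\hat\Lambda,\hat\lambda)$ in $L$ such that for each $(\Lambda,\lambda)\in V$ one of the following holds: (A) the solution is generic and $w$ has at least $n+1$ zeros; (B) the solution is noncompact and $w$ has exactly $n+1$ zeros; (C) the solution is a black hole. In particular, $V\cap\bar\partial C_n=\emptyset$. -/

import Mathlib

open Filter Topology Set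
open scoped ContDiff

namespace EYM

/-- `Φ = 1 - A - (1 - w²)² / r² - Λ r²`. -/
noncomputable def Phi (Λ r A w : ℝ) : ℝ :=
  1 - A - (1 - w ^ 2) ^ 2 / r ^ 2 - Λ * r ^ 2

/-- The metric coefficient `A` and the connection coefficient `w`, as functions of the radius,
solve the static spherically symmetric Einstein-Yang-Mills equations at the radius `r`. -/
def RadialEquationsAt (Λ : ℝ) (A w : ℝ → ℝ) (r : ℝ) : Prop :=
  r * deriv A r + 2 * A r * deriv w r ^ 2 = Phi Λ r (A r) (w r) ∧
  r ^ 2 * A r * deriv (deriv w) r + r * deriv w r * Phi Λ r (A r) (w r)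
    + w r * (1 - w r ^ 2) = 0

/-- The unknowns of the system in the parameter `τ`, where `dr/dτ = r N`; as long as `N > 0`
one has `N = √A`, `U = N w'` (prime is `d/dr`), `κ = (r z + 2 N²) / (2 N)` with
`r z = Φ + 2 A w'²`. In general `A = N²` and `w' = U / N`, and `N < 0` where `r` decreases. -/
structure Trajectory where
  r : ℝ → ℝ
  w : ℝ → ℝ
  N : ℝ → ℝ
  U : ℝ → ℝ
  κ : ℝ → ℝ

/-- The autonomous form of the equations, which stays regular where `A` vanishes,
holds for all `τ < T`. -/
def SolvesSystem (Λ : ℝ) (y : Trajectory) (T : EReal) : Prop :=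
  ∀ τ : ℝ, (τ : EReal) < T →
    0 < y.r τ ∧
    HasDerivAt y.r (y.r τ * y.N τ) τ ∧
    HasDerivAt y.w (y.r τ * y.U τ) τ ∧
    HasDerivAt y.N ((y.κ τ - y.N τ) * y.N τ - 2 * y.U τ ^ 2) τ ∧
    HasDerivAt y.U (-(y.w τ * (1 - y.w τ ^ 2)) / y.r τ - (y.κ τ - y.N τ) * y.U τ) τ ∧
    HasDerivAt y.κ (1 + 2 * y.U τ ^ 2 - y.κ τ ^ 2 - 2 * Λ * y.r τ ^ 2) τ

/-- The trajectory starts (as `τ → -∞`) at the center `r = 0`, where `A` and `w` are smooth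
functions of `r` that solve the radial equations, with
`(A, w, w', w'')(0) = (1, 1, 0, -lam)`. -/
def SmoothAtOrigin (Λ lam : ℝ) (y : Trajectory) : Prop :=
  ∃ A w : ℝ → ℝ,
    ContDiffAt ℝ ∞ A 0 ∧ ContDiffAt ℝ ∞ w 0 ∧
    A 0 = 1 ∧ w 0 = 1 ∧ deriv w 0 = 0 ∧ deriv (deriv w) 0 = -lam ∧
    (∀ᶠ r in 𝓝[>] (0 : ℝ), RadialEquationsAt Λ A w r) ∧
    Tendsto y.r atBot (𝓝[>] 0) ∧
    ∀ᶠ τ in atBot,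
      y.N τ = √(A (y.r τ)) ∧
      y.w τ = w (y.r τ) ∧
      y.U τ = y.N τ * deriv w (y.r τ) ∧
      y.κ τ = (Phi Λ (y.r τ) (A (y.r τ)) (w (y.r τ))
        + 2 * A (y.r τ) * deriv w (y.r τ) ^ 2 + 2 * y.N τ ^ 2) / (2 * y.N τ)

/-- `y`, on `(-∞, T)`, is a solution with parameters `(Λ, lam)`. -/
structure IsSolution (Λ lam : ℝ) (y : Trajectory) (T : EReal) : Prop where
  nonempty : ⊥ < T
  solves : SolvesSystem Λ y T
  origin : SmoothAtOrigin Λ lam y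

/-- `y`, on `(-∞, T)`, is the maximal solution with parameters `(Λ, lam)` (it is unique up to
a translation of `τ`). -/
structure IsMaximalSolution (Λ lam : ℝ) (y : Trajectory) (T : EReal) : Prop
    extends IsSolution Λ lam y T where
  maximal : ∀ (y' : Trajectory) (T' : EReal), IsSolution Λ lam y' T' →
    (∀ τ : ℝ, (τ : EReal) < T → y'.r τ = y.r τ ∧ y'.w τ = y.w τ ∧ y'.N τ = y.N τ ∧
      y'.U τ = y.U τ ∧ y'.κ τ = y.κ τ) → T' ≤ T

/-- The filter `τ ↗ T`; it is `atTop` if `T = ⊤`. -/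
noncomputable def upTo (T : EReal) : Filter ℝ :=
  comap (fun τ : ℝ => (τ : EReal)) (𝓝[<] T)

/-- The number of zeros of `w` on `(-∞, T)`, possibly infinite. -/
noncomputable def zeros (y : Trajectory) (T : EReal) : ℕ∞ :=
  {τ : ℝ | (τ : EReal) < T ∧ y.w τ = 0}.encard

/-- `r` increases up to its maximum `r_c = r(τ_c)`, where `A = 0`, and decreases thereafter. -/
def TurnsAt (y : Trajectory) (T : EReal) (τc : ℝ) : Prop :=
  (τc : EReal) < T ∧ (∀ τ < τc, 0 < y.N τ) ∧ y.N τc = 0 ∧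
    ∀ τ : ℝ, τc < τ → (τ : EReal) < T → y.N τ < 0

/-- Generic: `r` has a maximum, at which there is a horizon, and then decreases to `0`, where the
metric has a Reissner-Nordström like singularity, `A → ∞`. -/
def Generic (y : Trajectory) (T : EReal) : Prop :=
  (∃ τc, TurnsAt y T τc) ∧ Tendsto y.r (upTo T) (𝓝 0) ∧
    Tendsto (fun τ => y.N τ ^ 2) (upTo T) atTop

/-- Black hole: `r` has a maximum, at which there is a horizon, and then decreases to some
`r₀ > 0`, at which there is another horizon, `A → 0` with `w'` bounded. -/
def BlackHole (y : Trajectory) (T : EReal) : Prop :=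
  (∃ τc, TurnsAt y T τc) ∧ (∃ r₀ > 0, Tendsto y.r (upTo T) (𝓝 r₀)) ∧
    Tendsto y.N (upTo T) (𝓝 0) ∧ ∃ M : ℝ, ∀ᶠ τ in upTo T, |y.U τ / y.N τ| ≤ M

/-- `r` increases to some `r_c`, `A > 0` for `r < r_c`, and as `r ↗ r_c` one has `A → 0` while
`w'` stays bounded. -/
def RegularHorizon (y : Trajectory) (T : EReal) : Prop :=
  (∀ τ : ℝ, (τ : EReal) < T → 0 < y.N τ) ∧ (∃ rc > 0, Tendsto y.r (upTo T) (𝓝 rc)) ∧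
    Tendsto y.N (upTo T) (𝓝 0) ∧ ∃ M : ℝ, ∀ᶠ τ in upTo T, |y.U τ / y.N τ| ≤ M

/-- Particlelike: `A > 0` for all `r > 0` and `(A, w², w') → (1, 1, 0)` as `r → ∞`. -/
def Particlelike (y : Trajectory) (T : EReal) : Prop :=
  (∀ τ : ℝ, (τ : EReal) < T → 0 < y.N τ) ∧ Tendsto y.r (upTo T) atTop ∧
    Tendsto (fun τ => y.N τ ^ 2) (upTo T) (𝓝 1) ∧
    Tendsto (fun τ => y.w τ ^ 2) (upTo T) (𝓝 1) ∧
    Tendsto (fun τ => y.U τ / y.N τ) (upTo T) (𝓝 0)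

/-- Noncompact: for `Λ > 0` this is a regular horizon in the sense above (a coordinate
singularity beyond which `r` keeps increasing), for `Λ = 0` the particlelike solutions. -/
def Noncompact (Λ : ℝ) (y : Trajectory) (T : EReal) : Prop :=
  (0 < Λ ∧ RegularHorizon y T) ∨ (Λ = 0 ∧ Particlelike y T)

/-! Properties of the solution that belongs to the parameters `p = (Λ, lam)`. -/

def HasExactlyZeros (k : ℕ) (p : ℝ × ℝ) : Prop :=
  ∃ y T, IsMaximalSolution p.1 p.2 y T ∧ zeros y T = k

def IsNoncompactWith (k : ℕ) (p : ℝ × ℝ) : Prop :=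
  ∃ y T, IsMaximalSolution p.1 p.2 y T ∧ Noncompact p.1 y T ∧ zeros y T = k

def IsGenericWithAtLeast (k : ℕ) (p : ℝ × ℝ) : Prop :=
  ∃ y T, IsMaximalSolution p.1 p.2 y T ∧ Generic y T ∧ (k : ℕ∞) ≤ zeros y T

def IsBlackHole (p : ℝ × ℝ) : Prop :=
  ∃ y T, IsMaximalSolution p.1 p.2 y T ∧ BlackHole y T

/-- The parameter rectangle `L = [0, Λ₀] × [0, max {2, 2 Λ₀}]`. -/
def L (Λ₀ : ℝ) : Set (ℝ × ℝ) :=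
  Icc 0 Λ₀ ×ˢ Icc 0 (max 2 (2 * Λ₀))

/-- `(a, b)` is an interval `l_n = (λ_n, λ_{n+1})`: for `Λ = 0` its endpoints give particlelike
solutions with `n` and `n + 1` zeros, and every `lam` between them gives a solution with exactly
`n + 1` zeros. -/
structure IsInterval (n : ℕ) (a b : ℝ) : Prop where
  nonneg : 0 ≤ a
  lt : a < b
  left : IsNoncompactWith n (0, a)
  right : IsNoncompactWith (n + 1) (0, b)
  between : ∀ lam ∈ Ioo a b, HasExactlyZeros (n + 1) (0, lam)

/-- The set of parameters in `L` whose solution has exactly `k` zeros. -/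
def W (Λ₀ : ℝ) (k : ℕ) : Set (ℝ × ℝ) :=
  {p ∈ L Λ₀ | HasExactlyZeros k p}

/-- `C_n`, for `l_n = (a, b)`: the closure of the path component, without `{0} × l_n`, of the set
of parameters with exactly `n + 1` zeros that contains `{0} × l_n`. -/
def C (Λ₀ : ℝ) (n : ℕ) (a b : ℝ) : Set (ℝ × ℝ) :=
  closure ({p | ∃ lam ∈ Ioo a b, JoinedIn (W Λ₀ (n + 1)) (0, lam) p} \ ({0} ×ˢ Ioo a b))

/-- The boundary of `C_n` in the space `L`. -/
def boundaryC (Λ₀ : ℝ) (n : ℕ) (a b : ℝ) : Set (ℝ × ℝ) :=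
  Subtype.val '' frontier (Subtype.val ⁻¹' C Λ₀ n a b : Set (L Λ₀))

/-- The points of the boundary of `C_n` whose solution is noncompact with exactly `k` zeros. -/
def noncompactBoundary (Λ₀ : ℝ) (n : ℕ) (a b : ℝ) (k : ℕ) : Set (ℝ × ℝ) :=
  {p ∈ boundaryC Λ₀ n a b | IsNoncompactWith k p}

end EYM

namespace EYM

/-! The theorem is a stability statement: near a noncompact solution with k = n + 1 zeros, every
solution with Λ ≥ 0 has at least k zeros and is generic, a black hole, or noncompact with exactly k
zeros (`IsMaximalSolution.eventually_classified`). The given solution is followed up to a time b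
beyond its last zero, so late that the fate of every nearby state is settled (`Decided`,
`Flow.exists_decided`). It then suffices that nearby parameters lead to a nearby state at time b,
with equally many zeros before.

For the latter, the singular centre is handled by the implicit function theorem, which makes the
solution analytic in the radius and the parameters (`exists_profile`). From a small radius on,
Gronwall's inequality gives continuous dependence (`Flow.continuous_dependence`), and since the
zeros of w are simple, their number on a compact interval is stable (`exists_encard_zeros_eq`).

The fate of nearby states has two cases. At a regular horizon (Λ > 0), κ → -∞ while Φ < 0 and w ≠ 0
in the limit (`Flow.horizon_limit`). A Riccati inequality for κ + 2 N leaves nearby solutions no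
time to move r and w while N ≥ 0, so they either end at a regular horizon or reach N = 0 with U ≠ 0
and turn (`Flow.near_horizon`). A particlelike solution (Λ = 0) provides almost flat data at a large
radius (`Flow.near_flat`). There the energy h = r² U² - (1 - w²)² / 2 decides, whose derivative in τ
is 2 r² U² (2 N - κ). As long as h ≤ 0, w stays near ±1 and the solution turns out noncompact
without further zeros. Once h > 0, the solution is generic or a black hole
(`Flow.crash_of_energy_pos`): either w moves outward beyond ±1 (`Flow.outward`), or κ becomes
negative and r turns.

After a turning point, N < -1 at some time forces r → 0 and A → ∞ (`Flow.generic`), whereas N ≥ -1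
up to a finite end forces a second horizon (`Flow.blackHole`). Both rest on the analysis of what can
happen at a finite end, for the horizon in `Flow.horizon`.

Finally, the number of zeros depends on the parameters only (`zeros_le_of_isSolution`), so no point
of the neighbourhood has exactly n zeros. -/

/-! ### Calculus on an interval: monotonicity, continuous induction, limits at the end point. -/

theorem le_of_hasDerivAt_nonneg {f f' : ℝ → ℝ} {a b : ℝ} (hab : a ≤ b)
    (hf : ∀ x ∈ Icc a b, HasDerivAt f (f' x) x) (h : ∀ x ∈ Ioo a b, 0 ≤ f' x) : f a ≤ f b := by
  refine monotoneOn_of_hasDerivWithinAt_nonneg (f' := f') (convex_Icc a b)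
    (fun x hx => (hf x hx).continuousAt.continuousWithinAt) (fun x hx => ?_) (fun x hx => ?_)
    (left_mem_Icc.2 hab) (right_mem_Icc.2 hab) hab
  · exact (hf x (interior_subset hx)).hasDerivWithinAt
  · rw [interior_Icc] at hx; exact h x hx

theorem ge_of_hasDerivAt_nonpos {f f' : ℝ → ℝ} {a b : ℝ} (hab : a ≤ b)
    (hf : ∀ x ∈ Icc a b, HasDerivAt f (f' x) x) (h : ∀ x ∈ Ioo a b, f' x ≤ 0) : f b ≤ f a := by
  have := le_of_hasDerivAt_nonneg (f := fun x => -f x) (f' := fun x => -f' x) hab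
    (fun x hx => (hf x hx).fun_neg) (fun x hx => by linarith [h x hx])
  linarith

theorem le_add_mul_of_hasDerivAt {f f' : ℝ → ℝ} {a b C : ℝ} (hab : a ≤ b)
    (hf : ∀ x ∈ Icc a b, HasDerivAt f (f' x) x) (h : ∀ x ∈ Ioo a b, f' x ≤ C) :
    f b ≤ f a + C * (b - a) := by
  have := ge_of_hasDerivAt_nonpos (f := fun x => f x - C * x) (f' := fun x => f' x - C * 1) hab
    (fun x hx => (hf x hx).fun_sub ((hasDerivAt_id' x).const_mul C))
    (fun x hx => by linarith [h x hx])
  linarith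

theorem add_mul_le_of_hasDerivAt {f f' : ℝ → ℝ} {a b C : ℝ} (hab : a ≤ b)
    (hf : ∀ x ∈ Icc a b, HasDerivAt f (f' x) x) (h : ∀ x ∈ Ioo a b, C ≤ f' x) :
    f a + C * (b - a) ≤ f b := by
  have := le_of_hasDerivAt_nonneg (f := fun x => f x - C * x) (f' := fun x => f' x - C * 1) hab
    (fun x hx => (hf x hx).fun_sub ((hasDerivAt_id' x).const_mul C))
    (fun x hx => by linarith [h x hx])
  linarith

/-- Continuous induction along a compact interval. -/
theorem continuous_induction {P : ℝ → Prop} {a b : ℝ} (ha : P a)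
    (hclosed : ∀ x ∈ Ioc a b, (∀ y ∈ Ico a x, P y) → P x)
    (hopen : ∀ x ∈ Ico a b, (∀ y ∈ Icc a x, P y) → ∀ᶠ y in 𝓝[>] x, P y) :
    ∀ x ∈ Icc a b, P x := by
  by_contra hcon
  push Not at hcon
  obtain ⟨x₁, hx₁, hPx₁⟩ := hcon
  set S : Set ℝ := {x | x ∈ Icc a b ∧ ¬ P x} with hS
  have hSne : S.Nonempty := ⟨x₁, hx₁, hPx₁⟩
  have hSbdd : BddBelow S := ⟨a, fun x hx => hx.1.1⟩
  set c := sInf S with hc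
  have hac : a ≤ c := le_csInf hSne fun x hx => hx.1.1
  have hcb : c ≤ b := (csInf_le hSbdd ⟨hx₁, hPx₁⟩).trans hx₁.2
  have hlt : ∀ y ∈ Ico a c, P y := by
    intro y hy
    by_contra h
    exact absurd (csInf_le hSbdd ⟨⟨hy.1, hy.2.le.trans hcb⟩, h⟩) (not_le.2 hy.2)
  have hPc : P c := by
    rcases hac.eq_or_lt with h | h
    · rw [← h]; exact ha
    · exact hclosed c ⟨h, hcb⟩ hlt
  have hle : ∀ y ∈ Icc a c, P y := fun y hy => by
    rcases hy.2.eq_or_lt with h | h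
    · rw [h]; exact hPc
    · exact hlt y ⟨hy.1, h⟩
  have hcb' : c < b := by
    rcases hcb.eq_or_lt with h | h
    · exact absurd (hle x₁ ⟨hx₁.1, h ▸ hx₁.2⟩) hPx₁
    · exact h
  obtain ⟨d, hd, hd'⟩ := (mem_nhdsGT_iff_exists_Ioo_subset' hcb').1 (hopen c ⟨hac, hcb'⟩ hle)
  have : d ≤ c := by
    refine le_csInf hSne fun x hx => ?_
    by_contra h
    push Not at h
    rcases le_or_gt x c with h' | h'
    · exact hx.2 (hle x ⟨hx.1.1, h'⟩)
    · exact hx.2 (hd' ⟨h', h⟩)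
  exact absurd this (not_le.2 hd)

theorem exists_tendsto_of_hasDerivAt_bounded {f f' : ℝ → ℝ} {a t C : ℝ} (hat : a < t)
    (hf : ∀ x ∈ Ico a t, HasDerivAt f (f' x) x) (h : ∀ x ∈ Ico a t, |f' x| ≤ C) :
    ∃ l, Tendsto f (𝓝[<] t) (𝓝 l) := by
  have hC : 0 ≤ C := (abs_nonneg _).trans (h a ⟨le_rfl, hat⟩)
  have hL : LipschitzOnWith (Real.toNNReal C) f (Ico a t) := by
    refine Convex.lipschitzOnWith_of_nnnorm_hasDerivWithin_le (f' := f') (convex_Ico a t)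
      (fun x hx => (hf x hx).hasDerivWithinAt) (fun x hx => ?_)
    rw [← NNReal.coe_le_coe, coe_nnnorm, Real.coe_toNNReal _ hC]
    exact h x hx
  obtain ⟨g, hg, hfg⟩ := hL.extend_real
  refine ⟨g t, ((hg.continuous.tendsto t).mono_left nhdsWithin_le_nhds).congr' ?_⟩
  filter_upwards [Ico_mem_nhdsLT hat] with x hx using (hfg hx).symm

/-- A function that vanishes at the right end point and whose derivative is small is small. -/
theorem abs_le_of_tendsto_zero {y y' : ℝ → ℝ} {a t C D : ℝ} (hC : 0 ≤ C) (hD : 0 ≤ D)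
    (hy : ∀ x ∈ Ico a t, HasDerivAt y (y' x) x)
    (hb : ∀ x ∈ Ico a t, |y' x| ≤ C * |y x| + D * (t - x))
    (hlim : Tendsto y (𝓝[<] t) (𝓝 0)) (hsmall : C * (t - a) ≤ 1 / 2) :
    ∀ x ∈ Ico a t, |y x| ≤ 2 * D * (t - x) ^ 2 := by
  intro x hx
  -- Near t the limit bounds |y| by 1; up to there compactness does.
  obtain ⟨d, hd⟩ : BddAbove ((fun z => |y z|) '' Ico x t) := by
    have hlim' := hlim.abs
    rw [abs_zero] at hlim'
    obtain ⟨e, he, he'⟩ := (mem_nhdsLT_iff_exists_Ioo_subset' hx.2).1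
      (hlim'.eventually (gt_mem_nhds one_pos))
    have hcont : ContinuousOn (fun z => |y z|) (Icc x (max x e)) := fun z hz =>
      ((hy z ⟨hx.1.trans hz.1, hz.2.trans_lt (max_lt hx.2 he)⟩).continuousAt.abs).continuousWithinAt
    obtain ⟨B, hB⟩ := (isCompact_Icc.image_of_continuousOn hcont).bddAbove
    refine ⟨max B 1, ?_⟩
    rintro _ ⟨z, hz, rfl⟩
    rcases le_or_gt z (max x e) with h | h
    · exact (hB ⟨z, ⟨hz.1, h⟩, rfl⟩).trans (le_max_left _ _)
    · exact (le_of_lt (he' ⟨(le_max_right _ _).trans_lt h, hz.2⟩)).trans (le_max_right _ _)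
  set M := sSup ((fun z => |y z|) '' Ico x t) with hM
  have hMle : ∀ z ∈ Ico x t, |y z| ≤ M := fun z hz => le_csSup ⟨d, hd⟩ ⟨z, hz, rfl⟩
  have hMx : |y x| ≤ M := hMle x ⟨le_rfl, hx.2⟩
  have hM0 : 0 ≤ M := (abs_nonneg _).trans hMx
  have hs : 0 < t - x := sub_pos.2 hx.2
  have key : ∀ z ∈ Ico x t, |y z| ≤ (C * M + D * (t - x)) * (t - x) := by
    intro z hz
    have h1 : ∀ u ∈ Ico z t, |y u - y z| ≤ (C * M + D * (t - x)) * (t - x) := by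
      intro u hu
      have hb' : ∀ v ∈ Icc z u, ‖y' v‖ ≤ C * M + D * (t - x) := by
        intro v hv
        have hv' : v ∈ Ico x t := ⟨hz.1.trans hv.1, hv.2.trans_lt hu.2⟩
        refine (hb v ⟨hx.1.trans hv'.1, hv'.2⟩).trans ?_
        gcongr
        · exact hMle v hv'
        · exact hv'.1
      have := Convex.norm_image_sub_le_of_norm_hasDerivWithin_le (f := y) (f' := y')
        (s := Icc z u) (x := z) (y := u) (C := C * M + D * (t - x))
        (fun v hv => (hy v ⟨hx.1.trans (hz.1.trans hv.1), hv.2.trans_lt hu.2⟩).hasDerivWithinAt)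
        hb' (convex_Icc z u) (left_mem_Icc.2 hu.1) (right_mem_Icc.2 hu.1)
      refine (this.trans ?_)
      have : ‖u - z‖ ≤ t - x := by
        rw [Real.norm_eq_abs, abs_of_nonneg (by linarith [hu.1])]; linarith [hz.1, hu.2]
      gcongr
    have h2 : Tendsto (fun u => |y u - y z|) (𝓝[<] t) (𝓝 |0 - y z|) :=
      (hlim.sub_const _).abs
    have h3 := le_of_tendsto h2 (by filter_upwards [Ico_mem_nhdsLT hz.2] with u hu using h1 u hu)
    simpa using h3
  -- The supremum over `key` gives M ≤ C (t - x) M + D (t - x)², and C (t - x) ≤ 1/2 absorbs the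
  -- first term.
  have hM2 : M ≤ (C * M + D * (t - x)) * (t - x) :=
    csSup_le ⟨_, x, ⟨le_rfl, hx.2⟩, rfl⟩ (by rintro _ ⟨z, hz, rfl⟩; exact key z hz)
  have h4 : C * (t - x) ≤ 1 / 2 := (mul_le_mul_of_nonneg_left (by linarith [hx.1]) hC).trans hsmall
  nlinarith

/-! ### The reduced system -/

/-- The magnetic field strength `(1 - w²) / r`. -/
noncomputable def Trajectory.Q (y : Trajectory) (τ : ℝ) : ℝ := (1 - y.w τ ^ 2) / y.r τ

/-- The trajectory solves the autonomous equations at `τ`, and satisfies the constraint there. -/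
structure Reg (Λ : ℝ) (y : Trajectory) (τ : ℝ) : Prop where
  rpos : 0 < y.r τ
  dr : HasDerivAt y.r (y.r τ * y.N τ) τ
  dw : HasDerivAt y.w (y.r τ * y.U τ) τ
  dN : HasDerivAt y.N ((y.κ τ - y.N τ) * y.N τ - 2 * y.U τ ^ 2) τ
  dU : HasDerivAt y.U (-(y.w τ * y.Q τ) - (y.κ τ - y.N τ) * y.U τ) τ
  dκ : HasDerivAt y.κ (1 + 2 * y.U τ ^ 2 - y.κ τ ^ 2 - 2 * Λ * y.r τ ^ 2) τ
  con : 2 * y.κ τ * y.N τ = 1 + y.N τ ^ 2 + 2 * y.U τ ^ 2 - y.Q τ ^ 2 - Λ * y.r τ ^ 2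

/-- A solution on `(-∞, T)` that satisfies the constraint and cannot be continued beyond `T`. -/
structure Flow (Λ : ℝ) (y : Trajectory) (T : EReal) : Prop where
  reg : ∀ τ : ℝ, (τ : EReal) < T → Reg Λ y τ
  blowup : ∀ t a M : ℝ, T = t → a < t → (∀ τ ∈ Ico a t, y.r τ ≤ M ∧ (y.r τ)⁻¹ ≤ M ∧ |y.w τ| ≤ M ∧
    |y.N τ| ≤ M ∧ |y.U τ| ≤ M ∧ |y.κ τ| ≤ M) → False

namespace Reg

variable {Λ : ℝ} {y : Trajectory} {τ : ℝ}

/-- The constraint eliminates κ. For Λ ≥ 0 this form shows that the derivative of N is at most (1 -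
N²) / 2 - U², whatever κ does. -/
theorem dN' (H : Reg Λ y τ) : HasDerivAt y.N
    ((1 - y.N τ ^ 2) / 2 - y.U τ ^ 2 - y.Q τ ^ 2 / 2 - Λ * y.r τ ^ 2 / 2) τ :=
  H.dN.congr_deriv (by linarith [H.con])

/-- The constraint trades U² for Q², so that for Λ ≥ 0 the function κ grows at most at the rate Q².
-/
theorem dκ' (H : Reg Λ y τ) : HasDerivAt y.κ
    (-(y.κ τ - y.N τ) ^ 2 + y.Q τ ^ 2 - Λ * y.r τ ^ 2) τ :=
  H.dκ.congr_deriv (by linarith [H.con])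

/-- In the combination κ + 2 N the terms in U² cancel, which leaves a Riccati inequality; see
`length_le_of_P_le`. -/
theorem dP (H : Reg Λ y τ) : HasDerivAt (fun τ => y.κ τ + 2 * y.N τ)
    (2 - y.κ τ ^ 2 - y.N τ ^ 2 - y.Q τ ^ 2 - 3 * (Λ * y.r τ ^ 2)) τ :=
  (H.dκ.fun_add (H.dN'.const_mul 2)).congr_deriv (by ring)

theorem dS (H : Reg Λ y τ) : HasDerivAt (fun τ => y.N τ + y.κ τ)
    (1 + y.κ τ * y.N τ - y.N τ ^ 2 - y.κ τ ^ 2 - 2 * (Λ * y.r τ ^ 2)) τ :=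
  (H.dN.fun_add H.dκ).congr_deriv (by ring)

theorem dQ (H : Reg Λ y τ) : HasDerivAt y.Q (-2 * y.w τ * y.U τ - y.N τ * y.Q τ) τ := by
  have h0 := H.rpos.ne'
  refine (((H.dw.fun_pow 2).const_sub 1).fun_div H.dr h0).congr_deriv ?_
  simp only [Trajectory.Q]; field_simp; ring

theorem rQ (H : Reg Λ y τ) : y.r τ * y.Q τ = 1 - y.w τ ^ 2 := by
  have h0 := H.rpos.ne'
  simp only [Trajectory.Q]; field_simp

/-- The energy `r² U² - (1 - w²)² / 2` of the Yang-Mills field is monotone where `κ < 2 N`. -/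
theorem dh (H : Reg Λ y τ) :
    HasDerivAt (fun τ => (y.r τ * y.U τ) ^ 2 - (1 - y.w τ ^ 2) ^ 2 / 2)
    (2 * (y.r τ * y.U τ) ^ 2 * (2 * y.N τ - y.κ τ)) τ := by
  refine (((H.dr.fun_mul H.dU).fun_pow 2).fun_sub
    ((((H.dw.fun_pow 2).const_sub 1).fun_pow 2).div_const 2)).congr_deriv ?_
  rw [← H.rQ]; push_cast; ring

/-- Here r X is twice the mass function; it has derivative r N (Q² + 2 U²), so it grows with r. For
N > 0, X itself is driven towards Q² + 2 U², which yields barriers. -/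
theorem dX (H : Reg Λ y τ) :
    HasDerivAt (fun τ => 1 - y.N τ ^ 2 - Λ * y.r τ ^ 2 / 3)
    (y.N τ * (-(1 - y.N τ ^ 2 - Λ * y.r τ ^ 2 / 3) + y.Q τ ^ 2 + 2 * y.U τ ^ 2)) τ := by
  refine (((H.dN'.fun_pow 2).const_sub 1).fun_sub
    (((H.dr.fun_pow 2).const_mul Λ).div_const 3)).congr_deriv ?_
  push_cast; ring

end Reg

theorem Flow.regIcc {Λ : ℝ} {y : Trajectory} {T : EReal} (F : Flow Λ y T) {a b : ℝ}
    (hb : (b : EReal) < T) : ∀ τ ∈ Icc a b, Reg Λ y τ := fun τ hτ =>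
  F.reg τ ((EReal.coe_le_coe_iff.2 hτ.2).trans_lt hb)

theorem Flow.regIco {Λ : ℝ} {y : Trajectory} {t : ℝ} (F : Flow Λ y t) {a : ℝ} :
    ∀ τ ∈ Ico a t, Reg Λ y τ := fun τ hτ => F.reg τ (EReal.coe_lt_coe_iff.2 hτ.2)

/-! ### Filters at the end of a solution, and signs carried along the flow. -/

theorem upTo_top : upTo ⊤ = atTop := by
  rw [upTo]
  ext s
  rw [mem_comap, mem_atTop_sets]
  constructor
  · rintro ⟨u, hu, hus⟩
    obtain ⟨l, hl, hlu⟩ := (mem_nhdsLT_iff_exists_Ioo_subset' (a := (⊤ : EReal)) (l' := ⊥)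
      bot_lt_top).1 hu
    obtain ⟨x, hx1, hx2⟩ := EReal.lt_iff_exists_real_btwn.1 (mem_Iio.1 hl)
    refine ⟨x, fun b hb => hus (hlu ⟨hx1.trans_le (EReal.coe_le_coe_iff.2 hb), EReal.coe_lt_top b⟩)⟩
  · rintro ⟨a, ha⟩
    refine ⟨Ioo (a : EReal) ⊤, Ioo_mem_nhdsLT (EReal.coe_lt_top a), fun x hx => ha x ?_⟩
    exact (EReal.coe_lt_coe_iff.1 hx.1).le

theorem upTo_coe (t : ℝ) : upTo (t : EReal) = 𝓝[<] t := by
  rw [upTo]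
  ext s
  rw [mem_comap]
  constructor
  · rintro ⟨u, hu, hus⟩
    obtain ⟨l, hl, hlu⟩ := (mem_nhdsLT_iff_exists_Ioo_subset' (a := (t : EReal)) (l' := ⊥)
      (EReal.bot_lt_coe t)).1 hu
    obtain ⟨x, hx1, hx2⟩ := EReal.lt_iff_exists_real_btwn.1 (mem_Iio.1 hl)
    have hxt : x < t := EReal.coe_lt_coe_iff.1 hx2
    filter_upwards [Ioo_mem_nhdsLT hxt] with z hz
    exact hus (hlu ⟨hx1.trans (EReal.coe_lt_coe_iff.2 hz.1), EReal.coe_lt_coe_iff.2 hz.2⟩)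
  · intro hs
    obtain ⟨l, hl, hlu⟩ := (mem_nhdsLT_iff_exists_Ioo_subset' (a := t) (l' := t - 1)
      (by linarith)).1 hs
    refine ⟨Ioo (l : EReal) t, Ioo_mem_nhdsLT (EReal.coe_lt_coe_iff.2 hl), fun x hx => hlu ?_⟩
    exact ⟨EReal.coe_lt_coe_iff.1 hx.1, EReal.coe_lt_coe_iff.1 hx.2⟩

/-- Positivity propagates forward when `y' ≥ -C y`. -/
theorem pos_of_hasDerivAt_ge {y y' : ℝ → ℝ} {a b C : ℝ}
    (hy : ∀ x ∈ Icc a b, HasDerivAt y (y' x) x) (ha : 0 < y a)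
    (h : ∀ x ∈ Ico a b, (∀ z ∈ Icc a x, 0 < y z) → -C * y x ≤ y' x) :
    ∀ x ∈ Icc a b, 0 < y x := by
  refine continuous_induction ha (fun x hx hP => ?_) (fun x hx hP => ?_)
  · have hd : ∀ z ∈ Icc a x, HasDerivAt (fun z => Real.exp (C * z) * y z)
        (Real.exp (C * z) * (C * y z + y' z)) z := fun z hz =>
      ((((hasDerivAt_id' z).const_mul C).exp).fun_mul
        (hy z ⟨hz.1, hz.2.trans hx.2⟩)).congr_deriv (by ring)
    have := le_of_hasDerivAt_nonneg hx.1.le hd fun z hz => by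
      have := h z ⟨hz.1.le, hz.2.trans_le hx.2⟩ fun u hu => hP u ⟨hu.1, hu.2.trans_lt hz.2⟩
      have := Real.exp_pos (C * z)
      exact mul_nonneg this.le (by linarith)
    exact pos_of_mul_pos_right ((mul_pos (Real.exp_pos _) ha).trans_le this) (Real.exp_pos _).le
  · exact ((hy x ⟨hx.1, hx.2.le⟩).continuousAt.eventually
      (lt_mem_nhds (hP x ⟨hx.1, le_rfl⟩))).filter_mono nhdsWithin_le_nhds

/-- Positivity propagates backward when `y' ≤ C y`. -/
theorem pos_of_hasDerivAt_le {y y' : ℝ → ℝ} {a b C : ℝ}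
    (hy : ∀ x ∈ Icc a b, HasDerivAt y (y' x) x) (hb : 0 < y b)
    (h : ∀ x ∈ Icc a b, 0 < y x → y' x ≤ C * y x) :
    ∀ x ∈ Icc a b, 0 < y x := by
  have := pos_of_hasDerivAt_ge (y := fun x => y (-x)) (y' := fun x => -y' (-x)) (a := -b) (b := -a)
    (C := C)
    (fun x hx => by
      have h1 := hy (-x) ⟨by linarith [hx.2], by linarith [hx.1]⟩
      exact (HasDerivAt.comp x h1 (hasDerivAt_neg x)).congr_deriv (by ring))
    (by simpa using hb)
    (fun x hx hz => by
      have := h (-x) ⟨by linarith [hx.2], by linarith [hx.1]⟩ (hz x ⟨hx.1, le_rfl⟩)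
      linarith)
  intro x hx
  simpa using this (-x) ⟨by linarith [hx.2], by linarith [hx.1]⟩

theorem exists_abs_le_of_continuousOn {f : ℝ → ℝ} {a b : ℝ} (hf : ContinuousOn f (Icc a b)) :
    ∃ C, 0 ≤ C ∧ ∀ x ∈ Icc a b, |f x| ≤ C := by
  obtain ⟨C, hC⟩ := isCompact_Icc.exists_bound_of_continuousOn hf
  exact ⟨max C 0, le_max_right _ _, fun x hx => (hC x hx).trans (le_max_left _ _)⟩

theorem exists_abs_theta_le {Λ : ℝ} {y : Trajectory} {a b : ℝ} (H : ∀ τ ∈ Icc a b, Reg Λ y τ) :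
    ∃ C, 0 ≤ C ∧ ∀ x ∈ Icc a b, |y.κ x - y.N x| ≤ C :=
  exists_abs_le_of_continuousOn fun x hx =>
    ((H x hx).dκ.continuousAt.sub (H x hx).dN.continuousAt).continuousWithinAt

/-- The derivative (κ - N) N - 2 U² is linear in N up to a term of one sign. A Gronwall factor
therefore carries negative N forward and, in `N_pos_of_pos`, positive N backward. -/
theorem N_neg_of_neg {Λ : ℝ} {y : Trajectory} {a b : ℝ} (H : ∀ τ ∈ Icc a b, Reg Λ y τ)
    (ha : y.N a < 0) : ∀ τ ∈ Icc a b, y.N τ < 0 := by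
  obtain ⟨C, hC, hθ⟩ := exists_abs_theta_le H
  have := pos_of_hasDerivAt_ge (y := fun x => -y.N x) (C := C)
    (fun x hx => ((H x hx).dN).fun_neg) (by linarith)
    (fun x hx hz => by
      have h1 := abs_le.1 (hθ x ⟨hx.1, hx.2.le⟩)
      have h2 := hz x ⟨hx.1, le_rfl⟩
      nlinarith [sq_nonneg (y.U x)])
  intro τ hτ
  linarith [this τ hτ]

theorem N_pos_of_pos {Λ : ℝ} {y : Trajectory} {a b : ℝ} (H : ∀ τ ∈ Icc a b, Reg Λ y τ)
    (hb : 0 < y.N b) : ∀ τ ∈ Icc a b, 0 < y.N τ := by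
  obtain ⟨C, hC, hθ⟩ := exists_abs_theta_le H
  exact pos_of_hasDerivAt_le (C := C) (fun x hx => (H x hx).dN) hb
    (fun x hx hz => by
      have h1 := abs_le.1 (hθ x hx)
      nlinarith [sq_nonneg (y.U x)])

/-- At a zero of N the derivative is -2 U² < 0, so N crosses to negative values and stays there. -/
theorem N_neg_of_zero {Λ : ℝ} {y : Trajectory} {a b : ℝ} (H : ∀ τ ∈ Icc a b, Reg Λ y τ)
    (ha : y.N a = 0) (hU : y.U a ≠ 0) : ∀ τ ∈ Ioc a b, y.N τ < 0 := by
  intro τ hτ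
  have hd := (H a ⟨le_rfl, hτ.1.le.trans hτ.2⟩).dN
  rw [ha] at hd
  have hneg : (y.κ a - 0) * 0 - 2 * y.U a ^ 2 < 0 := by
    have : 0 < y.U a ^ 2 := by positivity
    linarith
  have hev : ∀ᶠ z in 𝓝[>] a, y.N z < 0 := by
    have h1 := (hasDerivWithinAt_iff_tendsto_slope' (s := Ioi a) (by simp)).1
      (hd.hasDerivWithinAt (s := Ioi a))
    filter_upwards [h1.eventually (gt_mem_nhds hneg), self_mem_nhdsWithin] with z hz hz'
    rw [slope_def_field, ha, sub_zero] at hz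
    by_contra h
    exact absurd hz (not_lt.2 (div_nonneg (not_lt.1 h) (sub_pos.2 hz').le))
  obtain ⟨z, hz, hz'⟩ := (hev.and (Ioc_mem_nhdsGT hτ.1)).exists
  exact N_neg_of_neg (fun x hx => H x ⟨hz'.1.le.trans hx.1, hx.2.trans hτ.2⟩) hz τ ⟨hz'.2, le_rfl⟩

/-- The first zero of a function that starts positive. -/
theorem exists_first_zero {f : ℝ → ℝ} {a b : ℝ} (hf : ∀ x ∈ Icc a b, ContinuousAt f x)
    (ha : 0 < f a) (hb : f b ≤ 0) (hab : a ≤ b) :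
    ∃ c ∈ Ioc a b, f c = 0 ∧ ∀ x ∈ Ico a c, 0 < f x := by
  by_contra hcon
  push Not at hcon
  have key : ∀ x ∈ Icc a b, 0 < f x := by
    refine continuous_induction ha (fun x hx hP => ?_) (fun x hx hP => ?_)
    · have h0 : 0 ≤ f x := by
        refine ge_of_tendsto (((hf x ⟨hx.1.le, hx.2⟩).tendsto).mono_left
          (nhdsWithin_le_nhds (s := Iio x))) ?_
        filter_upwards [Ico_mem_nhdsLT hx.1] with z hz using (hP z hz).le
      rcases h0.eq_or_lt with h | h
      · obtain ⟨z, hz, hz'⟩ := hcon x hx h.symm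
        exact absurd (hP z hz) (not_lt.2 hz')
      · exact h
    · exact ((hf x ⟨hx.1, hx.2.le⟩).eventually
        (lt_mem_nhds (hP x ⟨hx.1, le_rfl⟩))).filter_mono nhdsWithin_le_nhds
  exact absurd (key b ⟨hab, le_rfl⟩) (not_lt.2 hb)

/-- Either `N > 0` throughout, or `r` turns at a point where all of the constraint is known. -/
theorem Flow.pos_or_zero {Λ : ℝ} {y : Trajectory} {T : EReal} (F : Flow Λ y T) {a : ℝ}
    (ha : (a : EReal) < T) (hN : 0 < y.N a) :
    (∀ τ : ℝ, (τ : EReal) < T → 0 < y.N τ) ∨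
      ∃ c : ℝ, a < c ∧ (c : EReal) < T ∧ y.N c = 0 ∧ ∀ τ < c, 0 < y.N τ := by
  have hbefore : ∀ b : ℝ, (b : EReal) < T → 0 < y.N b → ∀ τ ≤ b, 0 < y.N τ := fun b hb hNb τ hτ =>
    N_pos_of_pos (F.regIcc (a := τ) hb) hNb τ ⟨le_rfl, hτ⟩
  by_cases h : ∀ τ : ℝ, (τ : EReal) < T → 0 < y.N τ
  · exact Or.inl h
  right
  push Not at h
  obtain ⟨b, hbT, hNb⟩ := h
  have hab : a ≤ b := by
    by_contra hba
    exact absurd (hbefore a ha hN b (le_of_lt (not_le.1 hba))) (not_lt.2 hNb)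
  obtain ⟨c, hc, hc0, hcpos⟩ := exists_first_zero
    (fun x hx => (F.regIcc hbT x hx).dN.continuousAt) hN hNb hab
  have hcT : (c : EReal) < T := (EReal.coe_le_coe_iff.2 hc.2).trans_lt hbT
  refine ⟨c, hc.1, hcT, hc0, fun τ hτ => ?_⟩
  rcases le_or_gt τ a with h | h
  · exact hbefore a ha hN τ h
  · exact hcpos τ ⟨h.le, hτ⟩

theorem Flow.turnsAt {Λ : ℝ} {y : Trajectory} {T : EReal} (F : Flow Λ y T) {c : ℝ}
    (hc : (c : EReal) < T) (h0 : y.N c = 0) (hpos : ∀ τ < c, 0 < y.N τ) (hU : y.U c ≠ 0) :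
    TurnsAt y T c :=
  ⟨hc, hpos, h0, fun τ hτ hτT => N_neg_of_zero (F.regIcc (a := c) hτT) h0 hU τ ⟨hτ, le_rfl⟩⟩

theorem nonneg_of_forall_Ico {f : ℝ → ℝ} {a x : ℝ} (hf : ContinuousAt f x) (hax : a < x)
    (h : ∀ z ∈ Ico a x, 0 ≤ f z) : 0 ≤ f x := by
  refine ge_of_tendsto (hf.tendsto.mono_left (nhdsWithin_le_nhds (s := Iio x))) ?_
  filter_upwards [Ico_mem_nhdsLT hax] with z hz using h z hz

/-! ### Barriers and a priori bounds. -/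

/-- A function cannot exceed the value `m` if it decreases above `m`. -/
theorem le_of_barrier {f f' : ℝ → ℝ} {a b m : ℝ} (hf : ∀ x ∈ Icc a b, HasDerivAt f (f' x) x)
    (ha : f a ≤ m) (h : ∀ x ∈ Ico a b, m < f x → f' x ≤ 0) : ∀ x ∈ Icc a b, f x ≤ m := by
  intro τ hτ
  -- The slack ε turns the claim into an open condition, as continuous induction requires.
  refine le_of_forall_pos_lt_add fun ε hε => ?_
  revert τ
  refine continuous_induction (by linarith) (fun x hx hP => ?_) (fun x hx hP => ?_)
  · by_contra hcon
    push Not at hcon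
    have hgt : ∀ᶠ z in 𝓝[<] x, m < f z :=
      ((hf x ⟨hx.1.le, hx.2⟩).continuousAt.eventually (lt_mem_nhds
        (show m < f x by linarith))).filter_mono nhdsWithin_le_nhds
    obtain ⟨l, hl, hl'⟩ := (mem_nhdsLT_iff_exists_Ioo_subset' hx.1).1 hgt
    have hz : (max l a + x) / 2 < x := by linarith [max_lt hl hx.1]
    have hz1 : max l a < (max l a + x) / 2 := by linarith [max_lt hl hx.1]
    have hza : a ≤ (max l a + x) / 2 := (le_max_right l a).trans hz1.le
    have := ge_of_hasDerivAt_nonpos hz.le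
      (fun u hu => hf u ⟨hza.trans hu.1, hu.2.trans hx.2⟩)
      (fun u hu => h u ⟨hza.trans hu.1.le, hu.2.trans_le hx.2⟩
        (hl' ⟨((le_max_left l a).trans_lt hz1).trans hu.1, hu.2⟩))
    linarith [hP _ ⟨hza, hz⟩]
  · exact ((hf x ⟨hx.1, hx.2.le⟩).continuousAt.eventually
      (gt_mem_nhds (hP x ⟨hx.1, le_rfl⟩))).filter_mono nhdsWithin_le_nhds

/-- `N ≤ 1` is preserved. -/
theorem N_le_max {Λ : ℝ} (hΛ : 0 ≤ Λ) {y : Trajectory} {a b : ℝ} (H : ∀ τ ∈ Icc a b, Reg Λ y τ) :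
    ∀ τ ∈ Icc a b, y.N τ ≤ max 1 (y.N a) :=
  le_of_barrier (fun x hx => (H x hx).dN') (le_max_right _ _) fun x _ h => by
    have h1 : 1 < y.N x := (le_max_left _ _).trans_lt h
    have := mul_nonneg hΛ (sq_nonneg (y.r x))
    nlinarith [sq_nonneg (y.U x), sq_nonneg (y.Q x)]

/-- Once `κ + 2 N` is sufficiently negative, the solution ends soon, as long as `|N| ≤ 2`. -/
theorem length_le_of_P_le {Λ : ℝ} (hΛ : 0 ≤ Λ) {y : Trajectory} {a b : ℝ} (hab : a ≤ b)
    (H : ∀ τ ∈ Icc a b, Reg Λ y τ) (hN : ∀ τ ∈ Icc a b, |y.N τ| ≤ 2)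
    (hP : y.κ a + 2 * y.N a ≤ -10) : b - a ≤ 4 / -(y.κ a + 2 * y.N a) := by
  -- As |N| ≤ 2, one has κ ≤ P + 4 < 0 for P = κ + 2 N ≤ -8, hence κ² ≥ (P + 4)².
  have hsq : ∀ x ∈ Icc a b, y.κ x + 2 * y.N x ≤ -8 → 2 - y.κ x ^ 2 - y.N x ^ 2 - y.Q x ^ 2
      - 3 * (Λ * y.r x ^ 2) ≤ 2 - (y.κ x + 2 * y.N x + 4) ^ 2 := fun x hx h => by
    have h1 := abs_le.1 (hN x hx)
    have := mul_nonneg hΛ (sq_nonneg (y.r x))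
    nlinarith [sq_nonneg (y.N x), sq_nonneg (y.Q x)]
  have hle : ∀ x ∈ Icc a b, (∀ z ∈ Ico a x, y.κ z + 2 * y.N z < -8) →
      y.κ x + 2 * y.N x ≤ y.κ a + 2 * y.N a := fun x hx h =>
    ge_of_hasDerivAt_nonpos hx.1 (fun u hu => (H u ⟨hu.1, hu.2.trans hx.2⟩).dP) fun u hu => by
      have h1 := h u ⟨hu.1.le, hu.2⟩
      have h2 := hsq u ⟨hu.1.le, hu.2.le.trans hx.2⟩ h1.le
      nlinarith
  have hlt : ∀ x ∈ Icc a b, y.κ x + 2 * y.N x < -8 :=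
    continuous_induction (by linarith) (fun x hx h => by
      linarith [hle x ⟨hx.1.le, hx.2⟩ h]) (fun x hx h =>
      ((H x ⟨hx.1, hx.2.le⟩).dP.continuousAt.eventually
        (gt_mem_nhds (h x ⟨hx.1, le_rfl⟩))).filter_mono nhdsWithin_le_nhds)
  have hle' : ∀ x ∈ Icc a b, y.κ x + 2 * y.N x ≤ -10 := fun x hx =>
    (hle x hx fun z hz => hlt z ⟨hz.1, hz.2.le.trans hx.2⟩).trans hP
  -- For P ≤ -10 one has (P + 4)² - 2 ≥ P² / 4. So 1 / P grows at least at the rate 1/4 while it has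
  -- to stay negative.
  have := add_mul_le_of_hasDerivAt (f := fun x => (y.κ x + 2 * y.N x)⁻¹) (C := 1 / 4) hab
    (fun x hx => (H x hx).dP.fun_inv (by linarith [hle' x hx])) (fun x hx => by
      have hx' : x ∈ Icc a b := ⟨hx.1.le, hx.2.le⟩
      have h1 := hle' x hx'
      have h2 := hsq x hx' (by linarith)
      rw [le_div_iff₀ (by nlinarith)]
      nlinarith)
  have h3 : (y.κ b + 2 * y.N b)⁻¹ < 0 := inv_lt_zero.2 (by linarith [hle' b ⟨hab, le_rfl⟩])
  rw [div_neg, div_eq_mul_inv]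
  linarith

/-- Since log r has derivative N, r and 1/r are bounded. The derivative r U of w is not controlled
by N, but ±w + (R / 2) N grows at most linearly: the term -U² in the derivative of N absorbs R |U|.
-/
theorem bounds_of_N_bounded {Λ : ℝ} (hΛ : 0 ≤ Λ) {y : Trajectory} {a t B : ℝ}
    (H : ∀ τ ∈ Ico a t, Reg Λ y τ) (hN : ∀ τ ∈ Ico a t, |y.N τ| ≤ B) (hat : a < t) :
    ∃ C, 0 < C ∧ ∀ τ ∈ Ico a t, y.r τ ≤ C ∧ (y.r τ)⁻¹ ≤ C ∧ |y.w τ| ≤ C := by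
  have hB : 0 ≤ B := (abs_nonneg _).trans (hN a ⟨le_rfl, hat⟩)
  have hts : 0 < t - a := sub_pos.2 hat
  set l := |Real.log (y.r a)| + B * (t - a) with hl
  have hlog : ∀ τ ∈ Ico a t, |Real.log (y.r τ)| ≤ l := by
    intro τ hτ
    have hd : ∀ x ∈ Icc a τ, HasDerivAt (fun x => Real.log (y.r x)) (y.N x) x := fun x hx => by
      have h := H x ⟨hx.1, hx.2.trans_lt hτ.2⟩
      exact (h.dr.log h.rpos.ne').congr_deriv (mul_div_cancel_left₀ _ h.rpos.ne')
    have h1 := le_add_mul_of_hasDerivAt (C := B) hτ.1 hd fun x hx =>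
      (abs_le.1 (hN x ⟨hx.1.le, hx.2.trans hτ.2⟩)).2
    have h2 := add_mul_le_of_hasDerivAt (C := -B) hτ.1 hd fun x hx =>
      (abs_le.1 (hN x ⟨hx.1.le, hx.2.trans hτ.2⟩)).1
    have h3 : B * (τ - a) ≤ B * (t - a) := mul_le_mul_of_nonneg_left (by linarith [hτ.2]) hB
    rw [abs_le]
    constructor <;> linarith [neg_abs_le (Real.log (y.r a)), le_abs_self (Real.log (y.r a))]
  set R := Real.exp l with hR
  have hRpos : 0 < R := Real.exp_pos _
  have hr : ∀ τ ∈ Ico a t, y.r τ ≤ R := fun τ hτ =>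
    (Real.log_le_iff_le_exp (H τ hτ).rpos).1 (abs_le.1 (hlog τ hτ)).2
  have hr' : ∀ τ ∈ Ico a t, (y.r τ)⁻¹ ≤ R := fun τ hτ => by
    rw [← Real.log_le_iff_le_exp (inv_pos.2 (H τ hτ).rpos), Real.log_inv]
    linarith [(abs_le.1 (hlog τ hτ)).1]
  have hw : ∀ τ ∈ Ico a t, |y.w τ| ≤ |y.w a| + R * B + R * (t - a) := by
    intro τ hτ
    have hIcc : ∀ x ∈ Icc a τ, x ∈ Ico a t := fun x hx => ⟨hx.1, hx.2.trans_lt hτ.2⟩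
    have hbound : ∀ ε : ℝ, |ε| = 1 → ε * y.w τ ≤ |y.w a| + R * B + R * (t - a) := by
      intro ε hε
      have h1 := le_add_mul_of_hasDerivAt (f := fun x => ε * y.w x + R / 2 * y.N x) (C := R) hτ.1
        (fun x hx => ((H x (hIcc x hx)).dw.const_mul ε).fun_add
          ((H x (hIcc x hx)).dN'.const_mul (R / 2))) (fun x hx => by
          have hx' := hIcc x ⟨hx.1.le, hx.2.le⟩
          have h2 : ε * (y.r x * y.U x) ≤ R * |y.U x| := by
            calc ε * (y.r x * y.U x) ≤ |ε * (y.r x * y.U x)| := le_abs_self _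
              _ = y.r x * |y.U x| := by rw [abs_mul, abs_mul, hε, abs_of_pos (H x hx').rpos, one_mul]
              _ ≤ R * |y.U x| := mul_le_mul_of_nonneg_right (hr x hx') (abs_nonneg _)
          have h3 := mul_nonneg hΛ (sq_nonneg (y.r x))
          have h4 : (1 - y.N x ^ 2) / 2 - y.U x ^ 2 - y.Q x ^ 2 / 2 - Λ * y.r x ^ 2 / 2
              ≤ 1 / 2 - |y.U x| ^ 2 := by
            rw [sq_abs]; nlinarith [sq_nonneg (y.N x), sq_nonneg (y.Q x)]
          nlinarith [mul_le_mul_of_nonneg_left h4 hRpos.le,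
            mul_nonneg hRpos.le (sq_nonneg (|y.U x| - 1))])
      have h2 : ε * y.w a ≤ |y.w a| := by
        calc ε * y.w a ≤ |ε * y.w a| := le_abs_self _
          _ = |y.w a| := by rw [abs_mul, hε, one_mul]
      have h3 := abs_le.1 (hN a ⟨le_rfl, hat⟩)
      have h4 := abs_le.1 (hN τ hτ)
      have h5 : R * (τ - a) ≤ R * (t - a) := mul_le_mul_of_nonneg_left (by linarith [hτ.2]) hRpos.le
      nlinarith
    rw [abs_le]
    have h1 := hbound 1 (by simp)
    have h2 := hbound (-1) (by simp)
    constructor <;> linarith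
  refine ⟨R + (|y.w a| + R * B + R * (t - a)), by positivity, fun τ hτ => ⟨?_, ?_, ?_⟩⟩
  · have := hr τ hτ; have : 0 ≤ |y.w a| + R * B + R * (t - a) := by positivity
    linarith
  · have := hr' τ hτ; have : 0 ≤ |y.w a| + R * B + R * (t - a) := by positivity
    linarith
  · linarith [hw τ hτ]

/-! ### The finite end of a solution with bounded N is a horizon. -/

set_option maxHeartbeats 1000000 in
/-- If `N` stays bounded up to the finite end of a solution, then the solution ends at a horizon:
`κ → -∞`, and `N` and `U` vanish there to first order. -/
theorem Flow.horizon {Λ : ℝ} (hΛ : 0 ≤ Λ) {y : Trajectory} {t a B : ℝ} (F : Flow Λ y t)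
    (hat : a < t) (hN : ∀ τ ∈ Ico a t, |y.N τ| ≤ B) :
    ∃ b C, a ≤ b ∧ b < t ∧ 0 < C ∧ ∀ τ ∈ Ico b t, y.κ τ < 0 ∧ |y.U τ| ≤ C * (t - τ) ∧
      |y.N τ| ≤ C * (t - τ) ∧ -y.κ τ * (t - τ) ≤ C ∧ 1 ≤ C * (-y.κ τ * (t - τ)) ∧ y.r τ ≤ C ∧
      (y.r τ)⁻¹ ≤ C ∧ |y.w τ| ≤ C ∧ |y.Q τ| ≤ C ∧ Λ * y.r τ ^ 2 ≤ C := by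
  have H := F.regIco (a := a)
  have hB : 0 ≤ B := (abs_nonneg _).trans (hN a ⟨le_rfl, hat⟩)
  obtain ⟨C, hC, hbd⟩ := bounds_of_N_bounded hΛ H hN hat
  have hQ : ∀ τ ∈ Ico a t, |y.Q τ| ≤ (1 + C ^ 2) * C := fun τ hτ => by
    obtain ⟨h1, h2, h3⟩ := hbd τ hτ
    rw [Trajectory.Q, div_eq_mul_inv, abs_mul, abs_of_pos (inv_pos.2 (H τ hτ).rpos)]
    have h4 : |1 - y.w τ ^ 2| ≤ 1 + C ^ 2 := by
      have : y.w τ ^ 2 ≤ C ^ 2 := sq_le_sq' (abs_le.1 h3).1 (abs_le.1 h3).2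
      rw [abs_le]; constructor <;> nlinarith [sq_nonneg (y.w τ)]
    have := inv_pos.2 (H τ hτ).rpos
    gcongr
  set q := (1 + C ^ 2) * C with hq
  have hq0 : 0 ≤ q := by positivity
  have hL : ∀ τ ∈ Ico a t, Λ * y.r τ ^ 2 ≤ Λ * C ^ 2 := fun τ hτ => by
    have := (H τ hτ).rpos
    have := (hbd τ hτ).1
    gcongr
  have hL0 : ∀ τ, 0 ≤ Λ * y.r τ ^ 2 := fun τ => mul_nonneg hΛ (sq_nonneg _)
  have hQ2 : ∀ τ ∈ Ico a t, y.Q τ ^ 2 ≤ q ^ 2 := fun τ hτ =>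
    sq_le_sq' (abs_le.1 (hQ τ hτ)).1 (abs_le.1 (hQ τ hτ)).2
  have hN2 : ∀ τ ∈ Ico a t, y.N τ ^ 2 ≤ B ^ 2 := fun τ hτ =>
    sq_le_sq' (abs_le.1 (hN τ hτ)).1 (abs_le.1 (hN τ hτ)).2
  set E := 1 + B ^ 2 + q ^ 2 + Λ * C ^ 2 with hE
  have hE1 : 1 ≤ E := by
    have : 0 ≤ Λ * C ^ 2 := by positivity
    nlinarith [sq_nonneg B, sq_nonneg q]
  have hU2 : ∀ τ ∈ Ico a t, y.U τ ^ 2 ≤ B * |y.κ τ| + E := fun τ hτ => by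
    have h1 : y.κ τ * y.N τ ≤ |y.κ τ| * B := by
      calc _ ≤ |y.κ τ * y.N τ| := le_abs_self _
        _ = |y.κ τ| * |y.N τ| := abs_mul _ _
        _ ≤ _ := mul_le_mul_of_nonneg_left (hN τ hτ) (abs_nonneg _)
    nlinarith [(H τ hτ).con, hQ2 τ hτ, hL τ hτ, sq_nonneg (y.N τ), sq_nonneg q, sq_nonneg B,
      hL0 τ, sq_nonneg (y.Q τ)]
  have hκup : ∀ x ∈ Ico a t, ∀ τ ∈ Ico x t, y.κ τ ≤ y.κ x + q ^ 2 * (t - a) := fun x hx τ hτ => by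
    have := le_add_mul_of_hasDerivAt (C := q ^ 2) hτ.1
      (fun z hz => (H z ⟨hx.1.trans hz.1, hz.2.trans_lt hτ.2⟩).dκ') (fun z hz => by
        have := hQ2 z ⟨hx.1.trans hz.1.le, hz.2.trans hτ.2⟩
        nlinarith [hL0 z, sq_nonneg (y.κ z - y.N z)])
    have h2 : q ^ 2 * (τ - x) ≤ q ^ 2 * (t - a) :=
      mul_le_mul_of_nonneg_left (by linarith [hτ.2, hx.1]) (sq_nonneg _)
    linarith
  -- Since κ grows at most at the rate q², one very negative value keeps κ very negative. Without
  -- such values κ, and by the constraint U, would be bounded, contrary to `blowup`.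
  have hunb : ∀ M, ∃ x ∈ Ico a t, ∀ τ ∈ Ico x t, y.κ τ ≤ -M := by
    intro M
    set M' := |M| + q ^ 2 * (t - a) with hM'
    have hM'0 : 0 ≤ M' := by have := sub_pos.2 hat; positivity
    obtain ⟨x, hx, hκx⟩ : ∃ x ∈ Ico a t, y.κ x < -M' := by
      by_contra hcon
      push Not at hcon
      set K := M' + |y.κ a| + q ^ 2 * (t - a) with hK
      have hts := sub_pos.2 hat
      have hK0 : 0 ≤ K := by positivity
      have hκK : ∀ τ ∈ Ico a t, |y.κ τ| ≤ K := fun τ hτ => by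
        have h1 := hcon τ hτ
        have h2 := hκup a ⟨le_rfl, hat⟩ τ hτ
        have h3 : 0 ≤ q ^ 2 * (t - a) := by positivity
        rw [abs_le]; constructor <;> linarith [le_abs_self (y.κ a), abs_nonneg (y.κ a)]
      refine F.blowup t a (C + B + K + (1 + (B * K + E))) rfl hat fun τ hτ => ?_
      obtain ⟨h1, h2, h3⟩ := hbd τ hτ
      have hBK : 0 ≤ B * K := by positivity
      have h4 : |y.U τ| ≤ 1 + (B * K + E) := by
        have h5 := hU2 τ hτ
        have h6 : B * |y.κ τ| ≤ B * K := mul_le_mul_of_nonneg_left (hκK τ hτ) hB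
        rw [← sq_abs] at h5
        nlinarith [abs_nonneg (y.U τ), sq_nonneg (|y.U τ| - 1)]
      have h5 := hκK τ hτ
      have h6 := hN τ hτ
      refine ⟨?_, ?_, ?_, ?_, ?_, ?_⟩ <;> linarith
    refine ⟨x, hx, fun τ hτ => ?_⟩
    linarith [hκup x hx τ hτ, le_abs_self M]
  -- a neighbourhood of the end where `κ` is large
  obtain ⟨x, hx, hκx⟩ := hunb (8 * B + 4 * E + 1)
  have hIco : ∀ τ ∈ Ico x t, τ ∈ Ico a t := fun τ hτ => ⟨hx.1.trans hτ.1, hτ.2⟩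
  have hbotlim : Tendsto y.κ (𝓝[<] t) atBot := by
    rw [tendsto_atBot]
    intro M
    obtain ⟨z, hz, hz'⟩ := hunb (-M)
    filter_upwards [Ico_mem_nhdsLT hz.2] with τ hτ
    linarith [hz' τ hτ]
  have hκ0 : ∀ τ ∈ Ico x t, y.κ τ < 0 := fun τ hτ => by linarith [hκx τ hτ]
  -- These are the terms by which the derivative of κ differs from -κ². Once they are at most κ² /
  -- 2, the derivative of 1 / κ lies between 1/2 and 3/2, and -κ (t - τ) between 1/2 and 2.
  have hrest : ∀ τ ∈ Ico x t,
      |2 * y.κ τ * y.N τ - y.N τ ^ 2 + y.Q τ ^ 2 - Λ * y.r τ ^ 2| ≤ y.κ τ ^ 2 / 2 := fun τ hτ => by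
    have hτ' := hIco τ hτ
    have h1 : |y.κ τ * y.N τ| ≤ -y.κ τ * B := by
      rw [abs_mul, abs_of_neg (hκ0 τ hτ)]
      exact mul_le_mul_of_nonneg_left (hN τ hτ') (by linarith [hκ0 τ hτ])
    have h2 := abs_le.1 h1
    have h3 := hκx τ hτ
    have h4 : -y.κ τ * B * 8 ≤ y.κ τ ^ 2 := by nlinarith
    have h5 : 4 * E ≤ y.κ τ ^ 2 := by nlinarith
    have := hQ2 τ hτ'; have := hN2 τ hτ'; have := hL τ hτ'; have := hL0 τ
    have := sq_nonneg (y.Q τ); have := sq_nonneg (y.N τ); have := sq_nonneg B; have := sq_nonneg q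
    rw [abs_le]; constructor <;> nlinarith
  have hdinv : ∀ τ ∈ Ico x t, HasDerivAt (fun τ => (y.κ τ)⁻¹)
      (-(-(y.κ τ - y.N τ) ^ 2 + y.Q τ ^ 2 - Λ * y.r τ ^ 2) / y.κ τ ^ 2) τ := fun τ hτ =>
    (H τ (hIco τ hτ)).dκ'.fun_inv (hκ0 τ hτ).ne
  have hinvlim : Tendsto (fun τ => (y.κ τ)⁻¹) (𝓝[<] t) (𝓝 0) :=
    tendsto_inv_atBot_zero.comp hbotlim
  have hinv : ∀ τ ∈ Ico x t, (y.κ τ)⁻¹ ≤ -((t - τ) / 2) ∧ -(3 / 2 * (t - τ)) ≤ (y.κ τ)⁻¹ := by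
    intro τ hτ
    have hd := fun (σ : ℝ) (hσ : σ ∈ Ico τ t) => fun z (hz : z ∈ Icc τ σ) =>
      hdinv z ⟨hτ.1.trans hz.1, hz.2.trans_lt hσ.2⟩
    have hb : ∀ z ∈ Ico x t,
        1 / 2 ≤ -(-(y.κ z - y.N z) ^ 2 + y.Q z ^ 2 - Λ * y.r z ^ 2) / y.κ z ^ 2 ∧
        -(-(y.κ z - y.N z) ^ 2 + y.Q z ^ 2 - Λ * y.r z ^ 2) / y.κ z ^ 2 ≤ 3 / 2 := fun z hz => by
      have h1 := abs_le.1 (hrest z hz)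
      have h2 : 0 < y.κ z ^ 2 := by have := (hκ0 z hz).ne; positivity
      rw [le_div_iff₀ h2, div_le_iff₀ h2]
      constructor <;> nlinarith
    constructor
    · have h1 : ∀ σ ∈ Ico τ t, (y.κ τ)⁻¹ + 1 / 2 * (σ - τ) ≤ (y.κ σ)⁻¹ := fun σ hσ =>
        add_mul_le_of_hasDerivAt hσ.1 (hd σ hσ) fun z hz =>
          (hb z ⟨hτ.1.trans hz.1.le, hz.2.trans hσ.2⟩).1
      have h2 : Tendsto (fun σ => (y.κ τ)⁻¹ + 1 / 2 * (σ - τ)) (𝓝[<] t)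
          (𝓝 ((y.κ τ)⁻¹ + 1 / 2 * (t - τ))) :=
        (Continuous.tendsto (by fun_prop) t).mono_left nhdsWithin_le_nhds
      have := le_of_tendsto_of_tendsto h2 hinvlim
        (by filter_upwards [Ico_mem_nhdsLT hτ.2] with σ hσ using h1 σ hσ)
      linarith
    · have h1 : ∀ σ ∈ Ico τ t, (y.κ σ)⁻¹ ≤ (y.κ τ)⁻¹ + 3 / 2 * (σ - τ) := fun σ hσ =>
        le_add_mul_of_hasDerivAt hσ.1 (hd σ hσ) fun z hz =>
          (hb z ⟨hτ.1.trans hz.1.le, hz.2.trans hσ.2⟩).2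
      have h2 : Tendsto (fun σ => (y.κ τ)⁻¹ + 3 / 2 * (σ - τ)) (𝓝[<] t)
          (𝓝 ((y.κ τ)⁻¹ + 3 / 2 * (t - τ))) :=
        (Continuous.tendsto (by fun_prop) t).mono_left nhdsWithin_le_nhds
      have := le_of_tendsto_of_tendsto hinvlim h2
        (by filter_upwards [Ico_mem_nhdsLT hτ.2] with σ hσ using h1 σ hσ)
      linarith
  have hκs : ∀ τ ∈ Ico x t, -y.κ τ * (t - τ) ≤ 2 ∧ 1 ≤ 2 * (-y.κ τ * (t - τ)) := fun τ hτ => by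
    obtain ⟨h1, h2⟩ := hinv τ hτ
    have h3 : y.κ τ * (y.κ τ)⁻¹ = 1 := mul_inv_cancel₀ (hκ0 τ hτ).ne
    have h4 := hκ0 τ hτ
    constructor <;> nlinarith
  -- `U / κ` vanishes to second order
  have hylim : Tendsto (fun τ => y.U τ / y.κ τ) (𝓝[<] t) (𝓝 0) := by
    have h1 : Tendsto (fun τ => -B * (y.κ τ)⁻¹ + E * ((y.κ τ)⁻¹) ^ 2) (𝓝[<] t) (𝓝 0) := by
      have := (hinvlim.const_mul (-B)).add ((hinvlim.pow 2).const_mul E)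
      simpa using this
    have h2 : Tendsto (fun τ => (y.U τ / y.κ τ) ^ 2) (𝓝[<] t) (𝓝 0) := by
      refine squeeze_zero' (Eventually.of_forall fun τ => sq_nonneg _) ?_ h1
      filter_upwards [Ico_mem_nhdsLT hx.2] with τ hτ
      have h3 := hU2 τ (hIco τ hτ)
      have h4 := hκ0 τ hτ
      rw [abs_of_neg h4] at h3
      rw [div_pow, div_le_iff₀ (by have := h4.ne; positivity)]
      have h5 : (-B * (y.κ τ)⁻¹ + E * ((y.κ τ)⁻¹) ^ 2) * y.κ τ ^ 2 = -B * y.κ τ + E := by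
        have := h4.ne
        field_simp
      rw [h5]; linarith
    have h3 := h2.sqrt
    simp only [Real.sqrt_sq_eq_abs, Real.sqrt_zero] at h3
    exact (tendsto_zero_iff_abs_tendsto_zero _).2 h3
  set D := 3 / 2 * (C * q) with hD
  have hD0 : 0 ≤ D := by positivity
  set C₁ := B + E with hC₁
  have hC₁0 : 0 < C₁ := by positivity
  set b := max x (t - 1 / (2 * C₁)) with hb
  have hbt : b < t := max_lt hx.2 (by have : 0 < 1 / (2 * C₁) := by positivity
                                      linarith)
  have hbx : ∀ τ ∈ Ico b t, τ ∈ Ico x t := fun τ hτ => ⟨(le_max_left _ _).trans hτ.1, hτ.2⟩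
  -- In the derivative of U / κ the terms of order κ cancel. What remains is a bounded multiple of U
  -- / κ and the source -w Q / κ, which is of order t - τ.
  have hyb := abs_le_of_tendsto_zero (y := fun τ => y.U τ / y.κ τ)
    (y' := fun τ => -(y.w τ * y.Q τ) / y.κ τ + y.U τ / y.κ τ *
      (-y.N τ + (y.N τ ^ 2 - y.Q τ ^ 2 + Λ * y.r τ ^ 2) / y.κ τ))
    (a := b) (t := t) (C := C₁) (D := D) hC₁0.le hD0
    (fun τ hτ => by
      have h1 := H τ (hIco τ (hbx τ hτ))
      have h2 := (hκ0 τ (hbx τ hτ)).ne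
      refine (h1.dU.fun_div h1.dκ' h2).congr_deriv ?_
      field_simp
      ring)
    (fun τ hτ => by
      have hτ' := hIco τ (hbx τ hτ)
      have h2 := hκ0 τ (hbx τ hτ)
      have h3 := hκx τ (hbx τ hτ)
      have h4 : |(y.κ τ)⁻¹| ≤ 3 / 2 * (t - τ) := by
        rw [abs_of_neg (inv_lt_zero.2 h2)]; linarith [(hinv τ (hbx τ hτ)).2]
      have h5 : |(y.κ τ)⁻¹| ≤ 1 := by
        rw [abs_inv, abs_of_neg h2]; exact inv_le_one_of_one_le₀ (by linarith)
      have h6 : |y.w τ * y.Q τ| ≤ C * q := by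
        rw [abs_mul]; exact mul_le_mul (hbd τ hτ').2.2 (hQ τ hτ') (abs_nonneg _) hC.le
      have h7 : |y.N τ ^ 2 - y.Q τ ^ 2 + Λ * y.r τ ^ 2| ≤ E := by
        have := hQ2 τ hτ'; have := hN2 τ hτ'; have := hL τ hτ'; have := hL0 τ
        have := sq_nonneg (y.Q τ); have := sq_nonneg (y.N τ); have := sq_nonneg B
        have := sq_nonneg q
        rw [abs_le]; constructor <;> linarith
      have hts : 0 < t - τ := sub_pos.2 hτ.2
      calc _ ≤ |-(y.w τ * y.Q τ) / y.κ τ| + |y.U τ / y.κ τ *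
            (-y.N τ + (y.N τ ^ 2 - y.Q τ ^ 2 + Λ * y.r τ ^ 2) / y.κ τ)| := abs_add_le _ _
        _ ≤ C * q * (3 / 2 * (t - τ)) + |y.U τ / y.κ τ| * (B + E * 1) := by
          refine add_le_add ?_ ?_
          · rw [div_eq_mul_inv, abs_mul, abs_neg]
            exact mul_le_mul h6 h4 (abs_nonneg _) (by positivity)
          · rw [abs_mul]
            refine mul_le_mul_of_nonneg_left ?_ (abs_nonneg _)
            refine (abs_add_le _ _).trans (add_le_add ?_ ?_)
            · rw [abs_neg]; exact hN τ hτ'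
            · rw [div_eq_mul_inv, abs_mul]
              exact mul_le_mul h7 h5 (abs_nonneg _) (by linarith)
        _ = C₁ * |y.U τ / y.κ τ| + D * (t - τ) := by rw [hC₁, hD]; ring)
    hylim
    (by
      have : t - b ≤ 1 / (2 * C₁) := by linarith [le_max_right x (t - 1 / (2 * C₁))]
      calc C₁ * (t - b) ≤ C₁ * (1 / (2 * C₁)) := mul_le_mul_of_nonneg_left this hC₁0.le
        _ = 1 / 2 := by field_simp)
  have hUs : ∀ τ ∈ Ico b t, |y.U τ| ≤ 4 * D * (t - τ) := fun τ hτ => by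
    have h1 := hyb τ hτ
    have h2 := hκ0 τ (hbx τ hτ)
    have h3 := (hκs τ (hbx τ hτ)).1
    have hts : 0 < t - τ := sub_pos.2 hτ.2
    rw [abs_div, abs_of_neg h2, div_le_iff₀ (by linarith)] at h1
    calc |y.U τ| ≤ 2 * D * (t - τ) * (-y.κ τ * (t - τ)) := by linarith
      _ ≤ 2 * D * (t - τ) * 2 := by gcongr
      _ = _ := by ring
  set G := 1 + B ^ 2 + 2 * (4 * D * (t - a)) ^ 2 + q ^ 2 + Λ * C ^ 2 with hG
  have hG0 : 0 < G := by positivity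
  -- The constraint bounds κ N, and 1 / |κ| is of order t - τ.
  have hNs : ∀ τ ∈ Ico b t, |y.N τ| ≤ G * (t - τ) := fun τ hτ => by
    have hτ' := hIco τ (hbx τ hτ)
    have h2 := hκ0 τ (hbx τ hτ)
    have hts : 0 < t - τ := sub_pos.2 hτ.2
    have h1 : y.U τ ^ 2 ≤ (4 * D * (t - a)) ^ 2 := by
      rw [← sq_abs (y.U τ)]
      have := hUs τ hτ
      have h8 : 4 * D * (t - τ) ≤ 4 * D * (t - a) :=
        mul_le_mul_of_nonneg_left (by linarith [hτ'.1]) (by positivity)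
      exact pow_le_pow_left₀ (abs_nonneg _) (this.trans h8) 2
    have h3 : 2 * |y.κ τ * y.N τ| ≤ G := by
      have := hQ2 τ hτ'; have := hN2 τ hτ'; have := hL τ hτ'; have := hL0 τ
      have := sq_nonneg (y.Q τ); have := sq_nonneg (y.N τ); have := sq_nonneg (y.U τ)
      have := sq_nonneg B; have := sq_nonneg q
      have h9 := (H τ hτ').con
      have : |2 * (y.κ τ * y.N τ)| ≤ G := by
        rw [abs_le]; constructor <;> linarith
      rwa [abs_mul, abs_two] at this
    rw [abs_mul, abs_of_neg h2] at h3
    have h4 := (hκs τ (hbx τ hτ)).2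
    calc |y.N τ| ≤ |y.N τ| * (2 * (-y.κ τ * (t - τ))) := le_mul_of_one_le_right (abs_nonneg _) h4
      _ = 2 * (-y.κ τ * |y.N τ|) * (t - τ) := by ring
      _ ≤ G * (t - τ) := mul_le_mul_of_nonneg_right h3 hts.le
  have hLC : 0 ≤ Λ * C ^ 2 := by positivity
  refine ⟨b, C + q + Λ * C ^ 2 + 4 * D + G + 2, hx.1.trans (le_max_left _ _), hbt, by positivity,
    fun τ hτ => ?_⟩
  have hτ' := hIco τ (hbx τ hτ)
  obtain ⟨h1, h2, h3⟩ := hbd τ hτ'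
  have hts : 0 < t - τ := sub_pos.2 hτ.2
  have h4 := hκs τ (hbx τ hτ)
  refine ⟨hκ0 τ (hbx τ hτ), (hUs τ hτ).trans ?_, (hNs τ hτ).trans ?_, ?_, ?_, ?_, ?_, ?_, ?_, ?_⟩
  · gcongr; linarith
  · gcongr; linarith
  · linarith
  · refine h4.2.trans (mul_le_mul_of_nonneg_right (by linarith) ?_)
    linarith [h4.2]
  · linarith
  · linarith
  · linarith
  · linarith [hQ τ hτ']
  · linarith [hL τ hτ']

theorem tendsto_zero_of_abs_le_mul_sub {f : ℝ → ℝ} {b t C : ℝ} (hbt : b < t)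
    (h : ∀ τ ∈ Ico b t, |f τ| ≤ C * (t - τ)) : Tendsto f (𝓝[<] t) (𝓝 0) := by
  have h1 : Tendsto (fun τ => C * (t - τ)) (𝓝[<] t) (𝓝 0) := by
    have : Tendsto (fun τ => C * (t - τ)) (𝓝 t) (𝓝 (C * (t - t))) :=
      Continuous.tendsto (by fun_prop) t
    rw [sub_self, mul_zero] at this
    exact this.mono_left nhdsWithin_le_nhds
  refine squeeze_zero_norm' ?_ h1
  filter_upwards [Ico_mem_nhdsLT hbt] with τ hτ using h τ hτ

theorem exists_tendsto_r {Λ : ℝ} {y : Trajectory} {b t C D : ℝ} (hbt : b < t) (hC : 0 < C)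
    (H : ∀ τ ∈ Ico b t, Reg Λ y τ)
    (h : ∀ τ ∈ Ico b t, y.r τ ≤ C ∧ (y.r τ)⁻¹ ≤ C ∧ |y.N τ| ≤ D) :
    ∃ l > 0, Tendsto y.r (𝓝[<] t) (𝓝 l) := by
  obtain ⟨l, hl⟩ := exists_tendsto_of_hasDerivAt_bounded (C := C * D) hbt (fun τ hτ => (H τ hτ).dr)
    (fun τ hτ => by
      rw [abs_mul, abs_of_pos (H τ hτ).rpos]
      exact mul_le_mul (h τ hτ).1 (h τ hτ).2.2 (abs_nonneg _) hC.le)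
  refine ⟨l, (inv_pos.2 hC).trans_le (ge_of_tendsto hl ?_), hl⟩
  filter_upwards [Ico_mem_nhdsLT hbt] with τ hτ
  exact inv_le_of_inv_le₀ (H τ hτ).rpos (h τ hτ).2.1

theorem eventually_upTo {T : EReal} {a : ℝ} (ha : (a : EReal) < T) :
    ∀ᶠ τ in upTo T, a < τ ∧ (τ : EReal) < T := by
  rw [upTo]
  refine (eventually_comap.2 ?_)
  filter_upwards [Ioo_mem_nhdsLT ha] with x hx τ hτ
  subst hτ
  exact ⟨EReal.coe_lt_coe_iff.1 hx.1, hx.2⟩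

/-! ### After the turning point: second horizon or singularity. -/

/-- By `Flow.horizon`, N and U vanish at least to first order. For U / N to stay bounded, N must not
vanish faster, which amounts to a positive lower bound for κ N. -/
theorem Flow.blackHole {Λ : ℝ} (hΛ : 0 ≤ Λ) {y : Trajectory} {t c : ℝ} (F : Flow Λ y t)
    (hturn : TurnsAt y t c) (hN : ∀ τ, c < τ → τ < t → -1 ≤ y.N τ) : BlackHole y t := by
  have hct : c < t := EReal.coe_lt_coe_iff.1 hturn.1
  have hneg : ∀ τ, c < τ → τ < t → y.N τ < 0 := fun τ h1 h2 =>
    hturn.2.2.2 τ h1 (EReal.coe_lt_coe_iff.2 h2)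
  obtain ⟨b₀, C, hb₀, hb₀t, hC, hh⟩ := F.horizon hΛ (B := 1) hct fun τ hτ => by
    rcases hτ.1.eq_or_lt with h | h
    · rw [← h, hturn.2.2.1]; simp
    · rw [abs_of_neg (hneg τ h hτ.2)]; linarith [hN τ h hτ.2]
  set b := max b₀ ((c + t) / 2) with hb
  have hbt : b < t := max_lt hb₀t (by linarith)
  have hcb : c < b := lt_of_lt_of_le (by linarith) (le_max_right b₀ ((c + t) / 2))
  have hh' : ∀ τ ∈ Ico b t, _ := fun τ hτ => hh τ ⟨(le_max_left _ _).trans hτ.1, hτ.2⟩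
  have hNneg : ∀ τ ∈ Ico b t, y.N τ < 0 := fun τ hτ => hneg τ (hcb.trans_le hτ.1) hτ.2
  have H := F.regIco (a := b)
  obtain ⟨r₀, hr₀, hr⟩ := exists_tendsto_r (D := C * (t - b)) hbt hC H fun τ hτ => by
    obtain ⟨-, -, h3, -, -, h6, h7, -⟩ := hh' τ hτ
    refine ⟨h6, h7, h3.trans ?_⟩
    gcongr; exact hτ.1
  set E := 1 + (1 + C ^ 2 + C) * (C * (t - b)) with hE
  have hm : ∀ τ ∈ Ico b t, 0 < y.κ τ * y.N τ := fun τ hτ =>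
    mul_pos_of_neg_of_neg (hh' τ hτ).1 (hNneg τ hτ)
  -- In the derivative κ N² - N³ + N (Q² - Λ r²) - 2 κ U² of κ N the terms κ² N have cancelled. As κ
  -- < 0, the last term helps, and the others are bounded multiples of κ N, because -N ≤ C (t - b) κ
  -- N. So log (κ N) falls at a bounded rate.
  have hlow : ∀ τ ∈ Ico b t, Real.log (y.κ b * y.N b) + -E * (τ - b) ≤
      Real.log (y.κ τ * y.N τ) := fun τ hτ => by
    refine add_mul_le_of_hasDerivAt hτ.1 (f := fun τ => Real.log (y.κ τ * y.N τ))
      (fun x hx => ((H x ⟨hx.1, hx.2.trans_lt hτ.2⟩).dκ'.fun_mul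
        (H x ⟨hx.1, hx.2.trans_lt hτ.2⟩).dN).log
        (hm x ⟨hx.1, hx.2.trans_lt hτ.2⟩).ne') (fun x hx => ?_)
    have hx' : x ∈ Ico b t := ⟨hx.1.le, hx.2.trans hτ.2⟩
    obtain ⟨h1, -, h3, h4, h5, -, -, -, h9, h10⟩ := hh' x hx'
    have hmx := hm x hx'
    have hNx := hNneg x hx'
    have hN1 : -1 ≤ y.N x := hN x (hcb.trans_le hx'.1) hx'.2
    rw [le_div_iff₀ hmx]
    have h11 : 0 ≤ Λ * y.r x ^ 2 := mul_nonneg hΛ (sq_nonneg _)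
    have h12 : y.Q x ^ 2 ≤ C ^ 2 := sq_le_sq' (abs_le.1 h9).1 (abs_le.1 h9).2
    have h13 : 1 ≤ C * (t - b) * -y.κ x := by
      refine h5.trans ?_
      have : C * (t - x) * -y.κ x ≤ C * (t - b) * -y.κ x := by
        have := hx'.1
        gcongr
        linarith
      linarith
    -- the terms without a factor `κ` are compared with `κ N`
    have h14 : -y.N x * (1 + C ^ 2 + C) ≤ (1 + C ^ 2 + C) * (C * (t - b)) * (y.κ x * y.N x) := by
      have : -y.N x * (1 + C ^ 2 + C) * 1 ≤ -y.N x * (1 + C ^ 2 + C) * (C * (t - b) * -y.κ x) :=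
        mul_le_mul_of_nonneg_left h13 (mul_nonneg (by linarith) (by positivity))
      nlinarith
    have h15 : y.N x ^ 3 = y.N x * y.N x ^ 2 := by ring
    have h16 : y.N x ^ 2 ≤ 1 := by nlinarith
    have h17 : -(y.κ x * y.N x) ≤ y.N x * (y.κ x * y.N x) := by nlinarith
    have h18 : 0 ≤ -y.κ x * y.U x ^ 2 := mul_nonneg (by linarith) (sq_nonneg _)
    have h19 : -y.N x * (y.N x ^ 2 - y.Q x ^ 2 + Λ * y.r x ^ 2) ≥ -(-y.N x * (1 + C ^ 2 + C)) := by
      nlinarith [sq_nonneg (y.N x)]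
    nlinarith
  set μ := Real.exp (Real.log (y.κ b * y.N b) - |E| * (t - b)) with hμ
  have hμ0 : 0 < μ := Real.exp_pos _
  have hlow' : ∀ τ ∈ Ico b t, μ ≤ y.κ τ * y.N τ := fun τ hτ => by
    rw [← Real.le_log_iff_exp_le (hm τ hτ)]
    have h1 : E * (τ - b) ≤ |E| * (t - b) := by
      have : 0 ≤ τ - b := sub_nonneg.2 hτ.1
      have h2 := hτ.2
      exact (mul_le_mul_of_nonneg_right (le_abs_self E) this).trans
        (mul_le_mul_of_nonneg_left (by linarith) (abs_nonneg _))
    linarith [hlow τ hτ]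
  refine ⟨⟨c, hturn⟩, ⟨r₀, hr₀, by rwa [upTo_coe]⟩, ?_, C ^ 2 / μ, ?_⟩
  · rw [upTo_coe]
    exact tendsto_zero_of_abs_le_mul_sub hbt fun τ hτ => (hh' τ hτ).2.2.1
  · rw [upTo_coe]
    filter_upwards [Ico_mem_nhdsLT hbt] with τ hτ
    obtain ⟨h1, h2, -, h4, -⟩ := hh' τ hτ
    have hNτ := hNneg τ hτ
    have hτt : 0 < t - τ := sub_pos.2 hτ.2
    rw [abs_div, abs_of_neg hNτ, div_le_div_iff₀ (by linarith) hμ0]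
    have h6 := hlow' τ hτ
    calc |y.U τ| * μ ≤ C * (t - τ) * (y.κ τ * y.N τ) := mul_le_mul h2 h6 hμ0.le (by positivity)
      _ = C * (-y.κ τ * (t - τ)) * -y.N τ := by ring
      _ ≤ C * C * -y.N τ := by gcongr; linarith
      _ = _ := by ring

theorem N_lt_neg_one {Λ : ℝ} (hΛ : 0 ≤ Λ) {y : Trajectory} {a b : ℝ}
    (H : ∀ τ ∈ Icc a b, Reg Λ y τ) (ha : y.N a < -1) : ∀ τ ∈ Icc a b, y.N τ ≤ y.N a := by
  have hd : ∀ x ∈ Icc a b, y.N x < -1 →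
      (1 - y.N x ^ 2) / 2 - y.U x ^ 2 - y.Q x ^ 2 / 2 - Λ * y.r x ^ 2 / 2 ≤ 0 := fun x _ h => by
    have := mul_nonneg hΛ (sq_nonneg (y.r x))
    nlinarith [sq_nonneg (y.U x), sq_nonneg (y.Q x)]
  have h1 := pos_of_hasDerivAt_ge (y := fun x => -1 - y.N x) (C := 0)
    (fun x hx => ((H x hx).dN').const_sub (-1)) (by linarith)
    (fun x hx hz => by
      have := hd x ⟨hx.1, hx.2.le⟩ (by linarith [hz x ⟨hx.1, le_rfl⟩])
      linarith)
  intro τ hτ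
  refine ge_of_hasDerivAt_nonpos hτ.1 (fun x hx => (H x ⟨hx.1, hx.2.trans hτ.2⟩).dN') fun x hx => ?_
  have hx' : x ∈ Icc a b := ⟨hx.1.le, hx.2.le.trans hτ.2⟩
  exact hd x hx' (by linarith [h1 x hx'])

/-- In the region `N < -1` the slope `U / N = w'` is bounded on `r > 0`. -/
theorem abs_slope_le {Λ : ℝ} (hΛ : 0 ≤ Λ) {y : Trajectory} {a b : ℝ}
    (H : ∀ τ ∈ Icc a b, Reg Λ y τ) (ha : y.N a < -1) (hr : ∀ τ ∈ Icc a b, y.r τ ≤ y.r a)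
    {B : ℝ} (hB : |y.U a / y.N a| < B)
    (hB' : 1 / (2 * (y.N a ^ 2 - 1)) + 1 / 2 + y.r a ≤ B) :
    ∀ τ ∈ Icc a b, |y.U τ / y.N τ| ≤ B := by
  have hNle := N_lt_neg_one hΛ H ha
  have hNneg : ∀ τ ∈ Icc a b, y.N τ < -1 := fun τ hτ => (hNle τ hτ).trans_lt ha
  set G : ℝ → ℝ := fun τ => y.N τ ^ 2 - 1 + y.Q τ ^ 2 + Λ * y.r τ ^ 2 with hG
  have hGc : ContinuousOn (fun τ => G τ / -y.N τ) (Icc a b) := fun x hx => by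
    have h := H x hx
    have h1 := h.dN.continuousAt; have h2 := h.dQ.continuousAt; have h3 := h.dr.continuousAt
    have h4 : -y.N x ≠ 0 := by linarith [hNneg x hx]
    exact ContinuousAt.continuousWithinAt (by fun_prop (disch := assumption))
  obtain ⟨C, hC0, hC⟩ := exists_abs_le_of_continuousOn hGc
  have hG0 : ∀ τ ∈ Icc a b, 0 ≤ G τ / -y.N τ := fun τ hτ => by
    have h1 := hNneg τ hτ
    have : 0 ≤ Λ * y.r τ ^ 2 := mul_nonneg hΛ (sq_nonneg _)
    refine div_nonneg ?_ (by linarith)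
    have := sq_nonneg (y.Q τ)
    simp only [hG]; nlinarith
  -- U / N obeys a linear equation with damping G / (-N) ≥ 0 and source w Q / (-N). So ±B are
  -- barriers as soon as |w Q| ≤ B G, and B is chosen for this, using |w| ≤ 1 + r |Q|.
  have hd : ∀ τ ∈ Icc a b, HasDerivAt (fun τ => y.U τ / y.N τ)
      (y.w τ * y.Q τ / -y.N τ - y.U τ / y.N τ * (G τ / -y.N τ)) τ := fun τ hτ => by
    have h := H τ hτ
    have h1 : y.N τ ≠ 0 := by linarith [hNneg τ hτ]
    refine (h.dU.fun_div h.dN h1).congr_deriv ?_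
    have h2 : G τ = 2 * y.N τ ^ 2 + 2 * y.U τ ^ 2 - 2 * y.κ τ * y.N τ := by
      rw [h.con]; simp only [hG]; ring
    rw [h2]
    field_simp
    ring
  have hwQ : ∀ τ ∈ Icc a b, |y.w τ * y.Q τ / -y.N τ| ≤ B * (G τ / -y.N τ) := fun τ hτ => by
    have h1 := hNneg τ hτ
    have h2 : 0 < -y.N τ := by linarith
    rw [abs_div, abs_of_pos h2, ← mul_div_assoc]
    refine div_le_div_of_nonneg_right ?_ h2.le
    have hra := (H a ⟨le_rfl, hτ.1.trans hτ.2⟩).rpos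
    have h3 : |y.w τ| ≤ 1 + y.r a * |y.Q τ| := by
      have h4 : y.w τ ^ 2 ≤ 1 + y.r a * |y.Q τ| := by
        have h5 := (H τ hτ).rQ
        have h6 : -(y.r τ * y.Q τ) ≤ y.r τ * |y.Q τ| := by
          rw [← mul_neg]
          exact mul_le_mul_of_nonneg_left (neg_le_abs _) (H τ hτ).rpos.le
        have h7 : y.r τ * |y.Q τ| ≤ y.r a * |y.Q τ| :=
          mul_le_mul_of_nonneg_right (hr τ hτ) (abs_nonneg _)
        linarith
      rw [← sq_abs] at h4
      have h5 := mul_nonneg hra.le (abs_nonneg (y.Q τ))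
      by_contra hcon
      push Not at hcon
      nlinarith
    have hc : 0 < y.N a ^ 2 - 1 := by nlinarith
    have h4 : |y.w τ * y.Q τ| ≤ 1 / 2 + (1 / 2 + y.r a) * y.Q τ ^ 2 := by
      rw [abs_mul, ← sq_abs (y.Q τ)]
      nlinarith [abs_nonneg (y.Q τ), sq_nonneg (|y.Q τ| - 1),
        mul_le_mul_of_nonneg_right h3 (abs_nonneg (y.Q τ))]
    have h5 : y.N a ^ 2 - 1 + y.Q τ ^ 2 ≤ G τ := by
      have h6 := hNle τ hτ
      have : 0 ≤ Λ * y.r τ ^ 2 := mul_nonneg hΛ (sq_nonneg _)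
      simp only [hG]; nlinarith
    have h6 : 0 ≤ 1 / (2 * (y.N a ^ 2 - 1)) := by positivity
    have h7 : 1 / (2 * (y.N a ^ 2 - 1)) * (y.N a ^ 2 - 1) = 1 / 2 := by field_simp
    calc |y.w τ * y.Q τ| ≤ 1 / 2 + (1 / 2 + y.r a) * y.Q τ ^ 2 := h4
      _ ≤ B * (y.N a ^ 2 - 1 + y.Q τ ^ 2) := by
        have h8 : 1 / (2 * (y.N a ^ 2 - 1)) ≤ B := by linarith
        have h9 : 1 / 2 + y.r a ≤ B := by linarith
        nlinarith [mul_le_mul_of_nonneg_right h8 hc.le,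
          mul_le_mul_of_nonneg_right h9 (sq_nonneg (y.Q τ))]
      _ ≤ B * G τ := mul_le_mul_of_nonneg_left h5 (by linarith)
  have hup := pos_of_hasDerivAt_ge (y := fun x => B - y.U x / y.N x) (C := C)
    (fun x hx => (hd x hx).const_sub B) (by linarith [(abs_lt.1 hB).2]) (fun x hx hz => by
      have hx' : x ∈ Icc a b := ⟨hx.1, hx.2.le⟩
      have h1 := hz x ⟨hx.1, le_rfl⟩
      have h2 := (abs_le.1 (hwQ x hx')).2
      have h3 := (abs_le.1 (hC x hx')).2
      nlinarith [mul_le_mul_of_nonneg_right h3 h1.le])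
  have hlo := pos_of_hasDerivAt_ge (y := fun x => B + y.U x / y.N x) (C := C)
    (fun x hx => (hd x hx).const_add B) (by linarith [(abs_lt.1 hB).1]) (fun x hx hz => by
      have hx' : x ∈ Icc a b := ⟨hx.1, hx.2.le⟩
      have h1 := hz x ⟨hx.1, le_rfl⟩
      have h2 := (abs_le.1 (hwQ x hx')).1
      have h3 := (abs_le.1 (hC x hx')).2
      nlinarith [mul_le_mul_of_nonneg_right h3 h1.le])
  intro τ hτ
  rw [abs_le]
  constructor <;> linarith [hup τ hτ, hlo τ hτ]

set_option maxHeartbeats 1000000 in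
-- Below -1, N keeps decreasing, so r decreases exponentially in τ. If r stayed above some r₀ > 0,
-- the time would be finite and the slope bound |U| ≤ B |N| would bound w, Q, N and κ in turn,
-- contrary to `blowup`. Hence r → 0, and as r (N² - 1) is nondecreasing, N² → ∞.
theorem Flow.generic {Λ : ℝ} (hΛ : 0 ≤ Λ) {y : Trajectory} {T : EReal} {c a : ℝ} (F : Flow Λ y T)
    (hturn : TurnsAt y T c) (haT : (a : EReal) < T) (ha : y.N a < -1) : Generic y T := by
  have hH : ∀ τ : ℝ, (τ : EReal) < T → ∀ x ∈ Icc a τ, Reg Λ y x := fun τ hτ => F.regIcc hτ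
  have hN : ∀ τ : ℝ, a ≤ τ → (τ : EReal) < T → y.N τ ≤ y.N a := fun τ h1 h2 =>
    N_lt_neg_one hΛ (hH τ h2) ha τ ⟨h1, le_rfl⟩
  have hN1 : ∀ τ : ℝ, a ≤ τ → (τ : EReal) < T → y.N τ < -1 := fun τ h1 h2 =>
    (hN τ h1 h2).trans_lt ha
  have hcoe : ∀ {x z : ℝ}, x ≤ z → (z : EReal) < T → (x : EReal) < T := fun h1 h2 =>
    (EReal.coe_le_coe_iff.2 h1).trans_lt h2
  have hanti : ∀ σ τ : ℝ, a ≤ σ → σ ≤ τ → (τ : EReal) < T → y.r τ ≤ y.r σ := fun σ τ h1 h2 h3 =>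
    ge_of_hasDerivAt_nonpos h2 (fun x hx => (hH τ h3 x ⟨h1.trans hx.1, hx.2⟩).dr) fun x hx => by
      have h4 := (hH τ h3 x ⟨h1.trans hx.1.le, hx.2.le⟩).rpos
      have h5 := hN1 x (h1.trans hx.1.le) (hcoe hx.2.le h3)
      nlinarith
  have hsmall : ∀ r₀ > 0, ∃ τ : ℝ, a ≤ τ ∧ (τ : EReal) < T ∧ y.r τ < r₀ := by
    intro r₀ hr₀
    by_contra hcon
    push Not at hcon
    have hlogd : ∀ τ : ℝ, (τ : EReal) < T → ∀ x ∈ Icc a τ,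
        HasDerivAt (fun x => Real.log (y.r x)) (y.N x) x := fun τ hτ x hx => by
      have h := hH τ hτ x hx
      exact (h.dr.log h.rpos.ne').congr_deriv (mul_div_cancel_left₀ _ h.rpos.ne')
    induction T with
    | bot => exact absurd haT (not_lt.2 bot_le)
    | top =>
      set τ := a + (|Real.log (y.r a)| + |Real.log r₀| + 1) with hτ
      have hτa : a ≤ τ := by rw [hτ]; linarith [abs_nonneg (Real.log (y.r a)), abs_nonneg (Real.log r₀)]
      have h1 := le_add_mul_of_hasDerivAt (C := -1) hτa (hlogd τ (EReal.coe_lt_top _))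
        fun x hx => (hN1 x hx.1.le (EReal.coe_lt_top _)).le
      have h2 := Real.log_le_log hr₀ (hcon τ hτa (EReal.coe_lt_top _))
      rw [hτ] at h1
      linarith [le_abs_self (Real.log (y.r a)), neg_abs_le (Real.log r₀)]
    | coe t =>
      have hat : a < t := EReal.coe_lt_coe_iff.1 haT
      have hlt : ∀ τ ∈ Ico a t, (τ : EReal) < (t : EReal) := fun τ hτ => EReal.coe_lt_coe_iff.2 hτ.2
      set R := y.r a with hR
      have hR0 : 0 < R := (hH a haT a ⟨le_rfl, le_rfl⟩).rpos
      have hrR : ∀ τ ∈ Ico a t, y.r τ ≤ R := fun τ hτ => hanti a τ le_rfl hτ.1 (hlt τ hτ)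
      have hc : 0 < y.N a ^ 2 - 1 := by nlinarith
      set B := |y.U a / y.N a| + 1 + (1 / (2 * (y.N a ^ 2 - 1)) + 1 / 2 + R) with hB
      have hBpos : 0 < B := by positivity
      have hp : ∀ τ ∈ Ico a t, |y.U τ / y.N τ| ≤ B := fun τ hτ => by
        refine abs_slope_le hΛ (hH τ (hlt τ hτ)) ha
          (fun x hx => hrR x ⟨hx.1, hx.2.trans_lt hτ.2⟩) ?_ ?_ τ ⟨hτ.1, le_rfl⟩
        · have : 0 ≤ 1 / (2 * (y.N a ^ 2 - 1)) + 1 / 2 + R := by positivity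
          linarith
        · linarith [abs_nonneg (y.U a / y.N a)]
      have hU : ∀ τ ∈ Ico a t, |y.U τ| ≤ B * -y.N τ := fun τ hτ => by
        have h1 := hp τ hτ
        have h2 := hN1 τ hτ.1 (hlt τ hτ)
        rwa [abs_div, abs_of_neg (show y.N τ < 0 by linarith), div_le_iff₀ (by linarith)] at h1
      set W := |y.w a| + B * R with hW
      have hw : ∀ τ ∈ Ico a t, |y.w τ| ≤ W := fun τ hτ => by
        have hreg := hH τ (hlt τ hτ)
        have hrτ := (hreg τ ⟨hτ.1, le_rfl⟩).rpos
        have hUx : ∀ x ∈ Ioo a τ, -(B * -y.N x) ≤ y.U x ∧ y.U x ≤ B * -y.N x := fun x hx =>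
          abs_le.1 (hU x ⟨hx.1.le, hx.2.trans hτ.2⟩)
        have h1 := ge_of_hasDerivAt_nonpos (f := fun x => y.w x + B * y.r x) hτ.1
          (fun x hx => (hreg x hx).dw.fun_add ((hreg x hx).dr.const_mul B)) fun x hx => by
            have h3 := (hreg x ⟨hx.1.le, hx.2.le⟩).rpos
            have h4 := (hUx x hx).2
            nlinarith [mul_le_mul_of_nonneg_left h4 h3.le]
        have h2 := le_of_hasDerivAt_nonneg (f := fun x => y.w x - B * y.r x) hτ.1
          (fun x hx => (hreg x hx).dw.fun_sub ((hreg x hx).dr.const_mul B)) fun x hx => by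
            have h3 := (hreg x ⟨hx.1.le, hx.2.le⟩).rpos
            have h4 := (hUx x hx).1
            nlinarith [mul_le_mul_of_nonneg_left h4 h3.le]
        have h3 := mul_pos hBpos hrτ
        rw [abs_le]
        constructor <;> linarith [le_abs_self (y.w a), neg_abs_le (y.w a)]
      have hW0 : 0 ≤ W := by positivity
      set q := (1 + W ^ 2) / r₀ with hq
      have hq0 : 0 ≤ q := by positivity
      have hQ : ∀ τ ∈ Ico a t, y.Q τ ^ 2 ≤ q ^ 2 := fun τ hτ => by
        have h1 : y.w τ ^ 2 ≤ W ^ 2 := sq_le_sq' (abs_le.1 (hw τ hτ)).1 (abs_le.1 (hw τ hτ)).2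
        rw [← sq_abs (y.Q τ)]
        refine pow_le_pow_left₀ (abs_nonneg _) ?_ 2
        rw [Trajectory.Q, abs_div, abs_of_pos (hH τ (hlt τ hτ) τ ⟨hτ.1, le_rfl⟩).rpos]
        refine div_le_div₀ (by positivity) ?_ hr₀ (hcon τ hτ.1 (hlt τ hτ))
        rw [abs_le]; constructor <;> nlinarith [sq_nonneg (y.w τ)]
      have hL : ∀ τ ∈ Ico a t, Λ * y.r τ ^ 2 ≤ Λ * R ^ 2 := fun τ hτ => by
        have := (hH τ (hlt τ hτ) τ ⟨hτ.1, le_rfl⟩).rpos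
        have := hrR τ hτ
        gcongr
      set E := q ^ 2 + Λ * R ^ 2 with hE
      have hE0 : 0 ≤ E := by positivity
      set K := Real.exp (Real.log (-y.N a) + (1 / 2 + B ^ 2) * (Real.log R - Real.log r₀)
        + E * (t - a)) with hK
      have hK0 : 0 < K := Real.exp_pos _
      have hNK : ∀ τ ∈ Ico a t, -y.N τ ≤ K := fun τ hτ => by
        have hreg := hH τ (hlt τ hτ)
        have hN1' : ∀ x ∈ Icc a τ, y.N x < -1 := fun x hx =>
          hN1 x hx.1 (hlt x ⟨hx.1, hx.2.trans_lt hτ.2⟩)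
        -- With |U| ≤ B |N|, log (-N) grows at most at the rate E + (1/2 + B²) (-N). Since -N is the
        -- rate at which log r falls, adding (1/2 + B²) log r removes the unbounded part.
        have h1 := le_add_mul_of_hasDerivAt (C := E) (f := fun x => Real.log (-y.N x)
            + (1 / 2 + B ^ 2) * Real.log (y.r x)) hτ.1
          (fun x hx => ((hreg x hx).dN'.fun_neg.log (by linarith [hN1' x hx])).fun_add
            ((hlogd τ (hlt τ hτ) x hx).const_mul _)) fun x hx => by
            have hx' : x ∈ Ico a t := ⟨hx.1.le, hx.2.trans hτ.2⟩
            have h3 := hN1' x ⟨hx.1.le, hx.2.le⟩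
            have h4 : y.U x ^ 2 ≤ (B * -y.N x) ^ 2 :=
              sq_le_sq' (abs_le.1 (hU x hx')).1 (abs_le.1 (hU x hx')).2
            have h5 := hQ x hx'
            have h6 := hL x hx'
            have h7 : -((1 - y.N x ^ 2) / 2 - y.U x ^ 2 - y.Q x ^ 2 / 2 - Λ * y.r x ^ 2 / 2)
                / -y.N x ≤ E + (1 / 2 + B ^ 2) * -y.N x := by
              rw [div_le_iff₀ (by linarith)]
              have h8 : E ≤ E * -y.N x := le_mul_of_one_le_right hE0 (by linarith)
              nlinarith
            linarith
        have h2 : Real.log r₀ ≤ Real.log (y.r τ) := Real.log_le_log hr₀ (hcon τ hτ.1 (hlt τ hτ))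
        have h3 : E * (τ - a) ≤ E * (t - a) := mul_le_mul_of_nonneg_left (by linarith [hτ.2]) hE0
        rw [← Real.log_le_iff_le_exp (by linarith [hN1' τ ⟨hτ.1, le_rfl⟩])]
        have h4 : (1 / 2 + B ^ 2) * Real.log r₀ ≤ (1 / 2 + B ^ 2) * Real.log (y.r τ) :=
          mul_le_mul_of_nonneg_left h2 (by positivity)
        linarith
      refine F.blowup t a (R + r₀⁻¹ + W + K + B * K + (1 + K ^ 2 + 2 * (B * K) ^ 2 + E)) rfl hat
        fun τ hτ => ?_
      have hreg := hH τ (hlt τ hτ) τ ⟨hτ.1, le_rfl⟩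
      have h1 := hN1 τ hτ.1 (hlt τ hτ)
      have h2 := hNK τ hτ
      have hUK : |y.U τ| ≤ B * K := (hU τ hτ).trans (mul_le_mul_of_nonneg_left h2 hBpos.le)
      have hri : (y.r τ)⁻¹ ≤ r₀⁻¹ := inv_anti₀ hr₀ (hcon τ hτ.1 (hlt τ hτ))
      have hri0 : 0 < r₀⁻¹ := inv_pos.2 hr₀
      have hBK : 0 < B * K := mul_pos hBpos hK0
      have hκ : |y.κ τ| ≤ 1 + K ^ 2 + 2 * (B * K) ^ 2 + E := by
        have h3 : |y.κ τ| ≤ |2 * y.κ τ * y.N τ| := by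
          rw [abs_mul, abs_mul, abs_two, abs_of_neg (show y.N τ < 0 by linarith)]
          nlinarith [abs_nonneg (y.κ τ)]
        refine h3.trans ?_
        rw [hreg.con]
        have h4 := hQ τ hτ
        have h5 := hL τ hτ
        have h6 : y.U τ ^ 2 ≤ (B * K) ^ 2 := sq_le_sq' (abs_le.1 hUK).1 (abs_le.1 hUK).2
        have h7 : y.N τ ^ 2 ≤ K ^ 2 := by nlinarith
        have h8 : 0 ≤ Λ * y.r τ ^ 2 := mul_nonneg hΛ (sq_nonneg _)
        rw [abs_le]
        constructor <;> linarith [sq_nonneg (y.Q τ), sq_nonneg (y.U τ), sq_nonneg (y.N τ),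
          sq_nonneg q, sq_nonneg K, sq_nonneg (B * K)]
      have h9 := hrR τ hτ
      have h10 := hw τ hτ
      have h11 : |y.N τ| ≤ K := by rwa [abs_of_neg (show y.N τ < 0 by linarith)]
      have h12 : 0 ≤ 1 + K ^ 2 + 2 * (B * K) ^ 2 + E := by positivity
      refine ⟨?_, ?_, ?_, ?_, ?_, ?_⟩ <;> linarith
  have hr0 : Tendsto y.r (upTo T) (𝓝 0) := by
    rw [Metric.tendsto_nhds]
    intro ε hε
    obtain ⟨σ, h1, h2, h3⟩ := hsmall ε hε
    filter_upwards [eventually_upTo h2] with τ hτ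
    rw [Real.dist_0_eq_abs, abs_of_pos (F.reg τ hτ.2).rpos]
    exact (hanti σ τ h1 hτ.1.le hτ.2).trans_lt h3
  refine ⟨⟨c, hturn⟩, hr0, ?_⟩
  set k := y.r a * (y.N a ^ 2 - 1) with hk
  have hk0 : 0 < k := mul_pos (F.reg a haT).rpos (by nlinarith)
  have hinv : Tendsto (fun τ => (y.r τ)⁻¹) (upTo T) atTop := by
    refine tendsto_inv_nhdsGT_zero.comp (tendsto_nhdsWithin_iff.2 ⟨hr0, ?_⟩)
    filter_upwards [eventually_upTo haT] with τ hτ using (F.reg τ hτ.2).rpos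
  refine tendsto_atTop_mono' _ ?_ (hinv.const_mul_atTop hk0)
  filter_upwards [eventually_upTo haT] with τ hτ
  have hreg := hH τ hτ.2
  have h1 := le_of_hasDerivAt_nonneg (f := fun x => y.r x * (y.N x ^ 2 - 1)) hτ.1.le
    (fun x hx => (hreg x hx).dr.fun_mul (((hreg x hx).dN'.fun_pow 2).sub_const 1)) fun x hx => by
      have h2 := (hreg x ⟨hx.1.le, hx.2.le⟩).rpos
      have h3 := hN1 x hx.1.le (hcoe hx.2.le hτ.2)
      have h4 : 0 ≤ Λ * y.r x ^ 2 := mul_nonneg hΛ (sq_nonneg _)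
      have h5 : 0 ≤ y.r x * -y.N x * (2 * y.U x ^ 2 + y.Q x ^ 2 + Λ * y.r x ^ 2) :=
        mul_nonneg (mul_nonneg h2.le (by linarith))
          (by linarith [sq_nonneg (y.U x), sq_nonneg (y.Q x)])
      push_cast
      nlinarith
  have h2 := (F.reg τ hτ.2).rpos
  rw [← div_eq_mul_inv, div_le_iff₀ h2]
  linarith

/-- After the turning point, only the generic and the black hole case are possible, unless the
solution exists forever with `N ≥ -1`. -/
theorem Flow.generic_or_blackHole {Λ : ℝ} (hΛ : 0 ≤ Λ) {y : Trajectory} {T : EReal} {c : ℝ}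
    (F : Flow Λ y T) (hturn : TurnsAt y T c) (htop : T = ⊤ → ∃ τ > c, y.N τ < -1) :
    Generic y T ∨ BlackHole y T := by
  by_cases h : ∃ τ : ℝ, c < τ ∧ (τ : EReal) < T ∧ y.N τ < -1
  · obtain ⟨τ, -, h2, h3⟩ := h
    exact Or.inl (F.generic hΛ hturn h2 h3)
  · push Not at h
    right
    induction T with
    | bot => exact absurd hturn.1 (not_lt.2 bot_le)
    | top =>
      obtain ⟨τ, h1, h2⟩ := htop rfl
      exact absurd h2 (not_lt.2 (h τ h1 (EReal.coe_lt_top _)))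
    | coe t =>
      exact F.blackHole hΛ hturn fun τ h1 h2 => h τ h1 (EReal.coe_lt_coe_iff.2 h2)

/-! ### A field that moves outward beyond w = 1. -/

/-- For w > 1 the force -w Q is nonnegative, so U stays positive and w goes on increasing. -/
theorem outward_persists {Λ : ℝ} {y : Trajectory} {a b : ℝ} (H : ∀ τ ∈ Icc a b, Reg Λ y τ)
    (hw : 1 < y.w a) (hU : 0 < y.U a) : ∀ τ ∈ Icc a b, 0 < y.U τ ∧ y.w a ≤ y.w τ := by
  obtain ⟨C, hC, hθ⟩ := exists_abs_theta_le H
  have hmono : ∀ x ∈ Icc a b, (∀ z ∈ Icc a x, 0 < y.U z) → y.w a ≤ y.w x := fun x hx hz =>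
    le_of_hasDerivAt_nonneg hx.1 (fun u hu => (H u ⟨hu.1, hu.2.trans hx.2⟩).dw) fun u hu =>
      (mul_pos (H u ⟨hu.1.le, hu.2.le.trans hx.2⟩).rpos (hz u ⟨hu.1.le, hu.2.le⟩)).le
  have hpos := pos_of_hasDerivAt_ge (C := C) (fun x hx => (H x hx).dU) hU fun x hx hz => by
    have hx' : x ∈ Icc a b := ⟨hx.1, hx.2.le⟩
    have h1 := hmono x hx' hz
    have h2 := hz x ⟨hx.1, le_rfl⟩
    have h3 := (abs_le.1 (hθ x hx')).2
    have h4 : y.w x * y.Q x ≤ 0 := by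
      refine mul_nonpos_of_nonneg_of_nonpos (by linarith) ?_
      exact div_nonpos_of_nonpos_of_nonneg (by nlinarith) (H x hx').rpos.le
    nlinarith
  exact fun τ hτ => ⟨hpos τ hτ, hmono τ hτ fun z hz => hpos z ⟨hz.1, hz.2.trans hτ.2⟩⟩

/-- While `r` decreases and `w` moves outward, `N` cannot stay in `[-1, 0]` forever. -/
theorem exists_N_lt_neg_one_of_outward {Λ : ℝ} {y : Trajectory} {a : ℝ}
    (H : ∀ τ ≥ a, Reg Λ y τ) (hN : y.N a < 0) (hw : 1 < y.w a) (hU : 0 < y.U a) :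
    ∃ τ > a, y.N τ < -1 := by
  by_contra hcon
  push Not at hcon
  have hI : ∀ b, ∀ τ ∈ Icc a b, Reg Λ y τ := fun b τ hτ => H τ hτ.1
  have hNneg : ∀ τ ≥ a, y.N τ < 0 := fun τ hτ => N_neg_of_neg (hI τ) hN τ ⟨hτ, le_rfl⟩
  have hout : ∀ τ ≥ a, 0 < y.U τ ∧ y.w a ≤ y.w τ := fun τ hτ =>
    outward_persists (hI τ) hw hU τ ⟨hτ, le_rfl⟩
  -- The terms in κ cancel in the derivative of f = -N U. While -1 ≤ N < 0 the derivative is at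
  -- least 2 U³ ≥ 2 f³, so f would blow up in finite time.
  have hd : ∀ τ ≥ a, HasDerivAt (fun τ => -y.N τ * y.U τ)
      (2 * y.U τ ^ 3 + y.N τ * (y.w τ * y.Q τ)) τ := fun τ hτ =>
    ((H τ hτ).dN.fun_neg.fun_mul (H τ hτ).dU).congr_deriv (by ring)
  have hpos : ∀ τ ≥ a, 0 < -y.N τ * y.U τ := fun τ hτ =>
    mul_pos (by linarith [hNneg τ hτ]) (hout τ hτ).1
  have hge : ∀ τ > a, 2 * (-y.N τ * y.U τ) ^ 3 ≤ 2 * y.U τ ^ 3 + y.N τ * (y.w τ * y.Q τ) :=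
    fun τ hτ => by
    have h1 := hout τ hτ.le
    have h2 := hNneg τ hτ.le
    have h3 := hcon τ hτ
    have h4 : y.w τ * y.Q τ ≤ 0 := by
      refine mul_nonpos_of_nonneg_of_nonpos (by linarith) ?_
      exact div_nonpos_of_nonpos_of_nonneg (by nlinarith) (H τ hτ.le).rpos.le
    have h5 : -y.N τ * y.U τ ≤ y.U τ := by nlinarith
    have h6 := pow_le_pow_left₀ (hpos τ hτ.le).le h5 3
    nlinarith
  set f := fun τ => -y.N τ * y.U τ with hf
  have hfmono : ∀ τ ≥ a, f a ≤ f τ := fun τ hτ =>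
    le_of_hasDerivAt_nonneg hτ (fun x hx => hd x hx.1) fun x hx => by
      have := hge x hx.1
      have h2 := pow_pos (hpos x hx.1.le) 3
      linarith
  have hfa := hpos a le_rfl
  have hfa' : 0 < f a := hfa
  -- As 1 / f falls at least at the rate 2 f(a), it would be negative at time a + f(a)⁻².
  set b := a + (f a)⁻¹ / f a with hb
  have hab : a ≤ b := by have : 0 ≤ (f a)⁻¹ / f a := by positivity
                         linarith
  have h1 := le_add_mul_of_hasDerivAt (f := fun τ => (f τ)⁻¹) (C := -2 * f a) hab
    (fun x hx => (hd x hx.1).fun_inv (hpos x hx.1).ne') fun x hx => by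
      have h2 := hpos x hx.1.le
      have h3 := hge x hx.1
      have h4 := hfmono x hx.1.le
      rw [div_le_iff₀ (by positivity)]
      have h5 : f a * f x ^ 2 ≤ f x * f x ^ 2 := mul_le_mul_of_nonneg_right h4 (sq_nonneg _)
      simp only [hf] at h5 ⊢
      nlinarith
  have h2 : 0 < (f b)⁻¹ := inv_pos.2 (hpos b hab)
  have h3 : -2 * f a * (b - a) = -2 * (f a)⁻¹ := by rw [hb]; field_simp; ring
  have h4 : 0 < (f a)⁻¹ := inv_pos.2 hfa'
  linarith

/-- Once `w > 1` and `w` increases with `r`, the solution must turn. -/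
theorem Flow.outward {Λ : ℝ} (hΛ : 0 ≤ Λ) {y : Trajectory} {T : EReal} (F : Flow Λ y T) {a : ℝ}
    (haT : (a : EReal) < T) (hN : 0 < y.N a) (hw : 1 < y.w a) (hU : 0 < y.U a) :
    Generic y T ∨ BlackHole y T := by
  rcases F.pos_or_zero haT hN with hpos | ⟨c, hac, hcT, hc0, hcpos⟩
  · exfalso
    induction T with
    | bot => exact absurd haT (not_lt.2 bot_le)
    | coe t =>
      have hat : a < t := EReal.coe_lt_coe_iff.1 haT
      have H := F.regIco (a := a)
      have hlt : ∀ τ ∈ Ico a t, (τ : EReal) < (t : EReal) := fun τ hτ => EReal.coe_lt_coe_iff.2 hτ.2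
      -- At a finite end with N > 0, U would tend to zero; but there κ < 0 < N, which makes U
      -- nondecreasing.
      obtain ⟨b, C, hab, hbt, hC, hh⟩ := F.horizon hΛ (B := max 1 (y.N a)) hat fun τ hτ => by
        rw [abs_of_pos (hpos τ (hlt τ hτ))]
        exact N_le_max hΛ (F.regIcc (hlt τ hτ)) τ ⟨hτ.1, le_rfl⟩
      have hout : ∀ τ ∈ Ico a t, 0 < y.U τ ∧ y.w a ≤ y.w τ := fun τ hτ =>
        outward_persists (F.regIcc (hlt τ hτ)) hw hU τ ⟨hτ.1, le_rfl⟩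
      have hmono : ∀ τ ∈ Ico b t, y.U b ≤ y.U τ := fun τ hτ =>
        le_of_hasDerivAt_nonneg hτ.1
          (fun x hx => (H x ⟨hab.trans hx.1, hx.2.trans_lt hτ.2⟩).dU) fun x hx => by
            have hx' : x ∈ Ico a t := ⟨hab.trans hx.1.le, hx.2.trans hτ.2⟩
            have h1 := (hh x ⟨hx.1.le, hx'.2⟩).1
            have h2 := hpos x (hlt x hx')
            have h3 := hout x hx'
            have h4 : y.w x * y.Q x ≤ 0 := by
              refine mul_nonpos_of_nonneg_of_nonpos (by linarith) ?_
              exact div_nonpos_of_nonpos_of_nonneg (by nlinarith) (H x hx').rpos.le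
            nlinarith
      have hlim := tendsto_zero_of_abs_le_mul_sub hbt fun τ hτ => (hh τ hτ).2.1
      have := ge_of_tendsto hlim (by filter_upwards [Ico_mem_nhdsLT hbt] with τ hτ using hmono τ hτ)
      linarith [(hout b ⟨hab, hbt⟩).1]
    | top =>
      have H : ∀ b, ∀ τ ∈ Icc a b, Reg Λ y τ := fun b => F.regIcc (EReal.coe_lt_top b)
      have hout : ∀ τ ≥ a, 0 < y.U τ ∧ y.w a ≤ y.w τ := fun τ hτ =>
        outward_persists (H τ) hw hU τ ⟨hτ, le_rfl⟩
      have hN0 : ∀ τ, 0 < y.N τ := fun τ => hpos τ (EReal.coe_lt_top τ)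
      set m := max 2 (y.N a + y.κ a) with hm
      have hm2 : 2 ≤ m := le_max_left _ _
      have hS : ∀ τ ≥ a, y.N τ + y.κ τ ≤ m := fun τ hτ =>
        le_of_barrier (fun x hx => (H τ x hx).dS) (le_max_right _ _) (fun x hx h => by
          have h1 : 0 ≤ Λ * y.r x ^ 2 := mul_nonneg hΛ (sq_nonneg _)
          nlinarith [sq_nonneg (y.N x - y.κ x)]) τ ⟨hτ, le_rfl⟩
      -- ζ satisfies a Riccati equation with linear coefficient 2 N - κ ≥ -m, so it cannot drop
      -- below c. Then w grows at least at the rate c (w² - 1) and would become infinite in finite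
      -- time.
      set ζ : ℝ → ℝ := fun τ => y.r τ * y.U τ / (y.w τ ^ 2 - 1) with hζ
      have hw1 : ∀ τ ≥ a, 0 < y.w τ ^ 2 - 1 := fun τ hτ => by nlinarith [(hout τ hτ).2]
      have hζ0 : ∀ τ ≥ a, 0 < ζ τ := fun τ hτ =>
        div_pos (mul_pos (H τ τ ⟨hτ, le_rfl⟩).rpos (hout τ hτ).1) (hw1 τ hτ)
      have hdζ : ∀ τ ≥ a, HasDerivAt ζ
          ((2 * y.N τ - y.κ τ) * ζ τ + y.w τ - 2 * y.w τ * ζ τ ^ 2) τ := fun τ hτ => by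
        have h := H τ τ ⟨hτ, le_rfl⟩
        have h1 := (hw1 τ hτ).ne'
        refine ((h.dr.fun_mul h.dU).fun_div ((h.dw.fun_pow 2).sub_const 1) h1).congr_deriv ?_
        have h2 : y.Q τ = -(y.w τ ^ 2 - 1) / y.r τ := by rw [Trajectory.Q]; ring
        have h3 := h.rpos.ne'
        rw [h2]
        simp only [hζ]
        field_simp
        push_cast
        ring
      set c := min (ζ a) (1 / (4 * m)) with hc
      have hc0 : 0 < c := lt_min (hζ0 a le_rfl) (by positivity)
      have hζc : ∀ τ ≥ a, c ≤ ζ τ := fun τ hτ => by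
        have := le_of_barrier (f := fun x => -ζ x) (m := -c)
          (fun x (hx : x ∈ Icc a τ) => (hdζ x hx.1).fun_neg)
          (by linarith [min_le_left (ζ a) (1 / (4 * m))]) (fun x hx h => by
            have h1 := hζ0 x hx.1
            have h2 : ζ x ≤ 1 / (4 * m) := by linarith [min_le_right (ζ a) (1 / (4 * m))]
            have h3 : m * ζ x ≤ 1 / 4 := by
              rw [le_div_iff₀ (by positivity)] at h2; linarith
            have h4 := hS x hx.1
            have h5 := hN0 x
            have h6 := (hout x hx.1).2
            have h7 : ζ x ≤ 1 / 8 := by nlinarith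
            have h8 : -(m * ζ x) ≤ (2 * y.N x - y.κ x) * ζ x := by nlinarith
            have h9 : ζ x ^ 2 ≤ 1 / 64 := by nlinarith
            have h10 : 2 * y.w x * ζ x ^ 2 ≤ y.w x / 32 := by nlinarith
            linarith) τ ⟨hτ, le_rfl⟩
        linarith
      have hwr : ∀ τ ≥ a, c * (y.w τ ^ 2 - 1) ≤ y.r τ * y.U τ := fun τ hτ => by
        have := hζc τ hτ
        rwa [hζ, le_div_iff₀ (hw1 τ hτ)] at this
      set b := a + (y.w a - 1)⁻¹ / c with hb
      have hwa : 0 < (y.w a - 1)⁻¹ := inv_pos.2 (by linarith)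
      have hab : a ≤ b := by have : 0 ≤ (y.w a - 1)⁻¹ / c := by positivity
                             linarith
      have h1 := le_add_mul_of_hasDerivAt (f := fun τ => (y.w τ - 1)⁻¹) (C := -c) hab
        (fun x hx => ((H b x hx).dw.sub_const 1).fun_inv (by linarith [(hout x hx.1).2]))
        fun x hx => by
          have h2 := hwr x hx.1.le
          have h3 := (hout x hx.1.le).2
          rw [div_le_iff₀ (by nlinarith)]
          nlinarith [mul_pos hc0 (show 0 < y.w x - 1 by linarith)]
      have h2 : 0 < (y.w b - 1)⁻¹ := inv_pos.2 (by linarith [(hout b hab).2])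
      have h3 : -c * (b - a) = -(y.w a - 1)⁻¹ := by rw [hb]; field_simp; ring
      linarith
  · have hout := outward_persists (F.regIcc (a := a) hcT) hw hU c ⟨hac.le, le_rfl⟩
    have hturn := F.turnsAt hcT hc0 hcpos hout.1.ne'
    refine F.generic_or_blackHole hΛ hturn fun hT => ?_
    subst hT
    have hN1 : y.N (c + 1) < 0 := hturn.2.2.2 _ (by linarith) (EReal.coe_lt_top _)
    have hout1 := outward_persists (F.regIcc (a := a) (EReal.coe_lt_top (c + 1))) hw hU (c + 1)
      ⟨by linarith, le_rfl⟩
    obtain ⟨τ, h1, h2⟩ := exists_N_lt_neg_one_of_outward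
      (fun τ _ => F.reg τ (EReal.coe_lt_top τ)) hN1 (hw.trans_le hout1.2) hout1.1
    exact ⟨τ, by linarith, h2⟩

/-! ### A neighbourhood of a regular horizon. -/

/-- If `Φ` stays negative, a solution with `N > 0` ends at a regular horizon. -/
theorem Flow.regularHorizon {Λ : ℝ} (hΛ : 0 ≤ Λ) {y : Trajectory} {t a B δ : ℝ} (F : Flow Λ y t)
    (hat : a < t) (hpos : ∀ τ : ℝ, (τ : EReal) < t → 0 < y.N τ) (hN : ∀ τ ∈ Ico a t, y.N τ ≤ B)
    (hδ : 0 < δ) (hΦ : ∀ τ ∈ Ico a t, 1 + δ ≤ y.Q τ ^ 2 + Λ * y.r τ ^ 2) :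
    RegularHorizon y t := by
  obtain ⟨b, C, hab, hbt, hC, hh⟩ := F.horizon hΛ (B := B) hat fun τ hτ => by
    rw [abs_of_pos (hpos τ (EReal.coe_lt_coe_iff.2 hτ.2))]; exact hN τ hτ
  obtain ⟨r₀, hr₀, hr⟩ := exists_tendsto_r (D := C * (t - b)) hbt hC F.regIco fun τ hτ => by
    obtain ⟨-, -, h3, -, -, h6, h7, -⟩ := hh τ hτ
    refine ⟨h6, h7, h3.trans ?_⟩
    gcongr; exact hτ.1
  have hN0 := tendsto_zero_of_abs_le_mul_sub hbt fun τ hτ => (hh τ hτ).2.2.1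
  have hU0 := tendsto_zero_of_abs_le_mul_sub hbt fun τ hτ => (hh τ hτ).2.1
  have hsmall : ∀ᶠ τ in 𝓝[<] t, y.N τ ^ 2 + 2 * y.U τ ^ 2 < δ / 2 := by
    have := (hN0.pow 2).add ((hU0.pow 2).const_mul 2)
    refine this.eventually (gt_mem_nhds ?_)
    simpa using by positivity
  refine ⟨hpos, ⟨r₀, hr₀, by rwa [upTo_coe]⟩, by rwa [upTo_coe], 4 * C ^ 2 / δ, ?_⟩
  rw [upTo_coe]
  filter_upwards [hsmall, Ico_mem_nhdsLT hbt] with τ h1 hτ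
  obtain ⟨h2, h3, -, h5, -⟩ := hh τ hτ
  have h6 := hpos τ (EReal.coe_lt_coe_iff.2 hτ.2)
  have h7 := (F.regIco (a := a) τ ⟨hab.trans hτ.1, hτ.2⟩).con
  have h8 := hΦ τ ⟨hab.trans hτ.1, hτ.2⟩
  -- N and U are already small, so the constraint is close to 2 κ N = 1 - Q² - Λ r² ≤ -δ. Hence N is
  -- at least of order t - τ, and U is at most of that order.
  have h9 : δ / 4 ≤ -y.κ τ * y.N τ := by nlinarith
  have hts : 0 < t - τ := sub_pos.2 hτ.2
  rw [abs_div, abs_of_pos h6, div_le_div_iff₀ h6 hδ]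
  calc |y.U τ| * δ ≤ C * (t - τ) * (4 * (-y.κ τ * y.N τ)) :=
        mul_le_mul h3 (by linarith) hδ.le (by positivity)
    _ = 4 * C * (-y.κ τ * (t - τ)) * y.N τ := by ring
    _ ≤ 4 * C * C * y.N τ := by gcongr
    _ = _ := by ring

/-- Near a regular horizon with `w ≠ 0` and `Φ < 0`. -/
theorem Flow.near_horizon {Λ : ℝ} (hΛ : 0 ≤ Λ) {y : Trajectory} {T : EReal} (F : Flow Λ y T)
    {a rc wc ε δ : ℝ} (haT : (a : EReal) < T) (hδ : 0 < δ)
    (hΦ : ∀ r w, 0 < r → |r - rc| < ε → |w - wc| < ε →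
      1 + δ ≤ ((1 - w ^ 2) / r) ^ 2 + Λ * r ^ 2 ∧ w ≠ 0)
    (hN : 0 < y.N a) (hN1 : y.N a ≤ 1) (hP : y.κ a + 2 * y.N a ≤ -10)
    (hr : |y.r a - rc| < ε / 2) (hw : |y.w a - wc| < ε / 2)
    (hsmall : 2 * y.r a * (y.N a + 2 * (4 / -(y.κ a + 2 * y.N a))) < ε / 2) :
    (Generic y T ∨ BlackHole y T) ∨
      (RegularHorizon y T ∧ ∀ τ : ℝ, a ≤ τ → (τ : EReal) < T → y.w τ ≠ 0) := by
  set η := 4 / -(y.κ a + 2 * y.N a) with hη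
  have hη0 : 0 < η := by have : 0 < -(y.κ a + 2 * y.N a) := by linarith
                         positivity
  have hη4 : η ≤ 2 / 5 := by
    rw [hη, div_le_div_iff₀ (by linarith) (by norm_num)]; linarith
  have hra : 0 < y.r a := (F.reg a haT).rpos
  have hle1 : ∀ b : ℝ, (b : EReal) < T → ∀ τ ∈ Icc a b, y.N τ ≤ 1 := fun b hb τ hτ => by
    simpa [hN1] using N_le_max hΛ (F.regIcc hb) τ hτ
  -- While N ≥ 0, the Riccati inequality leaves at most the time η. In that time r at most doubles,
  -- and ±w + r(a) N grows at most at the rate 3/2 r(a), so r and w stay within ε of the limit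
  -- point.
  have hclose : ∀ b : ℝ, a ≤ b → (b : EReal) < T → (∀ τ ∈ Icc a b, 0 ≤ y.N τ) →
      |y.r b - rc| < ε ∧ |y.w b - wc| < ε := by
    intro b hab hb hNb
    have H := F.regIcc (a := a) hb
    have hlen : b - a ≤ η := length_le_of_P_le hΛ hab H (fun τ hτ => by
      rw [abs_of_nonneg (hNb τ hτ)]; linarith [hle1 b hb τ hτ]) hP
    have hr2 : ∀ τ ∈ Icc a b, y.r τ ≤ 2 * y.r a := fun τ hτ => by
      have h1 := ge_of_hasDerivAt_nonpos (f := fun x => Real.exp (-(x - a)) * y.r x) hτ.1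
        (fun x hx => (((hasDerivAt_id' x).sub_const a).fun_neg.exp).fun_mul
          (H x ⟨hx.1, hx.2.trans hτ.2⟩).dr) fun x hx => by
            have hx' : x ∈ Icc a b := ⟨hx.1.le, hx.2.le.trans hτ.2⟩
            have h2 := mul_pos (Real.exp_pos (-(x - a))) (H x hx').rpos
            have h3 := hle1 b hb x hx'
            nlinarith
      simp only [sub_self, neg_zero, Real.exp_zero, one_mul] at h1
      have h4 : 1 / 2 ≤ Real.exp (-(τ - a)) := by
        have := Real.add_one_le_exp (-(τ - a))
        linarith [hτ.2]
      nlinarith [(H τ hτ).rpos]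
    have h1 : y.r b - y.r a ≤ 2 * y.r a * η := by
      have := le_add_mul_of_hasDerivAt (C := 2 * y.r a) hab (fun x hx => (H x hx).dr) fun x hx => by
        have hx' : x ∈ Icc a b := ⟨hx.1.le, hx.2.le⟩
        have h2 := hr2 x hx'
        have h3 := hle1 b hb x hx'
        have h4 := (H x hx').rpos
        nlinarith
      have h5 : 2 * y.r a * (b - a) ≤ 2 * y.r a * η :=
        mul_le_mul_of_nonneg_left hlen (by linarith)
      linarith
    have h2 : y.r a ≤ y.r b := le_of_hasDerivAt_nonneg hab (fun x hx => (H x hx).dr) fun x hx => by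
      have hx' : x ∈ Icc a b := ⟨hx.1.le, hx.2.le⟩
      exact mul_nonneg (H x hx').rpos.le (hNb x hx')
    have h3 : ∀ s : ℝ, |s| = 1 → s * (y.w b - y.w a) ≤ y.r a * (y.N a + 2 * η) := by
      intro s hs
      have := le_add_mul_of_hasDerivAt (f := fun x => s * y.w x + y.r a * y.N x)
        (C := 3 / 2 * y.r a) hab
        (fun x hx => ((H x hx).dw.const_mul s).fun_add ((H x hx).dN'.const_mul (y.r a)))
        fun x hx => by
          have hx' : x ∈ Icc a b := ⟨hx.1.le, hx.2.le⟩
          have h4 : s * (y.r x * y.U x) ≤ 2 * y.r a * |y.U x| := by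
            calc s * (y.r x * y.U x) ≤ |s * (y.r x * y.U x)| := le_abs_self _
              _ = y.r x * |y.U x| := by
                rw [abs_mul, abs_mul, hs, abs_of_pos (H x hx').rpos, one_mul]
              _ ≤ _ := mul_le_mul_of_nonneg_right (hr2 x hx') (abs_nonneg _)
          have h5 : 0 ≤ Λ * y.r x ^ 2 := mul_nonneg hΛ (sq_nonneg _)
          have h6 : (1 - y.N x ^ 2) / 2 - y.U x ^ 2 - y.Q x ^ 2 / 2 - Λ * y.r x ^ 2 / 2
              ≤ 1 / 2 - |y.U x| ^ 2 := by
            rw [sq_abs]; nlinarith [sq_nonneg (y.N x), sq_nonneg (y.Q x)]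
          nlinarith [mul_le_mul_of_nonneg_left h6 hra.le,
            mul_nonneg hra.le (sq_nonneg (|y.U x| - 1))]
      have h7 : 3 / 2 * y.r a * (b - a) ≤ 3 / 2 * y.r a * η :=
        mul_le_mul_of_nonneg_left hlen (by linarith)
      have h8 : 0 ≤ y.r a * y.N b := mul_nonneg hra.le (hNb b ⟨hab, le_rfl⟩)
      have h9 : 0 < y.r a * η := mul_pos hra hη0
      linarith
    have h4 := h3 1 (by simp)
    have h5 := h3 (-1) (by simp)
    have h6 : 0 < y.r a * y.N a := mul_pos hra hN
    have h9 : 0 < y.r a * η := mul_pos hra hη0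
    rw [abs_lt] at hr hw ⊢
    rw [abs_lt]
    refine ⟨⟨?_, ?_⟩, ?_, ?_⟩ <;> linarith
  rcases F.pos_or_zero haT hN with hpos | ⟨c, hac, hcT, hc0, hcpos⟩
  · right
    induction T with
    | bot => exact absurd haT (not_lt.2 bot_le)
    | top =>
      exfalso
      have := length_le_of_P_le hΛ (show a ≤ a + (η + 1) by linarith)
        (F.regIcc (EReal.coe_lt_top _)) (fun τ hτ => by
          rw [abs_of_pos (hpos τ (EReal.coe_lt_top _))]
          linarith [hle1 _ (EReal.coe_lt_top _) τ hτ]) hP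
      linarith
    | coe t =>
      have hcl : ∀ τ : ℝ, a ≤ τ → τ < t → _ := fun τ h1 h2 =>
        hclose τ h1 (EReal.coe_lt_coe_iff.2 h2) fun x hx =>
          (hpos x (EReal.coe_lt_coe_iff.2 (hx.2.trans_lt h2))).le
      refine ⟨F.regularHorizon hΛ (EReal.coe_lt_coe_iff.1 haT) hpos (B := 1) (fun τ hτ =>
        hle1 τ (EReal.coe_lt_coe_iff.2 hτ.2) τ ⟨hτ.1, le_rfl⟩) hδ fun τ hτ => ?_,
        fun τ h1 h2 => ?_⟩
      · have := hcl τ hτ.1 hτ.2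
        exact (hΦ _ _ (F.reg τ (EReal.coe_lt_coe_iff.2 hτ.2)).rpos this.1 this.2).1
      · have := hcl τ h1 (EReal.coe_lt_coe_iff.1 h2)
        exact (hΦ _ _ (F.reg τ h2).rpos this.1 this.2).2
  · left
    have hreg := F.reg c hcT
    have h1 := hclose c hac.le hcT fun τ hτ => by
      rcases hτ.2.eq_or_lt with h | h
      · rw [h, hc0]
      · exact (hcpos τ h).le
    have h2 := (hΦ _ _ hreg.rpos h1.1 h1.2).1
    -- At N = 0 the constraint reads 2 U² = Q² + Λ r² - 1 ≥ δ.
    have hU : y.U c ≠ 0 := by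
      intro hU
      have h3 := hreg.con
      rw [hc0, hU, Trajectory.Q] at h3
      linarith
    have hturn := F.turnsAt hcT hc0 hcpos hU
    refine F.generic_or_blackHole hΛ hturn fun hT => ?_
    subst hT
    -- If N never fell below -1, then |N| ≤ 2 for all time, and the Riccati inequality would bound
    -- the lifetime by η.
    by_contra hcon
    push Not at hcon
    have := length_le_of_P_le hΛ (show a ≤ a + (η + 1) by linarith)
      (F.regIcc (EReal.coe_lt_top _)) (fun τ hτ => by
        rw [abs_le]
        refine ⟨?_, by linarith [hle1 _ (EReal.coe_lt_top _) τ hτ]⟩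
        rcases lt_or_ge c τ with h | h
        · linarith [hcon τ h]
        · rcases h.eq_or_lt with h | h
          · rw [h, hc0]; norm_num
          · linarith [hcpos τ h]) hP
    linarith

/-! ### Positive Yang-Mills energy at a large radius. -/

theorem Q_sq_le {y : Trajectory} {τ B : ℝ}
    (hw : |1 - y.w τ ^ 2| ≤ B) : y.Q τ ^ 2 ≤ B ^ 2 / y.r τ ^ 2 := by
  rw [Trajectory.Q, div_pow]
  refine div_le_div_of_nonneg_right ?_ (sq_nonneg _)
  rw [← sq_abs]
  exact pow_le_pow_left₀ (abs_nonneg _) hw 2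

theorem r_mono {Λ : ℝ} {y : Trajectory} {a b : ℝ} (hab : a ≤ b) (H : ∀ τ ∈ Icc a b, Reg Λ y τ)
    (hN : ∀ τ ∈ Ico a b, 0 < y.N τ) : y.r a ≤ y.r b :=
  le_of_hasDerivAt_nonneg hab (fun x hx => (H x hx).dr) fun x hx =>
    mul_nonneg (H x ⟨hx.1.le, hx.2.le⟩).rpos.le (hN x ⟨hx.1.le, hx.2⟩).le

theorem w_mono {Λ : ℝ} {y : Trajectory} {a b : ℝ} (hab : a ≤ b) (H : ∀ τ ∈ Icc a b, Reg Λ y τ)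
    (hU : ∀ τ ∈ Ico a b, 0 < y.U τ) : y.w a ≤ y.w b :=
  le_of_hasDerivAt_nonneg hab (fun x hx => (H x hx).dw) fun x hx =>
    mul_nonneg (H x ⟨hx.1.le, hx.2.le⟩).rpos.le (hU x ⟨hx.1.le, hx.2⟩).le

theorem U_pos_of_h_pos {y : Trajectory} {x : ℝ} (hU : 0 ≤ y.U x)
    (hh : 0 < (y.r x * y.U x) ^ 2 - (1 - y.w x ^ 2) ^ 2 / 2) : 0 < y.U x := by
  rcases hU.eq_or_lt with h0 | h0
  · exfalso
    rw [← h0] at hh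
    nlinarith [sq_nonneg (1 - y.w x ^ 2)]
  · exact h0

set_option maxHeartbeats 2000000 in
/-- If the energy of the Yang-Mills field is positive at a large radius where `κ < 0`, then `r`
turns, and the solution is generic or a black hole. -/
theorem Flow.crash_of_neg_kappa {Λ : ℝ} (hΛ : 0 ≤ Λ) {y : Trajectory} {T : EReal} (F : Flow Λ y T)
    {a : ℝ} (haT : (a : EReal) < T) (hN : 0 < y.N a) (hN2 : y.N a ≤ 2) (hκ : y.κ a < 0)
    (hU : 0 < y.U a) (hh : 0 < (y.r a * y.U a) ^ 2 - (1 - y.w a ^ 2) ^ 2 / 2)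
    (hw : -(6 / 5) ≤ y.w a) (hr : 900 ≤ y.r a) (hL : 13 / 10 ≤ Λ * y.r a ^ 2) :
    Generic y T ∨ BlackHole y T := by
  by_contra hno
  have hcoe : ∀ {x z : ℝ}, x ≤ z → (z : EReal) < T → (x : EReal) < T := fun h1 h2 =>
    (EReal.coe_le_coe_iff.2 h1).trans_lt h2
  -- In a counterexample `Flow.outward` forbids w > 1 while N and U are positive. This keeps w
  -- bounded, and therefore Q small at large radii.
  have hnoout : ∀ τ : ℝ, (τ : EReal) < T → 0 < y.N τ → 0 < y.U τ → y.w τ ≤ 1 := fun τ h1 h2 h3 => by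
    by_contra hcon
    exact hno (F.outward hΛ h1 h2 (not_le.1 hcon) h3)
  have hLr : ∀ x, y.r a ≤ y.r x → 13 / 10 ≤ Λ * y.r x ^ 2 := fun x hx =>
    hL.trans (mul_le_mul_of_nonneg_left (pow_le_pow_left₀ (by linarith) hx 2) hΛ)
  have hQs : ∀ {x : ℝ}, 800 ≤ y.r x → -(6 / 5) ≤ y.w x → y.w x ≤ 1 →
      y.Q x ^ 2 ≤ 1 / 100 := fun {x} h1 h2 h3 => by
    refine (Q_sq_le (B := 1) ?_).trans ?_
    · rw [abs_le]; constructor <;> nlinarith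
    · rw [div_le_div_iff₀ (by positivity) (by norm_num)]; nlinarith
  -- Three facts support each other while N > 0: the derivative of κ is at most Q² - Λ r² ≤ -1, so κ
  -- stays negative; κ < 0 < N makes the energy nondecreasing; positive energy excludes U = 0.
  have key : ∀ b : ℝ, (b : EReal) < T → (∀ x ∈ Ico a b, 0 < y.N x) →
      ∀ x ∈ Icc a b, (y.κ x < 0 ∧ 0 < y.U x ∧
        (y.r a * y.U a) ^ 2 - (1 - y.w a ^ 2) ^ 2 / 2 ≤
          (y.r x * y.U x) ^ 2 - (1 - y.w x ^ 2) ^ 2 / 2 ∧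
        y.κ x ≤ y.κ a - (x - a)) := by
    intro b hb hNb
    have H := F.regIcc (a := a) hb
    refine continuous_induction ⟨hκ, hU, le_rfl, by linarith⟩ (fun x hx hP => ?_) (fun x hx hP => ?_)
    · have Hx : ∀ z ∈ Icc a x, Reg Λ y z := fun z hz => H z ⟨hz.1, hz.2.trans hx.2⟩
      have hbd : ∀ z ∈ Ioo a x, y.Q z ^ 2 ≤ 1 / 100 ∧ 13 / 10 ≤ Λ * y.r z ^ 2 := fun z hz => by
        have Hz : ∀ u ∈ Icc a z, Reg Λ y u := fun u hu => Hx u ⟨hu.1, hu.2.trans hz.2.le⟩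
        have h1 : y.r a ≤ y.r z := r_mono hz.1.le Hz fun u hu =>
          hNb u ⟨hu.1, (hu.2.trans hz.2).trans_le hx.2⟩
        have h2 : y.w a ≤ y.w z := w_mono hz.1.le Hz fun u hu =>
          (hP u ⟨hu.1, hu.2.trans hz.2⟩).2.1
        have h3 := hnoout z (hcoe (hz.2.le.trans hx.2) hb) (hNb z ⟨hz.1.le, hz.2.trans_le hx.2⟩)
          (hP z ⟨hz.1.le, hz.2⟩).2.1
        exact ⟨hQs (by linarith) (by linarith) h3, hLr z h1⟩
      have h1 : y.κ x ≤ y.κ a - (x - a) := by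
        have := le_add_mul_of_hasDerivAt (C := -1) hx.1.le (fun z hz => (Hx z hz).dκ') fun z hz => by
          have := hbd z hz
          nlinarith [sq_nonneg (y.κ z - y.N z)]
        linarith
      have h2 := le_of_hasDerivAt_nonneg hx.1.le (fun z hz => (Hx z hz).dh) fun z hz => by
        have h3 := (hP z ⟨hz.1.le, hz.2⟩).1
        have h4 := hNb z ⟨hz.1.le, hz.2.trans_le hx.2⟩
        exact mul_nonneg (by positivity) (by linarith)
      refine ⟨by linarith [hx.1], ?_, h2, h1⟩
      exact U_pos_of_h_pos (nonneg_of_forall_Ico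
        (Hx x ⟨hx.1.le, le_rfl⟩).dU.continuousAt hx.1 fun z hz => (hP z hz).2.1.le) (hh.trans_le h2)
    · have hx' : x ∈ Icc a b := ⟨hx.1, hx.2.le⟩
      obtain ⟨h1, h2, h3, h4⟩ := hP x ⟨hx.1, le_rfl⟩
      have hev1 : ∀ᶠ z in 𝓝[>] x, y.κ z < 0 ∧ 0 < y.U z :=
        (((H x hx').dκ.continuousAt.eventually (gt_mem_nhds h1)).and
          ((H x hx').dU.continuousAt.eventually (lt_mem_nhds h2))).filter_mono nhdsWithin_le_nhds
      -- on a short interval to the right everything is controlled by the signs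
      obtain ⟨d, hd, hd'⟩ := (mem_nhdsGT_iff_exists_Ioo_subset' hx.2).1 hev1
      filter_upwards [Ioo_mem_nhdsGT (lt_min hd hx.2)] with z hz
      have hzd : ∀ u, x < u → u ≤ z → y.κ u < 0 ∧ 0 < y.U u := fun u h5 h6 =>
        hd' ⟨h5, h6.trans_lt (hz.2.trans_le (min_le_left _ _))⟩
      have hzb : z < b := hz.2.trans_le (min_le_right _ _)
      have hall : ∀ u ∈ Icc a z, y.κ u < 0 ∧ 0 < y.U u := fun u hu => by
        rcases le_or_gt u x with h5 | h5
        · exact ⟨(hP u ⟨hu.1, h5⟩).1, (hP u ⟨hu.1, h5⟩).2.1⟩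
        · exact hzd u h5 hu.2
      have haz : a ≤ z := hx.1.trans hz.1.le
      have Hz : ∀ u ∈ Icc a z, Reg Λ y u := fun u hu => H u ⟨hu.1, hu.2.trans hzb.le⟩
      have h5 := le_of_hasDerivAt_nonneg haz (fun u hu => (Hz u hu).dh) fun u hu => by
        have h6 := (hall u ⟨hu.1.le, hu.2.le⟩).1
        have h7 := hNb u ⟨hu.1.le, hu.2.trans hzb⟩
        exact mul_nonneg (by positivity) (by linarith)
      have h6 := le_add_mul_of_hasDerivAt (C := -1) haz (fun u hu => (Hz u hu).dκ') fun u hu => by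
        have Hu : ∀ v ∈ Icc a u, Reg Λ y v := fun v hv => Hz v ⟨hv.1, hv.2.trans hu.2.le⟩
        have h8 : y.r a ≤ y.r u := r_mono hu.1.le Hu fun v hv =>
          hNb v ⟨hv.1, (hv.2.trans hu.2).trans hzb⟩
        have h9 : y.w a ≤ y.w u := w_mono hu.1.le Hu fun v hv =>
          (hall v ⟨hv.1, (hv.2.trans hu.2).le⟩).2
        have h10 := hnoout u (hcoe (hu.2.le.trans hzb.le) hb) (hNb u ⟨hu.1.le, hu.2.trans hzb⟩)
          (hall u ⟨hu.1.le, hu.2.le⟩).2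
        have h11 := hQs (by linarith) (by linarith) h10
        nlinarith [sq_nonneg (y.κ u - y.N u), hLr u h8]
      exact ⟨(hall z ⟨haz, le_rfl⟩).1, (hall z ⟨haz, le_rfl⟩).2, h5, by linarith⟩
  have hNle : ∀ b : ℝ, (b : EReal) < T → ∀ τ ∈ Icc a b, y.N τ ≤ 2 := fun b hb τ hτ =>
    (N_le_max hΛ (F.regIcc hb) τ hτ).trans (max_le (by norm_num) hN2)
  rcases F.pos_or_zero haT hN with hpos | ⟨c, hac, hcT, hc0, hcpos⟩
  · induction T with
    | bot => exact absurd haT (not_lt.2 bot_le)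
    | top =>
      -- After time 15 one has κ + 2 N ≤ -15 + 4 < -10, and then less than one unit of time remains.
      have hk := key (a + 15) (EReal.coe_lt_top _) (fun x _ => hpos x (EReal.coe_lt_top x))
        (a + 15) ⟨by linarith, le_rfl⟩
      have := length_le_of_P_le hΛ (show a + 15 ≤ a + 16 by linarith)
        (F.regIcc (EReal.coe_lt_top _)) (fun τ hτ => by
          rw [abs_of_pos (hpos τ (EReal.coe_lt_top _))]
          exact hNle _ (EReal.coe_lt_top (a + 16)) τ ⟨by linarith [hτ.1], hτ.2⟩)
        (by linarith [hNle _ (EReal.coe_lt_top (a + 15)) (a + 15) ⟨by linarith, le_rfl⟩])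
      rw [le_div_iff₀ (by
        linarith [hNle _ (EReal.coe_lt_top (a + 15)) (a + 15) ⟨by linarith, le_rfl⟩])] at this
      linarith [hNle _ (EReal.coe_lt_top (a + 15)) (a + 15) ⟨by linarith, le_rfl⟩]
    | coe t =>
      have hat : a < t := EReal.coe_lt_coe_iff.1 haT
      have hlt : ∀ τ ∈ Ico a t, (τ : EReal) < (t : EReal) := fun τ hτ => EReal.coe_lt_coe_iff.2 hτ.2
      obtain ⟨b, C, hab, hbt, hC, hh'⟩ := F.horizon hΛ (B := 2) hat fun τ hτ => by
        rw [abs_of_pos (hpos τ (hlt τ hτ))]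
        exact hNle τ (hlt τ hτ) τ ⟨hτ.1, le_rfl⟩
      -- At a horizon r U → 0, whereas (r U)² is at least the positive initial energy.
      have h0 : Tendsto (fun τ => y.r τ * y.U τ) (𝓝[<] t) (𝓝 0) :=
        tendsto_zero_of_abs_le_mul_sub (C := C * C) hbt fun τ hτ => by
          obtain ⟨-, h2, -, -, -, h6, -⟩ := hh' τ hτ
          have h7 := (F.regIco (a := a) τ ⟨hab.trans hτ.1, hτ.2⟩).rpos
          rw [abs_mul, abs_of_pos h7, mul_assoc]
          exact mul_le_mul h6 h2 (abs_nonneg _) hC.le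
      have h1 := ge_of_tendsto (h0.pow 2) (b := (y.r a * y.U a) ^ 2 - (1 - y.w a ^ 2) ^ 2 / 2) (by
        filter_upwards [Ico_mem_nhdsLT hat] with τ hτ
        have := (key τ (hlt τ hτ) (fun x hx => hpos x (hlt x ⟨hx.1, hx.2.trans hτ.2⟩)) τ
          ⟨hτ.1, le_rfl⟩).2.2.1
        nlinarith [sq_nonneg (1 - y.w τ ^ 2)])
      norm_num at h1
      linarith
  · have hkc := key c hcT (fun x hx => hcpos x hx.2) c ⟨hac.le, le_rfl⟩
    have hkx := key c hcT (fun x hx => hcpos x hx.2)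
    have Hc := F.regIcc (a := a) hcT
    have hrc := r_mono hac.le Hc fun x hx => hcpos x hx.2
    have hturn := F.turnsAt hcT hc0 hcpos hkc.2.1.ne'
    refine hno (F.generic_or_blackHole hΛ hturn fun hT => ?_)
    subst hT
    by_contra hcon
    push Not at hcon
    have H : ∀ τ, Reg Λ y τ := fun τ => F.reg τ (EReal.coe_lt_top τ)
    have hNneg : ∀ τ > c, y.N τ < 0 := fun τ h => hturn.2.2.2 τ h (EReal.coe_lt_top τ)
    have hw1 : ∀ τ > c, 0 < y.U τ → y.w τ ≤ 1 := fun τ h1 h2 => by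
      by_contra h3
      obtain ⟨σ, h4, h5⟩ := exists_N_lt_neg_one_of_outward (fun τ _ => H τ) (hNneg τ h1)
        (not_le.1 h3) h2
      exact absurd h5 (not_lt.2 (hcon σ (h1.trans h4)))
    have hwc : -(6 / 5) ≤ y.w c := hw.trans (w_mono hac.le Hc fun x hx => (hkx x ⟨hx.1, hx.2.le⟩).2.1)
    -- The constraint at the turning point gives 2 U² ≥ Λ r² - 1 ≥ 3/10. If N ≥ -1 from then on, U
    -- stays above 3/10 and r above 810 for time 1/10. So w grows by at least 20 and passes 1, after
    -- which N must fall below -1.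
    have hUc : 3 / 20 ≤ y.U c ^ 2 := by
      have h1 := (H c).con
      rw [hc0] at h1
      nlinarith [hLr c hrc, sq_nonneg (y.Q c)]
    have hUc' : 19 / 50 ≤ y.U c := by nlinarith [hkc.2.1]
    have hNle0 : ∀ τ ≥ c, -1 ≤ y.N τ ∧ y.N τ ≤ 0 := fun τ hτ => by
      rcases hτ.eq_or_lt with h | h
      · rw [← h, hc0]; norm_num
      · exact ⟨hcon τ h, (hNneg τ h).le⟩
    have hrx : ∀ x ∈ Icc c (c + 1 / 10), 9 / 10 * y.r c ≤ y.r x ∧ y.r x ≤ y.r c := fun x hx => by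
      have hle : ∀ z ∈ Icc c x, y.r z ≤ y.r c := fun z hz =>
        ge_of_hasDerivAt_nonpos hz.1 (fun u _ => (H u).dr) fun u hu => by
          have := (hNle0 u hu.1.le).2
          nlinarith [(H u).rpos]
      have := add_mul_le_of_hasDerivAt (C := -y.r c) hx.1 (fun u _ => (H u).dr) fun u hu => by
        have h1 := (hNle0 u hu.1.le).1
        have h2 := hle u ⟨hu.1.le, hu.2.le⟩
        nlinarith [(H u).rpos]
      refine ⟨?_, hle x ⟨hx.1, le_rfl⟩⟩
      nlinarith [hx.2, (H c).rpos]
    have key2 : ∀ x ∈ Icc c (c + 1 / 10), y.κ x < 0 ∧ 3 / 10 < y.U x := by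
      refine continuous_induction ⟨hkc.1, by linarith⟩ (fun x hx hP => ?_) (fun x hx hP => ?_)
      · have hbd : ∀ z ∈ Ioo c x, y.Q z ^ 2 ≤ 1 / 100 ∧ 1 ≤ Λ * y.r z ^ 2 ∧
            |y.w z * y.Q z| ≤ 1 / 100 := fun z hz => by
          have h1 := hrx z ⟨hz.1.le, hz.2.le.trans hx.2⟩
          have h2 : y.w c ≤ y.w z := w_mono hz.1.le (fun u _ => H u) fun u hu => by
            linarith [(hP u ⟨hu.1, hu.2.trans hz.2⟩).2]
          have h3 := hw1 z hz.1 (by linarith [(hP z ⟨hz.1.le, hz.2⟩).2])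
          have h5 : 800 ≤ y.r z := by linarith
          refine ⟨hQs h5 (by linarith) h3, ?_, ?_⟩
          · have h4 := hLr c hrc
            have h6 : (9 / 10 * y.r c) ^ 2 ≤ y.r z ^ 2 :=
              pow_le_pow_left₀ (by linarith) h1.1 2
            nlinarith [mul_le_mul_of_nonneg_left h6 hΛ]
          · rw [Trajectory.Q, ← mul_div_assoc, abs_div, abs_of_pos (H z).rpos,
              div_le_iff₀ (H z).rpos]
            have h7 : |y.w z * (1 - y.w z ^ 2)| ≤ 6 / 5 * 1 := by
              rw [abs_mul]
              refine mul_le_mul ?_ ?_ (abs_nonneg _) (by norm_num)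
              · rw [abs_le]; constructor <;> linarith
              · rw [abs_le]; constructor <;> nlinarith
            linarith
        constructor
        · have := ge_of_hasDerivAt_nonpos hx.1.le (fun z _ => (H z).dκ') fun z hz => by
            have := hbd z hz
            nlinarith [sq_nonneg (y.κ z - y.N z)]
          linarith [hkc.1]
        -- As κ < 0 and N ≥ -1, the derivative of U is at least -U - 1/100; the exponential is the
        -- integrating factor.
        · have h1 := le_of_hasDerivAt_nonneg (f := fun z => Real.exp (z - c) * (y.U z + 1 / 100))
            hx.1.le (fun z _ => (((hasDerivAt_id' z).sub_const c).exp).fun_mul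
              ((H z).dU.add_const (1 / 100))) fun z hz => by
              have h2 := hbd z hz
              have h3 := hP z ⟨hz.1.le, hz.2⟩
              have h4 := hNle0 z hz.1.le
              have h5 := (abs_le.1 h2.2.2).2
              have h6 : 0 ≤ (y.U z + 1 / 100) + (-(y.w z * y.Q z) - (y.κ z - y.N z) * y.U z) := by
                nlinarith
              have := mul_nonneg (Real.exp_pos (z - c)).le h6
              linarith
          simp only [sub_self, Real.exp_zero, one_mul] at h1
          have h2 : Real.exp (x - c) ≤ 10 / 9 := by
            have h3 := Real.add_one_le_exp (-(x - c))
            rw [Real.exp_neg] at h3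
            have h4 : 9 / 10 ≤ (Real.exp (x - c))⁻¹ := by linarith [hx.2]
            have h5 := inv_anti₀ (by norm_num) h4
            rw [inv_inv] at h5
            linarith
          nlinarith [Real.exp_pos (x - c)]
      · obtain ⟨h1, h2⟩ := hP x ⟨hx.1, le_rfl⟩
        exact (((H x).dκ.continuousAt.eventually (gt_mem_nhds h1)).and
          ((H x).dU.continuousAt.eventually (lt_mem_nhds h2))).filter_mono nhdsWithin_le_nhds
    have h1 := add_mul_le_of_hasDerivAt (C := 200) (show c ≤ c + 1 / 10 by linarith)
      (fun x _ => (H x).dw) fun x hx => by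
        have h2 := (key2 x ⟨hx.1.le, hx.2.le⟩).2
        have h3 := (hrx x ⟨hx.1.le, hx.2.le⟩).1
        nlinarith
    have h2 := hw1 (c + 1 / 10) (by linarith) (by linarith [(key2 (c + 1 / 10)
      ⟨by linarith, le_rfl⟩).2])
    linarith

/-- `2 N (2 N - κ)` in terms of the mass function `X = 1 - N² - Λ r² / 3`. -/
theorem Reg.two_N_mul {Λ : ℝ} {y : Trajectory} {τ : ℝ} (H : Reg Λ y τ) :
    2 * y.N τ * (2 * y.N τ - y.κ τ) =
      2 - 3 * (1 - y.N τ ^ 2 - Λ * y.r τ ^ 2 / 3) - 2 * y.U τ ^ 2 + y.Q τ ^ 2 := by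
  linarith [H.con]

theorem Q_sq_le_of_abs_w_le {y : Trajectory} {τ : ℝ} (hr : 1000 ≤ y.r τ) (hw : |y.w τ| ≤ 11 / 10) :
    y.Q τ ^ 2 ≤ 1 / 1000000 := by
  have h0 := abs_le.1 hw
  refine (Q_sq_le (B := 1) ?_).trans ?_
  · rw [abs_le]; constructor <;> nlinarith
  · rw [div_le_div_iff₀ (by positivity) (by norm_num)]; nlinarith

/-- Since (1 - w²)² ≤ 1, one has r U ≤ √(h + 1), so √(h + 1) has derivative at most 2 r U, twice
that of w. As w is bounded, so is r U, and U stays small at large radii. -/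
theorem sqrt_energy_le {Λ : ℝ} {y : Trajectory} {a b : ℝ} (hab : a ≤ b)
    (H : ∀ τ ∈ Icc a b, Reg Λ y τ) (hw : ∀ τ ∈ Ioo a b, |y.w τ| ≤ 11 / 10)
    (hU : ∀ τ ∈ Ioo a b, 0 < y.U τ) (hg : ∀ τ ∈ Ioo a b, 0 ≤ 2 * y.N τ - y.κ τ)
    (hg2 : ∀ τ ∈ Ioo a b, 2 * y.N τ - y.κ τ ≤ 2)
    (hh : ∀ τ ∈ Icc a b, 0 < (y.r τ * y.U τ) ^ 2 - (1 - y.w τ ^ 2) ^ 2 / 2) :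
    √((y.r b * y.U b) ^ 2 - (1 - y.w b ^ 2) ^ 2 / 2 + 1) ≤
      √((y.r a * y.U a) ^ 2 - (1 - y.w a ^ 2) ^ 2 / 2 + 1) + 2 * (y.w b - y.w a) := by
  have := ge_of_hasDerivAt_nonpos
    (f := fun τ => √((y.r τ * y.U τ) ^ 2 - (1 - y.w τ ^ 2) ^ 2 / 2 + 1) - 2 * y.w τ) hab
    (fun x hx => (((H x hx).dh.add_const 1).sqrt (by linarith [hh x hx])).fun_sub
      ((H x hx).dw.const_mul 2)) fun x hx => by
      have hx' : x ∈ Icc a b := ⟨hx.1.le, hx.2.le⟩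
      have h1 := hh x hx'
      have h2 := abs_le.1 (hw x hx)
      have h3 : 0 < y.r x * y.U x := mul_pos (H x hx').rpos (hU x hx)
      set S := √((y.r x * y.U x) ^ 2 - (1 - y.w x ^ 2) ^ 2 / 2 + 1)
      have hS : 0 < S := Real.sqrt_pos.2 (by linarith)
      have hS2 : y.r x * y.U x ≤ S := by
        refine Real.le_sqrt_of_sq_le ?_
        have : (1 - y.w x ^ 2) ^ 2 ≤ 1 := by
          rw [sq_le_one_iff_abs_le_one, abs_le]; constructor <;> nlinarith
        linarith
      rw [sub_nonpos, div_le_iff₀ (by positivity)]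
      have h4 := hg x hx
      have h5 := hg2 x hx
      have h6 : (y.r x * y.U x) * (2 * y.N x - y.κ x) ≤ S * 2 := mul_le_mul hS2 h5 h4 hS.le
      nlinarith
  linarith

set_option maxHeartbeats 2000000 in
/-- If the energy of the Yang-Mills field becomes positive at a large radius, near the vacuum,
then `r` turns, and the solution is generic or a black hole. -/
theorem Flow.crash {Λ : ℝ} (hΛ : 0 ≤ Λ) {y : Trajectory} {T : EReal} (F : Flow Λ y T)
    {a : ℝ} (haT : (a : EReal) < T) (hN : 0 < y.N a) (hN2 : y.N a ≤ 11 / 10)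
    (hU : 0 < y.U a) (hU2 : y.U a ≤ 1 / 100)
    (hh : 0 < (y.r a * y.U a) ^ 2 - (1 - y.w a ^ 2) ^ 2 / 2)
    (hw : |y.w a| ≤ 11 / 10) (hr : 1000 ≤ y.r a)
    (hX : |1 - y.N a ^ 2 - Λ * y.r a ^ 2 / 3| ≤ 1 / 50) :
    Generic y T ∨ BlackHole y T := by
  have Ha := F.reg a haT
  have hQa := Q_sq_le_of_abs_w_le hr hw
  have hXa := abs_le.1 hX
  -- With U, Q, X small, κ ≤ 0 and the constraint force Λ r² to be at least about 3/2; the value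
  -- 13/10 leaves room for the errors.
  rcases lt_or_ge (y.κ a) 0 with hκ | hκ
  · have h1 := Ha.con
    have h2 : y.κ a * y.N a ≤ 0 := mul_nonpos_of_nonpos_of_nonneg hκ.le hN.le
    exact F.crash_of_neg_kappa hΛ haT hN (by linarith) hκ hU hh (by linarith [(abs_le.1 hw).1])
      (by linarith) (by linarith [sq_nonneg (y.U a)])
  by_contra hno
  have hcoe : ∀ {x z : ℝ}, x ≤ z → (z : EReal) < T → (x : EReal) < T := fun h1 h2 =>
    (EReal.coe_le_coe_iff.2 h1).trans_lt h2
  have hnoout : ∀ τ : ℝ, (τ : EReal) < T → 0 < y.N τ → 0 < y.U τ → y.w τ ≤ 1 := fun τ h1 h2 h3 => by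
    by_contra hcon
    exact hno (F.outward hΛ h1 h2 (not_le.1 hcon) h3)
  -- bounds on an interval where the induction hypothesis holds
  have hNlow : ∀ x : ℝ, Reg Λ y x → 0 ≤ y.N x → 0 ≤ y.κ x → 0 ≤ y.U x → y.U x ≤ 1 / 50 →
      1 - y.N x ^ 2 - Λ * y.r x ^ 2 / 3 ≤ 1 / 50 → 3 / 5 < y.N x := fun x H h1 h2 h3 h4 h5 => by
    have h6 := H.con
    have h7 : 0 ≤ y.κ x * y.N x := mul_nonneg h2 h1
    nlinarith [sq_nonneg (y.Q x)]
  have key : ∀ b : ℝ, (b : EReal) < T → ∀ x ∈ Icc a b,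
      (0 ≤ y.κ x ∧ 0 < y.U x ∧ 3 / 5 < y.N x ∧ y.U x < 1 / 50 ∧
        |1 - y.N x ^ 2 - Λ * y.r x ^ 2 / 3| < 3 / 100 ∧
        (y.r a * y.U a) ^ 2 - (1 - y.w a ^ 2) ^ 2 / 2 ≤
          (y.r x * y.U x) ^ 2 - (1 - y.w x ^ 2) ^ 2 / 2) := by
    intro b hb
    have H := F.regIcc (a := a) hb
    have hbase : ∀ x ∈ Icc a b, (∀ z ∈ Ico a x, 0 < y.U z ∧ 3 / 5 < y.N z) →
        1000 ≤ y.r x ∧ -(11 / 10) ≤ y.w x := fun x hx h =>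
      ⟨hr.trans (r_mono hx.1 (fun u hu => H u ⟨hu.1, hu.2.trans hx.2⟩) fun u hu => by
          linarith [(h u hu).2]),
        (abs_le.1 hw).1.trans (w_mono hx.1 (fun u hu => H u ⟨hu.1, hu.2.trans hx.2⟩) fun u hu =>
          (h u hu).1)⟩
    have hrg : ∀ x ∈ Icc a b, (∀ z ∈ Ico a x, 0 < y.U z ∧ 3 / 5 < y.N z) → 0 < y.U x → 3 / 5 < y.N x →
        y.U x < 1 / 50 → |1 - y.N x ^ 2 - Λ * y.r x ^ 2 / 3| < 3 / 100 →
        0 ≤ 2 * y.N x - y.κ x ∧ 2 * y.N x - y.κ x ≤ 2 ∧ y.Q x ^ 2 ≤ 1 / 1000000 ∧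
          |y.w x| ≤ 11 / 10 := fun x hx h h2 h3 h4 h5 => by
      obtain ⟨h6, h7⟩ := hbase x hx h
      have h8 := hnoout x (hcoe hx.2 hb) (by linarith) h2
      have h9 : |y.w x| ≤ 11 / 10 := abs_le.2 ⟨h7, by linarith⟩
      have h10 := Q_sq_le_of_abs_w_le h6 h9
      have h11 := (H x hx).two_N_mul
      have h12 := abs_lt.1 h5
      have h13 : y.U x ^ 2 ≤ 1 / 2500 := by nlinarith
      refine ⟨?_, ?_, h10, h9⟩
      · by_contra hcon
        push Not at hcon
        nlinarith [sq_nonneg (y.Q x)]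
      · by_contra hcon
        push Not at hcon
        nlinarith [sq_nonneg (y.U x)]
    refine continuous_induction ⟨hκ, hU, ?_, by linarith, by linarith, le_rfl⟩
      (fun x hx hP => ?_) (fun x hx hP => ?_)
    · exact hNlow a Ha hN.le hκ hU.le (by linarith) hXa.2
    · have hx' : x ∈ Icc a b := ⟨hx.1.le, hx.2⟩
      have Hx : ∀ z ∈ Icc a x, Reg Λ y z := fun z hz => H z ⟨hz.1, hz.2.trans hx.2⟩
      have hz' : ∀ z ∈ Ico a x, 0 ≤ 2 * y.N z - y.κ z ∧ 2 * y.N z - y.κ z ≤ 2 ∧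
          y.Q z ^ 2 ≤ 1 / 1000000 ∧ |y.w z| ≤ 11 / 10 := fun z hz => by
        obtain ⟨-, h2, h3, h4, h5, -⟩ := hP z hz
        exact hrg z ⟨hz.1, hz.2.le.trans hx.2⟩ (fun u hu =>
          ⟨(hP u ⟨hu.1, hu.2.trans hz.2⟩).2.1, (hP u ⟨hu.1, hu.2.trans hz.2⟩).2.2.1⟩) h2 h3 h4 h5
      obtain ⟨hrx, hwx⟩ := hbase x hx' fun u hu => ⟨(hP u hu).2.1, (hP u hu).2.2.1⟩
      have hκx : 0 ≤ y.κ x := nonneg_of_forall_Ico (H x hx').dκ.continuousAt hx.1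
        fun z hz => (hP z hz).1
      have hNx : 0 ≤ y.N x := nonneg_of_forall_Ico (H x hx').dN.continuousAt hx.1
        fun z hz => by linarith [(hP z hz).2.2.1]
      have hUx : 0 ≤ y.U x := nonneg_of_forall_Ico (H x hx').dU.continuousAt hx.1
        fun z hz => (hP z hz).2.1.le
      have hwx1 : 0 ≤ 1 - y.w x := nonneg_of_forall_Ico (f := fun z => 1 - y.w z)
        ((H x hx').dw.continuousAt.const_sub 1) hx.1 fun z hz => by
          have := hnoout z (hcoe (hz.2.le.trans hx.2) hb) (by linarith [(hP z hz).2.2.1]) (hP z hz).2.1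
          linarith
      have hhx : ∀ u ∈ Icc a x, (y.r a * y.U a) ^ 2 - (1 - y.w a ^ 2) ^ 2 / 2 ≤
          (y.r u * y.U u) ^ 2 - (1 - y.w u ^ 2) ^ 2 / 2 := fun u hu =>
        le_of_hasDerivAt_nonneg hu.1 (fun z hz => (Hx z ⟨hz.1, hz.2.trans hu.2⟩).dh) fun z hz =>
          mul_nonneg (by positivity) (hz' z ⟨hz.1.le, hz.2.trans_le hu.2⟩).1
      have hUpos : 0 < y.U x := U_pos_of_h_pos hUx (hh.trans_le (hhx x ⟨hx.1.le, le_rfl⟩))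
      have hXu : 1 - y.N x ^ 2 - Λ * y.r x ^ 2 / 3 ≤ 1 / 50 :=
        le_of_barrier (m := 1 / 50) (fun z hz => (Hx z hz).dX) hXa.2 (fun z hz hm => by
          have h1 := hz' z hz
          obtain ⟨-, h2, h3, h4, -, -⟩ := hP z hz
          refine mul_nonpos_of_nonneg_of_nonpos (by linarith) ?_
          nlinarith) x ⟨hx.1.le, le_rfl⟩
      have hXl : -(1 - y.N x ^ 2 - Λ * y.r x ^ 2 / 3) ≤ 1 / 50 :=
        le_of_barrier (m := 1 / 50) (fun z hz => (Hx z hz).dX.fun_neg) (by linarith)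
          (fun z hz hm => by
            obtain ⟨-, h2, h3, h4, -, -⟩ := hP z hz
            rw [neg_nonpos]
            exact mul_nonneg (by linarith) (by
              linarith [sq_nonneg (y.U z), sq_nonneg (y.Q z)])) x ⟨hx.1.le, le_rfl⟩
      have hsq := sqrt_energy_le hx.1.le Hx (fun z hz => (hz' z ⟨hz.1.le, hz.2⟩).2.2.2)
        (fun z hz => (hP z ⟨hz.1.le, hz.2⟩).2.1) (fun z hz => (hz' z ⟨hz.1.le, hz.2⟩).1)
        (fun z hz => (hz' z ⟨hz.1.le, hz.2⟩).2.1) fun z hz => hh.trans_le (hhx z hz)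
      have hUx2 : y.U x < 1 / 50 := by
        have h1 : y.r x * y.U x ≤ √((y.r x * y.U x) ^ 2 - (1 - y.w x ^ 2) ^ 2 / 2 + 1) := by
          refine Real.le_sqrt_of_sq_le ?_
          have : (1 - y.w x ^ 2) ^ 2 ≤ 1 := by
            rw [sq_le_one_iff_abs_le_one, abs_le]; constructor <;> nlinarith
          linarith
        have h2 : √((y.r a * y.U a) ^ 2 - (1 - y.w a ^ 2) ^ 2 / 2 + 1) ≤ y.r a * y.U a + 1 := by
          refine Real.sqrt_le_iff.2 ⟨by nlinarith, ?_⟩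
          nlinarith [sq_nonneg (1 - y.w a ^ 2)]
        have h3 : y.r a ≤ y.r x := r_mono hx.1.le Hx fun u hu => by linarith [(hP u hu).2.2.1]
        have h4 : y.r a * y.U a ≤ y.r x * (1 / 100) := mul_le_mul h3 hU2 hU.le (by linarith)
        have h5 := (abs_le.1 hw).1
        by_contra hcon
        push Not at hcon
        nlinarith
      refine ⟨hκx, hUpos, hNlow x (H x hx') hNx hκx hUx hUx2.le hXu, hUx2, ?_,
        hhx x ⟨hx.1.le, le_rfl⟩⟩
      rw [abs_lt]; constructor <;> linarith
    · have hx' : x ∈ Icc a b := ⟨hx.1, hx.2.le⟩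
      obtain ⟨h1, h2, h3, h4, h5, h6⟩ := hP x ⟨hx.1, le_rfl⟩
      have hprev : ∀ z ∈ Ico a x, 0 < y.U z ∧ 3 / 5 < y.N z := fun z hz =>
        ⟨(hP z ⟨hz.1, hz.2.le⟩).2.1, (hP z ⟨hz.1, hz.2.le⟩).2.2.1⟩
      obtain ⟨g1, g2, g3, g4⟩ := hrg x hx' hprev h2 h3 h4 h5
      obtain ⟨hrx, hwx⟩ := hbase x hx' hprev
      have cU := (H x hx').dU.continuousAt
      have cN := (H x hx').dN.continuousAt
      have cκ := (H x hx').dκ.continuousAt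
      have cr := (H x hx').dr.continuousAt
      have cw := (H x hx').dw.continuousAt
      -- If κ = 0 then Λ r² > 13/10, so κ has negative derivative and is negative immediately
      -- afterwards, where `Flow.crash_of_neg_kappa` contradicts `hno`.
      have hκpos : 0 < y.κ x := by
        rcases h1.eq_or_lt with h0 | h0
        · exfalso
          have hcon := (H x hx').con
          rw [← h0] at hcon
          have hL : 13 / 10 < Λ * y.r x ^ 2 := by nlinarith [sq_nonneg (y.U x)]
          have hd : HasDerivAt y.κ _ x := (H x hx').dκ
          have hneg : 1 + 2 * y.U x ^ 2 - y.κ x ^ 2 - 2 * Λ * y.r x ^ 2 < 0 := by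
            nlinarith [sq_nonneg (y.κ x)]
          have hev : ∀ᶠ z in 𝓝[>] x, y.κ z < 0 := by
            have h1 := (hasDerivWithinAt_iff_tendsto_slope' (s := Ioi x) (by simp)).1
              (hd.hasDerivWithinAt (s := Ioi x))
            filter_upwards [h1.eventually (gt_mem_nhds hneg), self_mem_nhdsWithin] with z hz hz'
            rw [slope_def_field, ← h0, sub_zero] at hz
            by_contra hcon
            exact absurd hz (not_lt.2 (div_nonneg (not_lt.1 hcon) (sub_pos.2 hz').le))
          have hev2 : ∀ᶠ z in 𝓝 x, (3 / 5 < y.N z ∧ y.N z < 2) ∧ 0 < y.U z ∧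
              0 < (y.r z * y.U z) ^ 2 - (1 - y.w z ^ 2) ^ 2 / 2 ∧ -(6 / 5) < y.w z ∧
              900 < y.r z ∧ 13 / 10 < Λ * y.r z ^ 2 := by
            refine ((cN.eventually (lt_mem_nhds h3)).and (cN.eventually (gt_mem_nhds ?_))).and
              ((cU.eventually (lt_mem_nhds h2)).and (((H x hx').dh.continuousAt.eventually
              (lt_mem_nhds (hh.trans_le h6))).and ((cw.eventually (lt_mem_nhds (by linarith))).and
              ((cr.eventually (lt_mem_nhds (by linarith))).and
              (((cr.pow 2).const_mul Λ).eventually (lt_mem_nhds hL))))))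
            have := abs_lt.1 h5
            have := mul_nonneg hΛ (sq_nonneg (y.r x))
            nlinarith
          obtain ⟨z, ⟨hz1, ⟨hz2, hz2'⟩, hz3, hz4, hz5, hz6, hz7⟩, hz8⟩ :=
            ((hev.and (hev2.filter_mono nhdsWithin_le_nhds)).and
              (Ioo_mem_nhdsGT hx.2)).exists
          exact hno (F.crash_of_neg_kappa hΛ (hcoe hz8.2.le hb) (by linarith) hz2'.le hz1 hz3 hz4
            hz5.le hz6.le hz7.le)
        · exact h0
      have hgpos : 0 < 2 * y.N x - y.κ x := by
        have h7 := (H x hx').two_N_mul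
        have := abs_lt.1 h5
        rcases g1.eq_or_lt with h0 | h0
        · rw [← h0] at h7; nlinarith [sq_nonneg (y.Q x)]
        · exact h0
      have hev : ∀ᶠ z in 𝓝[>] x, 0 < y.κ z ∧ 0 < y.U z ∧ 3 / 5 < y.N z ∧ y.U z < 1 / 50 ∧
          |1 - y.N z ^ 2 - Λ * y.r z ^ 2 / 3| < 3 / 100 ∧ 0 < 2 * y.N z - y.κ z :=
        ((cκ.eventually (lt_mem_nhds hκpos)).and ((cU.eventually (lt_mem_nhds h2)).and
          ((cN.eventually (lt_mem_nhds h3)).and ((cU.eventually (gt_mem_nhds h4)).and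
          (((H x hx').dX.continuousAt.abs.eventually (gt_mem_nhds h5)).and
          (((cN.const_mul 2).sub cκ).eventually (lt_mem_nhds hgpos))))))).filter_mono
          nhdsWithin_le_nhds
      obtain ⟨d, hd, hd'⟩ := (mem_nhdsGT_iff_exists_Ioo_subset' hx.2).1 hev
      filter_upwards [Ioo_mem_nhdsGT (lt_min hd hx.2)] with z hz
      have hzd : ∀ u ∈ Ioc x z, _ := fun u hu =>
        hd' ⟨hu.1, hu.2.trans_lt (hz.2.trans_le (min_le_left _ _))⟩
      have hzb : z ≤ b := hz.2.le.trans (min_le_right _ _)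
      obtain ⟨e1, e2, e3, e4, e5, -⟩ := hzd z ⟨hz.1, le_rfl⟩
      refine ⟨e1.le, e2, e3, e4, e5, h6.trans ?_⟩
      exact le_of_hasDerivAt_nonneg hz.1.le (fun u hu => (H u ⟨hx.1.trans hu.1,
        hu.2.trans hzb⟩).dh) fun u hu =>
          mul_nonneg (by positivity) (hzd u ⟨hu.1, hu.2.le⟩).2.2.2.2.2.le
  induction T with
  | bot => exact absurd haT (not_lt.2 bot_le)
  | top =>
    -- The energy does not decrease, so r U ≥ m and w gains at least 3 in time 3 / m. Starting from
    -- w ≥ -11/10 it passes 1.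
    set m := √((y.r a * y.U a) ^ 2 - (1 - y.w a ^ 2) ^ 2 / 2) with hm
    have hmpos : 0 < m := Real.sqrt_pos.2 hh
    have hk := key (a + 3 / m) (EReal.coe_lt_top _)
    have h3 : 0 < 3 / m := by positivity
    have h1 := add_mul_le_of_hasDerivAt (C := m) (show a ≤ a + 3 / m by linarith)
      (fun x _ => (F.reg x (EReal.coe_lt_top x)).dw) fun x hx => by
        obtain ⟨-, h4, -, -, -, h5⟩ := hk x ⟨hx.1.le, hx.2.le⟩
        refine Real.sqrt_le_iff.2
          ⟨(mul_pos (F.reg x (EReal.coe_lt_top x)).rpos h4).le, h5.trans ?_⟩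
        linarith [sq_nonneg (1 - y.w x ^ 2)]
    have h2 := hk (a + 3 / m) ⟨by linarith, le_rfl⟩
    have h4 := hnoout (a + 3 / m) (EReal.coe_lt_top _) (by linarith [h2.2.2.1]) h2.2.1
    have h5 : m * (a + 3 / m - a) = 3 := by field_simp; ring
    linarith [(abs_le.1 hw).1]
  | coe t =>
    have hat : a < t := EReal.coe_lt_coe_iff.1 haT
    have hk : ∀ τ ∈ Ico a t, 3 / 5 < y.N τ := fun τ hτ =>
      (key τ (EReal.coe_lt_coe_iff.2 hτ.2) τ ⟨hτ.1, le_rfl⟩).2.2.1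
    obtain ⟨b, C, hab, hbt, hC, hh'⟩ := F.horizon hΛ (B := 11 / 10) hat fun τ hτ => by
      rw [abs_of_pos (by linarith [hk τ hτ])]
      exact (N_le_max hΛ (F.regIcc (EReal.coe_lt_coe_iff.2 hτ.2)) τ ⟨hτ.1, le_rfl⟩).trans
        (max_le (by norm_num) hN2)
    have h0 : Tendsto y.N (𝓝[<] t) (𝓝 0) := tendsto_zero_of_abs_le_mul_sub hbt fun τ hτ =>
      (hh' τ hτ).2.2.1
    have := ge_of_tendsto h0 (b := 3 / 5) (by
      filter_upwards [Ico_mem_nhdsLT hat] with τ hτ using (hk τ hτ).le)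
    norm_num at this

/-- The reflection `w ↦ -w`, a symmetry of the equations. -/
def Trajectory.neg (y : Trajectory) : Trajectory :=
  ⟨y.r, fun τ => -y.w τ, y.N, fun τ => -y.U τ, y.κ⟩

theorem Trajectory.neg_Q (y : Trajectory) (τ : ℝ) : y.neg.Q τ = y.Q τ := by
  simp [Trajectory.Q, Trajectory.neg]

theorem Reg.neg {Λ : ℝ} {y : Trajectory} {τ : ℝ} (H : Reg Λ y τ) : Reg Λ y.neg τ := by
  refine ⟨H.rpos, H.dr, ?_, ?_, ?_, ?_, ?_⟩
  · exact H.dw.fun_neg.congr_deriv (by simp [Trajectory.neg])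
  · exact H.dN.congr_deriv (by simp [Trajectory.neg])
  · exact H.dU.fun_neg.congr_deriv (by rw [Trajectory.neg_Q]; simp only [Trajectory.neg]; ring)
  · exact H.dκ.congr_deriv (by simp [Trajectory.neg])
  · rw [Trajectory.neg_Q]; simpa [Trajectory.neg] using H.con

theorem Flow.neg {Λ : ℝ} {y : Trajectory} {T : EReal} (F : Flow Λ y T) : Flow Λ y.neg T := by
  refine ⟨fun τ hτ => (F.reg τ hτ).neg, fun t a M hT hat h => F.blowup t a M hT hat fun τ hτ => ?_⟩
  have := h τ hτ
  simpa [Trajectory.neg] using this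

theorem generic_or_blackHole_neg {y : Trajectory} {T : EReal} :
    (Generic y.neg T ∨ BlackHole y.neg T) ↔ (Generic y T ∨ BlackHole y T) := by
  simp [Generic, BlackHole, TurnsAt, Trajectory.neg, abs_div]

theorem Flow.crash_of_energy_pos {Λ : ℝ} (hΛ : 0 ≤ Λ) {y : Trajectory} {T : EReal}
    (F : Flow Λ y T) {a : ℝ} (haT : (a : EReal) < T) (hN : 0 < y.N a) (hN2 : y.N a ≤ 11 / 10)
    (hU2 : |y.U a| ≤ 1 / 100)
    (hh : 0 < (y.r a * y.U a) ^ 2 - (1 - y.w a ^ 2) ^ 2 / 2)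
    (hw : |y.w a| ≤ 11 / 10) (hr : 1000 ≤ y.r a)
    (hX : |1 - y.N a ^ 2 - Λ * y.r a ^ 2 / 3| ≤ 1 / 50) :
    Generic y T ∨ BlackHole y T := by
  rcases lt_trichotomy (y.U a) 0 with h | h | h
  · refine generic_or_blackHole_neg.1 (F.neg.crash hΛ haT hN hN2 (neg_pos.2 h) ?_ ?_ ?_ hr hX)
    · rw [abs_of_neg h] at hU2; exact hU2
    · simpa [Trajectory.neg] using hh
    · simpa [Trajectory.neg] using hw
  · rw [h] at hh; nlinarith [sq_nonneg (1 - y.w a ^ 2)]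
  · exact F.crash hΛ haT hN hN2 h (by rwa [abs_of_pos h] at hU2) hh hw hr hX

/-! ### The almost vacuum regime and particlelike solutions. -/

/-- Almost flat data at a large radius. -/
structure NearFlat (Λ : ℝ) (y : Trajectory) (a : ℝ) : Prop where
  r : 1000 ≤ y.r a
  w : |1 - y.w a ^ 2| ≤ 1 / 1000
  N : |y.N a - 1| ≤ 1 / 1000
  U : |y.U a| ≤ 1 / 1000
  L : Λ * y.r a ^ 2 ≤ 1 / 1000

theorem NearFlat.X {Λ : ℝ} {y : Trajectory} {a : ℝ} (h : NearFlat Λ y a) (hΛ : 0 ≤ Λ) :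
    |1 - y.N a ^ 2 - Λ * y.r a ^ 2 / 3| ≤ 1 / 200 := by
  have h1 := abs_le.1 h.N
  have h2 := h.L
  have h3 := mul_nonneg hΛ (sq_nonneg (y.r a))
  rw [abs_le]; constructor <;> nlinarith

/-- The almost vacuum regime: negative energy, `w` near `±1`. -/
structure NearVacuum (Λ : ℝ) (y : Trajectory) (a b : ℝ) : Prop where
  r : 1000 ≤ y.r b
  X : |1 - y.N b ^ 2 - Λ * y.r b ^ 2 / 3| ≤ 1 / 200
  U : y.U b ^ 2 ≤ 1 / 1000000
  Q : y.Q b ^ 2 ≤ 1 / 1000000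
  N : 0 < y.N b
  N2 : y.N b ≤ 101 / 100
  g : 97 / 100 ≤ 2 * y.N b - y.κ b
  w : |1 - y.w b ^ 2| < 1 / 10
  rX : y.r a * (1 - y.N a ^ 2 - Λ * y.r a ^ 2 / 3) ≤ y.r b * (1 - y.N b ^ 2 - Λ * y.r b ^ 2 / 3)
  rX2 : y.r b * (1 - y.N b ^ 2 - Λ * y.r b ^ 2 / 3) + 3 * (y.r b)⁻¹ ≤
    y.r a * (1 - y.N a ^ 2 - Λ * y.r a ^ 2 / 3) + 3 * (y.r a)⁻¹

set_option maxHeartbeats 1000000 in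
-- Nonpositive energy bounds r U, so U and Q are small at large radii, barriers keep X small, and 2
-- N - κ is bounded below by a positive constant. Then the energy is nondecreasing, and confined
-- between -10⁻⁶ and 0 it leaves w no room to move away from ±1.
theorem nearVacuum {Λ : ℝ} (hΛ : 0 ≤ Λ) {y : Trajectory} {a b : ℝ} (hab : a ≤ b)
    (H : ∀ τ ∈ Icc a b, Reg Λ y τ) (h0 : NearFlat Λ y a) (hN : ∀ τ ∈ Icc a b, 0 ≤ y.N τ)
    (hw : ∀ τ ∈ Icc a b, |y.w τ| ≤ 11 / 10)
    (hh : ∀ τ ∈ Icc a b, (y.r τ * y.U τ) ^ 2 - (1 - y.w τ ^ 2) ^ 2 / 2 ≤ 0) :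
    NearVacuum Λ y a b := by
  have hb : b ∈ Icc a b := ⟨hab, le_rfl⟩
  have hr : ∀ τ ∈ Icc a b, 1000 ≤ y.r τ := fun τ hτ => h0.r.trans
    (le_of_hasDerivAt_nonneg hτ.1 (fun x hx => (H x ⟨hx.1, hx.2.trans hτ.2⟩).dr) fun x hx =>
      mul_nonneg (H x ⟨hx.1.le, hx.2.le.trans hτ.2⟩).rpos.le (hN x ⟨hx.1.le, hx.2.le.trans hτ.2⟩))
  have hV : ∀ τ ∈ Icc a b, (1 - y.w τ ^ 2) ^ 2 ≤ 1 := fun τ hτ => by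
    have := abs_le.1 (hw τ hτ)
    rw [sq_le_one_iff_abs_le_one, abs_le]; constructor <;> nlinarith
  have hD : ∀ τ ∈ Icc a b, (y.r τ * y.U τ) ^ 2 ≤ 1 / 2 := fun τ hτ => by
    linarith [hh τ hτ, hV τ hτ]
  have hU : ∀ τ ∈ Icc a b, y.U τ ^ 2 ≤ 1 / 1000000 := fun τ hτ => by
    have h1 := hD τ hτ
    have h2 := hr τ hτ
    rw [mul_pow] at h1
    nlinarith [sq_nonneg (y.U τ)]
  have hQ : ∀ τ ∈ Icc a b, y.Q τ ^ 2 ≤ 1 / 1000000 := fun τ hτ =>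
    Q_sq_le_of_abs_w_le (hr τ hτ) (hw τ hτ)
  have hX0 := abs_le.1 (h0.X hΛ)
  have hXu : ∀ τ ∈ Icc a b, 1 - y.N τ ^ 2 - Λ * y.r τ ^ 2 / 3 ≤ 1 / 200 :=
    le_of_barrier (fun x hx => (H x hx).dX) hX0.2 fun x hx hm => by
      have hx' : x ∈ Icc a b := ⟨hx.1, hx.2.le⟩
      exact mul_nonpos_of_nonneg_of_nonpos (hN x hx') (by linarith [hU x hx', hQ x hx'])
  have hXl : ∀ τ ∈ Icc a b, -(1 - y.N τ ^ 2 - Λ * y.r τ ^ 2 / 3) ≤ 1 / 200 :=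
    le_of_barrier (fun x hx => (H x hx).dX.fun_neg) (by linarith) fun x hx hm => by
      rw [neg_nonpos]
      exact mul_nonneg (hN x ⟨hx.1, hx.2.le⟩)
        (by linarith [sq_nonneg (y.U x), sq_nonneg (y.Q x)])
  have hg : ∀ τ ∈ Icc a b, 0 < y.N τ ∧ y.N τ ≤ 101 / 100 ∧ 97 / 100 ≤ 2 * y.N τ - y.κ τ :=
    fun τ hτ => by
      have h1 := (H τ hτ).two_N_mul
      have h2 := hXu τ hτ
      have h3 := hXl τ hτ
      have h4 := hU τ hτ
      have h5 := hN τ hτ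
      have h6 : 0 < y.N τ := by
        rcases h5.eq_or_lt with h | h
        · rw [← h] at h1 h2; nlinarith [sq_nonneg (y.Q τ)]
        · exact h
      have h7 : y.N τ ≤ 101 / 100 := by
        have := mul_nonneg hΛ (sq_nonneg (y.r τ))
        nlinarith
      refine ⟨h6, h7, ?_⟩
      by_contra hcon
      push Not at hcon
      have : 2 * y.N τ * (2 * y.N τ - y.κ τ) ≤ 2 * y.N τ * (97 / 100) :=
        mul_le_mul_of_nonneg_left hcon.le (by linarith)
      nlinarith [sq_nonneg (y.Q τ)]
  have hmono : ∀ c ∈ Icc a b, (y.r a * y.U a) ^ 2 - (1 - y.w a ^ 2) ^ 2 / 2 ≤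
      (y.r c * y.U c) ^ 2 - (1 - y.w c ^ 2) ^ 2 / 2 := fun c hc =>
    le_of_hasDerivAt_nonneg hc.1 (fun x hx => (H x ⟨hx.1, hx.2.trans hc.2⟩).dh) fun x hx =>
      mul_nonneg (by positivity) (by linarith [(hg x ⟨hx.1.le, hx.2.le.trans hc.2⟩).2.2])
  have hha : -(1 / 1000000) ≤ (y.r a * y.U a) ^ 2 - (1 - y.w a ^ 2) ^ 2 / 2 := by
    have h1 := sq_le_sq' (abs_le.1 h0.w).1 (abs_le.1 h0.w).2
    nlinarith [sq_nonneg (y.r a * y.U a)]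
  -- Suppose that |1 - w²| has reached 1/10 at time b, and let c be the last time at which it is at
  -- most 1/20. After c, |r U| ≥ 35/1000, so the energy grows at least 67/1000 times as fast as w
  -- moves. Its range of length 10⁻⁶ allows w to change by 1/50000 only.
  have hwb : |1 - y.w b ^ 2| < 1 / 10 := by
    by_contra hcon
    push Not at hcon
    have hcw : ContinuousOn (fun τ => |1 - y.w τ ^ 2|) (Icc a b) := fun x hx =>
      (show ContinuousAt (fun τ => |1 - y.w τ ^ 2|) x from
        (((H x hx).dw.continuousAt.pow 2).const_sub 1).abs).continuousWithinAt
    have hK : IsCompact {x ∈ Icc a b | |1 - y.w x ^ 2| ≤ 1 / 20} := by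
      have := hcw.preimage_isClosed_of_isClosed isClosed_Icc (isClosed_Iic (a := (1 / 20 : ℝ)))
      exact isCompact_Icc.of_isClosed_subset this inter_subset_left
    obtain ⟨c, ⟨hc, hcw'⟩, hc'⟩ := hK.exists_isGreatest
      ⟨a, ⟨le_rfl, hab⟩, h0.w.trans (by norm_num)⟩
    have hbig : ∀ x ∈ Ioo c b, 1 / 20 < |1 - y.w x ^ 2| := fun x hx => by
      by_contra h
      exact absurd (hc' ⟨⟨hc.1.trans hx.1.le, hx.2.le⟩, not_lt.1 h⟩) (not_le.2 hx.1)
    have hHc : ∀ x ∈ Icc c b, Reg Λ y x := fun x hx => H x ⟨hc.1.trans hx.1, hx.2⟩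
    have hrate : ∀ x ∈ Ioo c b, 67 / 1000 * |y.r x * y.U x| ≤
        2 * (y.r x * y.U x) ^ 2 * (2 * y.N x - y.κ x) := fun x hx => by
      have hx' : x ∈ Icc a b := ⟨hc.1.trans hx.1.le, hx.2.le⟩
      have h1 := hmono x hx'
      have h2 : (1 / 20) ^ 2 ≤ (1 - y.w x ^ 2) ^ 2 := by
        rw [← sq_abs (1 - y.w x ^ 2)]
        exact pow_le_pow_left₀ (by norm_num) (hbig x hx).le 2
      have h3 : (35 / 1000) ≤ |y.r x * y.U x| := by
        by_contra h
        nlinarith [sq_abs (y.r x * y.U x), abs_nonneg (y.r x * y.U x)]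
      have h4 := (hg x hx').2.2
      rw [← sq_abs (y.r x * y.U x)]
      have h5 : 97 / 100 * |y.r x * y.U x| ^ 2 ≤ (2 * y.N x - y.κ x) * |y.r x * y.U x| ^ 2 :=
        mul_le_mul_of_nonneg_right h4 (sq_nonneg _)
      nlinarith
    have h1 := le_of_hasDerivAt_nonneg (f := fun τ => ((y.r τ * y.U τ) ^ 2 -
        (1 - y.w τ ^ 2) ^ 2 / 2) - 67 / 1000 * y.w τ) hc.2
      (fun x hx => (hHc x hx).dh.fun_sub ((hHc x hx).dw.const_mul (67 / 1000))) fun x hx => by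
        linarith [hrate x hx, le_abs_self (y.r x * y.U x)]
    have h2 := le_of_hasDerivAt_nonneg (f := fun τ => ((y.r τ * y.U τ) ^ 2 -
        (1 - y.w τ ^ 2) ^ 2 / 2) + 67 / 1000 * y.w τ) hc.2
      (fun x hx => (hHc x hx).dh.fun_add ((hHc x hx).dw.const_mul (67 / 1000))) fun x hx => by
        linarith [hrate x hx, neg_abs_le (y.r x * y.U x)]
    have h3 := hmono c hc
    have h4 := hh b hb
    have h5 : |y.w b - y.w c| ≤ 1 / 50000 := by rw [abs_le]; constructor <;> linarith
    have h6 : |(1 - y.w b ^ 2) - (1 - y.w c ^ 2)| ≤ 1 / 50 := by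
      have : (1 - y.w b ^ 2) - (1 - y.w c ^ 2) = -(y.w b - y.w c) * (y.w b + y.w c) := by ring
      rw [this, abs_mul, abs_neg]
      have h7 : |y.w b + y.w c| ≤ 3 := (abs_add_le _ _).trans (by linarith [hw b hb, hw c hc])
      calc _ ≤ 1 / 50000 * 3 := mul_le_mul h5 h7 (abs_nonneg _) (by norm_num)
        _ ≤ _ := by norm_num
    have h7 := abs_sub_abs_le_abs_sub (1 - y.w b ^ 2) (1 - y.w c ^ 2)
    linarith
  have drX : ∀ x ∈ Icc a b, HasDerivAt
      (fun τ => y.r τ * (1 - y.N τ ^ 2 - Λ * y.r τ ^ 2 / 3))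
      (y.r x * y.N x * (y.Q x ^ 2 + 2 * y.U x ^ 2)) x := fun x hx =>
    ((H x hx).dr.fun_mul (H x hx).dX).congr_deriv (by ring)
  refine ⟨hr b hb, abs_le.2 ⟨by linarith [hXl b hb], hXu b hb⟩, hU b hb, hQ b hb, (hg b hb).1,
    (hg b hb).2.1, (hg b hb).2.2, hwb, ?_, ?_⟩
  · refine le_of_hasDerivAt_nonneg hab drX fun x hx => ?_
    have hx' : x ∈ Icc a b := ⟨hx.1.le, hx.2.le⟩
    have := hN x hx'
    have := (H x hx').rpos
    positivity
  -- As r² (Q² + 2 U²) ≤ 3, the growth of r X is at most 3 N / r, which the derivative of 3 / r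
  -- compensates.
  · refine ge_of_hasDerivAt_nonpos hab (fun x hx => (drX x hx).fun_add
      (((H x hx).dr.fun_inv (H x hx).rpos.ne').const_mul 3)) fun x hx => ?_
    have hx' : x ∈ Icc a b := ⟨hx.1.le, hx.2.le⟩
    have h1 := (H x hx').rpos
    have h2 : y.r x ^ 2 * (y.Q x ^ 2 + 2 * y.U x ^ 2) ≤ 3 := by
      have h3 := (H x hx').rQ
      have h4 := hV x hx'
      have h5 := hD x hx'
      rw [← h3] at h4
      nlinarith
    have h3 : y.r x * y.N x * (y.Q x ^ 2 + 2 * y.U x ^ 2) + 3 * (-(y.r x * y.N x) / y.r x ^ 2) =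
        y.N x / y.r x * (y.r x ^ 2 * (y.Q x ^ 2 + 2 * y.U x ^ 2) - 3) := by field_simp; ring
    rw [h3]
    exact mul_nonpos_of_nonneg_of_nonpos (div_nonneg (hN x hx') h1.le) (by linarith)

/-- Starting from almost flat data at a large radius, a solution that is neither generic nor a
black hole stays in the almost vacuum regime. -/
theorem Flow.stays_nearVacuum {Λ : ℝ} (hΛ : 0 ≤ Λ) {y : Trajectory} {T : EReal} (F : Flow Λ y T)
    {a : ℝ} (h0 : NearFlat Λ y a) (hno : ¬(Generic y T ∨ BlackHole y T)) :
    ∀ b : ℝ, a ≤ b → (b : EReal) < T → NearVacuum Λ y a b ∧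
      (y.r b * y.U b) ^ 2 - (1 - y.w b ^ 2) ^ 2 / 2 ≤ 0 := by
  have habs : ∀ {w : ℝ}, |1 - w ^ 2| < 1 / 10 → |w| < 53 / 50 := fun {w} hw => by
    have := abs_lt.1 hw
    exact abs_lt_of_sq_lt_sq (by linarith) (by norm_num)
  intro b hab hb
  have H := F.regIcc (a := a) hb
  -- The estimates of `nearVacuum` are stricter than the conditions they assume, which lets the
  -- induction continue. The energy cannot become positive by `Flow.crash_of_energy_pos`.
  have key : ∀ x ∈ Icc a b, (0 < y.N x ∧ |y.w x| < 53 / 50 ∧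
      (y.r x * y.U x) ^ 2 - (1 - y.w x ^ 2) ^ 2 / 2 ≤ 0) := by
    have hlt : ∀ x ∈ Icc a b, (x : EReal) < T := fun x hx =>
      (EReal.coe_le_coe_iff.2 hx.2).trans_lt hb
    refine continuous_induction ⟨?_, ?_, ?_⟩ (fun x hx hP => ?_) (fun x hx hP => ?_)
    · linarith [(abs_le.1 h0.N).1]
    · exact habs (h0.w.trans_lt (by norm_num))
    · by_contra hcon
      refine hno (F.crash_of_energy_pos hΛ (hlt a ⟨le_rfl, hab⟩) ?_ ?_ (h0.U.trans (by norm_num))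
        (not_le.1 hcon) ?_ h0.r ((h0.X hΛ).trans (by norm_num)))
      · linarith [(abs_le.1 h0.N).1]
      · linarith [(abs_le.1 h0.N).2]
      · exact (habs (h0.w.trans_lt (by norm_num))).le.trans (by norm_num)
    · have hx' : x ∈ Icc a b := ⟨hx.1.le, hx.2⟩
      have hall : ∀ z ∈ Icc a x, 0 ≤ y.N z ∧ |y.w z| ≤ 11 / 10 ∧
          (y.r z * y.U z) ^ 2 - (1 - y.w z ^ 2) ^ 2 / 2 ≤ 0 := fun z hz => by
        rcases hz.2.eq_or_lt with h | h
        · subst h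
          refine ⟨nonneg_of_forall_Ico (H z hx').dN.continuousAt hx.1 fun u hu => (hP u hu).1.le,
            ?_, ?_⟩
          · have := nonneg_of_forall_Ico (f := fun u => 11 / 10 - |y.w u|)
              (((H z hx').dw.continuousAt.abs).const_sub (11 / 10)) hx.1 fun u hu => by
                linarith [(hP u hu).2.1]
            linarith
          · have := nonneg_of_forall_Ico
              (f := fun u => -((y.r u * y.U u) ^ 2 - (1 - y.w u ^ 2) ^ 2 / 2))
              (H z hx').dh.continuousAt.neg hx.1 fun u hu => by
                linarith [(hP u hu).2.2]
            linarith
        · have := hP z ⟨hz.1, h⟩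
          exact ⟨this.1.le, by linarith, this.2.2⟩
      have := nearVacuum hΛ hx.1.le (fun z hz => H z ⟨hz.1, hz.2.trans hx.2⟩) h0
        (fun z hz => (hall z hz).1) (fun z hz => (hall z hz).2.1) fun z hz => (hall z hz).2.2
      exact ⟨this.N, habs this.w, (hall x ⟨hx.1.le, le_rfl⟩).2.2⟩
    · have hx' : x ∈ Icc a b := ⟨hx.1, hx.2.le⟩
      have hP' := fun z (hz : z ∈ Icc a x) => hP z hz
      have hv := nearVacuum hΛ hx.1 (fun z hz => H z ⟨hz.1, hz.2.trans hx.2.le⟩) h0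
        (fun z hz => (hP' z hz).1.le) (fun z hz => (hP' z hz).2.1.le.trans (by norm_num))
        fun z hz => (hP' z hz).2.2
      obtain ⟨h1, h2, h3⟩ := hP x ⟨hx.1, le_rfl⟩
      have hev : ∀ᶠ z in 𝓝[>] x, (0 < y.N z ∧ |y.w z| < 53 / 50) ∧ y.N z < 11 / 10 ∧
          |y.U z| < 1 / 100 ∧ |1 - y.N z ^ 2 - Λ * y.r z ^ 2 / 3| < 1 / 50 := by
        refine Filter.Eventually.filter_mono nhdsWithin_le_nhds ?_
        refine (((H x hx').dN.continuousAt.eventually (lt_mem_nhds h1)).and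
          ((H x hx').dw.continuousAt.abs.eventually (gt_mem_nhds h2))).and
          (((H x hx').dN.continuousAt.eventually (gt_mem_nhds ?_)).and
          (((H x hx').dU.continuousAt.abs.eventually (gt_mem_nhds ?_)).and
          ((H x hx').dX.continuousAt.abs.eventually (gt_mem_nhds ?_))))
        · linarith [hv.N2]
        · exact abs_lt_of_sq_lt_sq (by linarith [hv.U]) (by norm_num)
        · linarith [hv.X]
      obtain ⟨d, hd, hd'⟩ := (mem_nhdsGT_iff_exists_Ioo_subset' hx.2).1 hev
      filter_upwards [Ioo_mem_nhdsGT (lt_min hd hx.2)] with z hz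
      have hzd : ∀ u ∈ Ioc x z, _ := fun u hu =>
        hd' ⟨hu.1, hu.2.trans_lt (hz.2.trans_le (min_le_left _ _))⟩
      have hzb : z ≤ b := hz.2.le.trans (min_le_right _ _)
      obtain ⟨e1, e2, e3, e4⟩ := hzd z ⟨hz.1, le_rfl⟩
      refine ⟨e1.1, e1.2, ?_⟩
      by_contra hcon
      refine hno (F.crash_of_energy_pos hΛ (hlt z ⟨hx.1.trans hz.1.le, hzb⟩) e1.1 e2.le e3.le
        (not_le.1 hcon) (e1.2.le.trans (by norm_num)) (hv.r.trans ?_) e4.le)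
      refine r_mono hz.1.le (fun u hu => H u ⟨hx.1.trans hu.1, hu.2.trans hzb⟩) fun u hu => ?_
      rcases hu.1.eq_or_lt with h | h
      · rw [← h]; exact h1
      · exact (hzd u ⟨h, hu.2.le⟩).1.1
  exact ⟨nearVacuum hΛ hab H h0 (fun z hz => (key z hz).1.le)
    (fun z hz => (key z hz).2.1.le.trans (by norm_num)) fun z hz => (key z hz).2.2,
    (key b ⟨hab, le_rfl⟩).2.2⟩

/-- A solution that stays near the vacuum for ever with `Λ = 0` is particlelike. -/
theorem Flow.particlelike {y : Trajectory} (F : Flow 0 y ⊤) {a : ℝ}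
    (hpos : ∀ τ : ℝ, 0 < y.N τ)
    (h : ∀ b, a ≤ b → NearVacuum 0 y a b ∧
      (y.r b * y.U b) ^ 2 - (1 - y.w b ^ 2) ^ 2 / 2 ≤ 0) : Particlelike y ⊤ := by
  have H : ∀ τ, Reg 0 y τ := fun τ => F.reg τ (EReal.coe_lt_top τ)
  have hN : ∀ b, a ≤ b → 99 / 100 ≤ y.N b := fun b hb => by
    have h1 := (abs_le.1 (h b hb).1.X).2
    have := hpos b
    nlinarith
  have hr : Tendsto y.r atTop atTop := by
    refine tendsto_atTop_mono' atTop (f₁ := fun b => (b - a)) ?_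
      (tendsto_atTop_add_const_right _ _ tendsto_id)
    filter_upwards [eventually_ge_atTop a] with b hb
    have := add_mul_le_of_hasDerivAt (C := 1) hb (fun x _ => (H x).dr) fun x hx => by
      have h1 := hN x hx.1.le
      have h2 := (h x hx.1.le).1.r
      nlinarith
    linarith [(H a).rpos]
  have hinv : Tendsto (fun τ => (y.r τ)⁻¹) atTop (𝓝 0) := tendsto_inv_atTop_zero.comp hr
  have hV : ∀ b, a ≤ b → (1 - y.w b ^ 2) ^ 2 ≤ 1 / 100 := fun b hb => by
    have h1 := abs_lt.1 (h b hb).1.w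
    nlinarith
  refine ⟨fun τ _ => hpos τ, ?_, ?_, ?_, ?_⟩ <;> rw [upTo_top]
  · exact hr
  · -- `r X` stays bounded
    set c := y.r a * (1 - y.N a ^ 2) with hc
    have h1 : Tendsto (fun τ => 1 - (y.r τ)⁻¹ * (|c| + 3 * (y.r a)⁻¹)) atTop (𝓝 1) := by
      have := (hinv.mul_const (|c| + 3 * (y.r a)⁻¹)).const_sub 1
      simpa using this
    have h2 : Tendsto (fun τ => 1 + (y.r τ)⁻¹ * (|c| + 3 * (y.r a)⁻¹)) atTop (𝓝 1) := by
      have := (hinv.mul_const (|c| + 3 * (y.r a)⁻¹)).const_add 1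
      simpa using this
    have hb : ∀ b, a ≤ b → |1 - y.N b ^ 2| ≤ (y.r b)⁻¹ * (|c| + 3 * (y.r a)⁻¹) := fun b hb => by
      obtain ⟨hv, -⟩ := h b hb
      have h3 := hv.rX
      have h4 := hv.rX2
      rw [zero_mul, zero_div, sub_zero, zero_mul, zero_div, sub_zero, ← hc] at h3 h4
      have hrb := (H b).rpos
      have h5 := inv_pos.2 hrb
      have h6 := inv_pos.2 (H a).rpos
      have h8 : |y.r b * (1 - y.N b ^ 2)| ≤ |c| + 3 * (y.r a)⁻¹ := by
        rw [abs_le]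
        constructor
        · have := neg_abs_le c
          linarith
        · have := le_abs_self c
          linarith
      rw [abs_mul, abs_of_pos hrb] at h8
      rw [inv_mul_eq_div, le_div_iff₀ hrb]
      linarith
    refine tendsto_of_tendsto_of_tendsto_of_le_of_le' h1 h2 ?_ ?_ <;>
      filter_upwards [eventually_ge_atTop a] with b h7
    · linarith [(abs_le.1 (hb b h7)).2]
    · linarith [(abs_le.1 (hb b h7)).1]
  · -- the product `w e w'` of `e = w² - 1` and its derivative
    set z : ℝ → ℝ := fun τ => (y.w τ ^ 2 - 1) * (y.w τ * (y.r τ * y.U τ)) with hz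
    have hD : ∀ b, a ≤ b → (y.r b * y.U b) ^ 2 ≤ 1 / 200 := fun b hb => by
      linarith [(h b hb).2, hV b hb]
    have dz : ∀ τ, HasDerivAt z (2 * (y.w τ * (y.r τ * y.U τ)) ^ 2 +
        (y.w τ ^ 2 - 1) * ((y.r τ * y.U τ) ^ 2 + y.w τ ^ 2 * (y.w τ ^ 2 - 1)) +
        (2 * y.N τ - y.κ τ) * z τ) τ := fun τ => by
      refine ((((H τ).dw.fun_pow 2).sub_const 1).fun_mul
        ((H τ).dw.fun_mul ((H τ).dr.fun_mul (H τ).dU))).congr_deriv ?_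
      have := (H τ).rQ
      have h1 : y.r τ * (-(y.w τ * y.Q τ) - (y.κ τ - y.N τ) * y.U τ) =
        y.w τ * (y.w τ ^ 2 - 1) - (y.κ τ - y.N τ) * (y.r τ * y.U τ) := by
        linear_combination (-y.w τ) * this
      rw [h1]; simp only [hz]; push_cast; ring
    have hz' : ∀ τ, a ≤ τ → 9 / 10 * (y.w τ ^ 2 - 1) ^ 2 ≤ 2 * (y.w τ * (y.r τ * y.U τ)) ^ 2 +
        (y.w τ ^ 2 - 1) * ((y.r τ * y.U τ) ^ 2 + y.w τ ^ 2 * (y.w τ ^ 2 - 1)) := fun τ hτ => by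
      have h1 := abs_lt.1 (h τ hτ).1.w
      have h2 : 0 ≤ (y.r τ * y.U τ) ^ 2 * (2 * y.w τ ^ 2 + (y.w τ ^ 2 - 1)) :=
        mul_nonneg (sq_nonneg _) (by linarith)
      have h3 : 9 / 10 * (y.w τ ^ 2 - 1) ^ 2 ≤ y.w τ ^ 2 * (y.w τ ^ 2 - 1) ^ 2 :=
        mul_le_mul_of_nonneg_right (by linarith) (sq_nonneg _)
      nlinarith
    have hzle : ∀ τ, a ≤ τ → |z τ| ≤ 1 := fun τ hτ => by
      have h1 := abs_lt.1 (h τ hτ).1.w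
      have h2 := hD τ hτ
      have h3 := hV τ hτ
      rw [← sq_le_one_iff_abs_le_one]
      have : z τ ^ 2 = (1 - y.w τ ^ 2) ^ 2 * (y.w τ ^ 2 * (y.r τ * y.U τ) ^ 2) := by
        simp only [hz]; ring
      rw [this]
      have h4 : y.w τ ^ 2 * (y.r τ * y.U τ) ^ 2 ≤ 2 * (1 / 200) :=
        mul_le_mul (by linarith) h2 (sq_nonneg _) (by norm_num)
      calc _ ≤ 1 / 100 * (2 * (1 / 200)) :=
            mul_le_mul h3 h4 (by positivity) (by norm_num)
        _ ≤ 1 := by norm_num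
    -- With E = (w² - 1)², z is a quarter of the derivative of E, and z has derivative at least
    -- (9/10) E + (2 N - κ) z. A positive value of z would grow without bound, so z ≤ 0 and E is
    -- nonincreasing.
    have hznonpos : ∀ τ, a ≤ τ → z τ ≤ 0 := fun τ hτ => by
      by_contra hcon
      push Not at hcon
      have hp : ∀ b, ∀ x ∈ Icc τ b, 0 < z x := fun b =>
        pos_of_hasDerivAt_ge (C := 0) (fun x _ => dz x) hcon fun x hx hx' => by
          have h1 := hz' x (hτ.trans hx.1)
          have h2 := (h x (hτ.trans hx.1)).1.g
          have h3 := hx' x ⟨hx.1, le_rfl⟩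
          nlinarith [sq_nonneg (y.w x ^ 2 - 1)]
      have hder : ∀ x, τ ≤ x → 9 / 10 * z x ≤ 2 * (y.w x * (y.r x * y.U x)) ^ 2 +
          (y.w x ^ 2 - 1) * ((y.r x * y.U x) ^ 2 + y.w x ^ 2 * (y.w x ^ 2 - 1)) +
          (2 * y.N x - y.κ x) * z x := fun x hx => by
        have h1 := hz' x (hτ.trans hx)
        have h2 := (h x (hτ.trans hx)).1.g
        have h3 := hp x x ⟨hx, le_rfl⟩
        nlinarith [sq_nonneg (y.w x ^ 2 - 1)]
      have hge : ∀ x, τ ≤ x → z τ ≤ z x := fun x hx =>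
        le_of_hasDerivAt_nonneg hx (fun u _ => dz u) fun u hu => by
          have := hp u u ⟨hu.1.le, le_rfl⟩
          linarith [hder u hu.1.le]
      have h1 := add_mul_le_of_hasDerivAt (C := 9 / 10 * z τ) (show τ ≤ τ + 2 / z τ by
        have : 0 < 2 / z τ := by positivity
        linarith) (fun u _ => dz u) fun u hu => by linarith [hder u hu.1.le, hge u hu.1.le]
      have h2 := (abs_le.1 (hzle (τ + 2 / z τ) (hτ.trans (by
        have : 0 < 2 / z τ := by positivity
        linarith)))).2
      have h3 : 9 / 10 * z τ * (τ + 2 / z τ - τ) = 9 / 5 := by field_simp; ring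
      linarith
    have dE : ∀ τ, HasDerivAt (fun τ => (y.w τ ^ 2 - 1) ^ 2) (4 * z τ) τ := fun τ => by
      refine ((((H τ).dw.fun_pow 2).sub_const 1).fun_pow 2).congr_deriv ?_
      simp only [hz]; push_cast; ring
    have hEanti : ∀ b c, a ≤ b → b ≤ c → (y.w c ^ 2 - 1) ^ 2 ≤ (y.w b ^ 2 - 1) ^ 2 :=
      fun b c hab hbc => ge_of_hasDerivAt_nonpos hbc (fun u _ => dE u) fun u hu => by
        linarith [hznonpos u (hab.trans hu.1.le)]
    have hgle : ∀ τ, a ≤ τ → 2 * y.N τ - y.κ τ ≤ 6 / 5 := fun τ hτ => by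
      have h1 := (H τ).two_N_mul
      obtain ⟨hv, -⟩ := h τ hτ
      have h2 := hN τ hτ
      by_contra hcon
      push Not at hcon
      have h3 : 99 / 100 * (6 / 5) ≤ y.N τ * (2 * y.N τ - y.κ τ) :=
        mul_le_mul h2 hcon.le (by norm_num) (by linarith)
      nlinarith [hv.Q, sq_nonneg (y.U τ), (abs_le.1 hv.X).1]
    -- Because z ≤ 0 and 2 N - κ ≤ 6/5, the bounded function z - (3/10) E grows at least at the rate
    -- (9/10) E ≥ (9/10) E(b) on [a, b]. So E(b) is at most of order 1 / (b - a).
    have hEbd : ∀ b, a ≤ b → 9 / 10 * (y.w b ^ 2 - 1) ^ 2 * (b - a) ≤ 2 := fun b hab => by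
      have h1 := add_mul_le_of_hasDerivAt (C := 9 / 10 * (y.w b ^ 2 - 1) ^ 2) hab
        (fun u _ => (dz u).fun_sub ((dE u).const_mul (3 / 10))) fun u hu => by
          have h2 := hz' u hu.1.le
          have h3 := hEanti u b hu.1.le hu.2.le
          have h4 : 6 / 5 * z u ≤ (2 * y.N u - y.κ u) * z u :=
            mul_le_mul_of_nonpos_right (hgle u hu.1.le) (hznonpos u hu.1.le)
          linarith
      have h2 := (abs_le.1 (hzle a le_rfl)).1
      have h3 := hznonpos b hab
      have h4 := hV a le_rfl
      have h5 : (y.w a ^ 2 - 1) ^ 2 = (1 - y.w a ^ 2) ^ 2 := by ring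
      nlinarith [sq_nonneg (y.w b ^ 2 - 1)]
    have hE0 : Tendsto (fun τ => (y.w τ ^ 2 - 1) ^ 2) atTop (𝓝 0) := by
      have h1 : Tendsto (fun τ : ℝ => 3 * (τ - a)⁻¹) atTop (𝓝 0) := by
        have := (tendsto_inv_atTop_zero.comp
          (tendsto_atTop_add_const_right atTop (-a) tendsto_id)).const_mul 3
        simpa [sub_eq_add_neg] using this
      refine squeeze_zero' (Eventually.of_forall fun τ => sq_nonneg _) ?_ h1
      filter_upwards [eventually_gt_atTop a] with b hb
      have := hEbd b hb.le
      rw [← div_eq_mul_inv, le_div_iff₀ (by linarith)]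
      nlinarith
    have h1 := (Real.continuous_sqrt.tendsto 0).comp hE0
    simp only [Real.sqrt_zero, Function.comp_def, Real.sqrt_sq_eq_abs] at h1
    have h2 := (tendsto_zero_iff_abs_tendsto_zero _).2 h1
    simpa using h2.add_const 1
  · refine squeeze_zero_norm' ?_ hinv
    filter_upwards [eventually_ge_atTop a] with b hb
    have h1 := (h b hb).2
    have h2 := hV b hb
    have h3 := hN b hb
    have h4 : |y.r b * y.U b| ≤ 99 / 100 := abs_le_of_sq_le_sq (by linarith) (by norm_num)
    have h5 := (H b).rpos
    rw [Real.norm_eq_abs, abs_div, abs_of_pos (hpos b), div_le_iff₀ (hpos b), inv_mul_eq_div,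
      le_div_iff₀ h5]
    rw [abs_mul, abs_of_pos h5] at h4
    linarith

set_option maxHeartbeats 1000000 in
/-- Starting from almost flat data at a large radius, a solution is generic, or a black hole, or
noncompact with no further zeros. -/
theorem Flow.near_flat {Λ : ℝ} (hΛ : 0 ≤ Λ) {y : Trajectory} {T : EReal} (F : Flow Λ y T)
    {a : ℝ} (haT : (a : EReal) < T) (h0 : NearFlat Λ y a) :
    (Generic y T ∨ BlackHole y T) ∨
      (Noncompact Λ y T ∧ ∀ τ : ℝ, a ≤ τ → (τ : EReal) < T → y.w τ ≠ 0) := by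
  by_cases hno : Generic y T ∨ BlackHole y T
  · exact Or.inl hno
  right
  have hst := F.stays_nearVacuum hΛ h0 hno
  have hzero : ∀ τ : ℝ, a ≤ τ → (τ : EReal) < T → y.w τ ≠ 0 := fun τ h1 h2 h3 => by
    have := (hst τ h1 h2).1.w
    rw [h3] at this; norm_num at this
  refine ⟨?_, hzero⟩
  have hpos : ∀ τ : ℝ, (τ : EReal) < T → 0 < y.N τ := fun τ hτ => by
    rcases le_or_gt a τ with h | h
    · exact (hst τ h hτ).1.N
    · exact N_pos_of_pos (F.regIcc (a := τ) haT) (hst a le_rfl haT).1.N τ ⟨le_rfl, h.le⟩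
  induction T with
  | bot => exact absurd haT (not_lt.2 bot_le)
  | coe t =>
    have hat : a < t := EReal.coe_lt_coe_iff.1 haT
    have hlt : ∀ τ ∈ Ico a t, (τ : EReal) < (t : EReal) := fun τ hτ => EReal.coe_lt_coe_iff.2 hτ.2
    have hst' := fun τ (hτ : τ ∈ Ico a t) => (hst τ hτ.1 (hlt τ hτ)).1
    obtain ⟨b, C, hab, hbt, hC, hh'⟩ := F.horizon hΛ (B := 2) hat fun τ hτ => by
      rw [abs_of_pos (hst' τ hτ).N]; linarith [(hst' τ hτ).N2]
    have hN0 : Tendsto y.N (𝓝[<] t) (𝓝 0) := tendsto_zero_of_abs_le_mul_sub hbt fun τ hτ =>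
      (hh' τ hτ).2.2.1
    obtain ⟨c, hc, hc'⟩ := (mem_nhdsLT_iff_exists_Ioo_subset' hat).1
      (hN0.eventually (gt_mem_nhds (show (0 : ℝ) < 1 / 10 by norm_num)))
    have hc0 : max a ((c + t) / 2) < t := max_lt hat (by linarith [mem_Iio.1 hc])
    have hmem : ∀ τ ∈ Ico (max a ((c + t) / 2)) t, τ ∈ Ico a t ∧ y.N τ < 1 / 10 := fun τ hτ =>
      ⟨⟨(le_max_left _ _).trans hτ.1, hτ.2⟩, hc' ⟨by
        have := (le_max_right a _).trans hτ.1
        linarith [mem_Iio.1 hc], hτ.2⟩⟩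
    -- N is small near the end, so the bound on X forces Λ r² close to 3. This gives both Λ > 0 and
    -- Φ < 0.
    have hL : ∀ τ ∈ Ico (max a ((c + t) / 2)) t, 2 ≤ Λ * y.r τ ^ 2 := fun τ hτ => by
      obtain ⟨h1, h2⟩ := hmem τ hτ
      have h3 := (abs_le.1 (hst' τ h1).X).2
      have h4 := (hst' τ h1).N
      nlinarith
    left
    constructor
    · rcases hΛ.eq_or_lt with h | h
      · have := hL _ ⟨le_rfl, hc0⟩
        rw [← h, zero_mul] at this
        norm_num at this
      · exact h
    · refine F.regularHorizon hΛ hc0 hpos (B := 2) (δ := 1) (fun τ hτ => ?_) one_pos fun τ hτ => ?_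
      · linarith [(hmem τ hτ).2]
      · linarith [hL τ hτ, sq_nonneg (y.Q τ)]
  | top =>
    have H : ∀ τ, Reg Λ y τ := fun τ => F.reg τ (EReal.coe_lt_top τ)
    have hst' := fun τ (hτ : a ≤ τ) => (hst τ hτ (EReal.coe_lt_top τ))
    rcases hΛ.eq_or_lt with h | h
    · subst h
      exact Or.inr ⟨rfl, F.particlelike (fun τ => hpos τ (EReal.coe_lt_top τ)) hst'⟩
    -- For Λ > 0 infinite time is impossible. If κ < 0 once, κ falls linearly until the Riccati
    -- inequality ends the solution; if κ ≥ 0 for ever, N ≥ 7/10 and Λ r² outgrows the bound on X.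
    exfalso
    have hr : ∀ b c, a ≤ b → b ≤ c → y.r b ≤ y.r c := fun b c hb hc =>
      r_mono hc (fun u _ => H u) fun u _ => hpos u (EReal.coe_lt_top u)
    by_cases hk : ∃ τ, a ≤ τ ∧ y.κ τ < 0
    · obtain ⟨τ, hτ, hκ⟩ := hk
      have hL : 9 / 10 ≤ Λ * y.r τ ^ 2 := by
        have h1 := (H τ).con
        have h2 := mul_neg_of_neg_of_pos hκ (hpos τ (EReal.coe_lt_top τ))
        nlinarith [(hst' τ hτ).1.Q, sq_nonneg (y.U τ), sq_nonneg (y.N τ)]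
      have h1 := le_add_mul_of_hasDerivAt (C := -(1 / 2)) (show τ ≤ τ + 26 by linarith)
        (fun x _ => (H x).dκ') fun x hx => by
          have hx' := hτ.trans hx.1.le
          have h2 : y.r τ ^ 2 ≤ y.r x ^ 2 := pow_le_pow_left₀ (H τ).rpos.le (hr τ x hτ hx.1.le) 2
          have h3 := mul_le_mul_of_nonneg_left h2 hΛ
          nlinarith [(hst' x hx').1.Q, sq_nonneg (y.κ x - y.N x)]
      have h2 := (hst' (τ + 26) (by linarith)).1.N2
      have h3 := length_le_of_P_le hΛ (show τ + 26 ≤ τ + 27 by linarith) (fun x _ => H x)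
        (fun x hx => by
          have hv := (hst' x (by linarith [hx.1])).1
          rw [abs_of_pos hv.N]; linarith [hv.N2]) (by linarith)
      rw [le_div_iff₀ (by linarith)] at h3
      linarith
    · push Not at hk
      have hN : ∀ τ, a ≤ τ → 7 / 10 ≤ y.N τ := fun τ hτ => by
        have h1 := (H τ).con
        have hv := (hst' τ hτ).1
        have h2 := mul_nonneg (hk τ hτ) hv.N.le
        have h3 := (abs_le.1 hv.X).2
        nlinarith [hv.U, sq_nonneg (y.Q τ), hv.N]
      have h1 := add_mul_le_of_hasDerivAt (C := 1) (show a ≤ a + 2 / √Λ by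
        have : 0 < 2 / √Λ := by positivity
        linarith) (fun x _ => (H x).dr) fun x hx => by
          have h2 := hN x hx.1.le
          have h3 := (hst' x hx.1.le).1.r
          nlinarith
      have h2 : 2 / √Λ ≤ y.r (a + 2 / √Λ) := by linarith [(H a).rpos]
      have h3 : (2 / √Λ) ^ 2 ≤ y.r (a + 2 / √Λ) ^ 2 := pow_le_pow_left₀ (by positivity) h2 2
      have h4 := mul_le_mul_of_nonneg_left h3 hΛ
      rw [div_pow, Real.sq_sqrt hΛ, mul_div_cancel₀ _ h.ne'] at h4
      have hv := (hst' (a + 2 / √Λ) (by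
        have : 0 < 2 / √Λ := by positivity
        linarith)).1
      have := (abs_le.1 hv.X).1
      linarith [sq_nonneg (y.N (a + 2 / √Λ))]

/-! ### Limits at a regular horizon. -/

theorem pos_or_neg_of_ne_zero {f : ℝ → ℝ} {T : EReal} {a : ℝ}
    (hf : ∀ τ : ℝ, a ≤ τ → (τ : EReal) < T → ContinuousAt f τ)
    (h : ∀ τ : ℝ, a ≤ τ → (τ : EReal) < T → f τ ≠ 0) :
    (∀ τ : ℝ, a ≤ τ → (τ : EReal) < T → 0 < f τ) ∨
      (∀ τ : ℝ, a ≤ τ → (τ : EReal) < T → f τ < 0) := by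
  have key : ∀ g : ℝ → ℝ, (∀ τ : ℝ, a ≤ τ → (τ : EReal) < T → ContinuousAt g τ) →
      (∀ τ : ℝ, a ≤ τ → (τ : EReal) < T → g τ ≠ 0) → 0 < g a →
      ∀ τ : ℝ, a ≤ τ → (τ : EReal) < T → 0 < g τ := fun g hg hg0 hga τ h1 h2 => by
    by_contra hcon
    have hlt : ∀ x ≤ τ, (x : EReal) < T := fun x hx => (EReal.coe_le_coe_iff.2 hx).trans_lt h2
    obtain ⟨c, hc, hc0, -⟩ := exists_first_zero (fun x hx => hg x hx.1 (hlt x hx.2)) hga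
      (not_lt.1 hcon) h1
    exact hg0 c hc.1.le (hlt c hc.2) hc0
  by_cases haT : (a : EReal) < T
  · rcases lt_trichotomy (f a) 0 with h0 | h0 | h0
    · right
      intro τ h1 h2
      have := key (fun x => -f x) (fun τ h1 h2 => (hf τ h1 h2).neg)
        (fun τ h1 h2 => neg_ne_zero.2 (h τ h1 h2)) (neg_pos.2 h0) τ h1 h2
      linarith
    · exact absurd h0 (h a le_rfl haT)
    · exact Or.inl (key f hf h h0)
  · left
    intro τ h1 h2
    exact absurd ((EReal.coe_le_coe_iff.2 h1).trans_lt h2) haT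

set_option maxHeartbeats 1000000 in
/-- At a regular horizon that is reached in finite time, `w` has a nonzero limit if it has only
finitely many zeros, and `Φ < 0` in the limit. -/
theorem Flow.horizon_limit {Λ : ℝ} (hΛ : 0 ≤ Λ) {y : Trajectory} {t a : ℝ} (F : Flow Λ y t)
    (hR : RegularHorizon y t) (hat : a < t) (hw : ∀ τ ∈ Ico a t, 0 < y.w τ) :
    ∃ rc wc : ℝ, 0 < rc ∧ wc ≠ 0 ∧ 1 < ((1 - wc ^ 2) / rc) ^ 2 + Λ * rc ^ 2 ∧
      Tendsto y.r (𝓝[<] t) (𝓝 rc) ∧ Tendsto y.w (𝓝[<] t) (𝓝 wc) ∧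
      Tendsto y.N (𝓝[<] t) (𝓝 0) ∧ Tendsto y.κ (𝓝[<] t) atBot := by
  obtain ⟨hpos, ⟨rc, hrc, hr⟩, hN0, M, hM⟩ := hR
  rw [upTo_coe] at hr hN0 hM
  have hlt : ∀ τ < t, (τ : EReal) < (t : EReal) := fun τ hτ => EReal.coe_lt_coe_iff.2 hτ
  obtain ⟨a₁, ha₁, ha₁'⟩ := (mem_nhdsLT_iff_exists_Ioo_subset' hat).1
    ((hN0.eventually (gt_mem_nhds one_pos)).and hM)
  have ha₁t : a₁ < t := ha₁
  set a₂ := max a ((a₁ + t) / 2)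
  have ha₂ : a₂ < t := max_lt hat (by linarith)
  have ha₁₂ : a₁ < a₂ := lt_max_of_lt_right (by linarith)
  obtain ⟨b, C, hab, hbt, hC, hh⟩ := F.horizon hΛ (B := 1) ha₂ fun τ hτ => by
    rw [abs_of_pos (hpos τ (hlt τ hτ.2))]
    exact (ha₁' ⟨ha₁₂.trans_le hτ.1, hτ.2⟩).1.le
  have hMb : ∀ τ ∈ Ico b t, |y.U τ / y.N τ| ≤ M := fun τ hτ =>
    (ha₁' ⟨ha₁₂.trans_le (hab.trans hτ.1), hτ.2⟩).2
  have H := F.regIco (a := b)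
  have hU0 := tendsto_zero_of_abs_le_mul_sub hbt fun τ hτ => (hh τ hτ).2.1
  have hκ : Tendsto y.κ (𝓝[<] t) atBot := by
    have h1 : Tendsto (fun τ => -(C⁻¹ * (t - τ)⁻¹)) (𝓝[<] t) atBot := by
      refine tendsto_neg_atTop_atBot.comp ((tendsto_inv_nhdsGT_zero.comp ?_).const_mul_atTop
        (inv_pos.2 hC))
      refine tendsto_nhdsWithin_iff.2 ⟨?_, ?_⟩
      · have : Tendsto (fun τ => t - τ) (𝓝 t) (𝓝 (t - t)) := Continuous.tendsto (by fun_prop) t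
        rw [sub_self] at this
        exact this.mono_left nhdsWithin_le_nhds
      · filter_upwards [self_mem_nhdsWithin] with τ hτ using sub_pos.2 (mem_Iio.1 hτ)
    refine tendsto_atBot_mono' _ ?_ h1
    filter_upwards [Ico_mem_nhdsLT hbt] with τ hτ
    have h2 := (hh τ hτ).2.2.2.2.1
    have h3 : 0 < t - τ := sub_pos.2 hτ.2
    rw [le_neg, ← mul_inv, inv_eq_one_div, div_le_iff₀ (by positivity)]
    linarith
  obtain ⟨wc, hwc⟩ := exists_tendsto_of_hasDerivAt_bounded (C := C * (C * (t - b))) hbt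
    (fun τ hτ => (H τ hτ).dw) fun τ hτ => by
      obtain ⟨-, h2, -, -, -, h6, -⟩ := hh τ hτ
      rw [abs_mul, abs_of_pos (H τ hτ).rpos]
      refine mul_le_mul h6 (h2.trans ?_) (abs_nonneg _) hC.le
      gcongr; exact hτ.1
  have hwab : ∀ τ ∈ Ico b t, 0 < y.w τ := fun τ hτ =>
    hw τ ⟨(le_max_left _ _).trans (hab.trans hτ.1), hτ.2⟩
  refine ⟨rc, wc, hrc, ?_, ?_, hr, hwc, hN0, hκ⟩
  -- If w decreased to 0, then U < 0 at some late time. With κ < 0 < N and w Q ≥ 0 the derivative of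
  -- U is nonpositive, so U stays below a negative constant, contrary to U → 0.
  · rintro rfl
    obtain ⟨c, hc, hc'⟩ := (mem_nhdsLT_iff_exists_Ioo_subset' hbt).1
      (hwc.eventually (gt_mem_nhds one_pos))
    have hct : c < t := hc
    set d := max b ((c + t) / 2)
    have hd : d < t := max_lt hbt (by linarith)
    have hcd : c < d := lt_max_of_lt_right (by linarith)
    have hbd : b ≤ d := le_max_left _ _
    obtain ⟨e, he, hUe⟩ : ∃ e ∈ Ico d t, y.U e < 0 := by
      by_contra hcon
      push Not at hcon
      have h1 := ge_of_tendsto hwc (b := y.w d) (by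
        filter_upwards [Ico_mem_nhdsLT hd] with τ hτ
        exact le_of_hasDerivAt_nonneg hτ.1
          (fun x hx => (H x ⟨hbd.trans hx.1, hx.2.trans_lt hτ.2⟩).dw) fun x hx =>
            mul_nonneg (H x ⟨hbd.trans hx.1.le, hx.2.trans hτ.2⟩).rpos.le
              (hcon x ⟨hx.1.le, hx.2.trans hτ.2⟩))
      linarith [hwab d ⟨hbd, hd⟩]
    have hder : ∀ x ∈ Ico e t, y.U x < 0 → -(y.w x * y.Q x) - (y.κ x - y.N x) * y.U x ≤ 0 :=
      fun x hx hU => by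
        have hxb : x ∈ Ico b t := ⟨hbd.trans (he.1.trans hx.1), hx.2⟩
        have h1 := (hh x hxb).1
        have h2 := hpos x (hlt x hx.2)
        have h3 : y.w x < 1 := hc' ⟨hcd.trans_le (he.1.trans hx.1), hx.2⟩
        have h4 := hwab x hxb
        have h5 : 0 ≤ y.w x * y.Q x := mul_nonneg h4.le
          (div_nonneg (by nlinarith) (H x hxb).rpos.le)
        have h6 : 0 ≤ (y.κ x - y.N x) * y.U x := mul_nonneg_of_nonpos_of_nonpos (by linarith) hU.le
        linarith
    have hUneg : ∀ x ∈ Ico e t, y.U x < 0 := fun x hx => by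
      have := pos_of_hasDerivAt_ge (C := 0) (y := fun u => -y.U u) (a := e) (b := x)
        (fun u hu => (H u ⟨hbd.trans (he.1.trans hu.1), hu.2.trans_lt hx.2⟩).dU.fun_neg)
        (by linarith) (fun u hu hz => by
          have := hder u ⟨hu.1, hu.2.trans hx.2⟩ (by linarith [hz u ⟨hu.1, le_rfl⟩])
          linarith) x ⟨hx.1, le_rfl⟩
      linarith
    have := le_of_tendsto hU0 (b := y.U e) (by
      filter_upwards [Ico_mem_nhdsLT he.2] with τ hτ
      exact ge_of_hasDerivAt_nonpos hτ.1
        (fun u hu => (H u ⟨hbd.trans (he.1.trans hu.1), hu.2.trans_lt hτ.2⟩).dU) fun u hu =>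
          hder u ⟨hu.1.le, hu.2.trans hτ.2⟩ (hUneg u ⟨hu.1.le, hu.2.trans hτ.2⟩))
    linarith
  · -- `-κ N` stays away from zero
    obtain ⟨c, hc, hc'⟩ := (mem_nhdsLT_iff_exists_Ioo_subset' hbt).1
      (hκ.eventually (eventually_le_atBot (-1)))
    have hct : c < t := hc
    set d := max b ((c + t) / 2)
    have hd : d < t := max_lt hbt (by linarith)
    have hcd : c < d := lt_max_of_lt_right (by linarith)
    have hbd : b ≤ d := le_max_left _ _
    -- The bounds |Q| ≤ C and |U| ≤ M N limit the logarithmic rate of decay of -κ N to K. Its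
    -- positive lower bound turns the limit of the constraint into Φ < 0.
    set K := C ^ 2 + 2 * M ^ 2
    have hk : ∀ x ∈ Ico d t, Real.exp (K * d) * (-y.κ d * y.N d) ≤
        Real.exp (K * x) * (-y.κ x * y.N x) := fun x hx => by
      refine le_of_hasDerivAt_nonneg (f := fun τ => Real.exp (K * τ) * (-y.κ τ * y.N τ)) hx.1
        (fun u hu => (((hasDerivAt_id' u).const_mul K).exp).fun_mul
          ((H u ⟨hbd.trans hu.1, hu.2.trans_lt hx.2⟩).dκ'.fun_neg.fun_mul
            (H u ⟨hbd.trans hu.1, hu.2.trans_lt hx.2⟩).dN)) fun u hu => ?_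
      have hub : u ∈ Ico b t := ⟨hbd.trans hu.1.le, hu.2.trans hx.2⟩
      have hκu : y.κ u ≤ -1 := hc' ⟨hcd.trans hu.1, hub.2⟩
      have hNu := hpos u (hlt u hub.2)
      have hNu1 : y.N u < 1 := (ha₁' ⟨ha₁₂.trans_le (hab.trans hub.1), hub.2⟩).1
      have hUN : y.U u ^ 2 ≤ M ^ 2 * y.N u ^ 2 := by
        have h1 := hMb u hub
        rw [abs_div, abs_of_pos hNu, div_le_iff₀ hNu] at h1
        rw [← sq_abs, ← mul_pow]
        exact pow_le_pow_left₀ (abs_nonneg _) h1 2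
      have hQ : y.Q u ^ 2 ≤ C ^ 2 := by
        rw [← sq_abs]; exact pow_le_pow_left₀ (abs_nonneg _) (hh u hub).2.2.2.2.2.2.2.2.1 2
      have hL := mul_nonneg hΛ (sq_nonneg (y.r u))
      have h0 : 0 ≤ K * (-y.κ u * y.N u) + (-(-(y.κ u - y.N u) ^ 2 + y.Q u ^ 2 - Λ * y.r u ^ 2) *
          y.N u + -y.κ u * ((y.κ u - y.N u) * y.N u - 2 * y.U u ^ 2)) := by
        have e1 : y.N u * y.Q u ^ 2 ≤ -y.κ u * y.N u * C ^ 2 :=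
          mul_le_mul (by nlinarith) hQ (sq_nonneg _) (by nlinarith)
        have e2 : -y.κ u * y.U u ^ 2 ≤ -y.κ u * (M ^ 2 * y.N u) :=
          mul_le_mul_of_nonneg_left (hUN.trans (by nlinarith [sq_nonneg M])) (by linarith)
        have e3 : 0 ≤ y.N u * (Λ * y.r u ^ 2) := mul_nonneg hNu.le hL
        have e4 : 0 ≤ y.N u ^ 2 * (-y.κ u) := mul_nonneg (sq_nonneg _) (by linarith)
        have e5 : 0 ≤ y.N u ^ 2 * y.N u := mul_nonneg (sq_nonneg _) hNu.le
        simp only [K]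
        nlinarith
      have := mul_nonneg (Real.exp_pos (K * u)).le h0
      linarith
    have hκd : y.κ d ≤ -1 := hc' ⟨hcd, hd⟩
    have hNd := hpos d (hlt d hd)
    have hlim1 : Tendsto (fun τ => 1 + y.N τ ^ 2 + 2 * y.U τ ^ 2 - ((1 - y.w τ ^ 2) / y.r τ) ^ 2
        - Λ * y.r τ ^ 2) (𝓝[<] t) (𝓝 (1 + 0 ^ 2 + 2 * 0 ^ 2 - ((1 - wc ^ 2) / rc) ^ 2
        - Λ * rc ^ 2)) :=
      ((((hN0.pow 2).const_add 1).add ((hU0.pow 2).const_mul 2)).sub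
        ((((hwc.pow 2).const_sub 1).div hr hrc.ne').pow 2)).sub ((hr.pow 2).const_mul Λ)
    have hlim2 : Tendsto (fun τ => Real.exp (K * τ)) (𝓝[<] t) (𝓝 (Real.exp (K * t))) :=
      (Continuous.tendsto (by fun_prop) t).mono_left nhdsWithin_le_nhds
    have h1 := ge_of_tendsto (hlim2.mul hlim1.neg)
      (b := 2 * (Real.exp (K * d) * (-y.κ d * y.N d))) (by
        filter_upwards [Ico_mem_nhdsLT hd] with τ hτ
        have h2 := hk τ hτ
        have h3 := (H τ ⟨hbd.trans hτ.1, hτ.2⟩).con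
        rw [Trajectory.Q] at h3
        rw [← h3]
        linarith)
    have h2 : 0 < Real.exp (K * d) * (-y.κ d * y.N d) := by
      have := Real.exp_pos (K * d)
      have : 0 < -y.κ d := by linarith
      positivity
    have h3 := pos_of_mul_pos_right ((by linarith : (0 : ℝ) < _).trans_le h1) (Real.exp_pos _).le
    linarith

theorem not_eventually_deriv_le {f f' : ℝ → ℝ} {c B : ℝ} (hc : 0 < c)
    (hf : ∀ᶠ x in atTop, HasDerivAt f (f' x) x) (h : ∀ᶠ x in atTop, f' x ≤ -c)
    (hB : ∀ᶠ x in atTop, B ≤ f x) : False := by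
  obtain ⟨a, ha⟩ := eventually_atTop.1 (hf.and (h.and hB))
  have hab : a ≤ a + (|f a - B| + 1) / c := by
    have : 0 ≤ (|f a - B| + 1) / c := by positivity
    linarith
  have h1 := le_add_mul_of_hasDerivAt hab (fun x hx => (ha x hx.1).1)
    fun x hx => (ha x hx.1.le).2.1
  have h2 := (ha _ hab).2.2
  have h3 : -c * (a + (|f a - B| + 1) / c - a) = -(|f a - B| + 1) := by field_simp; ring
  linarith [le_abs_self (f a - B)]

set_option maxHeartbeats 1000000 in
/-- A regular horizon beyond which `w` has no zeros is reached in finite time. -/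
theorem Flow.not_regularHorizon_top {Λ : ℝ} (hΛ : 0 ≤ Λ) {y : Trajectory} {a : ℝ} (F : Flow Λ y ⊤)
    (hR : RegularHorizon y ⊤) (hw : ∀ τ, a ≤ τ → 0 < y.w τ) : False := by
  obtain ⟨hpos, ⟨rc, hrc, hr⟩, hN0, M, hM⟩ := hR
  rw [upTo_top] at hr hN0 hM
  have H : ∀ τ, Reg Λ y τ := fun τ => F.reg τ (EReal.coe_lt_top τ)
  replace hpos : ∀ τ, 0 < y.N τ := fun τ => hpos τ (EReal.coe_lt_top τ)
  have hU0 : Tendsto y.U atTop (𝓝 0) := by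
    have h1 : Tendsto (fun τ => M * y.N τ) atTop (𝓝 0) := by simpa using hN0.const_mul M
    refine squeeze_zero_norm' ?_ h1
    filter_upwards [hM] with τ hτ
    rwa [abs_div, abs_of_pos (hpos τ), div_le_iff₀ (hpos τ)] at hτ
  obtain ⟨b, hb⟩ := eventually_atTop.1 ((hN0.eventually (gt_mem_nhds one_pos)).and
    (((hU0.pow 2).eventually (gt_mem_nhds (show (0 : ℝ) ^ 2 < 1 / 20 by norm_num))).and
    (eventually_ge_atTop a)))
  -- With κ < -12 and N < 1 the Riccati inequality would end the solution within one unit of time.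
  have hκlow : ∀ τ, b ≤ τ → -12 ≤ y.κ τ := fun τ hτ => by
    by_contra hcon
    push Not at hcon
    have hN1 := (hb τ hτ).1
    have h1 := length_le_of_P_le hΛ (show τ ≤ τ + 1 by linarith) (fun x _ => H x)
      (fun x hx => by
        rw [abs_of_pos (hpos x)]; linarith [(hb x (hτ.trans hx.1)).1]) (by linarith)
    rw [le_div_iff₀ (by linarith)] at h1
    linarith
  have hdrop : ∀ c > 0, ¬ ∀ᶠ τ in atTop,
      1 + 2 * y.U τ ^ 2 - y.κ τ ^ 2 - 2 * Λ * y.r τ ^ 2 ≤ -c := fun c hc h =>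
    not_eventually_deriv_le hc (Eventually.of_forall fun x => (H x).dκ) h
      ((eventually_ge_atTop b).mono hκlow)
  -- For |κ| ≥ 3/2 the derivative of κ is at most 1 + 1/10 - 9/4 ≤ -1, so below -3/2 the function κ
  -- would fall for ever. That 3/2 is less than 2 matters for the oscillation argument below.
  have hκ1 : ∀ τ, b ≤ τ → -(3 / 2) ≤ y.κ τ := fun τ hτ => by
    by_contra hcon
    push Not at hcon
    have hle : ∀ c, ∀ x ∈ Icc τ c, y.κ x ≤ -(3 / 2) := fun c =>
      le_of_barrier (fun x _ => (H x).dκ) hcon.le fun x hx hx' => by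
        have h1 := (hb x (hτ.trans hx.1)).2.1
        have h2 := mul_nonneg hΛ (sq_nonneg (y.r x))
        by_contra h3
        push Not at h3
        -- the first time at which `κ` reaches `-3/2` from below
        obtain ⟨z, hz, hz0, hz'⟩ := exists_first_zero (f := fun u => -(3 / 2) - y.κ u)
          (fun u _ => (H u).dκ.continuousAt.const_sub (-(3 / 2))) (by linarith) (by linarith) hx.1
        have h4 := ge_of_hasDerivAt_nonpos hz.1.le (fun u _ => (H u).dκ) fun u hu => by
          have h5 := hz' u ⟨hu.1.le, hu.2⟩
          have h6 := (hb u (hτ.trans hu.1.le)).2.1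
          have h7 := mul_nonneg hΛ (sq_nonneg (y.r u))
          nlinarith
        linarith
    refine hdrop 1 one_pos ?_
    filter_upwards [eventually_ge_atTop τ] with x hx
    have h1 := hle x x ⟨hx, le_rfl⟩
    have h2 := (hb x (hτ.trans hx)).2.1
    have h3 := mul_nonneg hΛ (sq_nonneg (y.r x))
    nlinarith
  obtain ⟨d, hbd, hκ2⟩ : ∃ d, b ≤ d ∧ ∀ τ, d ≤ τ → y.κ τ ≤ 3 / 2 := by
    obtain ⟨d, hbd, hd⟩ : ∃ d, b ≤ d ∧ y.κ d ≤ 3 / 2 := by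
      by_contra hcon
      push Not at hcon
      refine hdrop 1 one_pos ?_
      filter_upwards [eventually_ge_atTop b] with x hx
      have h1 := hcon x hx
      have h2 := (hb x hx).2.1
      have h3 := mul_nonneg hΛ (sq_nonneg (y.r x))
      nlinarith
    refine ⟨d, hbd, fun τ hτ => le_of_barrier (a := d) (b := τ) (fun x _ => (H x).dκ) hd
      (fun x hx hm => ?_) τ ⟨hτ, le_rfl⟩⟩
    have h2 := (hb x (hbd.trans hx.1)).2.1
    have h3 := mul_nonneg hΛ (sq_nonneg (y.r x))
    nlinarith
  have hκabs : ∀ τ, d ≤ τ → |y.κ τ| ≤ 3 / 2 := fun τ hτ =>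
    abs_le.2 ⟨hκ1 τ (hbd.trans hτ), hκ2 τ hτ⟩
  have hκN : Tendsto (fun τ => y.κ τ * y.N τ) atTop (𝓝 0) := by
    have h1 : Tendsto (fun τ => 3 / 2 * y.N τ) atTop (𝓝 0) := by simpa using hN0.const_mul (3 / 2)
    refine squeeze_zero_norm' ?_ h1
    filter_upwards [eventually_ge_atTop d] with τ hτ
    rw [norm_mul, Real.norm_eq_abs, Real.norm_eq_abs, abs_of_pos (hpos τ)]
    exact mul_le_mul_of_nonneg_right (hκabs τ hτ) (hpos τ).le
  have hL : Λ * rc ^ 2 ≤ 1 / 2 := by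
    by_contra hcon
    push Not at hcon
    have h1 : Tendsto (fun τ => 1 + 2 * y.U τ ^ 2 - 2 * (Λ * y.r τ ^ 2)) atTop
        (𝓝 (1 + 2 * 0 ^ 2 - 2 * (Λ * rc ^ 2))) :=
      (((hU0.pow 2).const_mul 2).const_add 1).sub (((hr.pow 2).const_mul Λ).const_mul 2)
    refine hdrop ((2 * (Λ * rc ^ 2) - 1) / 2) (by linarith) ?_
    filter_upwards [h1.eventually (gt_mem_nhds (show 1 + 2 * 0 ^ 2 - 2 * (Λ * rc ^ 2) <
      -((2 * (Λ * rc ^ 2) - 1) / 2) by linarith))] with τ hτ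
    linarith [sq_nonneg (y.κ τ)]
  -- The constraint becomes Q² = 1 - Λ rc² > 0 in the limit. So the force -w Q does not fade unless
  -- w → 0, although r U → 0; each possibility is excluded.
  set q := √(1 - Λ * rc ^ 2) with hq
  have hq2 : q ^ 2 = 1 - Λ * rc ^ 2 := Real.sq_sqrt (by linarith)
  have hqpos : 0 < q := Real.sqrt_pos.2 (by linarith)
  have hQ2 : Tendsto (fun τ => y.Q τ ^ 2) atTop (𝓝 (q ^ 2)) := by
    have h1 := ((((hN0.pow 2).const_add 1).add ((hU0.pow 2).const_mul 2)).sub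
      ((hr.pow 2).const_mul Λ)).sub (hκN.const_mul 2)
    rw [show 1 + (0 : ℝ) ^ 2 + 2 * 0 ^ 2 - Λ * rc ^ 2 - 2 * 0 = q ^ 2 by rw [hq2]; ring] at h1
    refine h1.congr fun τ => ?_
    linarith [(H τ).con]
  have hv0 : Tendsto (fun τ => y.r τ * y.U τ) atTop (𝓝 0) := by simpa using hr.mul hU0
  have hg0 : Tendsto (fun τ => (2 * y.N τ - y.κ τ) * (y.r τ * y.U τ)) atTop (𝓝 0) := by
    have h1 : Tendsto (fun τ => 4 * |y.r τ * y.U τ|) atTop (𝓝 0) := by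
      simpa using hv0.abs.const_mul 4
    refine squeeze_zero_norm' ?_ h1
    filter_upwards [eventually_ge_atTop d] with τ hτ
    rw [norm_mul, Real.norm_eq_abs, Real.norm_eq_abs]
    refine mul_le_mul_of_nonneg_right ?_ (abs_nonneg _)
    have h2 := abs_le.1 (hκabs τ hτ)
    have h3 := (hb τ (hbd.trans hτ)).1
    have h4 := hpos τ
    rw [abs_le]; constructor <;> linarith
  have dv : ∀ τ, HasDerivAt (fun τ => y.r τ * y.U τ)
      ((2 * y.N τ - y.κ τ) * (y.r τ * y.U τ) - y.w τ * (y.r τ * y.Q τ)) τ := fun τ =>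
    ((H τ).dr.fun_mul (H τ).dU).congr_deriv (by ring)
  obtain ⟨e, he⟩ := eventually_atTop.1 ((hQ2.eventually (lt_mem_nhds
    (show q ^ 2 / 4 < q ^ 2 by nlinarith))).and ((eventually_ge_atTop a).and
      (hr.eventually (lt_mem_nhds (show rc / 2 < rc by linarith)))))
  have hQne : ∀ τ : ℝ, e ≤ τ → (τ : EReal) < ⊤ → y.Q τ ≠ 0 := fun τ hτ _ h0 => by
    have := (he τ hτ).1
    rw [h0] at this; nlinarith
  rcases pos_or_neg_of_ne_zero (fun τ _ _ => (H τ).dQ.continuousAt) hQne with hQ | hQ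
  · replace hQ : ∀ τ, e ≤ τ → 0 < y.Q τ := fun τ hτ => hQ τ hτ (EReal.coe_lt_top τ)
    have hQl : Tendsto y.Q atTop (𝓝 q) := by
      have h1 := (Real.continuous_sqrt.tendsto (q ^ 2)).comp hQ2
      rw [Real.sqrt_sq hqpos.le] at h1
      refine h1.congr' ?_
      filter_upwards [eventually_ge_atTop e] with τ hτ using Real.sqrt_sq (hQ τ hτ).le
    have hw2 : Tendsto (fun τ => y.w τ ^ 2) atTop (𝓝 (1 - rc * q)) := by
      refine ((hr.mul hQl).const_sub 1).congr fun τ => ?_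
      linarith [(H τ).rQ]
    have hwl : Tendsto y.w atTop (𝓝 √(1 - rc * q)) := by
      refine ((Real.continuous_sqrt.tendsto _).comp hw2).congr' ?_
      filter_upwards [eventually_ge_atTop a] with τ hτ using Real.sqrt_sq (hw τ hτ).le
    have hwc := Real.sqrt_nonneg (1 - rc * q)
    set wc := √(1 - rc * q)
    rcases hwc.eq_or_lt with h0 | h0
    -- Case w → 0, with the angle arctan (r U / w). As |2 N - κ| ≤ 8/5 < 2, the equation for w near
    -- zero is oscillatory: the angle falls at least at the rate 1/20, but w > 0 keeps it above
    -- -π/2.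
    · rw [← h0] at hwl
      obtain ⟨k, hk⟩ := eventually_atTop.1 ((hN0.eventually (gt_mem_nhds
        (show (0 : ℝ) < 1 / 20 by norm_num))).and ((hwl.eventually (gt_mem_nhds
        (show (0 : ℝ) < 1 / 10 by norm_num))).and ((eventually_ge_atTop d).and
        (eventually_ge_atTop a))))
      refine not_eventually_deriv_le (f := fun τ => Real.arctan (y.r τ * y.U τ / y.w τ))
        (c := 1 / 20) (B := -(Real.pi / 2)) (by norm_num) ?_ ?_
        (Eventually.of_forall fun τ => (Real.neg_pi_div_two_lt_arctan _).le)
        (f' := fun τ => 1 / (1 + (y.r τ * y.U τ / y.w τ) ^ 2) *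
          ((2 * y.N τ - y.κ τ) * (y.r τ * y.U τ / y.w τ) - (1 - y.w τ ^ 2) -
            (y.r τ * y.U τ / y.w τ) ^ 2))
      · filter_upwards [eventually_ge_atTop k] with τ hτ
        have hwτ := hw τ (hk τ hτ).2.2.2
        refine ((dv τ).fun_div (H τ).dw hwτ.ne').arctan.congr_deriv ?_
        congr 1
        rw [(H τ).rQ]
        field_simp
      · filter_upwards [eventually_ge_atTop k] with τ hτ
        obtain ⟨h1, h2, h3, h4⟩ := hk τ hτ
        have hwτ := hw τ h4
        have h5 := abs_le.1 (hκabs τ h3)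
        have h6 := hpos τ
        set ψ := y.r τ * y.U τ / y.w τ
        rw [one_div, inv_mul_eq_div, div_le_iff₀ (by positivity)]
        have h7 : (2 * y.N τ - y.κ τ) * ψ ≤ 8 / 5 * |ψ| := by
          refine (le_abs_self _).trans ?_
          rw [abs_mul]
          refine mul_le_mul_of_nonneg_right ?_ (abs_nonneg _)
          rw [abs_le]; constructor <;> linarith
        have h8 := sq_abs ψ
        nlinarith [sq_nonneg (|ψ| - 16 / 19)]
    · have h1 : Tendsto (fun τ => (2 * y.N τ - y.κ τ) * (y.r τ * y.U τ) - y.w τ * (y.r τ * y.Q τ))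
          atTop (𝓝 (0 - wc * (rc * q))) := hg0.sub (hwl.mul (hr.mul hQl))
      have h2 : 0 < wc * (rc * q) := by positivity
      refine not_eventually_deriv_le (c := wc * (rc * q) / 2) (B := -1) (by positivity)
        (Eventually.of_forall dv) ?_ (hv0.eventually (le_mem_nhds (by norm_num)))
      exact h1.eventually (ge_mem_nhds (by linarith))
  -- Negative Q means w > 1, and r U then grows at a rate bounded below, contrary to r U → 0.
  · replace hQ : ∀ τ, e ≤ τ → y.Q τ < 0 := fun τ hτ => hQ τ hτ (EReal.coe_lt_top τ)
    refine not_eventually_deriv_le (f := fun τ => -(y.r τ * y.U τ)) (c := rc * q / 8) (B := -1)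
      (by positivity) (Eventually.of_forall fun τ => (dv τ).fun_neg) ?_
      ((hv0.neg).eventually (le_mem_nhds (by norm_num)))
    filter_upwards [hg0.eventually (lt_mem_nhds (show -(rc * q / 8) < 0 by
      have : 0 < rc * q := by positivity
      linarith)), eventually_ge_atTop e] with τ h1 h2
    obtain ⟨h3, h4, h5⟩ := he τ h2
    have h6 := hQ τ h2
    have h7 : q / 2 ≤ -y.Q τ := by nlinarith
    have h8 : 1 ≤ y.w τ := by
      have := (H τ).rQ
      have := hw τ h4
      nlinarith [mul_neg_of_pos_of_neg (H τ).rpos h6]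
    have h9 : rc / 2 * (q / 2) ≤ y.r τ * -y.Q τ :=
      mul_le_mul h5.le h7 (by positivity) (H τ).rpos.le
    have h10 : 0 ≤ y.r τ * -y.Q τ := mul_nonneg (H τ).rpos.le (by linarith)
    have h11 := mul_le_mul_of_nonneg_right h8 h10
    linarith

/-! ### States whose fate is decided. -/

/-- The parameter `Λ` and the unknowns, together with `1 / r`, as a vector. -/
noncomputable def Trajectory.state (Λ : ℝ) (y : Trajectory) (τ : ℝ) : Fin 7 → ℝ :=
  ![Λ, y.r τ, (y.r τ)⁻¹, y.w τ, y.N τ, y.U τ, y.κ τ]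

/-- Whatever passes through a state near the one at time `a` is generic, a black hole, or
noncompact without later zeros. -/
def Decided (Λ : ℝ) (y : Trajectory) (a : ℝ) : Prop :=
  ∀ᶠ z in 𝓝 (y.state Λ a), ∀ (Λ' : ℝ) (y' : Trajectory) (T' : EReal), 0 ≤ Λ' → Flow Λ' y' T' →
    (a : EReal) < T' → y'.state Λ' a = z →
    (Generic y' T' ∨ BlackHole y' T') ∨
      (Noncompact Λ' y' T' ∧ ∀ τ : ℝ, a ≤ τ → (τ : EReal) < T' → y'.w τ ≠ 0)

theorem RegularHorizon.neg {y : Trajectory} {T : EReal} (h : RegularHorizon y T) :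
    RegularHorizon y.neg T := by
  obtain ⟨h1, h2, h3, M, h4⟩ := h
  refine ⟨h1, h2, h3, M, h4.mono fun τ hτ => ?_⟩
  simpa [Trajectory.neg, neg_div, abs_neg] using hτ

/-- Beyond its last zero w has a constant sign, which the reflection w ↦ -w makes positive. -/
theorem Flow.regularHorizon_limit {Λ : ℝ} (hΛ : 0 ≤ Λ) {y : Trajectory} {T : EReal}
    (F : Flow Λ y T) (hR : RegularHorizon y T) {a : ℝ} (haT : (a : EReal) < T)
    (hw : ∀ τ : ℝ, a ≤ τ → (τ : EReal) < T → y.w τ ≠ 0) :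
    ∃ (t : ℝ) (rc wc : ℝ), T = t ∧ 0 < rc ∧ wc ≠ 0 ∧ 1 < ((1 - wc ^ 2) / rc) ^ 2 + Λ * rc ^ 2 ∧
      Tendsto y.r (𝓝[<] t) (𝓝 rc) ∧ Tendsto y.w (𝓝[<] t) (𝓝 wc) ∧
      Tendsto y.N (𝓝[<] t) (𝓝 0) ∧ Tendsto y.κ (𝓝[<] t) atBot := by
  have hsgn := pos_or_neg_of_ne_zero (fun τ _ h2 => (F.reg τ h2).dw.continuousAt) hw
  induction T with
  | bot => exact absurd haT (not_lt.2 bot_le)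
  | top =>
    exfalso
    rcases hsgn with h | h
    · exact F.not_regularHorizon_top hΛ hR (a := a) fun τ hτ => h τ hτ (EReal.coe_lt_top τ)
    · exact F.neg.not_regularHorizon_top hΛ hR.neg (a := a) fun τ hτ =>
        neg_pos.2 (h τ hτ (EReal.coe_lt_top τ))
  | coe t =>
    have hat : a < t := EReal.coe_lt_coe_iff.1 haT
    rcases hsgn with h | h
    · obtain ⟨rc, wc, h1⟩ := F.horizon_limit hΛ hR hat fun τ hτ =>
        h τ hτ.1 (EReal.coe_lt_coe_iff.2 hτ.2)
      exact ⟨t, rc, wc, rfl, h1⟩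
    · obtain ⟨rc, wc, h1, h2, h3, h4, h5, h6⟩ := F.neg.horizon_limit hΛ hR.neg hat fun τ hτ =>
        neg_pos.2 (h τ hτ.1 (EReal.coe_lt_coe_iff.2 hτ.2))
      refine ⟨t, rc, -wc, rfl, h1, neg_ne_zero.2 h2, by rwa [neg_sq], h4, ?_, h6⟩
      simpa [Trajectory.neg] using h5.neg

theorem state_apply {Λ' : ℝ} {y' : Trajectory} {a : ℝ} {z : Fin 7 → ℝ}
    (h : y'.state Λ' a = z) : Λ' = z 0 ∧ y'.r a = z 1 ∧ y'.w a = z 3 ∧ y'.N a = z 4 ∧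
      y'.U a = z 5 ∧ y'.κ a = z 6 := by
  subst h
  exact ⟨rfl, rfl, rfl, rfl, rfl, rfl⟩

/-- Late on a particlelike solution the conditions of `NearFlat` hold with strict inequality, hence
for all nearby states. This includes Λ r² ≤ 1/1000: the time b is fixed before Λ varies, and at Λ =
0 the left side is zero. -/
theorem decided_of_particlelike {y : Trajectory} {T : EReal} (hP : Particlelike y T) {a : ℝ}
    (haT : (a : EReal) < T) : ∃ b, a ≤ b ∧ (b : EReal) < T ∧ Decided 0 y b := by
  obtain ⟨hpos, hr, hN, hw, hU⟩ := hP
  have hN1 : Tendsto y.N (upTo T) (𝓝 1) := by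
    have h1 := (Real.continuous_sqrt.tendsto 1).comp hN
    rw [Real.sqrt_one] at h1
    refine h1.congr' ?_
    filter_upwards [eventually_upTo haT] with τ hτ using Real.sqrt_sq (hpos τ hτ.2).le
  have hU0 : Tendsto y.U (upTo T) (𝓝 0) := by
    have h1 := hU.mul hN1
    rw [zero_mul] at h1
    refine h1.congr' ?_
    filter_upwards [eventually_upTo haT] with τ hτ using div_mul_cancel₀ _ (hpos τ hτ.2).ne'
  have hNe : (upTo T).NeBot := by
    rw [upTo, comap_neBot_iff]
    intro s hs
    obtain ⟨l, hl, hl'⟩ := (mem_nhdsLT_iff_exists_Ioo_subset' haT).1 hs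
    obtain ⟨x, hx1, hx2⟩ := EReal.lt_iff_exists_real_btwn.1 (mem_Iio.1 hl)
    exact ⟨x, hl' ⟨hx1, hx2⟩⟩
  have hw' : Tendsto (fun τ => |1 - y.w τ ^ 2|) (upTo T) (𝓝 0) := by
    simpa using (hw.const_sub 1).abs
  have hN' : Tendsto (fun τ => |y.N τ - 1|) (upTo T) (𝓝 0) := by simpa using (hN1.sub_const 1).abs
  have hU' : Tendsto (fun τ => |y.U τ|) (upTo T) (𝓝 0) := by simpa using hU0.abs
  have hε : (0 : ℝ) < 1 / 1000 := by norm_num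
  obtain ⟨b, hb, h1, h2, h3, h4⟩ := ((eventually_upTo haT).and ((hr.eventually_gt_atTop 1000).and
    ((hw'.eventually (gt_mem_nhds hε)).and ((hN'.eventually (gt_mem_nhds hε)).and
    (hU'.eventually (gt_mem_nhds hε)))))).exists
  refine ⟨b, hb.1.le, hb.2, ?_⟩
  have hev : ∀ᶠ z in 𝓝 (y.state 0 b), (1000 < z 1 ∧ |1 - z 3 ^ 2| < 1 / 1000) ∧
      (|z 4 - 1| < 1 / 1000 ∧ |z 5| < 1 / 1000) ∧ z 0 * z 1 ^ 2 < 1 / 1000 := by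
    refine ((?_ : ∀ᶠ z in 𝓝 (y.state 0 b), _).and ?_).and
      (((?_ : ∀ᶠ z in 𝓝 (y.state 0 b), _).and ?_).and ?_)
    · exact (isOpen_lt (by fun_prop) (by fun_prop)).mem_nhds h1
    · exact (isOpen_lt (by fun_prop) (by fun_prop)).mem_nhds h2
    · exact (isOpen_lt (by fun_prop) (by fun_prop)).mem_nhds h3
    · exact (isOpen_lt (by fun_prop) (by fun_prop)).mem_nhds h4
    · refine (isOpen_lt (by fun_prop) (by fun_prop)).mem_nhds ?_
      simp [Trajectory.state]
  filter_upwards [hev] with z hz Λ' y' T' hΛ' F hbT hs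
  obtain ⟨e0, e1, e3, e4, e5, -⟩ := state_apply hs
  refine F.near_flat hΛ' hbT ⟨?_, ?_, ?_, ?_, ?_⟩
  · rw [e1]; exact hz.1.1.le
  · rw [e3]; exact hz.1.2.le
  · rw [e4]; exact hz.2.1.1.le
  · rw [e5]; exact hz.2.1.2.le
  · rw [e0, e1]; exact hz.2.2.le

set_option maxHeartbeats 1000000 in
-- Λ > 0, Φ < 0 and w ≠ 0 hold at the limit point, hence within some distance ε of it. As κ + 2 N →
-- -∞ and N → 0, the displacement that `Flow.near_horizon` has to allow for drops below ε / 2 at a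
-- time b before the end.
theorem Flow.decided_of_regularHorizon {Λ : ℝ} (hΛ : 0 < Λ) {y : Trajectory} {T : EReal}
    (F : Flow Λ y T) (hR : RegularHorizon y T) {a : ℝ} (haT : (a : EReal) < T)
    (hw : ∀ τ : ℝ, a ≤ τ → (τ : EReal) < T → y.w τ ≠ 0) :
    ∃ b, a ≤ b ∧ (b : EReal) < T ∧ Decided Λ y b := by
  obtain ⟨t, rc, wc, rfl, hrc, hwc, hΦ, hr, hwl, hN, hκ⟩ :=
    F.regularHorizon_limit hΛ.le hR haT hw
  have hat : a < t := EReal.coe_lt_coe_iff.1 haT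
  obtain ⟨δ, hδ, hδ'⟩ : ∃ δ > 0, 1 + δ < ((1 - wc ^ 2) / rc) ^ 2 + Λ * rc ^ 2 :=
    ⟨(((1 - wc ^ 2) / rc) ^ 2 + Λ * rc ^ 2 - 1) / 2, by linarith, by linarith⟩
  obtain ⟨ε, hε, hε'⟩ : ∃ ε > 0, ∀ Λ' r w : ℝ, |Λ' - Λ| < ε → |r - rc| < ε → |w - wc| < ε →
      0 < Λ' ∧ 1 + δ ≤ ((1 - w ^ 2) / r) ^ 2 + Λ' * r ^ 2 ∧ w ≠ 0 := by
    have hc : ContinuousAt (fun z : ℝ × ℝ × ℝ => ((1 - z.2.2 ^ 2) / z.2.1) ^ 2 + z.1 * z.2.1 ^ 2)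
        (Λ, rc, wc) := by
      refine ContinuousAt.add (ContinuousAt.pow (ContinuousAt.div ?_ ?_ hrc.ne') 2) ?_ <;>
        exact Continuous.continuousAt (by fun_prop)
    have h1 := (hc.eventually (lt_mem_nhds hδ')).and
      (((continuous_fst.continuousAt (x := (Λ, rc, wc))).eventually (lt_mem_nhds hΛ)).and
      (((continuous_snd.comp continuous_snd).continuousAt (x := (Λ, rc, wc))).eventually
        (isOpen_ne.mem_nhds hwc)))
    obtain ⟨ε, hε, h2⟩ := Metric.eventually_nhds_iff.1 h1
    refine ⟨ε, hε, fun Λ' r w e1 e2 e3 => ?_⟩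
    have h3 := h2 (y := (Λ', r, w)) (by
      rw [Prod.dist_eq, Prod.dist_eq]
      exact max_lt e1 (max_lt e2 e3))
    exact ⟨h3.2.1, h3.1.le, h3.2.2⟩
  have hP : Tendsto (fun τ => y.κ τ + 2 * y.N τ) (𝓝[<] t) atBot :=
    hκ.atBot_add (hN.const_mul 2)
  have hsm : Tendsto (fun τ => 2 * y.r τ * (y.N τ + 2 * (4 / -(y.κ τ + 2 * y.N τ)))) (𝓝[<] t)
      (𝓝 0) := by
    have h1 : Tendsto (fun τ => 4 / -(y.κ τ + 2 * y.N τ)) (𝓝[<] t) (𝓝 0) :=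
      Tendsto.div_atTop tendsto_const_nhds (tendsto_neg_atBot_atTop.comp hP)
    have := (hr.const_mul 2).mul (hN.add (h1.const_mul 2))
    simpa using this
  have hr' : Tendsto (fun τ => |y.r τ - rc|) (𝓝[<] t) (𝓝 0) := by
    simpa using (hr.sub_const rc).abs
  have hw' : Tendsto (fun τ => |y.w τ - wc|) (𝓝[<] t) (𝓝 0) := by
    simpa using (hwl.sub_const wc).abs
  have hε2 : 0 < ε / 2 := by linarith
  have hIco : ∀ᶠ b in 𝓝[<] t, b ∈ Ico a t := Ico_mem_nhdsLT hat
  obtain ⟨b, hb, h1, h2, h3, h4, h5⟩ := (hIco.and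
    ((hN.eventually (gt_mem_nhds one_pos)).and ((hP.eventually (eventually_lt_atBot (-10))).and
    ((hr'.eventually (gt_mem_nhds hε2)).and ((hw'.eventually (gt_mem_nhds hε2)).and
    (hsm.eventually (gt_mem_nhds hε2))))))).exists
  have hbT : (b : EReal) < t := EReal.coe_lt_coe_iff.2 hb.2
  refine ⟨b, hb.1, hbT, ?_⟩
  have hev : ∀ᶠ z in 𝓝 (y.state Λ b), ((0 < z 4 ∧ z 4 < 1) ∧ z 6 + 2 * z 4 < -10) ∧
      ((|z 1 - rc| < ε / 2 ∧ |z 3 - wc| < ε / 2) ∧ |z 0 - Λ| < ε) ∧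
      2 * z 1 * (z 4 + 2 * (4 / -(z 6 + 2 * z 4))) < ε / 2 := by
    refine (((?_ : ∀ᶠ z in 𝓝 (y.state Λ b), _).and ?_).and ?_).and
      ((((?_ : ∀ᶠ z in 𝓝 (y.state Λ b), _).and ?_).and ?_).and ?_)
    · exact (isOpen_lt (by fun_prop) (by fun_prop)).mem_nhds (hR.1 b hbT)
    · exact (isOpen_lt (by fun_prop) (by fun_prop)).mem_nhds h1
    · exact (isOpen_lt (by fun_prop) (by fun_prop)).mem_nhds h2
    · exact (isOpen_lt (by fun_prop) (by fun_prop)).mem_nhds h3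
    · exact (isOpen_lt (by fun_prop) (by fun_prop)).mem_nhds h4
    · refine (isOpen_lt (by fun_prop) (by fun_prop)).mem_nhds ?_
      simpa [Trajectory.state] using hε
    · have hc : ContinuousAt (fun z : Fin 7 → ℝ => 2 * z 1 * (z 4 + 2 * (4 / -(z 6 + 2 * z 4))))
          (y.state Λ b) := by
        refine ContinuousAt.mul ?_ (ContinuousAt.add ?_
          (ContinuousAt.mul ?_ (ContinuousAt.div ?_ ?_ ?_)))
        iterate 5 exact Continuous.continuousAt (by fun_prop)
        have : y.κ b + 2 * y.N b ≠ 0 := by linarith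
        exact neg_ne_zero.2 this
      exact hc.eventually (gt_mem_nhds h5)
  filter_upwards [hev] with z hz Λ' y' T' hΛ' F' hbT' hs
  obtain ⟨e0, e1, e3, e4, -, e6⟩ := state_apply hs
  rw [← e0, ← e1, ← e3, ← e4, ← e6] at hz
  obtain ⟨⟨⟨g1, g2⟩, g3⟩, ⟨⟨g4, g5⟩, g6⟩, g7⟩ := hz
  refine (F'.near_horizon hΛ' hbT' hδ (fun r w _ h7 h8 => (hε' Λ' r w g6 h7 h8).2) g1 g2.le g3.le
    g4 g5 g7).imp id fun h => ⟨Or.inl ⟨?_, h.1⟩, h.2⟩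
  exact (hε' Λ' rc wc g6 (by simpa using hε) (by simpa using hε)).1

theorem Flow.exists_decided {Λ : ℝ} {y : Trajectory} {T : EReal} (F : Flow Λ y T)
    (hR : Noncompact Λ y T) {a : ℝ} (haT : (a : EReal) < T)
    (hw : ∀ τ : ℝ, a ≤ τ → (τ : EReal) < T → y.w τ ≠ 0) :
    ∃ b, a ≤ b ∧ (b : EReal) < T ∧ Decided Λ y b := by
  rcases hR with ⟨h1, h2⟩ | ⟨rfl, h2⟩
  · exact F.decided_of_regularHorizon h1 h2 haT hw
  · exact decided_of_particlelike h2 haT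

/-! ### Uniqueness, continuous dependence and maximal solutions. -/

/-- The polynomial vector field of the equations, in the variables of `Trajectory.state`. -/
def field (z : Fin 7 → ℝ) : Fin 7 → ℝ :=
  ![0, z 1 * z 4, -(z 2 * z 4), z 1 * z 5, (z 6 - z 4) * z 4 - 2 * z 5 ^ 2,
    -(z 3 * (1 - z 3 ^ 2)) * z 2 - (z 6 - z 4) * z 5, 1 + 2 * z 5 ^ 2 - z 6 ^ 2 - 2 * z 0 * z 1 ^ 2]

theorem contDiff_field : ContDiff ℝ 1 field := by
  refine contDiff_pi.2 fun i => ?_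
  fin_cases i <;> simp only [field] <;> simp <;> fun_prop

theorem exists_lipschitzOnWith_field (R : ℝ) :
    ∃ K, LipschitzOnWith K field (Metric.closedBall 0 R) :=
  contDiff_field.contDiffOn.exists_lipschitzOnWith one_ne_zero (convex_closedBall 0 R)
    (isCompact_closedBall 0 R)

theorem SolvesSystem.hasDerivAt_state {Λ : ℝ} {y : Trajectory} {T : EReal}
    (h : SolvesSystem Λ y T) {τ : ℝ} (hτ : (τ : EReal) < T) :
    HasDerivAt (y.state Λ) (field (y.state Λ τ)) τ := by
  obtain ⟨h0, h1, h2, h3, h4, h5⟩ := h τ hτ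
  refine hasDerivAt_pi.2 fun i => ?_
  fin_cases i
  · exact hasDerivAt_const τ Λ
  · exact h1
  · refine (h1.fun_inv h0.ne').congr_deriv ?_
    simp [field, Trajectory.state]; field_simp
  · exact h2
  · exact h3
  · exact h4.congr_deriv (by simp [field, Trajectory.state, div_eq_mul_inv])
  · exact h5

theorem Flow.solves {Λ : ℝ} {y : Trajectory} {T : EReal} (F : Flow Λ y T) : SolvesSystem Λ y T :=
  fun _ hτ => by
    have H := F.reg _ hτ
    refine ⟨H.rpos, H.dr, H.dw, H.dN, H.dU.congr_deriv ?_, H.dκ⟩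
    rw [Trajectory.Q]; ring

theorem SolvesSystem.exists_norm_le {Λ : ℝ} {y : Trajectory} {T : EReal}
    (h : SolvesSystem Λ y T) {a b : ℝ} (hb : (b : EReal) < T) :
    ∃ R, ∀ τ ∈ Icc a b, ‖y.state Λ τ‖ ≤ R :=
  isCompact_Icc.exists_bound_of_continuousOn fun _ hτ => (h.hasDerivAt_state
    ((EReal.coe_le_coe_iff.2 hτ.2).trans_lt hb)).continuousAt.continuousWithinAt

theorem SolvesSystem.state_eq {Λ : ℝ} {y₁ y₂ : Trajectory} {T₁ T₂ : EReal}
    (h₁ : SolvesSystem Λ y₁ T₁) (h₂ : SolvesSystem Λ y₂ T₂) {a τ : ℝ} (ha₁ : (a : EReal) < T₁)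
    (ha₂ : (a : EReal) < T₂) (heq : y₁.state Λ a = y₂.state Λ a) (hτ₁ : (τ : EReal) < T₁)
    (hτ₂ : (τ : EReal) < T₂) : y₁.state Λ τ = y₂.state Λ τ := by
  obtain ⟨d, hd1, hd2⟩ : ∃ d : ℝ, max a τ < d ∧ (d : EReal) < min T₁ T₂ := by
    have h : ((max a τ : ℝ) : EReal) < min T₁ T₂ := by
      rcases max_choice a τ with h | h <;> rw [h]
      · exact lt_min ha₁ ha₂
      · exact lt_min hτ₁ hτ₂
    obtain ⟨d, h1, h2⟩ := EReal.lt_iff_exists_real_btwn.1 h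
    exact ⟨d, EReal.coe_lt_coe_iff.1 h1, h2⟩
  have hd3 := hd2.trans_le (min_le_left _ _)
  have hd4 := hd2.trans_le (min_le_right _ _)
  obtain ⟨R₁, hR₁⟩ := h₁.exists_norm_le (a := min a τ - 1) hd3
  obtain ⟨R₂, hR₂⟩ := h₂.exists_norm_le (a := min a τ - 1) hd4
  obtain ⟨K, hK⟩ := exists_lipschitzOnWith_field (max R₁ R₂)
  have hle : ∀ {x}, x ≤ d → (x : EReal) ≤ (d : EReal) := fun h => EReal.coe_le_coe_iff.2 h
  refine ODE_solution_unique_of_mem_Icc (v := fun _ => field)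
    (s := fun _ => Metric.closedBall 0 (max R₁ R₂)) (K := K) (a := min a τ - 1) (b := d) (t₀ := a)
    (fun _ _ => hK) ⟨by linarith [min_le_left a τ], (le_max_left _ _).trans_lt hd1⟩
    (fun x hx => (h₁.hasDerivAt_state ((hle hx.2).trans_lt hd3)).continuousAt.continuousWithinAt)
    (fun x hx => h₁.hasDerivAt_state ((hle hx.2.le).trans_lt hd3))
    (fun x hx => mem_closedBall_zero_iff.2 ((hR₁ x ⟨hx.1.le, hx.2.le⟩).trans (le_max_left _ _)))
    (fun x hx => (h₂.hasDerivAt_state ((hle hx.2).trans_lt hd4)).continuousAt.continuousWithinAt)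
    (fun x hx => h₂.hasDerivAt_state ((hle hx.2.le).trans_lt hd4))
    (fun x hx => mem_closedBall_zero_iff.2 ((hR₂ x ⟨hx.1.le, hx.2.le⟩).trans (le_max_right _ _)))
    heq ⟨by linarith [min_le_right a τ], (le_max_right _ _).trans hd1.le⟩

theorem state_apply_norm_le {Λ : ℝ} {y : Trajectory} {τ M : ℝ} (h : ‖y.state Λ τ‖ ≤ M) :
    y.r τ ≤ M ∧ (y.r τ)⁻¹ ≤ M ∧ |y.w τ| ≤ M ∧ |y.N τ| ≤ M ∧ |y.U τ| ≤ M ∧ |y.κ τ| ≤ M := by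
  have hi : ∀ i, |y.state Λ τ i| ≤ M := fun i => (norm_le_pi_norm (y.state Λ τ) i).trans h
  exact ⟨(le_abs_self _).trans (hi 1), (le_abs_self _).trans (hi 2), hi 3, hi 4, hi 5, hi 6⟩

/-- Continuous dependence on the parameter and the initial values. -/
theorem Flow.continuous_dependence {Λ : ℝ} {y : Trajectory} {T : EReal} (F : Flow Λ y T) {a b : ℝ}
    (hb : (b : EReal) < T) {ε : ℝ} (hε : 0 < ε) :
    ∀ᶠ z in 𝓝 (y.state Λ a), ∀ (Λ' : ℝ) (y' : Trajectory) (T' : EReal), Flow Λ' y' T' →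
      (a : EReal) < T' → y'.state Λ' a = z →
      ∀ τ ∈ Icc a b, (τ : EReal) < T' ∧ ‖y'.state Λ' τ - y.state Λ τ‖ < ε := by
  obtain ⟨R, hR⟩ := F.solves.exists_norm_le (a := a) hb
  obtain ⟨K, hK⟩ := exists_lipschitzOnWith_field (R + ε)
  -- E is the Gronwall factor for [a, b]. While the distance is below ε both solutions lie in the
  -- ball of radius R + ε, where K is a Lipschitz constant; an initial distance below ε / (2 E) then
  -- keeps it below ε.
  set E := Real.exp (K * |b - a|)
  have hE : 0 < E := Real.exp_pos _
  have hE1 : 1 ≤ E := Real.one_le_exp (by positivity)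
  filter_upwards [Metric.ball_mem_nhds _ (show 0 < ε / (2 * E) by positivity)]
    with z hz Λ' y' T' F' ha' hs
  subst hs
  rw [Metric.mem_ball, dist_eq_norm] at hz
  have hlt : ∀ {x}, x ≤ b → (x : EReal) < T := fun h => (EReal.coe_le_coe_iff.2 h).trans_lt hb
  have hgron : ∀ x ∈ Icc a b, (x : EReal) < T' →
      (∀ u ∈ Ico a x, ‖y'.state Λ' u - y.state Λ u‖ < ε) → ‖y'.state Λ' x - y.state Λ x‖ < ε := by
    intro x hx hxT h
    have hlt' : ∀ {u}, u ≤ x → (u : EReal) < T' := fun h =>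
      (EReal.coe_le_coe_iff.2 h).trans_lt hxT
    have h1 := dist_le_of_trajectories_ODE_of_mem (v := fun _ => field)
      (s := fun _ => Metric.closedBall 0 (R + ε)) (K := K) (a := a) (b := x) (δ := ε / (2 * E))
      (fun _ _ => hK)
      (fun u hu => (F'.solves.hasDerivAt_state (hlt' hu.2)).continuousAt.continuousWithinAt)
      (fun u hu => (F'.solves.hasDerivAt_state (hlt' hu.2.le)).hasDerivWithinAt)
      (fun u hu => mem_closedBall_zero_iff.2 (by
        have h2 := h u hu
        have h3 := hR u ⟨hu.1, hu.2.le.trans hx.2⟩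
        calc ‖y'.state Λ' u‖ = ‖y.state Λ u + (y'.state Λ' u - y.state Λ u)‖ := by congr 1; abel
          _ ≤ _ := norm_add_le_of_le h3 h2.le))
      (fun u hu => (F.solves.hasDerivAt_state
        (hlt (hu.2.trans hx.2))).continuousAt.continuousWithinAt)
      (fun u hu => (F.solves.hasDerivAt_state (hlt (hu.2.le.trans hx.2))).hasDerivWithinAt)
      (fun u hu => mem_closedBall_zero_iff.2
        ((hR u ⟨hu.1, hu.2.le.trans hx.2⟩).trans (by linarith)))
      (by rw [dist_eq_norm]; exact hz.le) x ⟨hx.1, le_rfl⟩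
    rw [dist_eq_norm] at h1
    refine h1.trans_lt ?_
    have h2 : Real.exp (K * (x - a)) ≤ E := Real.exp_le_exp.2 (mul_le_mul_of_nonneg_left
      (by linarith [le_abs_self (b - a), hx.2]) K.2)
    calc ε / (2 * E) * Real.exp (K * (x - a)) ≤ ε / (2 * E) * E := by gcongr
      _ = ε / 2 := by field_simp
      _ < ε := by linarith
  refine continuous_induction ⟨ha', hz.trans_le ?_⟩ (fun x hx hP => ?_) (fun x hx hP => ?_)
  · rw [div_le_iff₀ (by positivity)]; nlinarith
  -- The nearby solution cannot end at x, because before x it is bounded by R + ε.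
  · have hxT : (x : EReal) < T' := by
      by_contra hcon
      have hT' : T' = x := by
        refine le_antisymm (not_lt.1 hcon) (le_of_forall_lt fun c hc => ?_)
        obtain ⟨c', h1, h2⟩ := EReal.lt_iff_exists_real_btwn.1 hc
        have h3 := EReal.coe_lt_coe_iff.1 h2
        exact h1.trans (lt_of_le_of_lt (EReal.coe_le_coe_iff.2 (le_max_left c' a))
          (hP _ ⟨le_max_right c' a, max_lt h3 hx.1⟩).1)
      refine F'.blowup x a (R + ε) hT' hx.1 fun τ hτ => state_apply_norm_le (Λ := Λ') ?_
      have h2 := (hP τ hτ).2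
      have h3 := hR τ ⟨hτ.1, hτ.2.le.trans hx.2⟩
      calc ‖y'.state Λ' τ‖ = ‖y.state Λ τ + (y'.state Λ' τ - y.state Λ τ)‖ := by congr 1; abel
        _ ≤ _ := norm_add_le_of_le h3 h2.le
    exact ⟨hxT, hgron x ⟨hx.1.le, hx.2⟩ hxT fun u hu => (hP u hu).2⟩
  · obtain ⟨h1, h2⟩ := hP x ⟨hx.1, le_rfl⟩
    have e1 : ∀ᶠ u : ℝ in 𝓝 x, (u : EReal) < T' :=
      continuous_coe_real_ereal.continuousAt.eventually (gt_mem_nhds h1)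
    have e2 : ∀ᶠ u in 𝓝 x, ‖y'.state Λ' u - y.state Λ u‖ < ε :=
      ((F'.solves.hasDerivAt_state h1).continuousAt.sub
        (F.solves.hasDerivAt_state (hlt hx.2.le)).continuousAt).norm.eventually (gt_mem_nhds h2)
    exact (e1.and e2).filter_mono nhdsWithin_le_nhds

/-- A bounded solution can be continued. -/
theorem SolvesSystem.exists_extension {Λ : ℝ} {y : Trajectory} {t a M : ℝ}
    (h : SolvesSystem Λ y t) (hat : a < t) (hM : ∀ τ ∈ Ico a t, y.r τ ≤ M ∧ (y.r τ)⁻¹ ≤ M ∧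
      |y.w τ| ≤ M ∧ |y.N τ| ≤ M ∧ |y.U τ| ≤ M ∧ |y.κ τ| ≤ M) :
    ∃ (y' : Trajectory) (ε : ℝ), 0 < ε ∧ SolvesSystem Λ y' ((t + ε : ℝ) : EReal) ∧
      ∀ τ < t, y'.r τ = y.r τ ∧ y'.w τ = y.w τ ∧ y'.N τ = y.N τ ∧ y'.U τ = y.U τ ∧
        y'.κ τ = y.κ τ := by
  have hlt : ∀ τ ∈ Ico a t, (τ : EReal) < (t : EReal) := fun τ hτ => EReal.coe_lt_coe_iff.2 hτ.2
  set R := max |Λ| (max M 0) with hRdef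
  have hR : ∀ τ ∈ Ico a t, y.state Λ τ ∈ Metric.closedBall 0 R := fun τ hτ => by
    obtain ⟨h1, h2, h3, h4, h5, h6⟩ := hM τ hτ
    have h0 := (h τ (hlt τ hτ)).1
    have hMR : M ≤ R := (le_max_left _ _).trans (le_max_right _ _)
    rw [mem_closedBall_zero_iff, pi_norm_le_iff_of_nonneg ((abs_nonneg Λ).trans (le_max_left _ _))]
    intro i
    rw [Real.norm_eq_abs]
    fin_cases i
    · exact le_max_left _ _
    · exact (abs_of_pos h0).le.trans (h1.trans hMR)
    · exact (abs_of_pos (inv_pos.2 h0)).le.trans (h2.trans hMR)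
    · exact h3.trans hMR
    · exact h4.trans hMR
    · exact h5.trans hMR
    · exact h6.trans hMR
  obtain ⟨B, hB⟩ := (isCompact_closedBall (0 : Fin 7 → ℝ) R).exists_bound_of_continuousOn
    contDiff_field.continuous.continuousOn
  have hder : ∀ i, ∀ τ ∈ Ico a t, HasDerivAt (fun τ => y.state Λ τ i) (field (y.state Λ τ) i) τ :=
    fun i τ hτ => hasDerivAt_pi.1 (h.hasDerivAt_state (hlt τ hτ)) i
  -- Bounded derivatives give a limit state l at time t, from which a local solution α starts; it
  -- continues y.
  have hlim : ∀ i, ∃ l, Tendsto (fun τ => y.state Λ τ i) (𝓝[<] t) (𝓝 l) := fun i =>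
    exists_tendsto_of_hasDerivAt_bounded hat (hder i) fun τ hτ =>
      (norm_le_pi_norm (field (y.state Λ τ)) i).trans (hB _ (hR τ hτ))
  choose l hl using hlim
  have hl' : Tendsto (y.state Λ) (𝓝[<] t) (𝓝 l) := tendsto_pi_nhds.2 hl
  have hne : (𝓝[<] t).NeBot := inferInstance
  have hIco : Ico a t ∈ 𝓝[<] t := Ico_mem_nhdsLT hat
  have hl0 : l 0 = Λ := tendsto_nhds_unique (hl 0) tendsto_const_nhds
  have hl12 : l 1 * l 2 = 1 := by
    refine tendsto_nhds_unique ((hl 1).mul (hl 2)) (tendsto_const_nhds.congr' ?_)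
    filter_upwards [hIco] with τ hτ
    exact (mul_inv_cancel₀ (h τ (hlt τ hτ)).1.ne').symm
  have hl1 : 0 < l 1 := by
    have h1 : 0 ≤ l 1 := ge_of_tendsto (hl 1) (by
      filter_upwards [hIco] with τ hτ using (h τ (hlt τ hτ)).1.le)
    rcases h1.eq_or_lt with h2 | h2
    · rw [← h2] at hl12; simp at hl12
    · exact h2
  obtain ⟨α, hα0, ε, hε, hα⟩ := (contDiff_field.contDiffAt (x := l)).exists_forall_mem_closedBall_exists_eq_forall_mem_Ioo_hasDerivAt₀ t
  have hαd : ∀ i, ∀ τ ∈ Ioo (t - ε) (t + ε), HasDerivAt (fun τ => α τ i) (field (α τ) i) τ :=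
    fun i τ hτ => hasDerivAt_pi.1 (hα τ hτ) i
  have hαc : ContinuousAt α t := (hα t ⟨by linarith, by linarith⟩).continuousAt
  obtain ⟨d, hd, hd'⟩ := Metric.eventually_nhds_iff.1
    (((continuous_apply 1).continuousAt.comp hαc).eventually
      (lt_mem_nhds (show 0 < (fun f : Fin 7 → ℝ => f 1) (α t) by simpa [hα0] using hl1)))
  set η := min ε d with hη
  have hηε : η ≤ ε := min_le_left _ _
  have hηpos : 0 < η := lt_min hε hd
  have hsub : ∀ {τ}, t ≤ τ → τ < t + η → τ ∈ Ioo (t - ε) (t + ε) := fun h1 h2 =>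
    ⟨by linarith, by linarith⟩
  have hα1 : ∀ τ, t ≤ τ → τ < t + η → 0 < α τ 1 := fun τ h1 h2 => hd' (by
    rw [Real.dist_eq, abs_of_nonneg (by linarith)]
    linarith [min_le_right ε d])
  -- The components z₀ and z₁ z₂ are conserved along α. So α keeps the value of Λ, and z₂ remains
  -- the inverse of the radius.
  have hconst : ∀ (f f' : ℝ → ℝ), (∀ u ∈ Ioo (t - ε) (t + ε), HasDerivAt f (f' u) u) →
      (∀ u ∈ Ioo (t - ε) (t + ε), f' u = 0) → ∀ τ, t ≤ τ → τ < t + η → f τ = f t :=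
    fun f f' hf hf' τ h1 h2 => by
      have hs : ∀ {u}, u ∈ Icc t τ → u ∈ Ioo (t - ε) (t + ε) := fun hu =>
        hsub hu.1 (hu.2.trans_lt h2)
      refine le_antisymm (ge_of_hasDerivAt_nonpos h1 (fun u hu => hf u (hs hu))
        fun u hu => (hf' u (hs ⟨hu.1.le, hu.2.le⟩)).le) (le_of_hasDerivAt_nonneg h1
        (fun u hu => hf u (hs hu)) fun u hu => (hf' u (hs ⟨hu.1.le, hu.2.le⟩)).ge)
  have hαΛ : ∀ τ, t ≤ τ → τ < t + η → α τ 0 = Λ := fun τ h1 h2 => by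
    rw [hconst _ _ (hαd 0) (fun u _ => rfl) τ h1 h2, hα0, hl0]
  have hα12 : ∀ τ, t ≤ τ → τ < t + η → α τ 1 * α τ 2 = 1 := fun τ h1 h2 => by
    rw [hconst _ _ (fun u hu => (hαd 1 u hu).fun_mul (hαd 2 u hu)) (fun u _ => by
      simp [field]; ring) τ h1 h2, hα0, hl12]
  -- glue the two pieces
  set f : ℝ → Fin 7 → ℝ := fun τ => if τ < t then y.state Λ τ else α τ with hf
  have hflt : ∀ τ < t, f τ = y.state Λ τ := fun τ hτ => if_pos hτ
  have hfge : ∀ τ, t ≤ τ → f τ = α τ := fun τ hτ => if_neg (not_lt.2 hτ)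
  have hfd : ∀ τ < t + η, HasDerivAt f (field (f τ)) τ := by
    intro τ hτ
    rcases lt_trichotomy τ t with h1 | h1 | h1
    · rw [hflt τ h1]
      refine (h.hasDerivAt_state (EReal.coe_lt_coe_iff.2 h1)).congr_of_eventuallyEq ?_
      filter_upwards [Iio_mem_nhds h1] with u hu using hflt u hu
    · subst h1
      have hr : HasDerivWithinAt f (field (f τ)) (Ici τ) τ := by
        rw [hfge τ le_rfl]
        exact (hα τ ⟨by linarith, by linarith⟩).hasDerivWithinAt.congr_of_mem
          (fun u hu => hfge u hu) (mem_Ici.2 le_rfl)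
      have hft : f τ = l := by rw [hfge τ le_rfl, hα0]
      have hlf : Tendsto f (𝓝[<] τ) (𝓝 l) := hl'.congr' (by
        filter_upwards [self_mem_nhdsWithin] with u hu using (hflt u hu).symm)
      have hfd' : ∀ u ∈ Ico a τ, HasDerivAt f (field (y.state Λ u)) u := fun u hu => by
        refine (h.hasDerivAt_state (hlt u hu)).congr_of_eventuallyEq ?_
        filter_upwards [Iio_mem_nhds hu.2] with v hv using hflt v hv
      -- At the junction the left derivative is the limit of the derivatives, which is the field at
      -- l and so equals the right derivative.
      have hleft : HasDerivWithinAt f (field (f τ)) (Iic τ) τ := by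
        refine hasDerivWithinAt_Iic_of_tendsto_deriv (s := Ico a τ)
          (fun u hu => (hfd' u hu).differentiableAt.differentiableWithinAt) ?_ hIco ?_
        · rw [ContinuousWithinAt, hft]
          exact hlf.mono_left (nhdsWithin_mono _ fun u hu => hu.2)
        · rw [hft]
          refine ((contDiff_field.continuous.tendsto l).comp hl').congr' ?_
          filter_upwards [hIco] with u hu using (hfd' u hu).deriv.symm
      have := hleft.union hr
      rwa [Iic_union_Ici, hasDerivWithinAt_univ] at this
    · rw [hfge τ h1.le]
      refine (hα τ (hsub h1.le hτ)).congr_of_eventuallyEq ?_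
      filter_upwards [Ioi_mem_nhds h1] with u hu using hfge u (le_of_lt hu)
  refine ⟨⟨fun τ => f τ 1, fun τ => f τ 3, fun τ => f τ 4, fun τ => f τ 5, fun τ => f τ 6⟩, η,
    hηpos, fun τ hτ => ?_, fun τ hτ => ?_⟩
  · have hτ' := EReal.coe_lt_coe_iff.1 hτ
    have hd := hasDerivAt_pi.1 (hfd τ hτ')
    have hprop : 0 < f τ 1 ∧ f τ 2 = (f τ 1)⁻¹ ∧ f τ 0 = Λ := by
      rcases lt_or_ge τ t with h1 | h1
      · rw [hflt τ h1]; exact ⟨(h τ (EReal.coe_lt_coe_iff.2 h1)).1, rfl, rfl⟩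
      · rw [hfge τ h1]
        exact ⟨hα1 τ h1 hτ', eq_inv_of_mul_eq_one_right (hα12 τ h1 hτ'), hαΛ τ h1 hτ'⟩
    obtain ⟨p1, p2, p3⟩ := hprop
    refine ⟨p1, hd 1, hd 3, hd 4, (hd 5).congr_deriv ?_, (hd 6).congr_deriv ?_⟩
    · simp [field, p2, div_eq_mul_inv]
    · simp [field, p3]
  · simp only [hflt τ hτ]
    exact ⟨rfl, rfl, rfl, rfl, rfl⟩

/-- Two trajectories agree on `(-∞, T)`. -/
def AgreeBefore (y y' : Trajectory) (T : EReal) : Prop :=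
  ∀ τ : ℝ, (τ : EReal) < T → y'.r τ = y.r τ ∧ y'.w τ = y.w τ ∧ y'.N τ = y.N τ ∧
    y'.U τ = y.U τ ∧ y'.κ τ = y.κ τ

theorem eventually_atBot_coe_lt {T : EReal} (hT : ⊥ < T) : ∀ᶠ τ : ℝ in atBot, (τ : EReal) < T := by
  obtain ⟨x, -, hx⟩ := EReal.lt_iff_exists_real_btwn.1 hT
  filter_upwards [eventually_le_atBot x] with τ hτ
  exact (EReal.coe_le_coe_iff.2 hτ).trans_lt hx

theorem SmoothAtOrigin.congr {Λ lam : ℝ} {y y' : Trajectory} {T : EReal} (hT : ⊥ < T)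
    (h : SmoothAtOrigin Λ lam y) (hy : AgreeBefore y y' T) : SmoothAtOrigin Λ lam y' := by
  obtain ⟨A, w, h1, h2, h3, h4, h5, h6, h7, h8, h9⟩ := h
  refine ⟨A, w, h1, h2, h3, h4, h5, h6, h7, h8.congr' ?_, ?_⟩
  · filter_upwards [eventually_atBot_coe_lt hT] with τ hτ using (hy τ hτ).1.symm
  · filter_upwards [eventually_atBot_coe_lt hT, h9] with τ hτ h
    obtain ⟨e1, e2, e3, e4, e5⟩ := hy τ hτ
    rw [e1, e2, e3, e4, e5]
    exact h

theorem AgreeBefore.state_eq {y y' : Trajectory} {T : EReal} (h : AgreeBefore y y' T) (Λ : ℝ)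
    {τ : ℝ} (hτ : (τ : EReal) < T) : y'.state Λ τ = y.state Λ τ := by
  obtain ⟨e1, e2, e3, e4, e5⟩ := h τ hτ
  simp only [Trajectory.state, e1, e2, e3, e4, e5]

theorem components_eq {Λ : ℝ} {y y' : Trajectory} {τ : ℝ} (h : y'.state Λ τ = y.state Λ τ) :
    y'.r τ = y.r τ ∧ y'.w τ = y.w τ ∧ y'.N τ = y.N τ ∧ y'.U τ = y.U τ ∧ y'.κ τ = y.κ τ :=
  ⟨congr_fun h 1, congr_fun h 3, congr_fun h 4, congr_fun h 5, congr_fun h 6⟩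

/-- Every solution extends to a maximal one. -/
theorem IsSolution.exists_maximal {Λ lam : ℝ} {y : Trajectory} {T : EReal}
    (h : IsSolution Λ lam y T) :
    ∃ y' T', T ≤ T' ∧ AgreeBefore y y' T ∧ IsMaximalSolution Λ lam y' T' := by
  obtain ⟨a, -, haT⟩ := EReal.lt_iff_exists_real_btwn.1 h.nonempty
  -- The maximal solution is the union of all extensions. Uniqueness makes the extensions `Y τ`
  -- agree wherever two of them are defined.
  set S : Set EReal := {T' | T ≤ T' ∧ ∃ y', SolvesSystem Λ y' T' ∧ AgreeBefore y y' T} with hS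
  have hTS : T ∈ S := ⟨le_rfl, y, h.solves, fun _ _ => ⟨rfl, rfl, rfl, rfl, rfl⟩⟩
  have hlt : ∀ τ : ℝ, (τ : EReal) < sSup S → ∃ T', T ≤ T' ∧ (τ : EReal) < T' ∧
      ∃ y', SolvesSystem Λ y' T' ∧ AgreeBefore y y' T := fun τ hτ => by
    obtain ⟨T', ⟨h1, h2⟩, h3⟩ := lt_sSup_iff.1 hτ
    exact ⟨T', h1, h3, h2⟩
  have : Nonempty Trajectory := ⟨y⟩
  choose! E hE1 hE2 Y hY1 hY2 using hlt
  set y' : Trajectory := ⟨fun τ => (Y τ).r τ, fun τ => (Y τ).w τ, fun τ => (Y τ).N τ,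
    fun τ => (Y τ).U τ, fun τ => (Y τ).κ τ⟩ with hy'
  have hYeq : ∀ σ τ : ℝ, (σ : EReal) < sSup S → (τ : EReal) < sSup S → (σ : EReal) < E τ →
      (Y σ).r σ = (Y τ).r σ ∧ (Y σ).w σ = (Y τ).w σ ∧ (Y σ).N σ = (Y τ).N σ ∧
      (Y σ).U σ = (Y τ).U σ ∧ (Y σ).κ σ = (Y τ).κ σ := fun σ τ hσ hτ hστ =>
    components_eq ((hY1 σ hσ).state_eq (hY1 τ hτ) (haT.trans_le (hE1 σ hσ))
      (haT.trans_le (hE1 τ hτ)) (((hY2 σ hσ).state_eq Λ haT).trans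
        ((hY2 τ hτ).state_eq Λ haT).symm) (hE2 σ hσ) hστ)
  have hTle : T ≤ sSup S := le_sSup hTS
  have hagree : AgreeBefore y y' T := fun τ hτ => hY2 τ (hτ.trans_le hTle) τ hτ
  have hsol : SolvesSystem Λ y' (sSup S) := fun τ hτ => by
    have hev : ∀ᶠ σ : ℝ in 𝓝 τ, (Y σ).r σ = (Y τ).r σ ∧ (Y σ).w σ = (Y τ).w σ ∧
        (Y σ).N σ = (Y τ).N σ ∧ (Y σ).U σ = (Y τ).U σ ∧ (Y σ).κ σ = (Y τ).κ σ := by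
      filter_upwards [continuous_coe_real_ereal.continuousAt.eventually (gt_mem_nhds hτ),
        continuous_coe_real_ereal.continuousAt.eventually (gt_mem_nhds (hE2 τ hτ))] with σ h1 h2
      exact hYeq σ τ h1 hτ h2
    obtain ⟨h0, h1, h2, h3, h4, h5⟩ := hY1 τ hτ τ (hE2 τ hτ)
    exact ⟨h0, h1.congr_of_eventuallyEq (hev.mono fun _ h => h.1),
      h2.congr_of_eventuallyEq (hev.mono fun _ h => h.2.1),
      h3.congr_of_eventuallyEq (hev.mono fun _ h => h.2.2.1),
      h4.congr_of_eventuallyEq (hev.mono fun _ h => h.2.2.2.1),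
      h5.congr_of_eventuallyEq (hev.mono fun _ h => h.2.2.2.2)⟩
  refine ⟨y', sSup S, hTle, hagree, ⟨h.nonempty.trans_le hTle, hsol,
    h.origin.congr h.nonempty hagree⟩, fun y'' T'' h1 h2 => ?_⟩
  rcases le_or_gt T T'' with h3 | h3
  · refine le_sSup ⟨h3, y'', h1.solves, fun τ hτ => ?_⟩
    obtain ⟨a1, a2, a3, a4, a5⟩ := h2 τ (hτ.trans_le hTle)
    obtain ⟨b1, b2, b3, b4, b5⟩ := hagree τ hτ
    exact ⟨a1.trans b1, a2.trans b2, a3.trans b3, a4.trans b4, a5.trans b5⟩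
  · exact h3.le.trans hTle

theorem SmoothAtOrigin.eventually_constraint {Λ lam : ℝ} {y : Trajectory}
    (h : SmoothAtOrigin Λ lam y) : ∀ᶠ τ in atBot,
      2 * y.κ τ * y.N τ = 1 + y.N τ ^ 2 + 2 * y.U τ ^ 2 - y.Q τ ^ 2 - Λ * y.r τ ^ 2 := by
  obtain ⟨A, w, h1, h2, h3, h4, h5, h6, h7, h8, h9⟩ := h
  have hA : ∀ᶠ τ in atBot, 0 < A (y.r τ) :=
    (h8.mono_right nhdsWithin_le_nhds).eventually
      (h1.continuousAt.eventually (lt_mem_nhds (by rw [h3]; exact one_pos)))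
  filter_upwards [h9, hA] with τ ⟨e1, e2, e3, e4⟩ hpos
  have hN : y.N τ ^ 2 = A (y.r τ) := by rw [e1, Real.sq_sqrt hpos.le]
  have hN0 : 0 < y.N τ := by rw [e1]; exact Real.sqrt_pos.2 hpos
  have hκ : 2 * y.κ τ * y.N τ = Phi Λ (y.r τ) (A (y.r τ)) (w (y.r τ))
      + 2 * A (y.r τ) * deriv w (y.r τ) ^ 2 + 2 * y.N τ ^ 2 := by
    rw [e4]; field_simp
  rw [hκ, e3, Trajectory.Q, e2, Phi, ← hN]
  ring

/-- The defect c of the constraint has derivative -2 N c, and it vanishes near the centre, where κ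
is defined through Φ. -/
theorem SolvesSystem.constraint {Λ lam : ℝ} {y : Trajectory} {T : EReal} (h : SolvesSystem Λ y T)
    (ho : SmoothAtOrigin Λ lam y) {τ : ℝ} (hτ : (τ : EReal) < T) :
    2 * y.κ τ * y.N τ = 1 + y.N τ ^ 2 + 2 * y.U τ ^ 2 - y.Q τ ^ 2 - Λ * y.r τ ^ 2 := by
  obtain ⟨a, ha, haτ⟩ := (ho.eventually_constraint.and (eventually_le_atBot τ)).exists
  have hlt : ∀ x ∈ Icc a τ, (x : EReal) < T := fun x hx =>
    (EReal.coe_le_coe_iff.2 hx.2).trans_lt hτ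
  set c : ℝ → ℝ := fun x =>
    2 * y.κ x * y.N x - (1 + y.N x ^ 2 + 2 * y.U x ^ 2 - y.Q x ^ 2 - Λ * y.r x ^ 2) with hc
  have hd : ∀ x ∈ Icc a τ, HasDerivAt c (-2 * y.N x * c x) x := fun x hx => by
    obtain ⟨h0, h1, h2, h3, h4, h5⟩ := h x (hlt x hx)
    have hQ : HasDerivAt y.Q (-2 * y.w x * y.U x - y.N x * y.Q x) x := by
      refine (((h2.fun_pow 2).const_sub 1).fun_div h1 h0.ne').congr_deriv ?_
      simp only [Trajectory.Q]; field_simp; ring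
    refine (((h5.const_mul 2).fun_mul h3).fun_sub (((((h3.fun_pow 2).const_add 1).fun_add
      ((h4.fun_pow 2).const_mul 2)).fun_sub (hQ.fun_pow 2)).fun_sub
      ((h1.fun_pow 2).const_mul Λ))).congr_deriv ?_
    have : -(y.w x * (1 - y.w x ^ 2)) / y.r x = -(y.w x * y.Q x) := by rw [Trajectory.Q]; ring
    rw [this]
    simp only [hc]; push_cast; ring
  obtain ⟨C, hC, hC'⟩ := exists_abs_le_of_continuousOn (f := y.N) (a := a) (b := τ) fun x hx =>
    ((h x (hlt x hx)).2.2.2.1).continuousAt.continuousWithinAt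
  have h1 := ge_of_hasDerivAt_nonpos (f := fun x => Real.exp (-(4 * C) * x) * c x ^ 2) haτ
    (fun x hx => ((((hasDerivAt_id' x).const_mul (-(4 * C))).exp).fun_mul ((hd x hx).fun_pow 2)))
    fun x hx => by
      have h2 := (abs_le.1 (hC' x ⟨hx.1.le, hx.2.le⟩)).1
      have h3 := Real.exp_pos (-(4 * C) * x)
      have h4 : 0 ≤ Real.exp (-(4 * C) * x) * c x ^ 2 * (4 * (C + y.N x)) :=
        mul_nonneg (by positivity) (by linarith)
      push_cast
      nlinarith
  have hca : c a = 0 := by simp only [hc]; linarith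
  rw [hca] at h1
  have h2 : c τ ^ 2 ≤ 0 := by
    have h3 := Real.exp_pos (-(4 * C) * τ)
    by_contra hcon
    push Not at hcon
    have := mul_pos h3 hcon
    rw [zero_pow two_ne_zero, mul_zero] at h1
    linarith
  have h3 : c τ = 0 := by nlinarith [sq_nonneg (c τ)]
  simp only [hc] at h3
  linarith

/-- A maximal solution satisfies the constraint and blows up if it ends at a finite time. -/
theorem IsMaximalSolution.flow {Λ lam : ℝ} {y : Trajectory} {T : EReal}
    (h : IsMaximalSolution Λ lam y T) : Flow Λ y T := by
  refine ⟨fun τ hτ => ?_, fun t a M hT hat hM => ?_⟩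
  · obtain ⟨h0, h1, h2, h3, h4, h5⟩ := h.solves τ hτ
    refine ⟨h0, h1, h2, h3, h4.congr_deriv ?_, h5, h.solves.constraint h.origin hτ⟩
    rw [Trajectory.Q]; ring
  · subst hT
    obtain ⟨y', ε, hε, h1, h2⟩ := h.solves.exists_extension hat hM
    have hag : AgreeBefore y y' t := fun τ hτ => h2 τ (EReal.coe_lt_coe_iff.1 hτ)
    have := h.maximal y' _ ⟨EReal.bot_lt_coe _, h1, h.origin.congr h.nonempty hag⟩ hag
    linarith [EReal.coe_le_coe_iff.1 this]

/-! ### The centre -/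

/-- Continuous functions on the unit interval. -/
abbrev Path₁ : Type := C(unitInterval, ℝ)

/-- The extension of a function on the unit interval that is constant beyond the end points. -/
noncomputable def ext (g : Path₁) : ℝ → ℝ := IccExtend (zero_le_one (α := ℝ)) g

theorem continuous_ext (g : Path₁) : Continuous (ext g) := g.continuous.Icc_extend'

theorem ext_of_mem (g : Path₁) {x : ℝ} (hx : x ∈ Icc (0 : ℝ) 1) : ext g x = g ⟨x, hx⟩ :=
  IccExtend_of_mem _ _ hx

theorem abs_ext_le (g : Path₁) (x : ℝ) : |ext g x| ≤ ‖g‖ := g.norm_coe_le_norm _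

/-- The average `s ↦ ∫₀¹ σᵏ g (s σ) dσ`. -/
noncomputable def avg (k : ℕ) : Path₁ →L[ℝ] Path₁ :=
  LinearMap.mkContinuous
    { toFun := fun g => ⟨fun s => ∫ x in (0 : ℝ)..1, x ^ k * ext g ((s : ℝ) * x), by
        refine intervalIntegral.continuous_parametric_intervalIntegral_of_continuous'
          (f := fun (s : unitInterval) x => x ^ k * ext g ((s : ℝ) * x)) ?_ 0 1
        have := continuous_ext g
        unfold Function.uncurry
        fun_prop⟩
      map_add' := fun f g => by
        ext s
        have hc : ∀ h : Path₁, Continuous fun x : ℝ => x ^ k * ext h ((s : ℝ) * x) := fun h => by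
          have := continuous_ext h
          fun_prop
        simp only [ContinuousMap.coe_mk, ContinuousMap.add_apply]
        rw [← intervalIntegral.integral_add ((hc f).intervalIntegrable _ _)
          ((hc g).intervalIntegrable _ _)]
        congr 1
        ext x
        simp only [EYM.ext, IccExtend, Function.comp, ContinuousMap.add_apply]
        ring
      map_smul' := fun c g => by
        ext s
        simp only [ContinuousMap.coe_mk, ContinuousMap.smul_apply, RingHom.id_apply, smul_eq_mul]
        rw [← intervalIntegral.integral_const_mul]
        congr 1
        ext x
        simp only [EYM.ext, IccExtend, Function.comp, ContinuousMap.smul_apply, smul_eq_mul]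
        ring }
    1 fun g => by
      rw [one_mul]
      refine (ContinuousMap.norm_le _ (norm_nonneg g)).2 fun s => ?_
      refine (intervalIntegral.norm_integral_le_of_norm_le_const (C := ‖g‖) fun x hx => ?_).trans
        (by simp)
      rw [uIoc_of_le zero_le_one] at hx
      rw [norm_mul, Real.norm_eq_abs, Real.norm_eq_abs, abs_of_nonneg (pow_nonneg hx.1.le k)]
      calc x ^ k * |ext g (s * x)| ≤ 1 * ‖g‖ :=
            mul_le_mul (pow_le_one₀ hx.1.le hx.2) (abs_ext_le g _) (abs_nonneg _) zero_le_one
        _ = ‖g‖ := one_mul _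

theorem avg_apply (k : ℕ) (g : Path₁) (s : unitInterval) :
    avg k g s = ∫ x in (0 : ℝ)..1, x ^ k * ext g ((s : ℝ) * x) := rfl

/-- The coordinate function of the unit interval. -/
def coord : Path₁ := ⟨fun s => s, continuous_subtype_val⟩

/-- The source term of the equation `r P' = -4 P + r G`. -/
noncomputable def sourceG (Λ r u P M : ℝ) : ℝ :=
  (-(P * M) + (r * P - 2 * u) * (u ^ 2 * (2 - r ^ 2 * u) ^ 2 + Λ) + 3 * u ^ 2 - r ^ 2 * u ^ 3) *
    (1 - r * M)⁻¹

/-- The source term of the equation `r M' = -2 M + r H`. -/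
def sourceH (Λ r u P M : ℝ) : ℝ :=
  u ^ 2 * (2 - r ^ 2 * u) ^ 2 + Λ + 2 * (1 - r * M) * (r * P - 2 * u) ^ 2

/-- The defect of the integral equations for `u = (1 - w) / r²`, `P = (w' / r + 2 u) / r`,
`M = (1 - A) / r` on the interval `[0, ε]`, scaled to the unit interval. The parameters are
`ε`, `Λ`, `u 0`. -/
noncomputable def defect (v : (ℝ × ℝ × ℝ) × (Path₁ × Path₁ × Path₁)) : Path₁ × Path₁ × Path₁ :=
  (v.2.1 - (v.1.2.2 • 1 - (v.1.1 • coord) * avg 0 v.2.2.1),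
    v.2.2.1 - (v.1.1 • coord) * avg 4
      ((-(v.2.2.1 * v.2.2.2) + ((v.1.1 • coord) * v.2.2.1 - (2 : ℝ) • v.2.1) *
        (v.2.1 ^ 2 * ((2 : ℝ) • 1 - (v.1.1 • coord) ^ 2 * v.2.1) ^ 2 + v.1.2.1 • 1) +
        (3 : ℝ) • v.2.1 ^ 2 - (v.1.1 • coord) ^ 2 * v.2.1 ^ 3) *
        Ring.inverse (1 - (v.1.1 • coord) * v.2.2.2)),
    v.2.2.2 - (v.1.1 • coord) * avg 2
      (v.2.1 ^ 2 * ((2 : ℝ) • 1 - (v.1.1 • coord) ^ 2 * v.2.1) ^ 2 + v.1.2.1 • 1 +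
        (2 : ℝ) • (1 - (v.1.1 • coord) * v.2.2.2) *
        ((v.1.1 • coord) * v.2.2.1 - (2 : ℝ) • v.2.1) ^ 2))

/-- The solution of the integral equations for `ε = 0`. -/
noncomputable def basePoint (u₀ : ℝ) : Path₁ × Path₁ × Path₁ := (u₀ • 1, 0, 0)

/-- All ingredients are polynomial or continuous linear, except `Ring.inverse`, which is analytic
near the unit 1, its argument at ε = 0. -/
theorem contDiffAt_defect (Λ u₀ : ℝ) :
    ContDiffAt ℝ ω defect ((0, Λ, u₀), basePoint u₀) := by
  have hinv : ContDiffAt ℝ ω (fun v : (ℝ × ℝ × ℝ) × (Path₁ × Path₁ × Path₁) =>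
      Ring.inverse (1 - (v.1.1 • coord) * v.2.2.2)) ((0, Λ, u₀), basePoint u₀) := by
    refine ContDiffAt.comp (g := Ring.inverse) _ ?_ (ContDiff.contDiffAt (by fun_prop))
    have := contDiffAt_ringInverse ℝ (n := ω) (1 : Path₁ˣ)
    simpa [basePoint] using this
  unfold defect
  refine ContDiffAt.prodMk (ContDiff.contDiffAt (by fun_prop)) (ContDiffAt.prodMk ?_
    (ContDiff.contDiffAt (by fun_prop)))
  refine ContDiffAt.sub (ContDiff.contDiffAt (by fun_prop)) (ContDiffAt.mul
    (ContDiff.contDiffAt (by fun_prop)) ?_)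
  exact (avg 4).contDiff.contDiffAt.comp _
    (ContDiffAt.mul (ContDiff.contDiffAt (by fun_prop)) hinv)

/-- At ε = 0 all averages drop out, so the derivative in the unknown is the identity and the
implicit function theorem applies. -/
theorem defect_zero (Λ u₀ : ℝ) (Y : Path₁ × Path₁ × Path₁) :
    defect ((0, Λ, u₀), Y) = Y - basePoint u₀ := by
  ext <;> simp [defect, basePoint]

theorem fderiv_defect (Λ u₀ : ℝ) :
    fderiv ℝ defect ((0, Λ, u₀), basePoint u₀) ∘L .inr ℝ (ℝ × ℝ × ℝ) (Path₁ × Path₁ × Path₁) =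
      ContinuousLinearMap.id ℝ _ := by
  have h1 : HasFDerivAt (fun Y => defect ((0, Λ, u₀), Y))
      (fderiv ℝ defect ((0, Λ, u₀), basePoint u₀) ∘L .inr ℝ (ℝ × ℝ × ℝ) (Path₁ × Path₁ × Path₁))
      (basePoint u₀) :=
    HasFDerivAt.comp (basePoint u₀) (((contDiffAt_defect Λ u₀).differentiableAt
      (by simp)).hasFDerivAt) (hasFDerivAt_prodMk_right _ _)
  have h2 : HasFDerivAt (fun Y => defect ((0, Λ, u₀), Y)) (ContinuousLinearMap.id ℝ _)
      (basePoint u₀) := by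
    simp only [defect_zero]
    exact (hasFDerivAt_id _).sub_const _
  exact h1.unique h2

/-- The integral equations have a unique solution near the base point, which depends
analytically on the parameters. -/
theorem exists_implicit (Λ u₀ : ℝ) : ∃ Ψ : ℝ × ℝ × ℝ → Path₁ × Path₁ × Path₁,
    ContDiffAt ℝ ω Ψ (0, Λ, u₀) ∧ Ψ (0, Λ, u₀) = basePoint u₀ ∧
    ∀ᶠ v in 𝓝 ((0, Λ, u₀), basePoint u₀), defect v = 0 ↔ Ψ v.1 = v.2 := by
  have hc := contDiffAt_defect Λ u₀
  have hi : (fderiv ℝ defect ((0, Λ, u₀), basePoint u₀) ∘L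
      .inr ℝ (ℝ × ℝ × ℝ) (Path₁ × Path₁ × Path₁)).IsInvertible := by
    rw [fderiv_defect]
    exact ⟨ContinuousLinearEquiv.refl ℝ _, rfl⟩
  refine ⟨hc.implicitFunction (by simp) hi, hc.contDiffAt_implicitFunction (by simp) hi,
    hc.implicitFunction_apply_self (by simp) hi, ?_⟩
  filter_upwards [hc.eventually_apply_eq_iff_implicitFunction (by simp) hi] with v hv
  rwa [defect_zero, sub_self] at hv

/-- `Ring.inverse` acts pointwise only on units of the algebra of continuous functions; the
hypothesis says that its argument is one. -/
theorem defect_eq_zero_iff {ε Λ u₀ : ℝ} {Y : Path₁ × Path₁ × Path₁}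
    (h : ∀ s : unitInterval, 1 - ε * s * Y.2.2 s ≠ 0) :
    defect ((ε, Λ, u₀), Y) = 0 ↔ ∀ s : unitInterval,
      Y.1 s = u₀ - ε * s * ∫ x in (0 : ℝ)..1, x ^ 0 * ext Y.2.1 (s * x) ∧
      Y.2.1 s = ε * s * ∫ x in (0 : ℝ)..1, x ^ 4 * sourceG Λ (ε * (s * x)) (ext Y.1 (s * x))
        (ext Y.2.1 (s * x)) (ext Y.2.2 (s * x)) ∧
      Y.2.2 s = ε * s * ∫ x in (0 : ℝ)..1, x ^ 2 * sourceH Λ (ε * (s * x)) (ext Y.1 (s * x))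
        (ext Y.2.1 (s * x)) (ext Y.2.2 (s * x)) := by
  have hinv : ∀ s, Ring.inverse (1 - (ε • coord) * Y.2.2) s = (1 - ε * s * Y.2.2 s)⁻¹ := by
    have hu : IsUnit (1 - (ε • coord) * Y.2.2) :=
      (ContinuousMap.isUnit_iff_forall_ne_zero _).2 fun s => by simpa [coord, mul_assoc] using h s
    intro s
    have := congr_arg (fun f : Path₁ => f s) (Ring.mul_inverse_cancel _ hu)
    simp only [ContinuousMap.mul_apply, ContinuousMap.one_apply] at this
    refine eq_inv_of_mul_eq_one_right ?_
    simpa [coord, mul_assoc] using this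
  have hmul : ∀ (s : unitInterval) {x : ℝ}, x ∈ uIcc (0 : ℝ) 1 → (s : ℝ) * x ∈ Icc (0 : ℝ) 1 :=
    fun s x hx => by
      rw [uIcc_of_le zero_le_one] at hx
      exact ⟨mul_nonneg s.2.1 hx.1, mul_le_one₀ s.2.2 hx.1 hx.2⟩
  rw [Prod.ext_iff, Prod.ext_iff]
  simp only [defect, Prod.fst_zero, Prod.snd_zero, sub_eq_zero, ContinuousMap.ext_iff,
    ContinuousMap.sub_apply, ContinuousMap.mul_apply, ContinuousMap.smul_apply, smul_eq_mul,
    ContinuousMap.one_apply, avg_apply, mul_one]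
  rw [← forall_and, ← forall_and]
  refine forall_congr' fun s => ?_
  refine and_congr Iff.rfl (and_congr ?_ ?_)
  · refine Eq.congr rfl (congr_arg _ (intervalIntegral.integral_congr fun x hx => ?_))
    have hs := hmul s hx
    simp only [ext_of_mem _ hs, ContinuousMap.mul_apply, hinv, sourceG]
    simp [coord, -mul_eq_mul_left_iff, -mul_eq_mul_right_iff]
    ring
  · refine Eq.congr rfl (congr_arg _ (intervalIntegral.integral_congr fun x hx => ?_))
    have hs := hmul s hx
    simp only [ext_of_mem _ hs, sourceH]
    simp [coord, -mul_eq_mul_left_iff, -mul_eq_mul_right_iff]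
    ring

/-- The rescaling `s ↦ g (t s)`. -/
def rescale (t : unitInterval) (g : Path₁) : Path₁ :=
  g.comp ⟨fun s => t * s, by fun_prop⟩

theorem rescale_apply (t : unitInterval) (g : Path₁) (s : unitInterval) :
    rescale t g s = g (t * s) := rfl

theorem ext_rescale (t : unitInterval) (g : Path₁) {x : ℝ} (hx : x ∈ Icc (0 : ℝ) 1) :
    ext (rescale t g) x = ext g (t * x) := by
  have h : (t : ℝ) * x ∈ Icc (0 : ℝ) 1 := ⟨mul_nonneg t.2.1 hx.1, mul_le_one₀ t.2.2 hx.1 hx.2⟩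
  rw [ext_of_mem _ hx, ext_of_mem _ h]
  rfl

theorem dist_rescale_le (t : unitInterval) (g : Path₁) (c : ℝ) :
    dist (rescale t g) (c • 1) ≤ dist g (c • 1) :=
  (ContinuousMap.dist_le dist_nonneg).2 fun s => by
    have := ContinuousMap.dist_apply_le_dist (f := g) (g := c • 1) (t * s)
    simpa [rescale_apply] using this

/-- Restricting a solution on [0, ε] to [0, ε t] solves the problem for ε t. By local uniqueness the
implicit function at ε t is then the rescaled one at ε, so its value at 1, as a function of ε, is
the solution itself. -/
theorem defect_rescale {ε Λ u₀ : ℝ} {Y : Path₁ × Path₁ × Path₁} (t : unitInterval)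
    (h : ∀ s : unitInterval, 1 - ε * s * Y.2.2 s ≠ 0) (hY : defect ((ε, Λ, u₀), Y) = 0) :
    defect ((ε * t, Λ, u₀), (rescale t Y.1, rescale t Y.2.1, rescale t Y.2.2)) = 0 := by
  rw [defect_eq_zero_iff h] at hY
  have hmem : ∀ (s : unitInterval) {x : ℝ}, x ∈ uIcc (0 : ℝ) 1 → (s : ℝ) * x ∈ Icc (0 : ℝ) 1 :=
    fun s x hx => by
      rw [uIcc_of_le zero_le_one] at hx
      exact ⟨mul_nonneg s.2.1 hx.1, mul_le_one₀ s.2.2 hx.1 hx.2⟩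
  rw [defect_eq_zero_iff (fun s => by
    have := h (t * s)
    rw [rescale_apply]
    push_cast at this
    rwa [← mul_assoc] at this)]
  intro s
  obtain ⟨h1, h2, h3⟩ := hY (t * s)
  simp only [rescale_apply]
  rw [h1, h2, h3]
  push_cast
  refine ⟨?_, ?_, ?_⟩
  · rw [← mul_assoc ε]
    congr 2
    refine intervalIntegral.integral_congr fun x hx => ?_
    simp only [ext_rescale t _ (hmem s hx), mul_assoc]
  · rw [← mul_assoc ε]
    congr 1
    refine intervalIntegral.integral_congr fun x hx => ?_
    simp only [ext_rescale t _ (hmem s hx), mul_assoc]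
  · rw [← mul_assoc ε]
    congr 1
    refine intervalIntegral.integral_congr fun x hx => ?_
    simp only [ext_rescale t _ (hmem s hx), mul_assoc]

/-- Solutions of the equations at the centre, in the variables `u = (1 - w) / r²`,
`P = (w' / r + 2 u) / r`, `M = (1 - A) / r`. -/
structure Profile (Λ u₀ δ : ℝ) (u P M : ℝ → ℝ) : Prop where
  smooth : ∀ r, |r| < δ → ContDiffAt ℝ ω u r ∧ ContDiffAt ℝ ω P r ∧ ContDiffAt ℝ ω M r
  zero : u 0 = u₀ ∧ P 0 = 0 ∧ M 0 = 0
  small : ∀ r, |r| < δ → |r * M r| ≤ 1 / 2 ∧ |r ^ 2 * u r| ≤ 1 / 2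
  du : ∀ r, 0 < r → r < δ → HasDerivAt u (-P r) r
  dP : ∀ r, 0 < r → r < δ → HasDerivAt P (sourceG Λ r (u r) (P r) (M r) - 4 * P r / r) r
  dM : ∀ r, 0 < r → r < δ → HasDerivAt M (sourceH Λ r (u r) (P r) (M r) - 2 * M r / r) r

/-- Substitution turns the average into xᵏ φ(x) = ∫₀ˣ sᵏ g(s) ds, whose derivative contains the
singular term k φ / r. -/
theorem hasDerivAt_of_eq_avg {g φ : ℝ → ℝ} {δ : ℝ} (k : ℕ) (hg : ∀ x, |x| < δ → ContinuousAt g x)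
    (hφ : ∀ x, |x| < δ → φ x = x * ∫ s in (0 : ℝ)..1, s ^ k * g (x * s)) {r : ℝ} (hr : 0 < r)
    (hrδ : r < δ) : HasDerivAt φ (g r - k * φ r / r) r := by
  have hc : ContinuousOn (fun x => x ^ k * g x) (Ioo (-δ) δ) := fun x hx =>
    (((continuous_id.pow k).continuousAt).mul (hg x (abs_lt.2 hx))).continuousWithinAt
  have hF : ∀ x, |x| < δ → x ^ k * φ x = ∫ s in (0 : ℝ)..x, s ^ k * g s := fun x hx => by
    have := intervalIntegral.mul_integral_comp_mul_left (a := 0) (b := 1)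
      (f := fun s => s ^ k * g s) x
    rw [mul_zero, mul_one] at this
    rw [← this, hφ x hx, mul_left_comm, ← intervalIntegral.integral_const_mul]
    congr 2
    ext s
    rw [mul_pow]; ring
  have hrm : r ∈ Ioo (-δ) δ := ⟨by linarith, hrδ⟩
  have hd : HasDerivAt (fun x => ∫ s in (0 : ℝ)..x, s ^ k * g s) (r ^ k * g r) r := by
    refine intervalIntegral.integral_hasDerivAt_right ?_
      (hc.stronglyMeasurableAtFilter isOpen_Ioo r hrm) (hc.continuousAt (Ioo_mem_nhds hrm.1 hrm.2))
    refine (hc.mono ?_).intervalIntegrable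
    rw [uIcc_of_le hr.le]
    exact fun x hx => ⟨by linarith [hx.1], hx.2.trans_lt hrδ⟩
  have hd2 := hd.fun_div (hasDerivAt_pow k r) (pow_pos hr k).ne'
  refine (hd2.congr_of_eventuallyEq ?_).congr_deriv ?_
  · filter_upwards [Ioo_mem_nhds hr hrδ] with x hx
    rw [← hF x (abs_lt.2 ⟨by linarith [hx.1], hx.2⟩)]
    field_simp [(pow_pos hx.1 k).ne']
  · rw [← hF r (abs_lt.2 hrm)]
    rcases k with _ | k
    · simp
    · have := hr.ne'
      simp only [Nat.add_sub_cancel]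
      field_simp
      ring

/-- The radius takes the place of ε, which makes the solution analytic jointly in the radius and the
parameters, with δ uniform in the parameters. The last clause is local uniqueness, needed to
recognise a given smooth solution as the constructed one. -/
theorem exists_profile (Λ u₀ : ℝ) : ∃ δ > 0, ∃ Ψ : ℝ × ℝ × ℝ → Path₁ × Path₁ × Path₁,
    (∀ e, dist e (0, Λ, u₀) < δ → ContDiffAt ℝ ω Ψ e) ∧
    (∀ Λ' u', dist (Λ', u') (Λ, u₀) < δ → Profile Λ' u' δ (fun r => (Ψ (r, Λ', u')).1 1)
      (fun r => (Ψ (r, Λ', u')).2.1 1) (fun r => (Ψ (r, Λ', u')).2.2 1)) ∧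
    ∀ Λ' u', dist (Λ', u') (Λ, u₀) < δ →
      ∀ᶠ v in 𝓝 ((0, Λ', u'), basePoint u'), defect v = 0 → Ψ v.1 = v.2 := by
  obtain ⟨Ψ, hΨ, hΨ0, hiff⟩ := exists_implicit Λ u₀
  obtain ⟨η, hη, hiff'⟩ := Metric.eventually_nhds_iff.1 hiff
  have hev : ∀ᶠ e in 𝓝 ((0, Λ, u₀) : ℝ × ℝ × ℝ), ContDiffAt ℝ ω Ψ e ∧
      dist (Ψ e) (basePoint u₀) < min η (1 / 4) := by
    refine (hΨ.eventually (by simp)).and ?_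
    have h1 := hΨ.continuousAt.eventually (Metric.ball_mem_nhds (Ψ (0, Λ, u₀))
      (show 0 < min η (1 / 4) from lt_min hη (by norm_num)))
    rw [hΨ0] at h1
    exact h1
  obtain ⟨δ₁, hδ₁, hδ₁'⟩ := Metric.eventually_nhds_iff.1 hev
  set B := |u₀| + 1
  have hB : 0 < B := by positivity
  -- B bounds |u|, so δ ≤ 1 and δ ≤ 1 / (2 B) ensure r² |u| ≤ 1/2.
  set δ := min (min δ₁ η) (min 1 (1 / (2 * B))) with hδ
  have hδpos : 0 < δ := lt_min (lt_min hδ₁ hη) (lt_min one_pos (by positivity))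
  have hδδ₁ : δ ≤ δ₁ := (min_le_left _ _).trans (min_le_left _ _)
  have hδη : δ ≤ η := (min_le_left _ _).trans (min_le_right _ _)
  have hδ1 : δ ≤ 1 := (min_le_right _ _).trans (min_le_left _ _)
  have hδB : δ ≤ 1 / (2 * B) := (min_le_right _ _).trans (min_le_right _ _)
  refine ⟨δ, hδpos, Ψ, fun e he => (hδ₁' (he.trans_le hδδ₁)).1, fun Λ' u' hq => ?_,
    fun Λ' u' hq => ?_⟩
  rotate_left
  · have h1 : dist (((0, Λ', u'), basePoint u') : (ℝ × ℝ × ℝ) × (Path₁ × Path₁ × Path₁))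
        ((0, Λ, u₀), basePoint u₀) < η := by
      rw [Prod.dist_eq, max_lt_iff, Prod.dist_eq, Prod.dist_eq (x := basePoint u')]
      have hq' := hq.trans_le hδη
      refine ⟨max_lt (by simpa using hη) hq', max_lt ?_ ?_⟩
      · rw [Prod.dist_eq, max_lt_iff] at hq'
        refine lt_of_le_of_lt ((ContinuousMap.dist_le dist_nonneg).2 fun s => ?_) hq'.2
        simp [basePoint]
      · simpa [basePoint] using hη
    filter_upwards [Metric.isOpen_ball.mem_nhds h1] with v hv
    exact (hiff' hv).1
  have hdist : ∀ r, |r| < δ → dist ((r, Λ', u') : ℝ × ℝ × ℝ) (0, Λ, u₀) < δ := fun r hr => by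
    rw [Prod.dist_eq]
    refine max_lt ?_ hq
    simpa [Real.dist_eq] using hr
  have hdΨ : ∀ r, |r| < δ → dist (Ψ (r, Λ', u')).1 (u₀ • 1) < min η (1 / 4) ∧
      dist (Ψ (r, Λ', u')).2.1 0 < min η (1 / 4) ∧
      dist (Ψ (r, Λ', u')).2.2 0 < min η (1 / 4) := fun r hr => by
    have := (hδ₁' ((hdist r hr).trans_le hδδ₁)).2
    rw [Prod.dist_eq, Prod.dist_eq, max_lt_iff, max_lt_iff] at this
    exact this
  have hM : ∀ r, |r| < δ → ∀ s, |(Ψ (r, Λ', u')).2.2 s| ≤ 1 / 4 := fun r hr s => by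
    have h1 := ((hdΨ r hr).2.2.trans_le (min_le_right _ _)).le
    rw [dist_zero_right] at h1
    exact ((Ψ (r, Λ', u')).2.2.norm_coe_le_norm s).trans h1
  have hu : ∀ r, |r| < δ → ∀ s, |(Ψ (r, Λ', u')).1 s| ≤ B := fun r hr s => by
    have h1 := ((hdΨ r hr).1.trans_le (min_le_right _ _)).le
    have h2 := (ContinuousMap.dist_apply_le_dist (f := (Ψ (r, Λ', u')).1) (g := u₀ • 1) s).trans h1
    rw [Real.dist_eq] at h2
    simp only [ContinuousMap.smul_apply, ContinuousMap.one_apply, smul_eq_mul, mul_one] at h2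
    have h3 := abs_sub_abs_le_abs_sub ((Ψ (r, Λ', u')).1 s) u₀
    simp only [B]
    linarith
  have hne : ∀ r, |r| < δ → ∀ s : unitInterval, 1 - r * s * (Ψ (r, Λ', u')).2.2 s ≠ 0 :=
    fun r hr s => by
      have h1 := hM r hr s
      have h2 : |r * s * (Ψ (r, Λ', u')).2.2 s| ≤ 1 * (1 / 4) := by
        rw [abs_mul, abs_mul, abs_of_nonneg s.2.1]
        exact mul_le_mul (mul_le_one₀ (hr.le.trans hδ1) s.2.1 s.2.2) h1 (abs_nonneg _) zero_le_one
      have h3 := (abs_le.1 h2).2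
      intro h4
      linarith
  have hdef : ∀ r, |r| < δ → defect ((r, Λ', u'), Ψ (r, Λ', u')) = 0 := fun r hr => by
    refine (hiff' ?_).2 rfl
    rw [Prod.dist_eq]
    exact max_lt ((hdist r hr).trans_le hδη) ((hδ₁' ((hdist r hr).trans_le hδδ₁)).2.trans_le
      (min_le_left _ _))
  have habs : ∀ r, |r| < δ → ∀ t : unitInterval, |r * t| < δ := fun r hr t => by
    rw [abs_mul, abs_of_nonneg t.2.1]
    exact (mul_le_of_le_one_right (abs_nonneg r) t.2.2).trans_lt hr
  -- The rescaled triple solves the equations for r t and is no farther from the base point, so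
  -- uniqueness identifies it.
  have hresc : ∀ r, |r| < δ → ∀ t : unitInterval, Ψ (r * t, Λ', u') =
      (rescale t (Ψ (r, Λ', u')).1, rescale t (Ψ (r, Λ', u')).2.1,
        rescale t (Ψ (r, Λ', u')).2.2) := fun r hr t => by
    have h1 := defect_rescale t (hne r hr) (hdef r hr)
    obtain ⟨d1, d2, d3⟩ := hdΨ r hr
    refine (hiff' (y := ((r * t, Λ', u'), _)) ?_).1 h1
    rw [Prod.dist_eq]
    refine max_lt ((hdist _ (habs r hr t)).trans_le hδη) ?_
    have e := dist_rescale_le t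
    rw [basePoint, Prod.dist_eq, Prod.dist_eq]
    refine max_lt ((e _ _).trans_lt (d1.trans_le (min_le_left _ _))) (max_lt ?_ ?_)
    · have := e (Ψ (r, Λ', u')).2.1 0
      rw [zero_smul] at this
      exact this.trans_lt (d2.trans_le (min_le_left _ _))
    · have := e (Ψ (r, Λ', u')).2.2 0
      rw [zero_smul] at this
      exact this.trans_lt (d3.trans_le (min_le_left _ _))
  have hext : ∀ r, |r| < δ → ∀ x ∈ uIcc (0 : ℝ) 1,
      ext (Ψ (r, Λ', u')).1 (((1 : unitInterval) : ℝ) * x) = (Ψ (r * x, Λ', u')).1 1 ∧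
      ext (Ψ (r, Λ', u')).2.1 (((1 : unitInterval) : ℝ) * x) = (Ψ (r * x, Λ', u')).2.1 1 ∧
      ext (Ψ (r, Λ', u')).2.2 (((1 : unitInterval) : ℝ) * x) = (Ψ (r * x, Λ', u')).2.2 1 :=
    fun r hr x hx => by
      rw [uIcc_of_le zero_le_one] at hx
      have h1 := hresc r hr ⟨x, hx⟩
      simp only at h1
      rw [h1]
      simp only [rescale_apply, mul_one, Set.Icc.coe_one, one_mul]
      exact ⟨ext_of_mem _ hx, ext_of_mem _ hx, ext_of_mem _ hx⟩
  have hint : ∀ r, |r| < δ →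
      (Ψ (r, Λ', u')).1 1 = u' - r * ∫ x in (0 : ℝ)..1, x ^ 0 * (Ψ (r * x, Λ', u')).2.1 1 ∧
      (Ψ (r, Λ', u')).2.1 1 = r * ∫ x in (0 : ℝ)..1, x ^ 4 * sourceG Λ' (r * x)
        ((Ψ (r * x, Λ', u')).1 1) ((Ψ (r * x, Λ', u')).2.1 1) ((Ψ (r * x, Λ', u')).2.2 1) ∧
      (Ψ (r, Λ', u')).2.2 1 = r * ∫ x in (0 : ℝ)..1, x ^ 2 * sourceH Λ' (r * x)
        ((Ψ (r * x, Λ', u')).1 1) ((Ψ (r * x, Λ', u')).2.1 1) ((Ψ (r * x, Λ', u')).2.2 1) :=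
    fun r hr => by
      obtain ⟨h1, h2, h3⟩ := (defect_eq_zero_iff (hne r hr)).1 (hdef r hr) 1
      have e : r * ((1 : unitInterval) : ℝ) = r := mul_one r
      rw [e] at h1 h2 h3
      refine ⟨h1.trans ?_, h2.trans ?_, h3.trans ?_⟩
      · congr 2
        refine intervalIntegral.integral_congr fun x hx => ?_
        simp only [(hext r hr x hx).2.1]
      · congr 1
        refine intervalIntegral.integral_congr fun x hx => ?_
        obtain ⟨e1, e2, e3⟩ := hext r hr x hx
        simp only [Set.Icc.coe_one, one_mul] at e1 e2 e3 ⊢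
        rw [e1, e2, e3]
      · congr 1
        refine intervalIntegral.integral_congr fun x hx => ?_
        obtain ⟨e1, e2, e3⟩ := hext r hr x hx
        simp only [Set.Icc.coe_one, one_mul] at e1 e2 e3 ⊢
        rw [e1, e2, e3]
  have hsm : ∀ r, |r| < δ → ContDiffAt ℝ ω (fun r => (Ψ (r, Λ', u')).1 1) r ∧
      ContDiffAt ℝ ω (fun r => (Ψ (r, Λ', u')).2.1 1) r ∧
      ContDiffAt ℝ ω (fun r => (Ψ (r, Λ', u')).2.2 1) r := fun r hr => by
    have h1 : ContDiffAt ℝ ω (fun r => Ψ (r, Λ', u')) r :=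
      ContDiffAt.comp (g := Ψ) (f := fun r : ℝ => (r, Λ', u')) r
        (hδ₁' ((hdist r hr).trans_le hδδ₁)).1 (ContDiff.contDiffAt (by fun_prop))
    have hE := (ContinuousMap.evalCLM ℝ (1 : unitInterval) : Path₁ →L[ℝ] ℝ).contDiff (n := ω)
    exact ⟨hE.contDiffAt.comp r h1.fst, hE.contDiffAt.comp r h1.snd.fst,
      hE.contDiffAt.comp r h1.snd.snd⟩
  have hne1 : ∀ r, |r| < δ → 1 - r * (Ψ (r, Λ', u')).2.2 1 ≠ 0 := fun r hr => by
    simpa using hne r hr 1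
  refine ⟨hsm, ?_, fun r hr => ⟨?_, ?_⟩, fun r hr hrδ => ?_, fun r hr hrδ => ?_, fun r hr hrδ => ?_⟩
  · have := hint 0 (by simpa using hδpos)
    simpa using this
  · rw [abs_mul]
    calc |r| * |(Ψ (r, Λ', u')).2.2 1| ≤ 1 * (1 / 4) :=
          mul_le_mul (hr.le.trans hδ1) (hM r hr 1) (abs_nonneg _) zero_le_one
      _ ≤ _ := by norm_num
  · rw [abs_mul, abs_pow]
    have h1 : |r| ^ 2 ≤ 1 / (2 * B) := by
      have := hr.le.trans hδB
      have := hr.le.trans hδ1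
      nlinarith [abs_nonneg r]
    calc |r| ^ 2 * |(Ψ (r, Λ', u')).1 1| ≤ 1 / (2 * B) * B :=
          mul_le_mul h1 (hu r hr 1) (abs_nonneg _) (by positivity)
      _ = 1 / 2 := by field_simp
  · have h1 := hasDerivAt_of_eq_avg (φ := fun r => u' - (Ψ (r, Λ', u')).1 1) 0
      (fun x hx => (hsm x hx).2.1.continuousAt) (fun x hx => by
        have := (hint x hx).1
        linarith) hr hrδ
    have h2 := h1.const_sub u'
    simp only [sub_sub_cancel] at h2
    exact h2.congr_deriv (by simp)
  · have h1 := hasDerivAt_of_eq_avg (φ := fun r => (Ψ (r, Λ', u')).2.1 1)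
      (g := fun r => sourceG Λ' r ((Ψ (r, Λ', u')).1 1) ((Ψ (r, Λ', u')).2.1 1)
        ((Ψ (r, Λ', u')).2.2 1)) 4 (fun x hx => by
        obtain ⟨c1, c2, c3⟩ := hsm x hx
        have c1 := c1.continuousAt
        have c2 := c2.continuousAt
        have c3 := c3.continuousAt
        unfold sourceG
        exact ContinuousAt.mul (by fun_prop) (ContinuousAt.inv₀ (by fun_prop) (hne1 x hx)))
      (fun x hx => (hint x hx).2.1) hr hrδ
    exact h1.congr_deriv (by simp)
  · have h1 := hasDerivAt_of_eq_avg (φ := fun r => (Ψ (r, Λ', u')).2.2 1)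
      (g := fun r => sourceH Λ' r ((Ψ (r, Λ', u')).1 1) ((Ψ (r, Λ', u')).2.1 1)
        ((Ψ (r, Λ', u')).2.2 1)) 2 (fun x hx => by
        obtain ⟨c1, c2, c3⟩ := hsm x hx
        have c1 := c1.continuousAt
        have c2 := c2.continuousAt
        have c3 := c3.continuousAt
        unfold sourceH
        fun_prop)
      (fun x hx => (hint x hx).2.2) hr hrδ
    exact h1.congr_deriv (by simp)

/-! ### From radial solutions to trajectories. -/

/-- `A`, `w` and `v = w'` solve the radial equations on `(0, δ)`, and `A > 0`. -/
structure RadialSolution (Λ δ : ℝ) (A w v : ℝ → ℝ) : Prop where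
  pos : ∀ r, 0 < r → r < δ → 0 < A r
  dA : ∀ r, 0 < r → r < δ → HasDerivAt A ((Phi Λ r (A r) (w r) - 2 * A r * v r ^ 2) / r) r
  dw : ∀ r, 0 < r → r < δ → HasDerivAt w (v r) r
  dv : ∀ r, 0 < r → r < δ →
    HasDerivAt v (-(r * v r * Phi Λ r (A r) (w r) + w r * (1 - w r ^ 2)) / (r ^ 2 * A r)) r

theorem RadialSolution.radialEquationsAt {Λ δ : ℝ} {A w v : ℝ → ℝ} (h : RadialSolution Λ δ A w v)
    {r : ℝ} (hr : 0 < r) (hrδ : r < δ) : RadialEquationsAt Λ A w r := by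
  have hA := (h.pos r hr hrδ).ne'
  have e : deriv w =ᶠ[𝓝 r] v := by
    filter_upwards [Ioo_mem_nhds hr hrδ] with x hx
    exact (h.dw x hx.1 hx.2).deriv
  rw [RadialEquationsAt, e.deriv_eq, (h.dw r hr hrδ).deriv, (h.dA r hr hrδ).deriv,
    (h.dv r hr hrδ).deriv]
  have := hr.ne'
  constructor
  · field_simp
    ring
  · field_simp
    ring

theorem Profile.radialSolution {Λ u₀ δ : ℝ} {u P M : ℝ → ℝ} (h : Profile Λ u₀ δ u P M) :
    RadialSolution Λ δ (fun r => 1 - r * M r) (fun r => 1 - r ^ 2 * u r)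
      (fun r => r * (r * P r - 2 * u r)) := by
  have hpos : ∀ r, 0 < r → r < δ → 0 < 1 - r * M r := fun r hr hrδ => by
    have := (abs_le.1 (h.small r (by rwa [abs_of_pos hr])).1).2
    linarith
  refine ⟨hpos, fun r hr hrδ => ?_, fun r hr hrδ => ?_, fun r hr hrδ => ?_⟩
  · refine (((hasDerivAt_id r).fun_mul (h.dM r hr hrδ)).const_sub 1).congr_deriv ?_
    have := hr.ne'
    simp only [id, Phi, sourceH]
    field_simp
    ring
  · refine (((hasDerivAt_pow 2 r).fun_mul (h.du r hr hrδ)).const_sub 1).congr_deriv ?_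
    simp only [Nat.add_one_sub_one, pow_one, Nat.cast_ofNat]
    ring
  · refine ((hasDerivAt_id r).fun_mul (((hasDerivAt_id r).fun_mul (h.dP r hr hrδ)).fun_sub
      ((h.du r hr hrδ).const_mul 2))).congr_deriv ?_
    have := hr.ne'
    have := (hpos r hr hrδ).ne'
    simp only [id, Phi, sourceG]
    field_simp
    ring

/-- The autonomous equation with merely continuous g is solved by inverting the primitive of 1 / g;
the two-sided bound on g makes this primitive a bijection of ℝ. -/
theorem exists_logarithmic_radius {g : ℝ → ℝ} (hg : Continuous g)
    (hb : ∀ x, 1 / 2 ≤ g x ∧ g x ≤ 2) (τ₁ ℓ₁ : ℝ) : ∃ ℓ : ℝ → ℝ, StrictMono ℓ ∧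
      Function.Surjective ℓ ∧ ℓ τ₁ = ℓ₁ ∧ ∀ τ, HasDerivAt ℓ (g (ℓ τ)) τ := by
  have hne : ∀ x, g x ≠ 0 := fun x => by linarith [(hb x).1]
  have hc : Continuous fun x => (g x)⁻¹ := hg.inv₀ hne
  set F : ℝ → ℝ := fun x => τ₁ + ∫ t in ℓ₁..x, (g t)⁻¹ with hF
  have hd : ∀ x, HasDerivAt F ((g x)⁻¹) x := fun x =>
    (intervalIntegral.integral_hasDerivAt_right (hc.intervalIntegrable _ _)
      hc.stronglyMeasurable.stronglyMeasurableAtFilter hc.continuousAt).const_add τ₁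
  have hdiff : Differentiable ℝ F := fun x => (hd x).differentiableAt
  have hder : ∀ x, 1 / 2 ≤ deriv F x := fun x => by
    rw [(hd x).deriv, one_div]
    exact inv_anti₀ (by linarith [(hb x).1]) (hb x).2
  have hmono : StrictMono F := strictMono_of_deriv_pos fun x => by linarith [hder x]
  have hgrow : ∀ x y, x ≤ y → 1 / 2 * (y - x) ≤ F y - F x := fun x y hxy =>
    mul_sub_le_image_sub_of_le_deriv hdiff hder hxy
  have hsurj : Function.Surjective F := by
    refine hdiff.continuous.surjective ?_ ?_
    · refine tendsto_atTop_mono' _ ?_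
        (tendsto_atTop_add_const_right _ (F 0) (tendsto_id.const_mul_atTop (one_half_pos (α := ℝ))))
      filter_upwards [eventually_ge_atTop 0] with x hx
      have := hgrow 0 x hx
      simp only [id]
      linarith
    · refine tendsto_atBot_mono' _ ?_
        (tendsto_atBot_add_const_right _ (F 0) (tendsto_id.const_mul_atBot (one_half_pos (α := ℝ))))
      filter_upwards [eventually_le_atBot 0] with x hx
      have := hgrow x 0 hx
      simp only [id]
      linarith
  set E := hmono.orderIsoOfSurjective F hsurj
  refine ⟨E.symm, E.symm.strictMono, E.symm.surjective, ?_, fun τ => ?_⟩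
  · rw [OrderIso.symm_apply_eq]
    simp [E, hF]
  · have := HasDerivAt.of_local_left_inverse (f := F) (g := E.symm) (a := τ)
      E.symm.continuous.continuousAt (hd (E.symm τ)) (inv_ne_zero (hne _))
      (Eventually.of_forall fun y => E.apply_symm_apply y)
    rwa [inv_inv] at this

theorem exists_radius {A : ℝ → ℝ} {δ r₁ : ℝ} (hr₁ : 0 < r₁) (hr₁δ : r₁ < δ)
    (hA : ContinuousOn A (Ioo 0 δ)) (hb : ∀ r ∈ Ioo 0 δ, 1 / 2 ≤ A r ∧ A r ≤ 2) (τ₁ : ℝ) :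
    ∃ ρ : ℝ → ℝ, ∃ T > τ₁, ρ τ₁ = r₁ ∧ Tendsto ρ atBot (𝓝[>] 0) ∧
      ∀ τ < T, 0 < ρ τ ∧ ρ τ < δ ∧ HasDerivAt ρ (ρ τ * √(A (ρ τ))) τ := by
  obtain ⟨r₂, h12, h2⟩ := exists_between hr₁δ
  have hr₂ := hr₁.trans h12
  -- Freezing the radius at r₂ makes the coefficient globally defined; only the times with ρ < r₂
  -- are used.
  have hmem : ∀ x, min (Real.exp x) r₂ ∈ Ioo 0 δ := fun x =>
    ⟨lt_min (Real.exp_pos x) hr₂, (min_le_right _ _).trans_lt h2⟩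
  have hg : Continuous fun x => √(A (min (Real.exp x) r₂)) :=
    Real.continuous_sqrt.comp (hA.comp_continuous (by fun_prop) hmem)
  obtain ⟨ℓ, hm, hs, h1, hd⟩ := exists_logarithmic_radius hg (fun x => by
    obtain ⟨ha, hb⟩ := hb _ (hmem x)
    exact ⟨Real.le_sqrt_of_sq_le (by linarith), Real.sqrt_le_iff.2 ⟨by norm_num, by linarith⟩⟩)
    τ₁ (Real.log r₁)
  obtain ⟨T, hT⟩ := hs (Real.log r₂)
  refine ⟨fun τ => Real.exp (ℓ τ), T, ?_, ?_, ?_, fun τ hτ => ?_⟩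
  · rw [gt_iff_lt, ← hm.lt_iff_lt, h1, hT]
    exact Real.log_lt_log hr₁ h12
  · simp only [h1, Real.exp_log hr₁]
  · refine tendsto_nhdsWithin_iff.2 ⟨Real.tendsto_exp_atBot.comp ?_,
      Eventually.of_forall fun τ => Real.exp_pos _⟩
    exact hm.monotone.tendsto_atBot_atBot fun b => (hs b).imp fun a ha => ha.le
  · have h3 : Real.exp (ℓ τ) < r₂ := by
      rw [← Real.exp_log hr₂, Real.exp_lt_exp, ← hT]
      exact hm hτ
    refine ⟨Real.exp_pos _, h3.trans h2, ?_⟩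
    have := (hd τ).exp
    rwa [min_eq_left h3.le] at this

/-- The trajectory that belongs to a solution of the radial equations and to a radius function. -/
noncomputable def radialTrajectory (Λ : ℝ) (A w v ρ : ℝ → ℝ) : Trajectory where
  r := ρ
  w := fun τ => w (ρ τ)
  N := fun τ => √(A (ρ τ))
  U := fun τ => √(A (ρ τ)) * v (ρ τ)
  κ := fun τ => (Phi Λ (ρ τ) (A (ρ τ)) (w (ρ τ)) + 2 * A (ρ τ) * v (ρ τ) ^ 2
    + 2 * √(A (ρ τ)) ^ 2) / (2 * √(A (ρ τ)))

theorem RadialSolution.solvesSystem {Λ δ : ℝ} {A w v ρ : ℝ → ℝ} (h : RadialSolution Λ δ A w v)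
    {T : ℝ} (hρ : ∀ τ < T, 0 < ρ τ ∧ ρ τ < δ ∧ HasDerivAt ρ (ρ τ * √(A (ρ τ))) τ) :
    SolvesSystem Λ (radialTrajectory Λ A w v ρ) T := by
  intro τ hτ
  have hτ := EReal.coe_lt_coe_iff.1 hτ
  obtain ⟨hr, hrδ, dr⟩ := hρ τ hτ
  have hA := h.pos _ hr hrδ
  have hN := Real.sqrt_pos.2 hA
  have hNA := Real.sq_sqrt hA.le
  have dw := (h.dw _ hr hrδ).comp τ dr
  have dv := (h.dv _ hr hrδ).comp τ dr
  have dN := ((h.dA _ hr hrδ).comp τ dr).sqrt hA.ne'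
  have dU := dN.fun_mul dv
  have hr' := hr.ne'
  have hN' := hN.ne'
  have hNe : HasDerivAt (fun τ => √(A (ρ τ)))
      ((Phi Λ (ρ τ) (A (ρ τ)) (w (ρ τ)) - 2 * A (ρ τ) * v (ρ τ) ^ 2) / 2) τ := by
    refine dN.congr_deriv ?_
    simp only [Function.comp]
    field_simp
  have hUe : HasDerivAt (fun τ => √(A (ρ τ)) * v (ρ τ))
      (-(Phi Λ (ρ τ) (A (ρ τ)) (w (ρ τ)) * v (ρ τ)) / 2 - A (ρ τ) * v (ρ τ) ^ 3
        - w (ρ τ) * (1 - w (ρ τ) ^ 2) / ρ τ) τ := by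
    refine dU.congr_deriv ?_
    simp only [Function.comp]
    generalize √(A (ρ τ)) = N at *
    rw [← hNA]
    field_simp
    ring
  have hΦ : ∀ᶠ t in 𝓝 τ, (Phi Λ (ρ t) (A (ρ t)) (w (ρ t)) + 2 * A (ρ t) * v (ρ t) ^ 2
      + 2 * √(A (ρ t)) ^ 2) / (2 * √(A (ρ t))) =
      (1 + √(A (ρ t)) ^ 2 - (1 - w (ρ t) ^ 2) ^ 2 / ρ t ^ 2 - Λ * ρ t ^ 2
        + 2 * (√(A (ρ t)) * v (ρ t)) ^ 2) / (2 * √(A (ρ t))) := by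
    filter_upwards [Iio_mem_nhds hτ] with t ht
    obtain ⟨h1, h2, -⟩ := hρ t ht
    have h3 := Real.sq_sqrt (h.pos _ h1 h2).le
    congr 1
    rw [Phi, mul_pow, h3]
    ring
  have dw' : HasDerivAt (fun τ => w (ρ τ)) _ τ := dw
  have hκ := ((((((hNe.fun_pow 2).const_add 1).fun_sub ((((dw'.fun_pow 2).const_sub 1).fun_pow
    2).fun_div (dr.fun_pow 2) (pow_ne_zero 2 hr'))).fun_sub ((dr.fun_pow 2).const_mul Λ)).fun_add
    ((hUe.fun_pow 2).const_mul 2)).fun_div (hNe.const_mul 2) (mul_ne_zero two_ne_zero hN'))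
  refine ⟨hr, dr, dw'.congr_deriv ?_, hNe.congr_deriv ?_, hUe.congr_deriv ?_,
    (hκ.congr_of_eventuallyEq hΦ).congr_deriv ?_⟩
  · simp only [radialTrajectory]
    ring
  · simp only [radialTrajectory, mul_pow, hNA]
    rw [sub_mul, div_mul_eq_mul_div, mul_div_mul_right _ _ hN', ← pow_two, hNA]
    ring
  · simp only [radialTrajectory]
    generalize √(A (ρ τ)) = N at *
    rw [← hNA]
    field_simp
    ring
  · simp only [radialTrajectory, Phi, Nat.add_one_sub_one, pow_one, Nat.cast_ofNat]
    generalize √(A (ρ τ)) = N at *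
    rw [← hNA]
    field_simp
    ring

/-! ### Smooth solutions at the centre satisfy the integral equations. -/

theorem contDiffAt_deriv {f : ℝ → ℝ} {x : ℝ} (hf : ContDiffAt ℝ ∞ f x) :
    ContDiffAt ℝ ∞ (deriv f) x := by
  have h := (hf.fderiv_right (m := ∞) (by simp)).clm_apply
    (contDiffAt_const (c := (1 : ℝ)))
  simpa only [fderiv_apply_one_eq_deriv] using h

theorem eventually_hasDerivAt {f : ℝ → ℝ} {x : ℝ} (hf : ContDiffAt ℝ ∞ f x) :
    ∀ᶠ y in 𝓝 x, HasDerivAt f (deriv f y) y := by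
  filter_upwards [(hf.of_le (m := 1) (by simp)).eventually (by simp)] with y hy
  exact (hy.differentiableAt (by simp)).hasDerivAt

theorem eventually_abs_le {f : ℝ → ℝ} {x : ℝ} (hf : ContinuousAt f x) :
    ∀ᶠ y in 𝓝 x, |f y| ≤ |f x| + 1 :=
  (hf.abs.eventually (gt_mem_nhds (lt_add_one |f x|))).mono fun _ h => h.le

theorem abs_le_mul_pow {φ φ' : ℝ → ℝ} {C ρ : ℝ} (k : ℕ) (h0 : φ 0 = 0)
    (hc : ContinuousOn φ (Ico 0 ρ)) (hd : ∀ x ∈ Ioo 0 ρ, HasDerivAt φ (φ' x) x)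
    (hb : ∀ x ∈ Ioo 0 ρ, |φ' x| ≤ C * x ^ k) : ∀ r ∈ Ioo 0 ρ, |φ r| ≤ C * r ^ (k + 1) := by
  intro r hr
  obtain ⟨c, hc, h⟩ := exists_hasDerivAt_eq_slope φ φ' hr.1
    (hc.mono (Icc_subset_Ico_right hr.2)) fun x hx => hd x ⟨hx.1, hx.2.trans hr.2⟩
  have hcm : c ∈ Ioo 0 ρ := ⟨hc.1, hc.2.trans hr.2⟩
  have hC : 0 ≤ C := by
    by_contra! hC
    exact absurd ((abs_nonneg _).trans (hb c hcm))
      (not_le.2 (mul_neg_of_neg_of_pos hC (pow_pos hc.1 k)))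
  rw [h0, sub_zero, sub_zero, eq_div_iff hr.1.ne'] at h
  rw [← h, abs_mul, abs_of_pos hr.1, pow_succ, ← mul_assoc]
  refine mul_le_mul_of_nonneg_right ((hb c hcm).trans ?_) hr.1.le
  exact mul_le_mul_of_nonneg_left (pow_le_pow_left₀ hc.1.le hc.2.le k) hC

theorem exists_source_bound (Λ C : ℝ) : ∃ K, ∀ r u P M : ℝ, |r| ≤ 1 → |u| ≤ C → |P| ≤ C → |M| ≤ C →
    1 / 2 ≤ 1 - r * M → |sourceG Λ r u P M| ≤ K ∧ |sourceH Λ r u P M| ≤ K := by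
  set S : Set (ℝ × ℝ × ℝ × ℝ) := (Icc (-1) 1 ×ˢ Icc (-C) C ×ˢ Icc (-C) C ×ˢ Icc (-C) C) ∩
    {x | 1 / 2 ≤ 1 - x.1 * x.2.2.2}
  have hS : IsCompact S := (isCompact_Icc.prod (isCompact_Icc.prod (isCompact_Icc.prod
    isCompact_Icc))).inter_right (isClosed_le (by fun_prop) (by fun_prop))
  obtain ⟨K₁, hK₁⟩ := hS.exists_bound_of_continuousOn
    (f := fun x => sourceG Λ x.1 x.2.1 x.2.2.1 x.2.2.2) (by
      unfold sourceG
      refine ContinuousOn.mul (Continuous.continuousOn (by fun_prop))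
        (ContinuousOn.inv₀ (Continuous.continuousOn (by fun_prop)) fun x hx => ?_)
      have : 1 / 2 ≤ 1 - x.1 * x.2.2.2 := hx.2
      linarith)
  obtain ⟨K₂, hK₂⟩ := hS.exists_bound_of_continuousOn
    (f := fun x => sourceH Λ x.1 x.2.1 x.2.2.1 x.2.2.2) (by
      unfold sourceH
      exact Continuous.continuousOn (by fun_prop))
  refine ⟨max K₁ K₂, fun r u P M hr hu hP hM h => ?_⟩
  have hmem : (r, u, P, M) ∈ S := ⟨⟨abs_le.1 hr, abs_le.1 hu, abs_le.1 hP, abs_le.1 hM⟩, h⟩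
  exact ⟨(hK₁ _ hmem).trans (le_max_left _ _), (hK₂ _ hmem).trans (le_max_right _ _)⟩

/-- Taylor's formula gives u - u₀ = O(r) and only boundedness of P and M. The radial equations, in
the form that r⁴ P and r² M have derivatives r⁴ G and r² H with bounded G and H, improve this to P,
M = O(r), as needed to enter the region of uniqueness. -/
theorem exists_centre_expansion {Λ u₀ : ℝ} {A w : ℝ → ℝ} (hA : ContDiffAt ℝ ∞ A 0)
    (hw : ContDiffAt ℝ ∞ w 0) (hA0 : A 0 = 1) (hw0 : w 0 = 1) (hw1 : deriv w 0 = 0)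
    (hw2 : deriv (deriv w) 0 = -(2 * u₀))
    (heq : ∀ᶠ r in 𝓝[>] (0 : ℝ), RadialEquationsAt Λ A w r) :
    ∃ ρ > 0, ∃ C : ℝ, ∃ u P M : ℝ → ℝ, u 0 = u₀ ∧ P 0 = 0 ∧ M 0 = 0 ∧ ∀ r ∈ Ioo 0 ρ,
      A r = 1 - r * M r ∧ w r = 1 - r ^ 2 * u r ∧ 1 / 2 ≤ 1 - r * M r ∧
      |u r - u₀| ≤ C * r ∧ |P r| ≤ C * r ∧ |M r| ≤ C * r ∧
      HasDerivAt u (-P r) r ∧ HasDerivAt P (sourceG Λ r (u r) (P r) (M r) - 4 * P r / r) r ∧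
      HasDerivAt M (sourceH Λ r (u r) (P r) (M r) - 2 * M r / r) r := by
  have hc1 := contDiffAt_deriv hw
  have hc2 := contDiffAt_deriv hc1
  have hc3 := contDiffAt_deriv hc2
  have hcA := contDiffAt_deriv hA
  have hAhalf : ∀ᶠ r in 𝓝 (0 : ℝ), 1 / 2 ≤ A r :=
    (hA.continuousAt.eventually (lt_mem_nhds (show 1 / 2 < A 0 by rw [hA0]; norm_num))).mono
      fun _ h => h.le
  have hev := (eventually_hasDerivAt hw).and ((eventually_hasDerivAt hc1).and
    ((eventually_hasDerivAt hc2).and ((eventually_hasDerivAt hA).and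
    ((eventually_abs_le hc3.continuousAt).and ((eventually_abs_le hcA.continuousAt).and hAhalf)))))
  obtain ⟨ρ₁, hρ₁, h₁⟩ := Metric.eventually_nhds_iff.1 hev
  obtain ⟨ρ₂, hρ₂, h₂⟩ := mem_nhdsGT_iff_exists_Ioo_subset.1 heq
  set ρ := min 1 (min ρ₁ ρ₂)
  have hρ : 0 < ρ := lt_min one_pos (lt_min hρ₁ hρ₂)
  have hρ1 : ρ ≤ 1 := min_le_left _ _
  have hs1 : ∀ r ∈ Ico 0 ρ, dist r 0 < ρ₁ := fun r hr => by
    rw [Real.dist_eq, sub_zero, abs_of_nonneg hr.1]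
    exact hr.2.trans_le ((min_le_right _ _).trans (min_le_left _ _))
  have hs2 : ∀ r ∈ Ioo 0 ρ, RadialEquationsAt Λ A w r := fun r hr =>
    h₂ ⟨hr.1, hr.2.trans_le ((min_le_right _ _).trans (min_le_right _ _))⟩
  have hIco : ∀ r ∈ Ioo 0 ρ, r ∈ Ico 0 ρ := fun r hr => ⟨hr.1.le, hr.2⟩
  have dw : ∀ r ∈ Ico 0 ρ, HasDerivAt w (deriv w r) r := fun r hr => (h₁ (hs1 r hr)).1
  have dw1 : ∀ r ∈ Ico 0 ρ, HasDerivAt (deriv w) (deriv (deriv w) r) r :=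
    fun r hr => (h₁ (hs1 r hr)).2.1
  have dw2 : ∀ r ∈ Ico 0 ρ, HasDerivAt (deriv (deriv w)) (deriv (deriv (deriv w)) r) r :=
    fun r hr => (h₁ (hs1 r hr)).2.2.1
  have dA : ∀ r ∈ Ico 0 ρ, HasDerivAt A (deriv A r) r := fun r hr => (h₁ (hs1 r hr)).2.2.2.1
  have b3 : ∀ r ∈ Ico 0 ρ, |deriv (deriv (deriv w)) r| ≤ |deriv (deriv (deriv w)) 0| + 1 :=
    fun r hr => (h₁ (hs1 r hr)).2.2.2.2.1
  have bA : ∀ r ∈ Ico 0 ρ, |deriv A r| ≤ |deriv A 0| + 1 :=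
    fun r hr => (h₁ (hs1 r hr)).2.2.2.2.2.1
  have hA2 : ∀ r ∈ Ico 0 ρ, 1 / 2 ≤ A r := fun r hr => (h₁ (hs1 r hr)).2.2.2.2.2.2
  generalize |deriv (deriv (deriv w)) 0| + 1 = C₃ at b3
  generalize |deriv A 0| + 1 = CA at bA
  have bound : ∀ {φ φ' : ℝ → ℝ} {C : ℝ} (k : ℕ), φ 0 = 0 →
      (∀ r ∈ Ico 0 ρ, HasDerivAt φ (φ' r) r) → (∀ r ∈ Ioo 0 ρ, |φ' r| ≤ C * r ^ k) →
      ∀ r ∈ Ioo 0 ρ, |φ r| ≤ C * r ^ (k + 1) := fun k h0 hd hb =>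
    abs_le_mul_pow k h0 (fun x hx => (hd x hx).continuousAt.continuousWithinAt)
      (fun x hx => hd x (hIco x hx)) hb
  -- expansion of `w`
  have e2 := bound (φ := fun r => deriv (deriv w) r + 2 * u₀) (C := C₃) 0 (by simp [hw2])
    (fun r hr => (dw2 r hr).add_const _) (fun r hr => by simpa using b3 r (hIco r hr))
  have e1 := bound (φ := fun r => deriv w r + 2 * u₀ * r) (C := C₃) 1 (by simp [hw1])
    (φ' := fun r => deriv (deriv w) r + 2 * u₀)
    (fun r hr => ((dw1 r hr).fun_add ((hasDerivAt_id r).const_mul (2 * u₀))).congr_deriv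
      (by simp)) (fun r hr => by simpa using e2 r hr)
  have e0 := bound (φ := fun r => w r - 1 + u₀ * r ^ 2) (C := C₃) 2 (by simp [hw0])
    (φ' := fun r => deriv w r + 2 * u₀ * r)
    (fun r hr => (((dw r hr).sub_const 1).fun_add ((hasDerivAt_pow 2 r).const_mul u₀)).congr_deriv
      (by simp; ring)) (fun r hr => by simpa using e1 r hr)
  have f1 := bound (φ := fun r => deriv (deriv w) r * r - deriv w r) (C := C₃) 1 (by simp [hw1])
    (φ' := fun r => deriv (deriv (deriv w)) r * r)
    (fun r hr => (((dw2 r hr).fun_mul (hasDerivAt_id r)).fun_sub (dw1 r hr)).congr_deriv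
      (by simp)) (fun r hr => by
        rw [abs_mul, abs_of_pos hr.1, pow_one]
        exact mul_le_mul_of_nonneg_right (b3 r (hIco r hr)) hr.1.le)
  have f0 := bound (φ := fun r => deriv w r * r + 2 * (1 - w r)) (C := C₃) 2 (by simp [hw0])
    (φ' := fun r => deriv (deriv w) r * r - deriv w r)
    (fun r hr => (((dw1 r hr).fun_mul (hasDerivAt_id r)).fun_add
      (((dw r hr).const_sub 1).const_mul 2)).congr_deriv (by simp; ring)) (fun r hr => f1 r hr)
  have a0 := bound (φ := fun r => 1 - A r) (C := CA) 0 (by simp [hA0])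
    (fun r hr => (dA r hr).const_sub 1) (fun r hr => by simpa using bA r (hIco r hr))
  set u : ℝ → ℝ := fun r => u₀ - (w r - 1 + u₀ * r ^ 2) / r ^ 2 with hu
  set P : ℝ → ℝ := fun r => (deriv w r * r + 2 * (1 - w r)) / r ^ 3 with hP
  set M : ℝ → ℝ := fun r => (1 - A r) / r with hM
  have hAM : ∀ r ∈ Ioo 0 ρ, A r = 1 - r * M r := fun r hr => by
    have := hr.1.ne'
    simp only [hM]
    field_simp
    ring
  have hwu : ∀ r ∈ Ioo 0 ρ, w r = 1 - r ^ 2 * u r := fun r hr => by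
    have := hr.1.ne'
    simp only [hu]
    field_simp
    ring
  have hwP : ∀ r ∈ Ioo 0 ρ, deriv w r = r * (r * P r - 2 * u r) := fun r hr => by
    have := hr.1.ne'
    simp only [hu, hP]
    field_simp
    ring
  have bu : ∀ r ∈ Ioo 0 ρ, |u r - u₀| ≤ C₃ * r := fun r hr => by
    have e : u r - u₀ = -((w r - 1 + u₀ * r ^ 2) / r ^ 2) := by
      simp only [hu]; ring
    rw [e, abs_neg, abs_div, abs_of_pos (pow_pos hr.1 2), div_le_iff₀ (pow_pos hr.1 2)]
    calc _ ≤ C₃ * r ^ (2 + 1) := e0 r hr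
      _ = _ := by ring
  have bP : ∀ r ∈ Ioo 0 ρ, |P r| ≤ C₃ := fun r hr => by
    simp only [hP]
    rw [abs_div, abs_of_pos (pow_pos hr.1 3), div_le_iff₀ (pow_pos hr.1 3)]
    exact f0 r hr
  have bM : ∀ r ∈ Ioo 0 ρ, |M r| ≤ CA := fun r hr => by
    simp only [hM]
    rw [abs_div, abs_of_pos hr.1, div_le_iff₀ hr.1]
    simpa using a0 r hr
  obtain ⟨K, hK⟩ := exists_source_bound Λ (max (|u₀| + C₃) (max C₃ CA))
  have hK' : ∀ r ∈ Ioo 0 ρ, |sourceG Λ r (u r) (P r) (M r)| ≤ K ∧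
      |sourceH Λ r (u r) (P r) (M r)| ≤ K := fun r hr => by
    have hr1 : r ≤ 1 := hr.2.le.trans hρ1
    have hC₃ : 0 ≤ C₃ := (abs_nonneg _).trans (bP r hr)
    refine hK r _ _ _ (by rwa [abs_of_pos hr.1]) (le_max_of_le_left ?_)
      (le_max_of_le_right (le_max_of_le_left (bP r hr)))
      (le_max_of_le_right (le_max_of_le_right (bM r hr))) (by
        rw [← hAM r hr]
        exact hA2 r (hIco r hr))
    have h1 := abs_sub_abs_le_abs_sub (u r) u₀
    have h2 := bu r hr
    have h3 := mul_le_of_le_one_right hC₃ hr1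
    linarith
  have hA' : ∀ r ∈ Ioo 0 ρ, deriv A r = -(M r) - r * (sourceH Λ r (u r) (P r) (M r) - 2 * M r / r) :=
    fun r hr => by
      obtain ⟨h1, -⟩ := hs2 r hr
      rw [hwP r hr, hAM r hr, hwu r hr, Phi] at h1
      have hr0 := hr.1.ne'
      rw [← mul_right_inj' hr0, eq_sub_of_add_eq h1]
      simp only [sourceH]
      field_simp
      ring
  have hw'' : ∀ r ∈ Ioo 0 ρ, deriv (deriv w) r = r ^ 2 * sourceG Λ r (u r) (P r) (M r) - 2 * u r :=
    fun r hr => by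
      obtain ⟨-, h1⟩ := hs2 r hr
      have hpos : 0 < 1 - r * M r := by
        rw [← hAM r hr]
        linarith [hA2 r (hIco r hr)]
      rw [hwP r hr, hAM r hr, hwu r hr, Phi] at h1
      have hr0 := hr.1.ne'
      have hne := hpos.ne'
      have h2 : r ^ 2 * (1 - r * M r) ≠ 0 := mul_ne_zero (pow_ne_zero 2 hr0) hne
      rw [← mul_right_inj' h2]
      rw [add_assoc] at h1
      rw [eq_neg_of_add_eq_zero_left h1]
      simp only [sourceG]
      field_simp
      ring
  have gM := bound (φ := fun r => r * (1 - A r)) (C := K) 2 (by simp)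
    (φ' := fun r => 1 - A r - r * deriv A r)
    (fun r hr => ((hasDerivAt_id r).fun_mul ((dA r hr).const_sub 1)).congr_deriv (by simp; ring))
    (fun r hr => by
      have e : 1 - A r - r * deriv A r = sourceH Λ r (u r) (P r) (M r) * r ^ 2 := by
        have := hr.1.ne'
        rw [hA' r hr, hAM r hr]
        field_simp
        ring
      rw [e, abs_mul, abs_of_pos (pow_pos hr.1 2)]
      exact mul_le_mul_of_nonneg_right (hK' r hr).2 (pow_pos hr.1 2).le)
  have gP := bound (φ := fun r => r * (deriv w r * r + 2 * (1 - w r))) (C := K) 4 (by simp)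
    (φ' := fun r => r ^ 2 * deriv (deriv w) r + 2 * (1 - w r))
    (fun r hr => ((hasDerivAt_id r).fun_mul (((dw1 r hr).fun_mul (hasDerivAt_id r)).fun_add
      (((dw r hr).const_sub 1).const_mul 2))).congr_deriv (by simp; ring))
    (fun r hr => by
      have e : r ^ 2 * deriv (deriv w) r + 2 * (1 - w r) =
          sourceG Λ r (u r) (P r) (M r) * r ^ 4 := by
        rw [hw'' r hr, hwu r hr]
        ring
      rw [e, abs_mul, abs_of_pos (pow_pos hr.1 4)]
      exact mul_le_mul_of_nonneg_right (hK' r hr).1 (pow_pos hr.1 4).le)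
  refine ⟨ρ, hρ, max C₃ K, u, P, M, by simp [hu], by simp [hP], by simp [hM], fun r hr => ?_⟩
  have hr0 := hr.1.ne'
  have hmx : C₃ * r ≤ max C₃ K * r ∧ K * r ≤ max C₃ K * r :=
    ⟨mul_le_mul_of_nonneg_right (le_max_left _ _) hr.1.le,
      mul_le_mul_of_nonneg_right (le_max_right _ _) hr.1.le⟩
  have hI := hIco r hr
  refine ⟨hAM r hr, hwu r hr, ?_, (bu r hr).trans hmx.1, le_trans ?_ hmx.2, le_trans ?_ hmx.2,
    ?_, ?_, ?_⟩
  · rw [← hAM r hr]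
    exact hA2 r hI
  · simp only [hP]
    rw [abs_div, abs_of_pos (pow_pos hr.1 3), div_le_iff₀ (pow_pos hr.1 3)]
    have := gP r hr
    simp only [abs_mul, abs_of_pos hr.1] at this
    refine le_of_mul_le_mul_left (this.trans_eq ?_) hr.1
    ring
  · simp only [hM]
    rw [abs_div, abs_of_pos hr.1, div_le_iff₀ hr.1]
    have := gM r hr
    simp only [abs_mul, abs_of_pos hr.1] at this
    refine le_of_mul_le_mul_left (this.trans_eq ?_) hr.1
    ring
  · refine (((((dw r hI).sub_const 1).fun_add ((hasDerivAt_pow 2 r).const_mul u₀)).fun_div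
      (hasDerivAt_pow 2 r) (pow_ne_zero 2 hr0)).const_sub u₀).congr_deriv ?_
    simp only [hP, Nat.add_one_sub_one, pow_one, Nat.cast_ofNat]
    field_simp
    ring
  · refine ((((dw1 r hI).fun_mul (hasDerivAt_id r)).fun_add
      (((dw r hI).const_sub 1).const_mul 2)).fun_div (hasDerivAt_pow 3 r)
      (pow_ne_zero 3 hr0)).congr_deriv ?_
    simp only [id]
    rw [hw'' r hr, hwP r hr, hwu r hr]
    generalize sourceG Λ r (u r) (P r) (M r) = G
    simp only [Nat.add_one_sub_one, Nat.cast_ofNat]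
    field_simp
    ring
  · refine (((dA r hI).const_sub 1).fun_div (hasDerivAt_id r) hr0).congr_deriv ?_
    simp only [id]
    rw [hA' r hr, hAM r hr]
    generalize sourceH Λ r (u r) (P r) (M r) = H
    field_simp
    ring

/-- Integration of the singular equation, converse to `hasDerivAt_of_eq_avg`. -/
theorem eq_avg_of_hasDerivAt {g φ p : ℝ → ℝ} {ρ : ℝ} (k : ℕ) (hg : ContinuousOn g (Ico 0 ρ))
    (hφ : ContinuousOn φ (Ico 0 ρ)) (h0 : φ 0 = 0)
    (hd : ∀ r ∈ Ioo 0 ρ, HasDerivAt φ (r ^ k * g r) r) (hp : ∀ r ∈ Ioo 0 ρ, φ r = r ^ k * p r)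
    {r : ℝ} (hr : r ∈ Ioo 0 ρ) : p r = r * ∫ s in (0 : ℝ)..1, s ^ k * g (r * s) := by
  have hsub : Icc 0 r ⊆ Ico 0 ρ := Icc_subset_Ico_right hr.2
  have h1 := intervalIntegral.integral_eq_sub_of_hasDerivAt_of_le hr.1.le (hφ.mono hsub)
    (fun x hx => hd x ⟨hx.1, hx.2.trans hr.2⟩) (ContinuousOn.intervalIntegrable (by
      rw [uIcc_of_le hr.1.le]
      exact ((continuous_pow k).continuousOn.mul hg).mono hsub))
  rw [h0, sub_zero, hp r hr] at h1
  have h2 := intervalIntegral.mul_integral_comp_mul_left (a := 0) (b := 1)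
    (f := fun s => s ^ k * g s) r
  rw [mul_zero, mul_one, h1] at h2
  have h3 : r ^ k * p r = r ^ k * (r * ∫ s in (0 : ℝ)..1, s ^ k * g (r * s)) := by
    rw [← h2, mul_left_comm (r ^ k), ← intervalIntegral.integral_const_mul (r ^ k)]
    refine congr_arg (r * ·) (intervalIntegral.integral_congr fun s _ => ?_)
    simp only [mul_pow]
    ring
  exact mul_left_cancel₀ (pow_pos hr.1 k).ne' h3

theorem continuousOn_Ico_of_bound {f : ℝ → ℝ} {C ρ : ℝ} (hb : ∀ r ∈ Ioo 0 ρ, |f r - f 0| ≤ C * r)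
    (hc : ∀ r ∈ Ioo 0 ρ, ContinuousAt f r) : ContinuousOn f (Ico 0 ρ) := by
  intro r hr
  rcases hr.1.eq_or_lt with rfl | h
  · rw [ContinuousWithinAt, tendsto_iff_dist_tendsto_zero]
    refine squeeze_zero' (Eventually.of_forall fun _ => dist_nonneg) (g := fun r => C * r) ?_ ?_
    · filter_upwards [self_mem_nhdsWithin] with x hx
      rcases hx.1.eq_or_lt with rfl | h
      · simp
      · exact hb x ⟨h, hx.2⟩
    · have : Tendsto (fun r : ℝ => C * r) (𝓝 0) (𝓝 (C * 0)) := tendsto_id.const_mul C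
      rw [mul_zero] at this
      exact this.mono_left nhdsWithin_le_nhds
  · exact (hc r ⟨h, hr.2⟩).continuousWithinAt

/-- A smooth solution at the centre agrees with the solution of the integral equations. -/
theorem eventually_eq_profile {Λ u₀ : ℝ} {A w : ℝ → ℝ} (hA : ContDiffAt ℝ ∞ A 0)
    (hw : ContDiffAt ℝ ∞ w 0) (hA0 : A 0 = 1) (hw0 : w 0 = 1) (hw1 : deriv w 0 = 0)
    (hw2 : deriv (deriv w) 0 = -(2 * u₀))
    (heq : ∀ᶠ r in 𝓝[>] (0 : ℝ), RadialEquationsAt Λ A w r)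
    {Ψ : ℝ × ℝ × ℝ → Path₁ × Path₁ × Path₁}
    (hΨ : ∀ᶠ v in 𝓝 ((0, Λ, u₀), basePoint u₀), defect v = 0 → Ψ v.1 = v.2) :
    ∀ᶠ r in 𝓝[>] (0 : ℝ), A r = 1 - r * (Ψ (r, Λ, u₀)).2.2 1 ∧
      w r = 1 - r ^ 2 * (Ψ (r, Λ, u₀)).1 1 := by
  obtain ⟨ρ, hρ, C, u, P, M, u0, P0, M0, h⟩ :=
    exists_centre_expansion hA hw hA0 hw0 hw1 hw2 heq
  obtain ⟨η, hη, hΨ⟩ := Metric.eventually_nhds_iff.1 hΨ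
  have cu : ContinuousOn u (Ico 0 ρ) := continuousOn_Ico_of_bound
    (fun r hr => by rw [u0]; exact (h r hr).2.2.2.1)
    fun r hr => (h r hr).2.2.2.2.2.2.1.continuousAt
  have cP : ContinuousOn P (Ico 0 ρ) := continuousOn_Ico_of_bound
    (fun r hr => by rw [P0, sub_zero]; exact (h r hr).2.2.2.2.1)
    fun r hr => (h r hr).2.2.2.2.2.2.2.1.continuousAt
  have cM : ContinuousOn M (Ico 0 ρ) := continuousOn_Ico_of_bound
    (fun r hr => by rw [M0, sub_zero]; exact (h r hr).2.2.2.2.2.1)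
    fun r hr => (h r hr).2.2.2.2.2.2.2.2.continuousAt
  have cG : ContinuousOn (fun r => sourceG Λ r (u r) (P r) (M r)) (Ico 0 ρ) := by
    unfold sourceG
    refine ContinuousOn.mul (by fun_prop) (ContinuousOn.inv₀ (by fun_prop) fun r hr => ?_)
    rcases hr.1.eq_or_lt with rfl | hr0
    · simp
    · have := (h r ⟨hr0, hr.2⟩).2.2.1
      linarith
  have cH : ContinuousOn (fun r => sourceH Λ r (u r) (P r) (M r)) (Ico 0 ρ) := by
    unfold sourceH
    fun_prop
  have iu : ∀ r ∈ Ico 0 ρ, u r = u₀ - r * ∫ s in (0 : ℝ)..1, s ^ 0 * P (r * s) := fun r hr => by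
    rcases hr.1.eq_or_lt with rfl | hr0
    · simp [u0]
    · have := eq_avg_of_hasDerivAt (φ := fun r => u₀ - u r) (p := fun r => u₀ - u r) 0 cP
        (continuousOn_const.sub cu) (by simp [u0])
        (fun r hr => ((h r hr).2.2.2.2.2.2.1.const_sub u₀).congr_deriv (by simp)) (by simp)
        ⟨hr0, hr.2⟩
      rw [← this]
      ring
  have iP : ∀ r ∈ Ico 0 ρ, P r = r * ∫ s in (0 : ℝ)..1, s ^ 4 *
      sourceG Λ (r * s) (u (r * s)) (P (r * s)) (M (r * s)) := fun r hr => by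
    rcases hr.1.eq_or_lt with rfl | hr0
    · simp [P0]
    · refine eq_avg_of_hasDerivAt (g := fun r => sourceG Λ r (u r) (P r) (M r))
        (φ := fun r => r ^ 4 * P r) 4 cG (by fun_prop) (by simp) (fun r hr => ?_)
        (fun r hr => rfl) ⟨hr0, hr.2⟩
      refine ((hasDerivAt_pow 4 r).fun_mul (h r hr).2.2.2.2.2.2.2.1).congr_deriv ?_
      have := hr.1.ne'
      simp only [Nat.add_one_sub_one, Nat.cast_ofNat]
      field_simp
      ring
  have iM : ∀ r ∈ Ico 0 ρ, M r = r * ∫ s in (0 : ℝ)..1, s ^ 2 *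
      sourceH Λ (r * s) (u (r * s)) (P (r * s)) (M (r * s)) := fun r hr => by
    rcases hr.1.eq_or_lt with rfl | hr0
    · simp [M0]
    · refine eq_avg_of_hasDerivAt (g := fun r => sourceH Λ r (u r) (P r) (M r))
        (φ := fun r => r ^ 2 * M r) 2 cH (by fun_prop) (by simp) (fun r hr => ?_)
        (fun r hr => rfl) ⟨hr0, hr.2⟩
      refine ((hasDerivAt_pow 2 r).fun_mul (h r hr).2.2.2.2.2.2.2.2).congr_deriv ?_
      have := hr.1.ne'
      simp only [Nat.add_one_sub_one, Nat.cast_ofNat, pow_one]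
      field_simp
      ring
  have hsmall : ∀ᶠ r : ℝ in 𝓝[>] 0, r < η ∧ C * r < η := by
    have h1 : ∀ᶠ r : ℝ in 𝓝 0, r < η ∧ C * r < η :=
      (gt_mem_nhds hη).and ((continuous_const.mul continuous_id).continuousAt.eventually
        (gt_mem_nhds (show C * id (0 : ℝ) < η by simpa using hη)))
    exact h1.filter_mono nhdsWithin_le_nhds
  filter_upwards [hsmall, Ioo_mem_nhdsGT hρ] with ε hε hερ
  have hmem : ∀ s : ℝ, s ∈ Icc (0 : ℝ) 1 → ε * s ∈ Ico 0 ρ := fun s hs =>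
    ⟨mul_nonneg hερ.1.le hs.1, (mul_le_of_le_one_right hερ.1.le hs.2).trans_lt hερ.2⟩
  have hC : 0 ≤ C := by
    by_contra! hC
    exact absurd ((abs_nonneg _).trans (h ε hερ).2.2.2.2.1)
      (not_le.2 (mul_neg_of_neg_of_pos hC hερ.1))
  let path : (f : ℝ → ℝ) → ContinuousOn f (Ico 0 ρ) → Path₁ := fun f hf =>
    ⟨fun s => f (ε * s), hf.comp_continuous (by fun_prop) fun s => hmem s s.2⟩
  have hdist : ∀ (f : ℝ → ℝ) (hf : ContinuousOn f (Ico 0 ρ)) (c : ℝ), f 0 = c →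
      (∀ r ∈ Ioo 0 ρ, |f r - c| ≤ C * r) → dist (path f hf) (c • 1) < η := by
    intro f hf c h0 hb
    refine lt_of_le_of_lt ((ContinuousMap.dist_le (mul_nonneg hC hερ.1.le)).2 fun s => ?_) hε.2
    have e : dist (path f hf s) ((c • 1 : Path₁) s) = |f (ε * s) - c| := by
      simp [path, Real.dist_eq]
    rw [e]
    rcases (hmem s s.2).1.eq_or_lt with h1 | h1
    · rw [← h1, h0]
      simpa using mul_nonneg hC hερ.1.le
    · exact (hb _ ⟨h1, (hmem s s.2).2⟩).trans
        (mul_le_mul_of_nonneg_left (mul_le_of_le_one_right hερ.1.le s.2.2) hC)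
  have hext : ∀ (f : ℝ → ℝ) (hf : ContinuousOn f (Ico 0 ρ)) (s : unitInterval) (x : ℝ),
      x ∈ uIcc (0 : ℝ) 1 → EYM.ext (path f hf) (s * x) = f (ε * (s * x)) := fun f hf s x hx => by
    rw [uIcc_of_le zero_le_one] at hx
    rw [ext_of_mem _ ⟨mul_nonneg s.2.1 hx.1, mul_le_one₀ s.2.2 hx.1 hx.2⟩]
    rfl
  -- The three functions on [0, ε], rescaled to the unit interval, are within C ε of the base point
  -- and solve the integral equations, so uniqueness applies.
  have key : Ψ (ε, Λ, u₀) = (path u cu, path P cP, path M cM) := by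
    refine hΨ (y := ((ε, Λ, u₀), _)) ?_ ?_
    · rw [Prod.dist_eq]
      refine max_lt ?_ ?_
      · rw [Prod.dist_eq]
        refine max_lt ?_ (by simpa using hη)
        simpa [Real.dist_eq, abs_of_pos hερ.1] using hε.1
      · rw [basePoint, Prod.dist_eq, Prod.dist_eq]
        refine max_lt (hdist u cu u₀ u0 fun r hr => (h r hr).2.2.2.1) (max_lt ?_ ?_)
        · have := hdist P cP 0 P0 fun r hr => by
            rw [sub_zero]
            exact (h r hr).2.2.2.2.1
          rwa [zero_smul] at this
        · have := hdist M cM 0 M0 fun r hr => by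
            rw [sub_zero]
            exact (h r hr).2.2.2.2.2.1
          rwa [zero_smul] at this
    · refine (defect_eq_zero_iff fun s => ?_).2 fun s => ⟨?_, ?_, ?_⟩
      · change 1 - ε * s * M (ε * s) ≠ 0
        rcases (hmem s s.2).1.eq_or_lt with h1 | h1
        · simp [← h1]
        · have := (h _ ⟨h1, (hmem s s.2).2⟩).2.2.1
          linarith
      · refine (iu _ (hmem s s.2)).trans ?_
        congr 2
        refine intervalIntegral.integral_congr fun x hx => ?_
        simp only [hext P cP s x hx, mul_assoc]
      · refine (iP _ (hmem s s.2)).trans ?_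
        congr 1
        refine intervalIntegral.integral_congr fun x hx => ?_
        simp only [hext u cu s x hx, hext P cP s x hx, hext M cM s x hx, mul_assoc]
      · refine (iM _ (hmem s s.2)).trans ?_
        congr 1
        refine intervalIntegral.integral_congr fun x hx => ?_
        simp only [hext u cu s x hx, hext P cP s x hx, hext M cM s x hx, mul_assoc]
  have e1 : (Ψ (ε, Λ, u₀)).1 1 = u ε := by
    rw [key]
    exact congr_arg u (mul_one ε)
  have e3 : (Ψ (ε, Λ, u₀)).2.2 1 = M ε := by
    rw [key]
    exact congr_arg M (mul_one ε)
  rw [e1, e3]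
  exact ⟨(h ε hερ).1, (h ε hερ).2.1⟩

/-! ### Existence, uniqueness up to translation, and dependence on the parameters. -/

/-- The parameter is 2 u₀ because w = 1 - r² u has second derivative -2 u(0) at the centre. -/
theorem Profile.isSolution {Λ u₀ δ : ℝ} {u P M ρ : ℝ → ℝ} (h : Profile Λ u₀ δ u P M) (hδ : 0 < δ)
    (hρ : Tendsto ρ atBot (𝓝[>] 0)) {T : ℝ}
    (hT : ∀ τ < T, 0 < ρ τ ∧ ρ τ < δ ∧ HasDerivAt ρ (ρ τ * √(1 - ρ τ * M (ρ τ))) τ) :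
    IsSolution Λ (2 * u₀) (radialTrajectory Λ (fun r => 1 - r * M r) (fun r => 1 - r ^ 2 * u r)
      (fun r => r * (r * P r - 2 * u r)) ρ) T := by
  have hR := h.radialSolution
  obtain ⟨su, sP, sM⟩ := h.smooth 0 (by simpa using hδ)
  have hu1 : ∀ᶠ r in 𝓝 (0 : ℝ), HasDerivAt (fun r => 1 - r ^ 2 * u r)
      (-(2 * r * u r + r ^ 2 * deriv u r)) r := by
    filter_upwards [eventually_hasDerivAt (su.of_le le_top)] with r hr
    exact (((hasDerivAt_pow 2 r).fun_mul hr).const_sub 1).congr_deriv (by simp)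
  have hu2 : HasDerivAt (fun r => -(2 * r * u r + r ^ 2 * deriv u r)) (-(2 * u₀)) 0 := by
    have h1 := (eventually_hasDerivAt (su.of_le le_top)).self_of_nhds
    have h2 := (eventually_hasDerivAt (contDiffAt_deriv (su.of_le le_top))).self_of_nhds
    refine (((((hasDerivAt_id (0 : ℝ)).const_mul 2).fun_mul h1).fun_add
      ((hasDerivAt_pow 2 (0 : ℝ)).fun_mul h2)).fun_neg).congr_deriv ?_
    simp [h.zero.1]
  refine ⟨EReal.bot_lt_coe T, hR.solvesSystem hT, fun r => 1 - r * M r, fun r => 1 - r ^ 2 * u r,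
    ?_, ?_, ?_, ?_, ?_, ?_, ?_, hρ, ?_⟩
  · exact contDiffAt_const.sub (contDiffAt_id.mul (sM.of_le le_top))
  · exact contDiffAt_const.sub ((contDiffAt_id.pow 2).mul (su.of_le le_top))
  · simp
  · simp
  · rw [hu1.self_of_nhds.deriv]
    simp
  · have e : deriv (fun r => 1 - r ^ 2 * u r) =ᶠ[𝓝 0]
        fun r => -(2 * r * u r + r ^ 2 * deriv u r) := hu1.mono fun r hr => hr.deriv
    rw [e.deriv_eq, hu2.deriv]
  · filter_upwards [Ioo_mem_nhdsGT hδ] with r hr using hR.radialEquationsAt hr.1 hr.2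
  · filter_upwards [eventually_lt_atBot T] with τ hτ
    obtain ⟨h1, h2, -⟩ := hT τ hτ
    have e := (hR.dw _ h1 h2).deriv
    refine ⟨rfl, rfl, ?_, ?_⟩ <;>
      (simp only [radialTrajectory]; rw [e])

/-- The state of a solution near the centre, in terms of the radius and of `u`, `P`, `M`. -/
noncomputable def centreState (Λ r u P M : ℝ) : Fin 7 → ℝ :=
  ![Λ, r, r⁻¹, 1 - r ^ 2 * u, √(1 - r * M), √(1 - r * M) * (r * (r * P - 2 * u)),
    (Phi Λ r (1 - r * M) (1 - r ^ 2 * u) + 2 * (1 - r * M) * (r * (r * P - 2 * u)) ^ 2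
      + 2 * √(1 - r * M) ^ 2) / (2 * √(1 - r * M))]

/-- Near the centre the whole state is a function of the radius and the parameters. Two solutions
with equal parameters therefore pass through the same state where their radii agree. -/
theorem IsSolution.eventually_state_eq {Λ u₀ δ : ℝ} {y : Trajectory} {T : EReal}
    (h : IsSolution Λ (2 * u₀) y T) {Ψ : ℝ × ℝ × ℝ → Path₁ × Path₁ × Path₁} (hδ : 0 < δ)
    (hP : Profile Λ u₀ δ (fun r => (Ψ (r, Λ, u₀)).1 1)
      (fun r => (Ψ (r, Λ, u₀)).2.1 1) (fun r => (Ψ (r, Λ, u₀)).2.2 1))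
    (hΨ : ∀ᶠ v in 𝓝 ((0, Λ, u₀), basePoint u₀), defect v = 0 → Ψ v.1 = v.2) :
    ∀ᶠ τ : ℝ in atBot, (τ : EReal) < T ∧ y.r τ ∈ Ioo 0 δ ∧ y.state Λ τ = centreState Λ (y.r τ)
      ((Ψ (y.r τ, Λ, u₀)).1 1) ((Ψ (y.r τ, Λ, u₀)).2.1 1) ((Ψ (y.r τ, Λ, u₀)).2.2 1) := by
  obtain ⟨A, w, h1, h2, h3, h4, h5, h6, h7, h8, h9⟩ := h.origin
  obtain ⟨ε, hε, hev⟩ := mem_nhdsGT_iff_exists_Ioo_subset.1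
    (eventually_eq_profile h1 h2 h3 h4 h5 h6 h7 hΨ)
  have hε' : 0 < min ε δ := lt_min hε hδ
  filter_upwards [eventually_atBot_coe_lt h.nonempty, h9, h8 (Ioo_mem_nhdsGT hε')] with τ hτ h9 hr
  have hr : y.r τ ∈ Ioo 0 (min ε δ) := hr
  have hrδ : y.r τ ∈ Ioo 0 δ := ⟨hr.1, hr.2.trans_le (min_le_right _ _)⟩
  have hrε : y.r τ ∈ Ioo 0 ε := ⟨hr.1, hr.2.trans_le (min_le_left _ _)⟩
  refine ⟨hτ, hrδ, ?_⟩
  obtain ⟨eN, ew, eU, eκ⟩ := h9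
  obtain ⟨e1, e2⟩ := hev hrε
  have e3 : deriv w (y.r τ) = y.r τ * (y.r τ * (Ψ (y.r τ, Λ, u₀)).2.1 1 -
      2 * (Ψ (y.r τ, Λ, u₀)).1 1) := by
    have e : w =ᶠ[𝓝 (y.r τ)] fun r => 1 - r ^ 2 * (Ψ (r, Λ, u₀)).1 1 := by
      filter_upwards [Ioo_mem_nhds hrε.1 hrε.2] with r hr using (hev hr).2
    rw [e.deriv_eq, (hP.radialSolution.dw _ hrδ.1 hrδ.2).deriv]
  rw [e1] at eN
  rw [e2] at ew
  rw [e3] at eU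
  rw [e1, e2, e3] at eκ
  rw [eN] at eU eκ
  rw [Trajectory.state, centreState, ew, eU, eκ, eN]

/-- The trajectory with its parameter translated by `s`. -/
def Trajectory.shift (y : Trajectory) (s : ℝ) : Trajectory :=
  ⟨fun τ => y.r (τ + s), fun τ => y.w (τ + s), fun τ => y.N (τ + s), fun τ => y.U (τ + s),
    fun τ => y.κ (τ + s)⟩

theorem IsSolution.shift {Λ lam s : ℝ} {y : Trajectory} {T T' : EReal} (h : IsSolution Λ lam y T)
    (hT' : ⊥ < T') (hT : ∀ τ : ℝ, (τ : EReal) < T' → ((τ + s : ℝ) : EReal) < T) :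
    IsSolution Λ lam (y.shift s) T' := by
  have hs : Tendsto (fun τ : ℝ => τ + s) atBot atBot := tendsto_atBot_add_const_right _ s tendsto_id
  refine ⟨hT', fun τ hτ => ?_, ?_⟩
  · obtain ⟨h1, h2, h3, h4, h5, h6⟩ := h.solves (τ + s) (hT τ hτ)
    exact ⟨h1, h2.comp_add_const τ s, h3.comp_add_const τ s, h4.comp_add_const τ s,
      h5.comp_add_const τ s, h6.comp_add_const τ s⟩
  · obtain ⟨A, w, h1, h2, h3, h4, h5, h6, h7, h8, h9⟩ := h.origin
    exact ⟨A, w, h1, h2, h3, h4, h5, h6, h7, h8.comp hs, hs.eventually h9⟩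

theorem exists_le_eq {f : ℝ → ℝ} {σ c : ℝ} (hc : ∀ τ ≤ σ, ContinuousAt f τ)
    (hf : Tendsto f atBot (𝓝[>] 0)) (h0 : 0 < c) (hcσ : c ≤ f σ) : ∃ τ ≤ σ, f τ = c := by
  obtain ⟨τ', h1, h2⟩ := ((eventually_le_atBot σ).and
    ((hf.mono_right nhdsWithin_le_nhds).eventually (gt_mem_nhds h0))).exists
  obtain ⟨τ, hτ, h⟩ := intermediate_value_Icc h1
    (fun x hx => (hc x hx.2).continuousWithinAt) ⟨h2.le, hcσ⟩
  exact ⟨τ, hτ.2, h⟩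

/-- Two solutions with the same parameters agree up to a translation. -/
theorem IsSolution.exists_shift {Λ lam : ℝ} {y₁ y₂ : Trajectory} {T₁ T₂ : EReal}
    (h₁ : IsSolution Λ lam y₁ T₁) (h₂ : IsSolution Λ lam y₂ T₂) : ∃ s a : ℝ, (a : EReal) < T₁ ∧
      ((a + s : ℝ) : EReal) < T₂ ∧ (y₂.shift s).state Λ a = y₁.state Λ a := by
  obtain ⟨δ, hδ, Ψ, -, hP, hΨ⟩ := exists_profile Λ (lam / 2)
  have hself : dist (Λ, lam / 2) (Λ, lam / 2) < δ := by rwa [dist_self]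
  have e : 2 * (lam / 2) = lam := by ring
  rw [← e] at h₁ h₂
  obtain ⟨σ₁, hσ₁⟩ := eventually_atBot.1 (h₁.eventually_state_eq hδ (hP _ _ hself) (hΨ _ _ hself))
  obtain ⟨σ₂, hσ₂⟩ := eventually_atBot.1 (h₂.eventually_state_eq hδ (hP _ _ hself) (hΨ _ _ hself))
  -- Both solutions attain this small radius, and there their states coincide; the difference of the
  -- two times is the translation.
  have hc₀ : 0 < min (y₁.r σ₁) (y₂.r σ₂) := lt_min (hσ₁ _ le_rfl).2.1.1 (hσ₂ _ le_rfl).2.1.1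
  have hr₁ : Tendsto y₁.r atBot (𝓝[>] 0) := by
    obtain ⟨_, _, _, _, _, _, _, _, _, h, _⟩ := h₁.origin
    exact h
  have hr₂ : Tendsto y₂.r atBot (𝓝[>] 0) := by
    obtain ⟨_, _, _, _, _, _, _, _, _, h, _⟩ := h₂.origin
    exact h
  obtain ⟨a, ha, ea⟩ := exists_le_eq
    (fun τ hτ => (h₁.solves τ (hσ₁ τ hτ).1).2.1.continuousAt) hr₁ hc₀ (min_le_left _ _)
  obtain ⟨b, hb, eb⟩ := exists_le_eq
    (fun τ hτ => (h₂.solves τ (hσ₂ τ hτ).1).2.1.continuousAt) hr₂ hc₀ (min_le_right _ _)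
  have hab : a + (b - a) = b := by ring
  refine ⟨b - a, a, (hσ₁ a ha).1, by rw [hab]; exact (hσ₂ b hb).1, ?_⟩
  have h3 : (y₂.shift (b - a)).state Λ a = y₂.state Λ b := by
    simp only [Trajectory.state, Trajectory.shift, hab]
  rw [h3, (hσ₁ a ha).2.2, (hσ₂ b hb).2.2, ea, eb]

/-- By uniqueness up to translation and by maximality, any solution is a translated piece of the
maximal one. In particular the number of zeros of a maximal solution depends only on the parameters.
-/
theorem zeros_le_of_isSolution {Λ lam : ℝ} {y₁ y₂ : Trajectory} {T₁ T₂ : EReal}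
    (h₁ : IsMaximalSolution Λ lam y₁ T₁) (h₂ : IsSolution Λ lam y₂ T₂) :
    zeros y₂ T₂ ≤ zeros y₁ T₁ := by
  obtain ⟨s, a, ha₁, ha₂, heq⟩ := h₁.toIsSolution.exists_shift h₂
  have hiff : ∀ τ : ℝ, (τ : EReal) < T₂ - s ↔ ((τ + s : ℝ) : EReal) < T₂ := fun τ => by
    rw [EReal.lt_sub_iff_add_lt (by simp) (by simp), EReal.coe_add]
  have hsol : IsSolution Λ lam (y₂.shift s) (T₂ - s) :=
    h₂.shift ((EReal.bot_lt_coe a).trans ((hiff a).2 ha₂)) fun τ hτ => (hiff τ).1 hτ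
  have hag : ∀ τ : ℝ, (τ : EReal) < T₁ → (τ : EReal) < T₂ - s →
      (y₂.shift s).state Λ τ = y₁.state Λ τ := fun τ h3 h4 =>
    SolvesSystem.state_eq hsol.solves h₁.solves ((hiff a).2 ha₂) ha₁ heq h4 h3
  have hle : T₂ - s ≤ T₁ := by
    by_contra! hlt
    exact absurd (h₁.maximal _ _ hsol fun τ hτ => components_eq (hag τ hτ (hτ.trans hlt)))
      (not_le.2 hlt)
  have hmaps : (fun τ => τ - s) '' {τ : ℝ | (τ : EReal) < T₂ ∧ y₂.w τ = 0} ⊆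
      {τ : ℝ | (τ : EReal) < T₁ ∧ y₁.w τ = 0} := by
    rintro _ ⟨τ, ⟨h3, h4⟩, rfl⟩
    have h5 : ((τ - s : ℝ) : EReal) < T₂ - s := (hiff _).2 (by rwa [sub_add_cancel])
    have h6 := h5.trans_le hle
    refine ⟨h6, ?_⟩
    rw [← (components_eq (hag _ h6 h5)).2.1]
    simpa [Trajectory.shift] using h4
  rw [zeros, zeros, ← (sub_left_injective (b := s)).encard_image]
  exact encard_le_encard hmaps

/-- Near the centre, the maximal solutions depend continuously on the parameters. -/
theorem IsSolution.eventually_nearby {Λ lam : ℝ} {y : Trajectory} {T : EReal}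
    (h : IsSolution Λ lam y T) : ∃ τ₁ : ℝ, (τ₁ : EReal) < T ∧ (∀ τ ≤ τ₁, 1 / 2 ≤ y.w τ) ∧
      ∀ O ∈ 𝓝 (y.state Λ τ₁), ∀ᶠ q in 𝓝 (Λ, lam), ∃ y' T', IsMaximalSolution q.1 q.2 y' T' ∧
        (τ₁ : EReal) < T' ∧ (∀ τ ≤ τ₁, 1 / 2 ≤ y'.w τ) ∧ y'.state q.1 τ₁ ∈ O := by
  obtain ⟨δ, hδ, Ψ, hsm, hP, hΨ⟩ := exists_profile Λ (lam / 2)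
  have hself : dist (Λ, lam / 2) (Λ, lam / 2) < δ := by rwa [dist_self]
  have e2 : ∀ x : ℝ, 2 * (x / 2) = x := fun x => by ring
  rw [← e2 lam] at h
  obtain ⟨τ₁, hτ₁⟩ := eventually_atBot.1
    (h.eventually_state_eq hδ (hP _ _ hself) (hΨ _ _ hself))
  have hw : ∀ {Λ' u'}, dist (Λ', u') (Λ, lam / 2) < δ → ∀ r ∈ Ioo 0 δ,
      1 / 2 ≤ 1 - r ^ 2 * (Ψ (r, Λ', u')).1 1 := fun hq r hr => by
    have := (abs_le.1 ((hP _ _ hq).small r (by rw [abs_of_pos hr.1]; exact hr.2)).2).2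
    linarith
  refine ⟨τ₁, (hτ₁ _ le_rfl).1, fun τ hτ => ?_, fun O hO => ?_⟩
  · have h1 := congr_fun (hτ₁ τ hτ).2.2 3
    have h2 : y.w τ = 1 - y.r τ ^ 2 * (Ψ (y.r τ, Λ, lam / 2)).1 1 := h1
    rw [h2]
    exact hw hself _ (hτ₁ τ hτ).2.1
  obtain ⟨-, ⟨hr0, hrδ⟩, hst⟩ := hτ₁ τ₁ le_rfl
  set r₁ := y.r τ₁
  rw [hst] at hO
  have hcont : ContinuousAt (fun q : ℝ × ℝ => centreState q.1 r₁ ((Ψ (r₁, q.1, q.2 / 2)).1 1)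
      ((Ψ (r₁, q.1, q.2 / 2)).2.1 1) ((Ψ (r₁, q.1, q.2 / 2)).2.2 1)) (Λ, lam) := by
    have hΨc : ContinuousAt (fun q : ℝ × ℝ => Ψ (r₁, q.1, q.2 / 2)) (Λ, lam) := by
      refine ContinuousAt.comp (g := Ψ) (f := fun q : ℝ × ℝ => (r₁, q.1, q.2 / 2))
        (hsm _ ?_).continuousAt (Continuous.continuousAt (by fun_prop))
      rw [Prod.dist_eq]
      refine max_lt ?_ hself
      simpa [Real.dist_eq, abs_of_pos hr0] using hrδ
    have hev : Continuous fun f : Path₁ => f 1 := continuous_eval_const 1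
    have c1 : ContinuousAt (fun q : ℝ × ℝ => (Ψ (r₁, q.1, q.2 / 2)).1 1) (Λ, lam) :=
      hev.continuousAt.comp hΨc.fst
    have c2 : ContinuousAt (fun q : ℝ × ℝ => (Ψ (r₁, q.1, q.2 / 2)).2.1 1) (Λ, lam) :=
      hev.continuousAt.comp hΨc.snd.fst
    have c3 : ContinuousAt (fun q : ℝ × ℝ => (Ψ (r₁, q.1, q.2 / 2)).2.2 1) (Λ, lam) :=
      hev.continuousAt.comp hΨc.snd.snd
    have hpos : √(1 - r₁ * (Ψ (r₁, Λ, lam / 2)).2.2 1) ≠ 0 :=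
      (Real.sqrt_pos.2 ((hP _ _ hself).radialSolution.pos _ hr0 hrδ)).ne'
    have hr' := hr0.ne'
    refine continuousAt_pi.2 fun i => ?_
    fin_cases i
    · exact continuousAt_fst
    · exact continuousAt_const
    · exact continuousAt_const
    · simp only [centreState]
      exact (show ContinuousAt (fun q : ℝ × ℝ => 1 - r₁ ^ 2 * (Ψ (r₁, q.1, q.2 / 2)).1 1) (Λ, lam)
        by fun_prop)
    · exact (show ContinuousAt (fun q : ℝ × ℝ => √(1 - r₁ * (Ψ (r₁, q.1, q.2 / 2)).2.2 1))
        (Λ, lam) by fun_prop)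
    · exact (show ContinuousAt (fun q : ℝ × ℝ => √(1 - r₁ * (Ψ (r₁, q.1, q.2 / 2)).2.2 1) *
        (r₁ * (r₁ * (Ψ (r₁, q.1, q.2 / 2)).2.1 1 - 2 * (Ψ (r₁, q.1, q.2 / 2)).1 1)))
        (Λ, lam) by fun_prop)
    · refine ContinuousAt.div ?_ ?_ (mul_ne_zero two_ne_zero hpos)
      · unfold Phi
        fun_prop
      · fun_prop
  have hnear : ∀ᶠ q : ℝ × ℝ in 𝓝 (Λ, lam), dist (q.1, q.2 / 2) (Λ, lam / 2) < δ := by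
    have : ContinuousAt (fun q : ℝ × ℝ => (q.1, q.2 / 2)) (Λ, lam) :=
      Continuous.continuousAt (by fun_prop)
    exact this.eventually (Metric.ball_mem_nhds _ hδ)
  filter_upwards [hcont.eventually hO, hnear] with q hq hdist
  have hPq := hP _ _ hdist
  -- The translation is fixed by requiring radius r₁ at time τ₁ for every q, so the state at τ₁ is
  -- continuous in q.
  obtain ⟨ρ, T₁, hT₁, hρ1, hρ0, hρ⟩ := exists_radius
    (A := fun r => 1 - r * (Ψ (r, q.1, q.2 / 2)).2.2 1) hr0 hrδ
    (fun r hr => by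
      have h1 := (hPq.smooth r (by rw [abs_of_pos hr.1]; exact hr.2)).2.2.continuousAt
      exact (continuousAt_const.sub (continuousAt_id.mul h1)).continuousWithinAt)
    (fun r hr => by
      have h1 := abs_le.1 (hPq.small r (by rw [abs_of_pos hr.1]; exact hr.2)).1
      constructor <;> linarith [h1.1, h1.2]) τ₁
  have hsol := hPq.isSolution hδ hρ0 hρ
  rw [e2] at hsol
  obtain ⟨y', T', hTT', hag, hmax⟩ := hsol.exists_maximal
  have hlt : (τ₁ : EReal) < (T₁ : EReal) := EReal.coe_lt_coe_iff.2 hT₁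
  refine ⟨y', T', hmax, hlt.trans_le hTT', fun τ hτ => ?_, ?_⟩
  · have hτ' : τ < T₁ := hτ.trans_lt hT₁
    rw [(hag τ (EReal.coe_lt_coe_iff.2 hτ')).2.1]
    exact hw hdist _ ⟨(hρ τ hτ').1, (hρ τ hτ').2.1⟩
  · rw [hag.state_eq _ hlt]
    have e : (radialTrajectory q.1 (fun r => 1 - r * (Ψ (r, q.1, q.2 / 2)).2.2 1)
        (fun r => 1 - r ^ 2 * (Ψ (r, q.1, q.2 / 2)).1 1)
        (fun r => r * (r * (Ψ (r, q.1, q.2 / 2)).2.1 1 - 2 * (Ψ (r, q.1, q.2 / 2)).1 1))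
        ρ).state q.1 τ₁ = centreState q.1 r₁ ((Ψ (r₁, q.1, q.2 / 2)).1 1)
      ((Ψ (r₁, q.1, q.2 / 2)).2.1 1) ((Ψ (r₁, q.1, q.2 / 2)).2.2 1) := by
      simp only [Trajectory.state, radialTrajectory, centreState, hρ1]
    rw [e]
    exact hq

/-! ### Stability of the number of zeros. -/

/-- The number of zeros of a function with simple zeros on a compact interval is stable under
perturbations that are small together with their derivatives. -/
theorem exists_encard_zeros_eq {f f' : ℝ → ℝ} {a b : ℝ} (ha : f a ≠ 0) (hb : f b ≠ 0)
    (hd : ∀ τ ∈ Icc a b, HasDerivAt f (f' τ) τ) (hc : ContinuousOn f' (Icc a b))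
    (hs : ∀ τ ∈ Icc a b, f τ = 0 → f' τ ≠ 0) (hfin : {τ ∈ Icc a b | f τ = 0}.Finite) :
    ∃ ε > 0, ∀ g g' : ℝ → ℝ, (∀ τ ∈ Icc a b, HasDerivAt g (g' τ) τ) →
      (∀ τ ∈ Icc a b, |g τ - f τ| < ε ∧ |g' τ - f' τ| < ε) →
      {τ ∈ Icc a b | g τ = 0}.encard = {τ ∈ Icc a b | f τ = 0}.encard := by
  set Z := {τ ∈ Icc a b | f τ = 0} with hZ
  have hfc : ContinuousOn f (Icc a b) := fun τ hτ => (hd τ hτ).continuousAt.continuousWithinAt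
  have hZI : ∀ z ∈ Z, z ∈ Ioo a b := fun z hz =>
    ⟨lt_of_le_of_ne hz.1.1 fun h => ha (h ▸ hz.2), lt_of_le_of_ne hz.1.2 fun h => hb (h ▸ hz.2)⟩
  have hlocal : ∀ z ∈ Z, ∀ᶠ η in 𝓝[>] (0 : ℝ), ∀ x ∈ Icc (z - η) (z + η),
      x ∈ Ioo a b ∧ 0 < f' z * f' x := fun z hz => by
    have hzI := hZI z hz
    have h1 : ∀ᶠ x in 𝓝 z, x ∈ Ioo a b ∧ 0 < f' z * f' x := by
      have h3 : ∀ᶠ x in 𝓝 z, x ∈ Ioo a b := Ioo_mem_nhds hzI.1 hzI.2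
      refine h3.and ?_
      have h2 : ContinuousAt (fun x => f' z * f' x) z :=
        continuousAt_const.mul (hc.continuousAt (Icc_mem_nhds hzI.1 hzI.2))
      exact h2.eventually (lt_mem_nhds (mul_self_pos.2 (hs z hz.1 hz.2)))
    obtain ⟨r, hr, h⟩ := Metric.eventually_nhds_iff.1 h1
    filter_upwards [Ioo_mem_nhdsGT hr] with η hη x hx
    refine h ?_
    rw [Real.dist_eq, abs_lt]
    constructor <;> linarith [hx.1, hx.2, hη.2]
  have hsep : ∀ z ∈ Z, ∀ z' ∈ Z, ∀ᶠ η in 𝓝[>] (0 : ℝ), z ≠ z' → 2 * η < |z - z'| :=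
    fun z _ z' _ => by
      by_cases h : z = z'
      · exact Eventually.of_forall fun η hη => absurd h hη
      · have h1 : 0 < |z - z'| / 2 := half_pos (abs_pos.2 (sub_ne_zero.2 h))
        filter_upwards [Ioo_mem_nhdsGT h1] with η hη _
        linarith [hη.2]
  -- η isolates the zeros: the intervals [z - η, z + η] are disjoint, and on each of them f' keeps
  -- the sign of f'(z).
  obtain ⟨η, hη, hη1, hη2⟩ := ((eventually_mem_nhdsWithin (a := (0 : ℝ)) (s := Ioi 0)).and
    (((eventually_all_finite hfin).2 hlocal).and ((eventually_all_finite hfin).2 fun z hz =>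
      (eventually_all_finite hfin).2 (hsep z hz)))).exists
  have hη : 0 < η := hη
  set O : Set ℝ := ⋃ z ∈ Z, Ioo (z - η) (z + η)
  set K : Set ℝ := Icc a b \ O
  have hK : IsCompact K := isCompact_Icc.diff (isOpen_biUnion fun z _ => isOpen_Ioo)
  set J : Set ℝ := ⋃ z ∈ Z, Icc (z - η) (z + η)
  have hJ : IsCompact J := hfin.isCompact_biUnion fun z _ => isCompact_Icc
  have hJab : J ⊆ Icc a b := iUnion₂_subset fun z hz x hx => Ioo_subset_Icc_self (hη1 z hz x hx).1
  obtain ⟨m, hm, hmK⟩ : ∃ m > 0, ∀ x ∈ K, m ≤ |f x| := by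
    rcases K.eq_empty_or_nonempty with h | h
    · exact ⟨1, one_pos, fun x hx => by simp [h] at hx⟩
    · obtain ⟨x, hx, hmin⟩ := hK.exists_isMinOn h (hfc.mono sdiff_subset).abs
      refine ⟨|f x|, abs_pos.2 fun h0 => hx.2 ?_, fun y hy => hmin hy⟩
      exact mem_iUnion₂.2 ⟨x, ⟨hx.1, h0⟩, by linarith, by linarith⟩
  obtain ⟨c, hc0, hcJ⟩ : ∃ c > 0, ∀ x ∈ J, c ≤ |f' x| := by
    rcases J.eq_empty_or_nonempty with h | h
    · exact ⟨1, one_pos, fun x hx => by simp [h] at hx⟩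
    · obtain ⟨x, hx, hmin⟩ := hJ.exists_isMinOn h (hc.mono hJab).abs
      refine ⟨|f' x|, abs_pos.2 fun h0 => ?_, fun y hy => hmin hy⟩
      obtain ⟨z, hz, hxz⟩ := mem_iUnion₂.1 hx
      have := (hη1 z hz x hxz).2
      rw [h0, mul_zero] at this
      exact lt_irrefl _ this
  -- Outside the open intervals |f| ≥ m, so g has no zero there. Inside, |f'| ≥ c makes g strictly
  -- monotone, with a change of sign inherited from f, so g has exactly one zero in each.
  refine ⟨min m c, lt_min hm hc0, fun g g' hg hgf => ?_⟩
  have hgc : ContinuousOn g (Icc a b) := fun τ hτ => (hg τ hτ).continuousAt.continuousWithinAt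
  have hJz : ∀ z ∈ Z, Icc (z - η) (z + η) ⊆ Icc a b := fun z hz x hx =>
    Ioo_subset_Icc_self (hη1 z hz x hx).1
  have same : ∀ {s x y e : ℝ}, 0 < s * x → |y - x| < e → e ≤ |x| → 0 < s * y :=
    fun {s x y e} h1 h2 h3 => by
      have h4 := abs_lt.1 (h2.trans_le h3)
      rcases lt_trichotomy x 0 with hx | hx | hx
      · rw [abs_of_neg hx] at h4
        have hs : s < 0 := by
          by_contra! hs
          exact absurd h1 (not_lt.2 (mul_nonpos_of_nonneg_of_nonpos hs hx.le))
        exact mul_pos_of_neg_of_neg hs (by linarith)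
      · simp [hx] at h1
      · rw [abs_of_pos hx] at h4
        exact mul_pos (pos_of_mul_pos_left h1 hx.le) (by linarith)
  have hmono : ∀ z ∈ Z, ∀ φ φ' : ℝ → ℝ, (∀ τ ∈ Icc a b, HasDerivAt φ (φ' τ) τ) →
      (∀ x ∈ Icc (z - η) (z + η), 0 < f' z * φ' x) →
      StrictMonoOn (fun x => f' z * φ x) (Icc (z - η) (z + η)) := fun z hz φ φ' h1 h2 => by
    refine strictMonoOn_of_hasDerivWithinAt_pos (convex_Icc _ _) (f' := fun x => f' z * φ' x)
      (fun x hx => ((h1 x (hJz z hz hx)).const_mul _).continuousAt.continuousWithinAt)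
      (fun x hx => ((h1 x (hJz z hz (interior_subset hx))).const_mul _).hasDerivWithinAt)
      fun x hx => h2 x (interior_subset hx)
  have hgmono : ∀ z ∈ Z, StrictMonoOn (fun x => f' z * g x) (Icc (z - η) (z + η)) :=
    fun z hz => hmono z hz g g' hg fun x hx =>
      same (hη1 z hz x hx).2 (hgf x (hJz z hz hx)).2
        ((min_le_right _ _).trans (hcJ x (mem_iUnion₂.2 ⟨z, hz, hx⟩)))
  have hend : ∀ z ∈ Z, ∀ x ∈ Icc (z - η) (z + η), |x - z| = η → x ∈ K := fun z hz x hx hxz => by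
    refine ⟨hJz z hz hx, fun hO => ?_⟩
    obtain ⟨z', hz', hx'⟩ := mem_iUnion₂.1 hO
    have h1 : |x - z'| < η := abs_lt.2 ⟨by linarith [hx'.1], by linarith [hx'.2]⟩
    by_cases hzz : z = z'
    · rw [← hzz, hxz] at h1
      exact lt_irrefl _ h1
    · have h2 := hη2 z hz z' hz' hzz
      have h3 := abs_sub_le z x z'
      rw [abs_sub_comm z x, hxz] at h3
      linarith
  have hex : ∀ z ∈ Z, ∃ x ∈ Icc (z - η) (z + η), g x = 0 := fun z hz => by
    have hl : z - η ∈ Icc (z - η) (z + η) := ⟨le_rfl, by linarith⟩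
    have hr : z + η ∈ Icc (z - η) (z + η) := ⟨by linarith, le_rfl⟩
    have hzm : z ∈ Icc (z - η) (z + η) := ⟨by linarith, by linarith⟩
    have hf := hmono z hz f f' hd fun x hx => (hη1 z hz x hx).2
    have h1 := hf hl hzm (by linarith)
    have h2 := hf hzm hr (by linarith)
    simp only [hz.2, mul_zero] at h1 h2
    have hKl := hend z hz _ hl (by simp [abs_of_pos hη])
    have hKr := hend z hz _ hr (by simp [abs_of_pos hη])
    have h3 := same h2 (hgf _ (hJz z hz hr)).1 ((min_le_left _ _).trans (hmK _ hKr))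
    have h4 := same (s := -f' z) (by linarith) (hgf _ (hJz z hz hl)).1
      ((min_le_left _ _).trans (hmK _ hKl))
    obtain ⟨x, hx, h5⟩ := intermediate_value_Icc (show z - η ≤ z + η by linarith)
      (f := fun x => f' z * g x) (continuousOn_const.mul (hgc.mono (hJz z hz)))
      (show (0 : ℝ) ∈ Icc _ _ from ⟨by linarith, h3.le⟩)
    exact ⟨x, hx, (mul_eq_zero.1 h5).resolve_left (hs z hz.1 hz.2)⟩
  choose! x hx hgx using hex
  have himg : x '' Z = {τ ∈ Icc a b | g τ = 0} := by
    ext τ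
    constructor
    · rintro ⟨z, hz, rfl⟩
      exact ⟨hJz z hz (hx z hz), hgx z hz⟩
    · rintro ⟨hτ, hgτ⟩
      by_cases hO : τ ∈ O
      · obtain ⟨z, hz, hτz⟩ := mem_iUnion₂.1 hO
        refine ⟨z, hz, (hgmono z hz).injOn (hx z hz) (Ioo_subset_Icc_self hτz) ?_⟩
        simp only [hgx z hz, hgτ]
      · have h1 := (hgf τ hτ).1
        have h2 := hmK τ ⟨hτ, hO⟩
        rw [hgτ, zero_sub, abs_neg] at h1
        exact absurd (h1.trans_le (min_le_left _ _)) (not_lt.2 h2)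
  have hinj : InjOn x Z := fun z hz z' hz' h => by
    by_contra hne
    have h1 := hη2 z hz z' hz' hne
    have h2 := hx z hz
    have h3 := hx z' hz'
    rw [← h] at h3
    have h4 : |z - z'| ≤ 2 * η := abs_le.2 ⟨by linarith [h2.1, h2.2, h3.1, h3.2],
      by linarith [h2.1, h2.2, h3.1, h3.2]⟩
    linarith
  rw [← himg, hinj.encard_image]

theorem SolvesSystem.neg {Λ : ℝ} {y : Trajectory} {T : EReal} (h : SolvesSystem Λ y T) :
    SolvesSystem Λ y.neg T := fun τ hτ => by
  obtain ⟨h1, h2, h3, h4, h5, h6⟩ := h τ hτ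
  refine ⟨h1, h2, h3.fun_neg.congr_deriv ?_, h4.congr_deriv ?_, h5.fun_neg.congr_deriv ?_,
    h6.congr_deriv ?_⟩ <;> simp only [Trajectory.neg] <;> ring

/-- The zeros of `w` are simple. -/
theorem SolvesSystem.U_ne_zero {Λ : ℝ} {y : Trajectory} {T : EReal} (h : SolvesSystem Λ y T)
    {τ₁ τ : ℝ} (h₁ : (τ₁ : EReal) < T) (hw₁ : y.w τ₁ ≠ 0) (hτ : (τ : EReal) < T)
    (hw : y.w τ = 0) : y.U τ ≠ 0 := fun hU => by
  -- If w = U = 0 at τ, the solution and its reflection share this state; by uniqueness w = -w at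
  -- τ₁, contrary to w(τ₁) ≠ 0.
  have heq : y.neg.state Λ τ = y.state Λ τ := by
    simp only [Trajectory.state, Trajectory.neg, hw, hU, neg_zero]
  have h2 := (components_eq (h.neg.state_eq h hτ hτ heq h₁ h₁)).2.1
  simp only [Trajectory.neg] at h2
  exact hw₁ (by linarith)

theorem zeros_eq_of_pos {y : Trajectory} {T : EReal} {a b : ℝ} (hbT : (b : EReal) < T)
    (ha : ∀ τ ≤ a, y.w τ ≠ 0) (hb : ∀ τ : ℝ, b ≤ τ → (τ : EReal) < T → y.w τ ≠ 0) :
    {τ : ℝ | (τ : EReal) < T ∧ y.w τ = 0} = {τ ∈ Icc a b | y.w τ = 0} := by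
  ext τ
  constructor
  · rintro ⟨h1, h2⟩
    exact ⟨⟨not_lt.1 fun h => ha τ h.le h2, not_lt.1 fun h => hb τ h.le h1 h2⟩, h2⟩
  · rintro ⟨h1, h2⟩
    exact ⟨(EReal.coe_le_coe_iff.2 h1.2).trans_lt hbT, h2⟩

/-- The number of zeros on a compact interval is stable under perturbations of the solution. -/
theorem Flow.exists_encard_zeros_eq {Λ : ℝ} {y : Trajectory} {T : EReal} (F : Flow Λ y T)
    {a b : ℝ} (hab : a ≤ b) (hbT : (b : EReal) < T) (ha : y.w a ≠ 0) (hb : y.w b ≠ 0)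
    (hfin : {τ ∈ Icc a b | y.w τ = 0}.Finite) :
    ∃ ε > 0, ∀ Λ' y' T', Flow Λ' y' T' →
      (∀ τ ∈ Icc a b, (τ : EReal) < T' ∧ ‖y'.state Λ' τ - y.state Λ τ‖ < ε) →
      {τ ∈ Icc a b | y'.w τ = 0}.encard = {τ ∈ Icc a b | y.w τ = 0}.encard := by
  have hT : ∀ τ ∈ Icc a b, (τ : EReal) < T := fun τ hτ =>
    (EReal.coe_le_coe_iff.2 hτ.2).trans_lt hbT
  have hr : ContinuousOn y.r (Icc a b) := fun τ hτ =>
    (F.solves τ (hT τ hτ)).2.1.continuousAt.continuousWithinAt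
  have hU : ContinuousOn y.U (Icc a b) := fun τ hτ =>
    (F.solves τ (hT τ hτ)).2.2.2.2.1.continuousAt.continuousWithinAt
  obtain ⟨ε, hε, h⟩ := EYM.exists_encard_zeros_eq ha hb (f' := fun τ => y.r τ * y.U τ)
    (fun τ hτ => (F.solves τ (hT τ hτ)).2.2.1) (hr.mul hU)
    (fun τ hτ h0 => mul_ne_zero (F.solves τ (hT τ hτ)).1.ne'
      (F.solves.U_ne_zero (hT a ⟨le_rfl, hab⟩) ha (hT τ hτ) h0)) hfin
  obtain ⟨B₁, hB₁⟩ := isCompact_Icc.exists_bound_of_continuousOn hr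
  obtain ⟨B₂, hB₂⟩ := isCompact_Icc.exists_bound_of_continuousOn hU
  have hB : 0 < |B₁| + |B₂| + 1 := by positivity
  refine ⟨min (min ε 1) (ε / (|B₁| + |B₂| + 1)),
    lt_min (lt_min hε one_pos) (div_pos hε hB), fun Λ' y' T' F' hy => ?_⟩
  refine h y'.w (fun τ => y'.r τ * y'.U τ) (fun τ hτ => (F'.solves τ (hy τ hτ).1).2.2.1)
    fun τ hτ => ?_
  have hn := (hy τ hτ).2
  set e := ‖y'.state Λ' τ - y.state Λ τ‖
  have hcomp : ∀ i, |y'.state Λ' τ i - y.state Λ τ i| ≤ e := fun i =>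
    norm_le_pi_norm (y'.state Λ' τ - y.state Λ τ) i
  have hw : |y'.w τ - y.w τ| ≤ e := hcomp 3
  have hr' : |y'.r τ - y.r τ| ≤ e := hcomp 1
  have hU' : |y'.U τ - y.U τ| ≤ e := hcomp 5
  have he : e < ε := hn.trans_le ((min_le_left _ _).trans (min_le_left _ _))
  have he1 : e ≤ 1 := hn.le.trans ((min_le_left _ _).trans (min_le_right _ _))
  have he2 : e * (|B₁| + |B₂| + 1) < ε := (lt_div_iff₀ hB).1 (hn.trans_le (min_le_right _ _))
  have he0 : 0 ≤ e := norm_nonneg _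
  refine ⟨hw.trans_lt he, lt_of_le_of_lt ?_ he2⟩
  have hb1 : |y.r τ| ≤ |B₁| := (hB₁ τ hτ).trans (le_abs_self _)
  have hb2 : |y.U τ| ≤ |B₂| := (hB₂ τ hτ).trans (le_abs_self _)
  have e1 : y'.r τ * y'.U τ - y.r τ * y.U τ = (y'.r τ - y.r τ) * y.U τ +
      y.r τ * (y'.U τ - y.U τ) + (y'.r τ - y.r τ) * (y'.U τ - y.U τ) := by ring
  calc |y'.r τ * y'.U τ - y.r τ * y.U τ|
      ≤ |y'.r τ - y.r τ| * |y.U τ| + |y.r τ| * |y'.U τ - y.U τ|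
        + |y'.r τ - y.r τ| * |y'.U τ - y.U τ| := by
        rw [e1, ← abs_mul, ← abs_mul, ← abs_mul]
        exact abs_add_three _ _ _
    _ ≤ e * |B₂| + |B₁| * e + e * 1 := by
        gcongr
        exact hU'.trans he1
    _ = e * (|B₁| + |B₂| + 1) := by ring

theorem exists_beyond_zeros {y : Trajectory} {T : EReal} {τ₁ : ℝ} (hτ₁ : (τ₁ : EReal) < T)
    (hfin : {τ : ℝ | (τ : EReal) < T ∧ y.w τ = 0}.Finite) :
    ∃ a : ℝ, τ₁ ≤ a ∧ (a : EReal) < T ∧ ∀ τ : ℝ, a ≤ τ → (τ : EReal) < T → y.w τ ≠ 0 := by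
  have hlt : max (τ₁ : EReal) (sSup ((fun τ : ℝ => (τ : EReal)) ''
      {τ : ℝ | (τ : EReal) < T ∧ y.w τ = 0})) < T := by
    rcases {τ : ℝ | (τ : EReal) < T ∧ y.w τ = 0}.eq_empty_or_nonempty with h | h
    · rw [h, image_empty, sSup_empty]
      simpa using hτ₁
    · refine max_lt hτ₁ ?_
      obtain ⟨z, hz, hz'⟩ := (h.image _).csSup_mem (hfin.image (fun τ : ℝ => (τ : EReal)))
      rw [← hz']
      exact hz.1
  obtain ⟨a, h2, h3⟩ := EReal.lt_iff_exists_real_btwn.1 hlt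
  refine ⟨a, EReal.coe_le_coe_iff.1 ((le_max_left _ _).trans h2.le), h3, fun τ h4 h5 h6 => ?_⟩
  have h7 : (τ : EReal) < a := (le_sSup (mem_image_of_mem (fun τ : ℝ => (τ : EReal))
    (show τ ∈ {τ : ℝ | (τ : EReal) < T ∧ y.w τ = 0} from ⟨h5, h6⟩))).trans_lt
    ((le_max_right _ _).trans_lt h2)
  exact absurd (EReal.coe_lt_coe_iff.1 h7) (not_lt.2 h4)

/-! ### Classification near a noncompact solution, and the theorem. -/

/-- Near a noncompact solution with `k` zeros, every solution with `Λ ≥ 0` has at least `k` zeros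
and is generic, a black hole, or noncompact with exactly `k` zeros. -/
theorem IsMaximalSolution.eventually_classified {Λ lam : ℝ} {y : Trajectory} {T : EReal}
    (h : IsMaximalSolution Λ lam y T) (hN : Noncompact Λ y T) {k : ℕ} (hk : zeros y T = k) :
    ∀ᶠ q in 𝓝 (Λ, lam), 0 ≤ q.1 → ∃ y' T', IsMaximalSolution q.1 q.2 y' T' ∧
      (k : ℕ∞) ≤ zeros y' T' ∧
      (Generic y' T' ∨ BlackHole y' T' ∨ (Noncompact q.1 y' T' ∧ zeros y' T' = k)) := by
  have F := h.flow
  obtain ⟨τ₁, hτ₁, hw₁, hnear⟩ := h.toIsSolution.eventually_nearby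
  have hfin : {τ : ℝ | (τ : EReal) < T ∧ y.w τ = 0}.Finite := finite_of_encard_eq_coe hk
  obtain ⟨a, ha₁, haT, hwa⟩ := exists_beyond_zeros hτ₁ hfin
  obtain ⟨b, hab, hbT, hD⟩ := F.exists_decided hN haT hwa
  have hwb : ∀ τ : ℝ, b ≤ τ → (τ : EReal) < T → y.w τ ≠ 0 := fun τ hτ => hwa τ (hab.trans hτ)
  have hw₁' : ∀ τ ≤ τ₁, y.w τ ≠ 0 := fun τ hτ h0 => by
    have := hw₁ τ hτ
    rw [h0] at this
    norm_num at this
  have hset := zeros_eq_of_pos hbT hw₁' hwb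
  obtain ⟨ε₁, hε₁, hcount⟩ := F.exists_encard_zeros_eq (ha₁.trans hab) hbT (hw₁' _ le_rfl)
    (hwb b le_rfl hbT) (hset ▸ hfin)
  obtain ⟨ε₂, hε₂, hD⟩ := Metric.eventually_nhds_iff.1 hD
  -- Both requirements on nearby solutions, an equal number of zeros on [τ₁, b] and a decided state
  -- at b, follow from closeness of the state at τ₁. Before τ₁ there are no zeros since w ≥ 1/2.
  filter_upwards [hnear _ (F.continuous_dependence hbT (lt_min hε₁ hε₂))] with q hq hq0
  obtain ⟨y', T', hmax, hT', hw', hst⟩ := hq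
  have F' := hmax.flow
  have hclose := hst q.1 y' T' F' hT' rfl
  have hb : b ∈ Icc τ₁ b := ⟨ha₁.trans hab, le_rfl⟩
  have hzeros : {τ ∈ Icc τ₁ b | y'.w τ = 0}.encard = k := by
    rw [hcount q.1 y' T' F' fun τ hτ =>
      ⟨(hclose τ hτ).1, (hclose τ hτ).2.trans_le (min_le_left _ _)⟩, ← hset]
    exact hk
  refine ⟨y', T', hmax, ?_, ?_⟩
  · rw [← hzeros, zeros]
    refine encard_le_encard fun τ hτ => ⟨?_, hτ.2⟩
    exact (EReal.coe_le_coe_iff.2 hτ.1.2).trans_lt (hclose b hb).1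
  · rcases hD (y := y'.state q.1 b)
        (by rw [dist_eq_norm]; exact (hclose b hb).2.trans_le (min_le_right _ _))
        q.1 y' T' hq0 F' (hclose b hb).1 rfl with (h1 | h1) | ⟨h1, h2⟩
    · exact Or.inl h1
    · exact Or.inr (Or.inl h1)
    · refine Or.inr (Or.inr ⟨h1, ?_⟩)
      rw [zeros, zeros_eq_of_pos (hclose b hb).1 (a := τ₁) (fun τ hτ h0 => ?_) h2, hzeros]
      have := hw' τ hτ
      rw [h0] at this
      norm_num at this

end EYM

theorem mainTheorem4 (Λ₀ : ℝ) (hΛ₀ : 0 < Λ₀) (n : ℕ) (a b : ℝ) (hab : EYM.IsInterval n a b)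
    (p : ℝ × ℝ) (hp : p ∈ EYM.noncompactBoundary Λ₀ n a b (n + 1)) :
    ∃ V : Set (ℝ × ℝ), V ⊆ EYM.L Λ₀ ∧ V ∈ 𝓝[EYM.L Λ₀] p ∧
      (∀ q ∈ V,
        EYM.IsGenericWithAtLeast (n + 1) q ∨
        EYM.IsNoncompactWith (n + 1) q ∨
        EYM.IsBlackHole q) ∧
      V ∩ EYM.noncompactBoundary Λ₀ n a b n = ∅ := by
  obtain ⟨-, y, T, hmax, hN, hk⟩ := hp
  have hev := hmax.eventually_classified hN hk
  refine ⟨EYM.L Λ₀ ∩ {q | 0 ≤ q.1 → ∃ y' T', EYM.IsMaximalSolution q.1 q.2 y' T' ∧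
      ((n + 1 : ℕ) : ℕ∞) ≤ EYM.zeros y' T' ∧ (EYM.Generic y' T' ∨ EYM.BlackHole y' T' ∨
        (EYM.Noncompact q.1 y' T' ∧ EYM.zeros y' T' = (n + 1 : ℕ)))}, inter_subset_left,
    inter_mem self_mem_nhdsWithin (mem_nhdsWithin_of_mem_nhds hev), fun q hq => ?_, ?_⟩
  · obtain ⟨y', T', h1, h2, h3 | h3 | ⟨h3, h4⟩⟩ := hq.2 hq.1.1.1
    · exact Or.inl ⟨y', T', h1, h3, h2⟩
    · exact Or.inr (Or.inr ⟨y', T', h1, h3⟩)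
    · exact Or.inr (Or.inl ⟨y', T', h1, h3, h4⟩)
  -- A common point would have exactly n zeros by one set and at least n + 1 by the other, but the
  -- number of zeros depends only on the parameters.
  · refine eq_empty_of_forall_notMem fun q hq => ?_
    obtain ⟨y', T', h1, h2, -⟩ := hq.1.2 hq.1.1.1.1
    obtain ⟨-, y₂, T₂, h3, -, h4⟩ := hq.2
    have h5 := h2.trans (EYM.zeros_le_of_isSolution h3 h1.toIsSolution)
    rw [h4] at h5
    exact absurd (Nat.cast_le.1 h5) (Nat.not_succ_le_self n)
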